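/- **Conventions.** A layered arithmetic circuit $C$ with $n\ge 1$ input wires has layers $0,\dots,d$ ($d\ge 1$); layer $0$ is a single output gate, layer $d$ consists of the $n$ input wires, and each gate $j$ of layer $i<d$ is the sum or the product of two gates $\mathrm{left}_i(j)$, $\mathrm{right}_i(j)$ of layer $i+1$. Let $s_i$ be the number of gates of layer $i$, $S=\sum_{i=0}^d s_i$ the size, $b_i=\lceil\log_2 s_i\rceil$, and identify gates of layer $i$ with labels in $\{0,1\}^{b_i}$. A family $(C_n)_{n\ge1}$, where $C_n$ has $n$ input wires, size $S(n)$ and depth $d(n)$, is *log-space uniform* if a Turing machine (read-only input tape, work tape, write-only output tape) prints on input $1^n$ the list of gates of $C_n$ using $O(\log S(n))$ work-tape cells. Let $F$ be any field, $K\supseteq F$ an extension field (possibly $K=F$) and $\Omega\subseteq K$ a finite non-empty set of challenges. The input is a stream $\sigma$ of updates $(i,\delta)\in[n]\times F$, which defines $a\in F^n$, $a_i=\sum_{(i,\delta)\in\sigma}\delta$; write $f(a)$ for the output of $C_n$ on $a$. Let $V_i:\{0,1\}^{b_i}\to K$ give the gate values at layer $i$ on input $a$ ($0$ at unused labels), let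 $\mathrm{add}_i,\mathrm{mult}_i:\{0,1\}^{b_i+2b_{i+1}}\to\{0,1\}$ be the wiring predicate (gate $j_1$ of layer $i$ is an addition, resp. multiplication, gate with left input $j_2$ and right input $j_3$), and let a tilde denote the multilinear extension. **The GKR protocol with multilinear extensions.** The prover $\mathcal P$ first sends a claimed output $c_0$, a claim for $\tilde V_0(z_0)$, where $z_0$ is the empty vector. For $i=0,\dots,d-1$, a claim $c_i$ for $\tilde V_i(z_i)$ is reduced to one for layer $i+1$: the parties run the sum-check protocol, in $N_i=b_i+2b_{i+1}$ rounds, for the claim that the sum over $\{0,1\}^{N_i}$ of $$f_i(p,\omega_1,\omega_2)=\beta(z_i,p)\Big(\widetilde{\mathrm{add}}_i(p,\omega_1,\omega_2)\big(\tilde V_{i+1}(\omega_1)+\tilde V_{i+1}(\omega_2)\big)+\widetilde{\mathrm{mult}}_i(p,\omega_1,\omega_2)\,\tilde V_{i+1}(\omega_1)\tilde V_{i+1}(\omega_2)\Big),$$ $\beta(z,p)=\prod_k(z_kp_k+(1-z_k)(1-p_k))$, equals $c_i$, each round polynomial being sent as its $3$ coefficients; then $\mathcal P$ sends the $b_{i+1}+1$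 coefficients of $q(t)=\tilde V_{i+1}(\omega_1+t(\omega_2-\omega_1))$, the verifier $\mathcal V$ checks the last sum-check claim using $q(0)$ and $q(1)$ in place of $\tilde V_{i+1}(\omega_1)$ and $\tilde V_{i+1}(\omega_2)$, and $z_{i+1}=\omega_1+t(\omega_2-\omega_1)$, $c_{i+1}=q(t)$ for a fresh challenge $t$. All challenges are independent and uniform in $\Omega$. Finally $\mathcal V$ checks $c_d=\tilde V_d(z_d)$, where $\tilde V_d$ is the multilinear extension of $a$. $\mathcal V$ outputs $c_0$ if all checks succeed and $\perp$ otherwise. **Machine model.** $\mathcal P$ and $\mathcal V$ are fixed programs, independent of $n$, $F$, $K$, $\Omega$ and $\sigma$, of a random access machine that performs, at unit cost, operations on integers of $O(\log S(n))$ bits, and ring operations, equality tests, storage, sampling and transmission of elements of $K$. Both read the stream once, before the conversation starts. $\mathcal P$ has the explicit gate list of $C_n$ in memory; $\mathcal V$ is given only $n$. **Theorem.** Let $(C_n)_{n\ge 1}$ be a log-space uniform family of layered arithmetic circuits. There are programs $\mathcal P$, $\mathcal V$ and a constant $c$ such that for all $n$, with $S=S(n)$ and $d=d(n)$: 1. The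 above protocol for $C_n$ takes at most $c\,d\log S$ rounds and at most $c\,d\log S$ words (elements of $K$) are exchanged. 2. For all $F,K,\Omega,\sigma$, against the honest prover the verifier outputs $f(a)$ with probability $1$. If moreover $|\Omega|\ge 3\sum_{i<d}(2N_i+b_{i+1})$ (this bound being at most $3c\,d\log S$), then against every prover strategy the verifier outputs an element outside $\{f(a),\perp\}$ with probability at most $1/3$. 3. $\mathcal P$ implements the honest prover, and over the entire execution it takes at most $c\,S\log S$ steps plus at most $c$ steps per element of the stream. 4. $\mathcal V$ implements the verifier, for every prover strategy, using at most $c\log S$ words of each of its two memories (for integers and for elements of $K$) besides a constant number of registers, where its challenges are the successive elements of its random tape in an order that depends only on $n$. -/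

import Mathlib

namespace GKR

/-! ### Layered arithmetic circuits -/

/-- A layered arithmetic circuit of fan-in two with `n` input wires and one output gate.
Layer `0` is the output layer and layer `depth` consists of the input wires. For `i < depth` and
`j < width i`, gate `j` of layer `i` multiplies (if `isMul i j`) or adds (otherwise) the values of
the gates `left i j` and `right i j` of layer `i + 1`. -/
structure LayeredCircuit (n : ℕ) where
  depth : ℕ
  width : ℕ → ℕ
  isMul : ℕ → ℕ → Bool
  left : ℕ → ℕ → ℕ
  right : ℕ → ℕ → ℕ
  depth_pos : 0 < depth
  width_zero : width 0 = 1
  width_depth : width depth = n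
  left_lt : ∀ i < depth, ∀ j < width i, left i j < width (i + 1)
  right_lt : ∀ i < depth, ∀ j < width i, right i j < width (i + 1)

namespace LayeredCircuit

variable {n : ℕ} (C : LayeredCircuit n)

/-- The number of gates of the circuit, input gates included. -/
def size : ℕ := ∑ i ∈ Finset.range (C.depth + 1), C.width i

/-- Number of bits of a gate label at layer `i`. -/
def bits (i : ℕ) : ℕ := Nat.clog 2 (C.width i)

/-- The values of the gates of the layer that lies `t` layers above the input layer
(`0` at labels that name no gate). -/
def upValue {K : Type*} [Field K] (x : Fin n → K) : ℕ → ℕ → K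
  | 0, j => if h : j < n then x ⟨j, h⟩ else 0
  | t + 1, j =>
      if j < C.width (C.depth - (t + 1)) then
        if C.isMul (C.depth - (t + 1)) j then
          upValue x t (C.left (C.depth - (t + 1)) j) * upValue x t (C.right (C.depth - (t + 1)) j)
        else
          upValue x t (C.left (C.depth - (t + 1)) j) + upValue x t (C.right (C.depth - (t + 1)) j)
      else 0

/-- `V_i(j)`: the value of gate `j` at layer `i`, and `0` if there is no such gate. -/
def value {K : Type*} [Field K] (x : Fin n → K) (i j : ℕ) : K := C.upValue x (C.depth - i) j

/-- The function computed by the circuit. -/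
def eval {K : Type*} [Field K] (x : Fin n → K) : K := C.value x 0 0

/-- The wiring predicate of layer `i`: gate `j₁` of layer `i` is the sum (`mul = false`) or the
product (`mul = true`) of the gates `j₂` and `j₃` of layer `i + 1`. -/
def Wired (i : ℕ) (mul : Bool) (j₁ j₂ j₃ : ℕ) : Prop :=
  j₁ < C.width i ∧ C.isMul i j₁ = mul ∧ C.left i j₁ = j₂ ∧ C.right i j₁ = j₃

instance (i : ℕ) (mul : Bool) (j₁ j₂ j₃ : ℕ) : Decidable (C.Wired i mul j₁ j₂ j₃) :=
  inferInstanceAs (Decidable (_ ∧ _ ∧ _ ∧ _))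

/-- The explicit description of a circuit as a list of numbers: the depth, the widths of the
layers from output to input, and then, layer by layer, the triple (kind, left, right) of every
gate. -/
def code : List ℕ :=
  C.depth :: (List.range (C.depth + 1)).map C.width ++
    (List.range C.depth).flatMap fun i => (List.range (C.width i)).flatMap fun j =>
      [(C.isMul i j).toNat, C.left i j, C.right i j]

end LayeredCircuit

/-! ### Turing machines with output, and log-space uniformity -/

/-- Symbols of the read-only input tape `⊢ 1 ⋯ 1 ⊣`. -/
inductive InSym
  | leftEnd
  | one
  | rightEnd

/-- Symbols of the write-only output tape. -/
inductive OutSym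
  | bit (b : Bool)
  | sep

/-- Head moves. -/
inductive Move
  | left
  | stay
  | right

/-- The position of a head on a tape with cells `0, 1, 2, …` after a move. -/
def Move.apply : Move → ℕ → ℕ
  | .left, p => p - 1
  | .stay, p => p
  | .right, p => p + 1

/-- A deterministic Turing machine with a read-only input tape, one work tape and a write-only
output tape. State `0` is the start state, work symbol `0` is the blank; the transition function
gives the new state, the symbol written on the work tape, the moves of the input head and of the
work head, and the symbol that is printed, if any. The machine halts when it is undefined. -/
structure Transducer where
  numStates : ℕ
  numSymbols : ℕ
  trans : Fin (numStates + 1) → InSym → Fin (numSymbols + 1) →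
    Option (Fin (numStates + 1) × Fin (numSymbols + 1) × Move × Move × Option OutSym)

namespace Transducer

/-- Configurations of a transducer. -/
structure Config (M : Transducer) where
  state : Fin (M.numStates + 1)
  inputHead : ℕ
  workHead : ℕ
  tape : ℕ → Fin (M.numSymbols + 1)
  out : List OutSym

variable (M : Transducer)

/-- The start configuration. -/
def start : M.Config := ⟨0, 0, 0, fun _ => 0, []⟩

/-- The content of cell `p` of the input tape that holds `1ⁿ` in the cells `1, …, n`. -/
def inputCell (n p : ℕ) : InSym :=
  if p = 0 then .leftEnd else if p ≤ n then .one else .rightEnd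

/-- One step on input `1ⁿ`; `none` if the machine has halted. -/
def step (n : ℕ) (c : M.Config) : Option M.Config :=
  (M.trans c.state (inputCell n c.inputHead) (c.tape c.workHead)).map
    fun (q, a, mi, mw, o) =>
      { state := q
        inputHead := min (mi.apply c.inputHead) (n + 1)
        workHead := mw.apply c.workHead
        tape := Function.update c.tape c.workHead a
        out := c.out ++ o.toList }

/-- The configuration after `t` steps on input `1ⁿ`. -/
def run (n : ℕ) : ℕ → M.Config
  | 0 => M.start
  | t + 1 => (M.step n (run n t)).getD (run n t)

/-- On input `1ⁿ` the machine halts with output `w`, and visits only the first `s` cells of its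
work tape. -/
def PrintsInSpace (n : ℕ) (w : List OutSym) (s : ℕ) : Prop :=
  (∃ t, M.step n (M.run n t) = none ∧ (M.run n t).out = w) ∧ ∀ t, (M.run n t).workHead < s

end Transducer

/-- Numbers are printed in binary, most significant bit first, each followed by a separator. -/
def printed (l : List ℕ) : List OutSym :=
  l.flatMap fun m => (Nat.bits m).reverse.map OutSym.bit ++ [OutSym.sep]

/-- A family of circuits is log-space uniform if a Turing machine prints, on input `1ⁿ`, the
description of the `n`-th circuit in space `O(log S(n))`. -/
def LogSpaceUniform (C : (n : ℕ+) → LayeredCircuit n) : Prop :=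
  ∃ (M : Transducer) (c : ℕ), ∀ n : ℕ+,
    M.PrintsInSpace n (printed (C n).code) (c * Nat.log 2 (C n).size)

/-! ### Streams -/

/-- The frequency vector of a stream of updates `(i, δ)`. -/
def freq {n : ℕ} {F : Type*} [Field F] (σ : List (Fin n × F)) (i : Fin n) : F :=
  ((σ.filter fun p => p.1 = i).map Prod.snd).sum

/-! ### Multilinear extensions -/

section Extensions

variable {K : Type*} [Field K]

/-- The multilinear polynomial in the `v` variables `X_o, …, X_{o+v-1}` that is the indicator on
`{0,1}^v` of the binary representation of `j`. -/
noncomputable def chi (v o j : ℕ) : MvPolynomial ℕ K :=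
  ∏ k ∈ Finset.range v,
    if j.testBit k then MvPolynomial.X (o + k) else 1 - MvPolynomial.X (o + k)

/-- The multilinear extension, in the variables `X_o, …, X_{o+v-1}`, of a function on
`v`-bit labels. -/
noncomputable def mle (v o : ℕ) (g : ℕ → K) : MvPolynomial ℕ K :=
  ∑ j ∈ Finset.range (2 ^ v), MvPolynomial.C (g j) * chi v o j

/-- `β(p) = ∏ₖ (zₖ pₖ + (1 - zₖ)(1 - pₖ))`, the multilinear extension of equality with
first argument `z`. -/
noncomputable def beta (u : ℕ) (z : ℕ → K) : MvPolynomial ℕ K :=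
  ∏ k ∈ Finset.range u,
    (MvPolynomial.C (z k) * MvPolynomial.X k +
      (1 - MvPolynomial.C (z k)) * (1 - MvPolynomial.X k))

end Extensions

/-! ### The GKR protocol with multilinear extensions

Iteration `i < depth` reduces a claim about the multilinear extension of the gate values of layer
`i` to one about layer `i + 1`, by a sum-check over the variables `p` (`bits i` of them),
`ω₁` and `ω₂` (`bits (i + 1)` each) and then a restriction to the line through `ω₁` and `ω₂`.
Univariate polynomials are sent as coefficient lists. All messages of the verifier are its random
challenges; `r k` is the `k`-th challenge. -/

namespace LayeredCircuit

variable {n : ℕ} (C : LayeredCircuit n)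

/-- Number of sum-check rounds in iteration `i`. -/
def rounds (i : ℕ) : ℕ := C.bits i + 2 * C.bits (i + 1)

/-- Index of the first challenge of iteration `i`: every iteration has one challenge per sum-check
round and one for the line. -/
def offset (i : ℕ) : ℕ := ∑ i' ∈ Finset.range i, (C.rounds i' + 1)

/-- The total number of challenges, which is the number of rounds of the protocol. -/
def numChallenges : ℕ := C.offset C.depth

/-- The lengths of the prover's messages: the first message contains in addition the claimed
output. -/
def msgLengths : List ℕ :=
  ((List.range C.depth).flatMap fun i =>
    List.replicate (C.rounds i) 3 ++ [C.bits (i + 1) + 1]).modifyHead (· + 1)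

/-- The number of words exchanged by prover and verifier. -/
def communication : ℕ := C.msgLengths.sum + C.numChallenges

/-- The sum of the degree bounds of the prover's polynomials: three times this number of
possible challenges suffices for soundness error `1/3`. -/
def totalDegree : ℕ := ∑ i ∈ Finset.range C.depth, (2 * C.rounds i + C.bits (i + 1))

variable {K : Type*} [Field K]

/-- The multilinear extension of the wiring predicate of layer `i`, in the variables
`(p, ω₁, ω₂)`. -/
noncomputable def wiringMLE (i : ℕ) (mul : Bool) : MvPolynomial ℕ K :=
  ∑ j₁ ∈ Finset.range (2 ^ C.bits i), ∑ j₂ ∈ Finset.range (2 ^ C.bits (i + 1)),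
    ∑ j₃ ∈ Finset.range (2 ^ C.bits (i + 1)),
      MvPolynomial.C (if C.Wired i mul j₁ j₂ j₃ then 1 else 0) *
        (chi (C.bits i) 0 j₁ * chi (C.bits (i + 1)) (C.bits i) j₂ *
          chi (C.bits (i + 1)) (C.bits i + C.bits (i + 1)) j₃)

/-- The polynomial to which sum-check is applied in iteration `i`, where `z` is the point at
which the extension of layer `i` is to be verified. -/
noncomputable def layerPoly (x : Fin n → K) (i : ℕ) (z : ℕ → K) : MvPolynomial ℕ K :=
  let V₁ := mle (C.bits (i + 1)) (C.bits i) (C.value x (i + 1))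
  let V₂ := mle (C.bits (i + 1)) (C.bits i + C.bits (i + 1)) (C.value x (i + 1))
  beta (C.bits i) z * (C.wiringMLE i false * (V₁ + V₂) + C.wiringMLE i true * (V₁ * V₂))

/-- The challenges `(p, ω₁, ω₂)` of the sum-check of iteration `i`. -/
def sumcheckPoint (r : ℕ → K) (i k : ℕ) : K := r (C.offset i + k)

/-- The point at which the extension of layer `i` is verified: the origin (of `K⁰`) for the
output layer, and for layer `i + 1` the point `ω₁ + t (ω₂ - ω₁)`, `t` being the last challenge of
iteration `i`. -/
def layerPoint (r : ℕ → K) : ℕ → ℕ → K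
  | 0, _ => 0
  | i + 1, k =>
      C.sumcheckPoint r i (C.bits i + k) + r (C.offset i + C.rounds i) *
        (C.sumcheckPoint r i (C.bits i + C.bits (i + 1) + k) - C.sumcheckPoint r i (C.bits i + k))

/-- The `j`-th sum-check polynomial
`g_j(X) = ∑_{b ∈ {0,1}^{N-j-1}} f(r₀, …, r_{j-1}, X, b)` for a polynomial `f` in `N` variables. -/
noncomputable def roundPoly (f : MvPolynomial ℕ K) (N : ℕ) (r : ℕ → K) (j : ℕ) : Polynomial K :=
  ∑ b ∈ Finset.range (2 ^ (N - (j + 1))),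
    MvPolynomial.aeval
      (fun k => if k < j then Polynomial.C (r k) else if k = j then Polynomial.X
        else if b.testBit (k - (j + 1)) then 1 else 0) f

/-- The restriction of the extension of layer `i + 1` to the line through `ω₁` and `ω₂`. -/
noncomputable def linePoly (x : Fin n → K) (r : ℕ → K) (i : ℕ) : Polynomial K :=
  MvPolynomial.aeval
    (fun k => Polynomial.C (C.sumcheckPoint r i (C.bits i + k)) +
      Polynomial.X * Polynomial.C (C.sumcheckPoint r i (C.bits i + C.bits (i + 1) + k) -
        C.sumcheckPoint r i (C.bits i + k)))
    (mle (C.bits (i + 1)) 0 (C.value x (i + 1)))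

/-- The messages of the honest prover when the challenges are `r`; the `k`-th message depends on
the first `k` challenges only. -/
noncomputable def honestMsgs (x : Fin n → K) (r : ℕ → K) : List (List K) :=
  ((List.range C.depth).flatMap fun i =>
    (List.range (C.rounds i)).map (fun j => (List.range 3).map
      (roundPoly (C.layerPoly x i (C.layerPoint r i)) (C.rounds i) (C.sumcheckPoint r i) j).coeff)
    ++ [(List.range (C.bits (i + 1) + 1)).map (C.linePoly x r i).coeff]).modifyHead
      (C.value x 0 0 :: ·)

end LayeredCircuit

/-- A prover strategy: `P cs e` is word number `e` of the message that is sent after the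
challenges `cs` have been received. -/
abbrev Strategy (K : Type*) := List K → ℕ → K

namespace LayeredCircuit

variable {n : ℕ} (C : LayeredCircuit n) {K : Type*} [Field K]

/-- The strategy of the honest prover. -/
noncomputable def honestProver (x : Fin n → K) : Strategy K := fun cs e =>
  ((C.honestMsgs x fun k => cs.getD k 0).getD cs.length []).getD e 0

/-- The univariate polynomial of degree at most `m` that the prover sends before challenge `k`
(in the first message it is preceded by the claimed output). -/
noncomputable def sentPoly (P : Strategy K) (r : ℕ → K) (m k : ℕ) : Polynomial K :=
  ∑ e ∈ Finset.range (m + 1),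
    Polynomial.C (P ((List.range k).map r) (e + if k = 0 then 1 else 0)) * Polynomial.X ^ e

/-- The value claimed for the extension of layer `i` at `layerPoint r i`. -/
noncomputable def layerClaim (P : Strategy K) (r : ℕ → K) : ℕ → K
  | 0 => P [] 0
  | i + 1 => (sentPoly P r (C.bits (i + 1)) (C.offset i + C.rounds i)).eval
      (r (C.offset i + C.rounds i))

/-- The value claimed for the remaining sum before round `j` of the sum-check of iteration `i`. -/
noncomputable def roundClaim (P : Strategy K) (r : ℕ → K) (i : ℕ) : ℕ → K
  | 0 => C.layerClaim P r i
  | j + 1 => (sentPoly P r 2 (C.offset i + j)).eval (r (C.offset i + j))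

/-- All checks of the verifier succeed. -/
def Accepts (x : Fin n → K) (P : Strategy K) (r : ℕ → K) : Prop :=
  (∀ i < C.depth,
    (∀ j < C.rounds i,
      (sentPoly P r 2 (C.offset i + j)).eval 0 + (sentPoly P r 2 (C.offset i + j)).eval 1 =
        C.roundClaim P r i j) ∧
    (let q := sentPoly P r (C.bits (i + 1)) (C.offset i + C.rounds i)
     let ev := MvPolynomial.eval (C.sumcheckPoint r i)
     C.roundClaim P r i (C.rounds i) =
      ev (beta (C.bits i) (C.layerPoint r i)) *
        (ev (C.wiringMLE i false) * (q.eval 0 + q.eval 1) +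
          ev (C.wiringMLE i true) * (q.eval 0 * q.eval 1)))) ∧
  C.layerClaim P r C.depth =
    MvPolynomial.eval (C.layerPoint r C.depth)
      (mle (C.bits C.depth) 0 (C.value x C.depth))

open Classical in
/-- The output of the verifier: the value claimed by the prover in its first word, or `none`
(that is, `⊥`). -/
noncomputable def output (x : Fin n → K) (P : Strategy K) (r : ℕ → K) : Option K :=
  if C.Accepts x P r then some (P [] 0) else none

end LayeredCircuit

/-- A finite tape of challenges, continued by zeros. -/
def ofTape {K : Type*} [Zero K] {T : ℕ} (ρ : Fin T → K) (k : ℕ) : K :=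
  if h : k < T then ρ ⟨k, h⟩ else 0

/-! ### The machine model

Prover and verifier are programs of one random access machine. It has integer registers and field
registers, named by numbers (a program mentions finitely many of them), an integer memory and a
field memory with indirect addressing, one pass over the input stream, a one-way tape of random
field elements, and a channel to the other party. Every operation and every test has unit cost. -/

/-- Integer operations; `sub` is truncated subtraction. -/
inductive IntOp
  | add
  | sub
  | mul
  | div
  | mod

/-- The meaning of the integer operations. -/
def IntOp.apply : IntOp → ℕ → ℕ → ℕ
  | .add, a, b => a + b
  | .sub, a, b => a - b
  | .mul, a, b => a * b
  | .div, a, b => a / b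
  | .mod, a, b => a % b

/-- Field operations. -/
inductive FieldOp
  | add
  | sub
  | mul

/-- The meaning of the field operations. -/
def FieldOp.apply {K : Type*} [Field K] : FieldOp → K → K → K
  | .add, a, b => a + b
  | .sub, a, b => a - b
  | .mul, a, b => a * b

/-- Elementary operations. In the names of the registers, `d` is the destination. -/
inductive Op
  | const (d c : ℕ)
  | int (o : IntOp) (d a b : ℕ)
  | load (d a : ℕ)
  | store (a b : ℕ)
  | zero (d : ℕ)
  | one (d : ℕ)
  | field (o : FieldOp) (d a b : ℕ)
  | fload (d a : ℕ)
  | fstore (a b : ℕ)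
  | isEq (d a b : ℕ)
  | read (flag i d : ℕ)
  | toss (d : ℕ)
  | send (a : ℕ)
  | recv (d : ℕ)
  | output (a : ℕ)

/-- Programs. The tests ask whether an integer register is nonzero. -/
inductive Prog
  | skip
  | op (o : Op)
  | seq (p q : Prog)
  | ite (t : ℕ) (p q : Prog)
  | loop (t : ℕ) (p : Prog)

/-- A word sent to or received from the other party. -/
inductive Event (K : Type*)
  | send (w : K)
  | recv (w : K)

/-- States of the machine. `trace` is the conversation so far in chronological order, `time` the
number of steps made, `space` the least `s` such that only memory cells with address below `s` have
been accessed, and `peak` the largest integer that has been written. -/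
structure State (K : Type*) where
  ireg : ℕ → ℕ
  freg : ℕ → K
  imem : ℕ → ℕ
  fmem : ℕ → K
  stream : List (ℕ × K)
  coins : ℕ → K
  trace : List (Event K)
  out : Option K
  time : ℕ
  space : ℕ
  peak : ℕ

namespace State

variable {K : Type*}

/-- One unit of time passes. -/
def tick (s : State K) : State K := { s with time := s.time + 1 }

/-- Write an integer register. -/
def setInt (s : State K) (d v : ℕ) : State K :=
  { s with ireg := Function.update s.ireg d v, peak := max s.peak v }

/-- Write a field register. -/
def setField (s : State K) (d : ℕ) (v : K) : State K :=
  { s with freg := Function.update s.freg d v }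

/-- Record an access to address `a` of one of the memories. -/
def touch (s : State K) (a : ℕ) : State K := { s with space := max s.space (a + 1) }

/-- Record an exchanged word. Once the conversation has begun, the stream is over. -/
def say (s : State K) (e : Event K) : State K := { s with trace := s.trace ++ [e], stream := [] }

end State

open Classical in
/-- The effect of an operation. The function `peer` describes the other party: it gives the next
word received as a function of the conversation so far. The operation `read` reports in the
register `flag` whether there was another stream element. -/
noncomputable def Op.effect {K : Type*} [Field K] (peer : List (Event K) → K) :
    Op → State K → State K
  | .const d c, s => s.setInt d c
  | .int o d a b, s => s.setInt d (o.apply (s.ireg a) (s.ireg b))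
  | .load d a, s => (s.touch (s.ireg a)).setInt d (s.imem (s.ireg a))
  | .store a b, s =>
      { s.touch (s.ireg a) with imem := Function.update s.imem (s.ireg a) (s.ireg b) }
  | .zero d, s => s.setField d 0
  | .one d, s => s.setField d 1
  | .field o d a b, s => s.setField d (o.apply (s.freg a) (s.freg b))
  | .fload d a, s => (s.touch (s.ireg a)).setField d (s.fmem (s.ireg a))
  | .fstore a b, s =>
      { s.touch (s.ireg a) with fmem := Function.update s.fmem (s.ireg a) (s.freg b) }
  | .isEq d a b, s => s.setInt d (if s.freg a = s.freg b then 1 else 0)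
  | .read flag i d, s =>
      match s.stream with
      | [] => s.setInt flag 0
      | (j, δ) :: rest => (({ s with stream := rest }.setInt flag 1).setInt i j).setField d δ
  | .toss d, s => { s.setField d (s.coins 0) with coins := fun k => s.coins (k + 1) }
  | .send a, s => s.say (.send (s.freg a))
  | .recv d, s => (s.say (.recv (peer s.trace))).setField d (peer s.trace)
  | .output a, s => { s with out := some (s.freg a) }

/-- `Runs peer p s s'`: program `p`, started in state `s`, halts in state `s'`. -/
inductive Runs {K : Type*} [Field K] (peer : List (Event K) → K) :
    Prog → State K → State K → Prop
  | skip (s : State K) : Runs peer .skip s s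
  | op (o : Op) (s : State K) : Runs peer (.op o) s (o.effect peer s).tick
  | seq {p q : Prog} {s s' s'' : State K} :
      Runs peer p s s' → Runs peer q s' s'' → Runs peer (.seq p q) s s''
  | iteTrue {t : ℕ} {p q : Prog} {s s' : State K} :
      s.ireg t ≠ 0 → Runs peer p s.tick s' → Runs peer (.ite t p q) s s'
  | iteFalse {t : ℕ} {p q : Prog} {s s' : State K} :
      s.ireg t = 0 → Runs peer q s.tick s' → Runs peer (.ite t p q) s s'
  | loopTrue {t : ℕ} {p : Prog} {s s' s'' : State K} :
      s.ireg t ≠ 0 → Runs peer p s.tick s' → Runs peer (.loop t p) s' s'' →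
        Runs peer (.loop t p) s s''
  | loopFalse {t : ℕ} {p : Prog} {s : State K} :
      s.ireg t = 0 → Runs peer (.loop t p) s s.tick

/-! ### Prover and verifier as machines -/

section Machines

variable {n : ℕ} {F K : Type*} [Field F] [Field K] [Algebra F K]

/-- The start state: register `0` holds `n`, the integer memory holds the numbers `mem` from
address `0` on, and everything else is zero. -/
def State.start (n : ℕ) (mem : List ℕ) (σ : List (Fin n × F)) (coins : ℕ → K) : State K where
  ireg := Function.update (fun _ => 0) 0 n
  freg := fun _ => 0
  imem := fun a => mem.getD a 0
  fmem := fun _ => 0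
  stream := σ.map fun p => (p.1.val, algebraMap F K p.2)
  coins := coins
  trace := []
  out := none
  time := 0
  space := 0
  peak := 0

/-- The words sent in a conversation. -/
def sentWords (tr : List (Event K)) : List K :=
  tr.filterMap fun e => match e with
    | .send w => some w
    | .recv _ => none

/-- The number of words received in a conversation. -/
def numReceived (tr : List (Event K)) : ℕ :=
  tr.countP fun e => match e with
    | .send _ => false
    | .recv _ => true

/-- The number of words received since the last word was sent. -/
def receivedSinceSend (tr : List (Event K)) : ℕ :=
  (tr.reverse.takeWhile fun e => match e with
    | .send _ => false
    | .recv _ => true).length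

/-- A prover strategy, as seen by the verifier. -/
def proverPeer (P : Strategy K) (tr : List (Event K)) : K :=
  P (sentWords tr) (receivedSinceSend tr)

/-- The verifier with challenges `r`, as seen by the prover. -/
def challengePeer (r : ℕ → K) (tr : List (Event K)) : K := r (numReceived tr)

/-- The conversation of the honest prover with a verifier whose challenges are `r`. -/
noncomputable def proverTrace (C : LayeredCircuit n) (x : Fin n → K) (r : ℕ → K) :
    List (Event K) :=
  (List.range C.numChallenges).flatMap fun k =>
    ((C.honestMsgs x r).getD k []).map Event.send ++ [Event.recv (r k)]

/-- The conversation of the verifier with challenges `r` and a prover with strategy `P`. -/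
def verifierTrace (C : LayeredCircuit n) (P : Strategy K) (r : ℕ → K) : List (Event K) :=
  (List.range C.numChallenges).flatMap fun k =>
    (List.range (C.msgLengths.getD k 0)).map
      (fun e => Event.recv (P ((List.range k).map r) e)) ++ [Event.send (r k)]

/-- On the stream `σ`, the program `p` is an implementation of the honest prover for the circuit
`C`, given the explicit description of `C`: whatever the challenges are, it sends the messages of
the honest prover, makes at most `t` steps, and uses integers up to `b` only. -/
def ImplementsProver (p : Prog) (C : LayeredCircuit n) (K : Type*) [Field K] [Algebra F K]
    (σ : List (Fin n × F)) (t b : ℕ) : Prop :=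
  ∀ r : ℕ → K, ∃ s : State K,
    Runs (challengePeer r) p (State.start n C.code σ fun _ => 0) s ∧
      s.trace = proverTrace C (fun i => algebraMap F K (freq σ i)) r ∧
      s.time ≤ t ∧ s.peak ≤ b

/-- On the stream `σ`, the program `p` (which knows `n` only) is an implementation of the verifier
for the circuit `C`: whatever the strategy of the prover is, the challenges are the elements of the
random tape, in the order given by the permutation `e`, the conversation and the output are those
of the protocol, and `p` uses at most `m` cells of each memory and integers up to `b` only. -/
def ImplementsVerifier (p : Prog) (C : LayeredCircuit n) (e : Equiv.Perm (Fin C.numChallenges))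
    (K : Type*) [Field K] [Algebra F K] (σ : List (Fin n × F)) (m b : ℕ) : Prop :=
  ∀ (P : Strategy K) (ρ : Fin C.numChallenges → K), ∃ s : State K,
    Runs (proverPeer P) p (State.start n [] σ (ofTape ρ)) s ∧
      s.trace = verifierTrace C P (ofTape (ρ ∘ e)) ∧
      s.out = C.output (fun i => algebraMap F K (freq σ i)) P (ofTape (ρ ∘ e)) ∧
      s.space ≤ m ∧ s.peak ≤ b

end Machines

/-! ### Validity -/

section Validity

variable {n : ℕ} {F K : Type*} [Field F] [Field K] [Algebra F K]

/-- The output of the verifier on the stream `σ`, against the prover `P`, with challenges `ρ`. -/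
noncomputable def protocolOut (C : LayeredCircuit n) (σ : List (Fin n × F)) (P : Strategy K)
    {Ω : Finset K} (ρ : Fin C.numChallenges → Ω) : Option K :=
  C.output (fun i => algebraMap F K (freq σ i)) P (ofTape fun k => (ρ k : K))

/-- The correct answer `f(a)`, where `a` is the frequency vector of the stream. -/
noncomputable def answer (C : LayeredCircuit n) (K : Type*) [Field K] [Algebra F K]
    (σ : List (Fin n × F)) : K :=
  algebraMap F K (C.eval (freq σ))

/-- The honest prover makes the verifier output the correct answer with probability `1`. -/
def Complete (C : LayeredCircuit n) (Ω : Finset K) (σ : List (Fin n × F)) : Prop :=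
  ∀ ρ : Fin C.numChallenges → Ω,
    protocolOut C σ (C.honestProver fun i => algebraMap F K (freq σ i)) ρ =
      some (answer C K σ)

open Classical in
/-- For every prover, the probability over uniform challenges from `Ω` that the verifier's output
is neither the correct answer nor `⊥` is at most `1/3`. -/
def Sound (C : LayeredCircuit n) (Ω : Finset K) (σ : List (Fin n × F)) : Prop :=
  ∀ P : Strategy K,
    ((Finset.univ.filter fun ρ : Fin C.numChallenges → Ω =>
        protocolOut C σ P ρ ≠ some (answer C K σ) ∧ protocolOut C σ P ρ ≠ none).card : ℚ) /
      Fintype.card (Fin C.numChallenges → Ω) ≤ 1 / 3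

end Validity

end GKR

/-!
Soundness and completeness concern the protocol alone. At iteration `i` the sum over the Boolean
cube of the polynomial `f_i` is the value of the multilinear extension of layer `i` at `z_i`
(`partialSum_layerPoly_zero`), and its value at the challenges is determined by the values of the
line polynomial at `0` and `1` (`eval_layerPoly_eq_linePoly`). So a wrong claimed output remains a
wrong claim from layer to layer, unless at some point the polynomial that is sent differs from the
honest one but agrees with it at the challenge that follows (`claim_eq_of_accepts`). Such an event
has probability at most the degree of the polynomial over `|Ω|` (`card_agree_mul_le`), and the
degrees add up to `totalDegree` (`sound`). The honest messages pass all checks (`complete`).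

For the statements about the machine, programs are written in a small structured language, whose
variables are registers and whose arrays are interleaved in the memory. Its semantics `Exec` counts
steps and keeps track of the sizes of integers and addresses, the compiled programs inherit these
bounds (`Exec.compile_spec`), and the rules for `Tr` are used to verify programs.

*The prover.* A sum-check costs time linear in the sizes of the tables if the polynomial has the
form `A B + D` with `A`, `B` and `D` multilinear and given by tables: these are folded, and halved,
after every challenge (`sumcheck_spec`). Each of the three parts of a sum-check of the protocol is
of this form, with tables that result from the gates of the layer in a single pass
(`roundPoly_layerPoly_p`, `roundPoly_layerPoly_left`, `roundPoly_layerPoly_right`, `gather_spec`).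
The line polynomial of a layer with `s` gates is obtained from the table of values in
`O(s log s)` steps, by folding a table of polynomials (`lineTable_spec`). Summation over the layers
gives `O(S log S)` (`sum_iteration_cost_le`, `implementsProver`).

*The verifier.* It has no room for the circuit. Whenever it needs a number of the description, it
runs the log-space transducer from the start and keeps only the number in question (`ask_spec`); so
it evaluates the extensions of the wiring predicates gate by gate (`wiringSums_spec`). At the end it
needs the extension of the input at the point `z_d`, but the stream has to be read before the
conversation starts. As `z_d` depends only on the challenges of the last iteration, these are drawn
first, and the value is accumulated while the stream is read (`readStream_spec`). This is the reason
for the permutation `coinOrder` of the random tape (`implementsVerifier`).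
-/

set_option linter.constructorNameAsVariable false
set_option linter.unusedSectionVars false

namespace GKR

/-! ### A structured language for the random access machine -/

/-- Names of the integer variables of the programs. The order matters only for `n`, which is
register `0`, where the machine finds the number of input wires at the start. -/
inductive IVar
  | n | depth | layer | base | base' | width | width' | bits | bits' | size | size'
  | ptr | lft | rgt | kind | run | idx | pow
  | j | k | x | y | e
  | query | ans | state | ihead | whead | wmax | cnt | cur | ok | flag | gates | len
  deriving DecidableEq

/-- Names of the variables for field elements. -/
inductive FVar
  | c0 | c1 | c2 | rho | delta | chi | acc | claim | claim0 | val1 | beta | addSum | mulSum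
  | q0 | q1 | qt | tpow | wt
  deriving DecidableEq

/-- Names of the arrays of field elements. -/
inductive Arr
  | val | A | B | C | E | D | G | Z | R | L
  deriving DecidableEq

/-- The register of an integer variable. The registers from `64` on are left for intermediate
results. -/
def IVar.reg (v : IVar) : ℕ := v.ctorIdx

/-- The register of a field variable. -/
def FVar.reg (v : FVar) : ℕ := v.ctorIdx

/-- The number of an array. Entry `k` of array number `t` is stored at the address `16 * k + t`, so
that all arrays share one memory and its size is proportional to the largest index in use. -/
def Arr.num (A : Arr) : ℕ := A.ctorIdx

theorem IVar.reg_lt (v : IVar) : v.reg < 64 := by cases v <;> decide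
theorem FVar.reg_lt (v : FVar) : v.reg < 64 := by cases v <;> decide
theorem Arr.num_lt (v : Arr) : v.num < 16 := by cases v <;> decide

theorem IVar.reg_inj {v w : IVar} : v.reg = w.reg ↔ v = w := by
  constructor
  · intro h
    rw [← IVar.ofNat_ctorIdx v, ← IVar.ofNat_ctorIdx w]
    exact congrArg _ h
  · rintro rfl; rfl

theorem FVar.reg_inj {v w : FVar} : v.reg = w.reg ↔ v = w := by
  constructor
  · intro h
    rw [← FVar.ofNat_ctorIdx v, ← FVar.ofNat_ctorIdx w]
    exact congrArg _ h
  · rintro rfl; rfl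

theorem Arr.num_inj {v w : Arr} : v.num = w.num ↔ v = w := by
  constructor
  · intro h
    rw [← Arr.ofNat_ctorIdx v, ← Arr.ofNat_ctorIdx w]
    exact congrArg _ h
  · rintro rfl; rfl

/-- The part of the state of the machine that the variables and arrays of the language name. -/
structure Store (K : Type*) where
  int : IVar → ℕ
  fld : FVar → K
  imem : ℕ → ℕ
  arr : Arr → ℕ → K
  stream : List (ℕ × K)
  coins : ℕ → K
  trace : List (Event K)
  out : Option K

/-- The store that a state of the machine represents. -/
def State.view {K : Type*} (s : State K) : Store K where
  int v := s.ireg v.reg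
  fld v := s.freg v.reg
  imem := s.imem
  arr A k := s.fmem (16 * k + A.num)
  stream := s.stream
  coins := s.coins
  trace := s.trace
  out := s.out

/-- Integer expressions. -/
inductive IExp
  | const (c : ℕ)
  | var (v : IVar)
  | bin (o : IntOp) (x y : IExp)
  | load (x : IExp)

/-- Field expressions; `load A x` is entry `x` of the array `A`. -/
inductive FExp
  | zero
  | one
  | var (v : FVar)
  | bin (o : FieldOp) (x y : FExp)
  | load (A : Arr) (x : IExp)

instance : Coe IVar IExp := ⟨IExp.var⟩
instance : Coe FVar FExp := ⟨FExp.var⟩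
instance (c : ℕ) : OfNat IExp c := ⟨IExp.const c⟩
instance : Add IExp := ⟨IExp.bin .add⟩
instance : Sub IExp := ⟨IExp.bin .sub⟩
instance : Mul IExp := ⟨IExp.bin .mul⟩
instance : Div IExp := ⟨IExp.bin .div⟩
instance : Mod IExp := ⟨IExp.bin .mod⟩
instance : Zero FExp := ⟨FExp.zero⟩
instance : One FExp := ⟨FExp.one⟩
instance : Add FExp := ⟨FExp.bin .add⟩
instance : Sub FExp := ⟨FExp.bin .sub⟩
instance : Mul FExp := ⟨FExp.bin .mul⟩

/-- The environment of a computation: the other party, the bound `B` for the integers in use, and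
the bound `M` for the addresses in use. -/
structure Env (K : Type*) where
  peer : List (Event K) → K
  B : ℕ
  M : ℕ

namespace IExp

variable {K : Type*}

/-- The value of an integer expression. -/
def eval (a : Store K) : IExp → ℕ
  | const c => c
  | var v => a.int v
  | bin o x y => o.apply (x.eval a) (y.eval a)
  | load x => a.imem (x.eval a)

/-- The intermediate results respect the bounds of the environment. Differences, quotients and
remainders are at most their first operand and need no condition. -/
def Ok (E : Env K) (a : Store K) : IExp → Prop
  | const c => c ≤ E.B
  | var _ => True
  | bin .add x y => x.Ok E a ∧ y.Ok E a ∧ x.eval a + y.eval a ≤ E.B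
  | bin .mul x y => x.Ok E a ∧ y.Ok E a ∧ x.eval a * y.eval a ≤ E.B
  | bin _ x y => x.Ok E a ∧ y.Ok E a
  | load x => x.Ok E a ∧ x.eval a + 1 ≤ E.M

/-- The number of steps of the evaluation. -/
def cost : IExp → ℕ
  | const _ => 1
  | var _ => 2
  | bin _ x y => x.cost + y.cost + 1
  | load x => x.cost + 1

/-- Evaluation into register `d`, using the registers from `d` on. The machine has no operation that
copies a register, hence the addition of zero. -/
def compile : IExp → ℕ → Prog
  | const c, d => .op (.const d c)
  | var v, d => .seq (.op (.const d 0)) (.op (.int .add d v.reg d))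
  | bin o x y, d => .seq (x.compile d) (.seq (y.compile (d + 1)) (.op (.int o d d (d + 1))))
  | load x, d => .seq (x.compile d) (.op (.load d d))

section simps
variable (a : Store K) (E : Env K) (x y : IExp) (c : ℕ) (v : IVar)
@[simp] theorem eval_const : (const c).eval a = c := rfl
@[simp] theorem eval_ofNat : (no_index (OfNat.ofNat c) : IExp).eval a = c := rfl
@[simp] theorem eval_var : (var v).eval a = a.int v := rfl
@[simp] theorem eval_add : (x + y).eval a = x.eval a + y.eval a := rfl
@[simp] theorem eval_sub : (x - y).eval a = x.eval a - y.eval a := rfl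
@[simp] theorem eval_mul : (x * y).eval a = x.eval a * y.eval a := rfl
@[simp] theorem eval_div : (x / y).eval a = x.eval a / y.eval a := rfl
@[simp] theorem eval_mod : (x % y).eval a = x.eval a % y.eval a := rfl
@[simp] theorem eval_load : (load x).eval a = a.imem (x.eval a) := rfl
@[simp] theorem ok_const : (const c).Ok E a ↔ c ≤ E.B := Iff.rfl
@[simp] theorem ok_ofNat : (no_index (OfNat.ofNat c) : IExp).Ok E a ↔ c ≤ E.B := Iff.rfl
@[simp] theorem ok_var : (var v).Ok E a ↔ True := Iff.rfl
@[simp] theorem ok_add : (x + y).Ok E a ↔ x.Ok E a ∧ y.Ok E a ∧ x.eval a + y.eval a ≤ E.B := Iff.rfl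
@[simp] theorem ok_mul : (x * y).Ok E a ↔ x.Ok E a ∧ y.Ok E a ∧ x.eval a * y.eval a ≤ E.B := Iff.rfl
@[simp] theorem ok_sub : (x - y).Ok E a ↔ x.Ok E a ∧ y.Ok E a := Iff.rfl
@[simp] theorem ok_div : (x / y).Ok E a ↔ x.Ok E a ∧ y.Ok E a := Iff.rfl
@[simp] theorem ok_mod : (x % y).Ok E a ↔ x.Ok E a ∧ y.Ok E a := Iff.rfl
@[simp] theorem ok_load :
    (load x).Ok E a ↔ x.Ok E a ∧ x.eval a + 1 ≤ E.M := Iff.rfl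
@[simp] theorem cost_const : (const c).cost = 1 := rfl
@[simp] theorem cost_ofNat : (no_index (OfNat.ofNat c) : IExp).cost = 1 := rfl
@[simp] theorem cost_var : (var v).cost = 2 := rfl
@[simp] theorem cost_add : (x + y).cost = x.cost + y.cost + 1 := rfl
@[simp] theorem cost_sub : (x - y).cost = x.cost + y.cost + 1 := rfl
@[simp] theorem cost_mul : (x * y).cost = x.cost + y.cost + 1 := rfl
@[simp] theorem cost_div : (x / y).cost = x.cost + y.cost + 1 := rfl
@[simp] theorem cost_mod : (x % y).cost = x.cost + y.cost + 1 := rfl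
@[simp] theorem cost_load : (load x).cost = x.cost + 1 := rfl
end simps

end IExp

/-- Entry `k` of an array may be accessed. -/
def Env.Idx {K : Type*} (E : Env K) (k : ℕ) : Prop :=
  16 * (k + 1) ≤ E.B ∧ 16 * (k + 1) ≤ E.M

/-- The address of entry `x` of the array `A`. -/
def Arr.addr (A : Arr) (x : IExp) : IExp := .const 16 * x + .const A.num

namespace FExp

variable {K : Type*} [Field K]

/-- The value of a field expression. -/
def eval (a : Store K) : FExp → K
  | zero => 0
  | one => 1
  | var v => a.fld v
  | bin o x y => o.apply (x.eval a) (y.eval a)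
  | load A x => a.arr A (x.eval a)

/-- The intermediate results of the address computations respect the bounds of the environment. -/
def Ok (E : Env K) (a : Store K) : FExp → Prop
  | zero => True
  | one => True
  | var _ => True
  | bin _ x y => x.Ok E a ∧ y.Ok E a
  | load _ x => x.Ok E a ∧ E.Idx (x.eval a)

/-- The number of steps of the evaluation. -/
def cost : FExp → ℕ
  | zero => 1
  | one => 1
  | var _ => 2
  | bin _ x y => x.cost + y.cost + 1
  | load A x => (A.addr x).cost + 1

/-- Evaluation into the field register `d`, using the field registers from `d` on and the integer
registers from `64` on. -/
def compile : FExp → ℕ → Prog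
  | zero, d => .op (.zero d)
  | one, d => .op (.one d)
  | var v, d => .seq (.op (.zero d)) (.op (.field .add d v.reg d))
  | bin o x y, d => .seq (x.compile d) (.seq (y.compile (d + 1)) (.op (.field o d d (d + 1))))
  | load A x, d => .seq ((A.addr x).compile 64) (.op (.fload d 64))

section simps
variable (a : Store K) (E : Env K) (x y : FExp) (v : FVar) (A : Arr) (k : IExp)
@[simp] theorem eval_zero : (0 : FExp).eval a = 0 := rfl
@[simp] theorem eval_one : (1 : FExp).eval a = 1 := rfl
@[simp] theorem eval_var : (var v).eval a = a.fld v := rfl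
@[simp] theorem eval_add : (x + y).eval a = x.eval a + y.eval a := rfl
@[simp] theorem eval_sub : (x - y).eval a = x.eval a - y.eval a := rfl
@[simp] theorem eval_mul : (x * y).eval a = x.eval a * y.eval a := rfl
@[simp] theorem eval_load : (load A k).eval a = a.arr A (k.eval a) := rfl
@[simp] theorem ok_zero : (0 : FExp).Ok E a ↔ True := Iff.rfl
@[simp] theorem ok_one : (1 : FExp).Ok E a ↔ True := Iff.rfl
@[simp] theorem ok_var : (var v).Ok E a ↔ True := Iff.rfl
@[simp] theorem ok_add : (x + y).Ok E a ↔ x.Ok E a ∧ y.Ok E a := Iff.rfl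
@[simp] theorem ok_sub : (x - y).Ok E a ↔ x.Ok E a ∧ y.Ok E a := Iff.rfl
@[simp] theorem ok_mul : (x * y).Ok E a ↔ x.Ok E a ∧ y.Ok E a := Iff.rfl
@[simp] theorem ok_load : (load A k).Ok E a ↔ k.Ok E a ∧ E.Idx (k.eval a) := Iff.rfl
@[simp] theorem cost_zero : (0 : FExp).cost = 1 := rfl
@[simp] theorem cost_one : (1 : FExp).cost = 1 := rfl
@[simp] theorem cost_var : (var v).cost = 2 := rfl
@[simp] theorem cost_add : (x + y).cost = x.cost + y.cost + 1 := rfl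
@[simp] theorem cost_sub : (x - y).cost = x.cost + y.cost + 1 := rfl
@[simp] theorem cost_mul : (x * y).cost = x.cost + y.cost + 1 := rfl
@[simp] theorem cost_load : (load A k).cost = k.cost + 5 := by
  simp [cost, Arr.addr]; ring
end simps

end FExp

/-- Elementary commands. -/
inductive Cmd
  | iset (v : IVar) (x : IExp)
  | fset (v : FVar) (x : FExp)
  | istore (x y : IExp)
  | fstore (A : Arr) (x : IExp) (y : FExp)
  | eqf (v : IVar) (x y : FExp)
  | read (flag i : IVar) (δ : FVar)
  | toss (v : FVar)
  | send (x : FExp)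
  | recv (v : FVar)
  | output (x : FExp)

/-- The components of a store that are not variables or arrays. -/
inductive Comp
  | imem | stream | coins | trace | out
  deriving DecidableEq

namespace Cmd

variable {K : Type*} [Field K]

open Classical in
/-- The effect of a command. As on the machine, the stream is over once the conversation has
begun. -/
noncomputable def run (E : Env K) : Cmd → Store K → Store K
  | iset v x, a => { a with int := Function.update a.int v (x.eval a) }
  | fset v x, a => { a with fld := Function.update a.fld v (x.eval a) }
  | istore x y, a => { a with imem := Function.update a.imem (x.eval a) (y.eval a) }
  | fstore A x y, a =>
      { a with arr := Function.update a.arr A (Function.update (a.arr A) (x.eval a) (y.eval a)) }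
  | eqf v x y, a => { a with int := Function.update a.int v (if x.eval a = y.eval a then 1 else 0) }
  | read flag i δ, a =>
      match a.stream with
      | [] => { a with int := Function.update a.int flag 0 }
      | (j, d) :: rest =>
          { a with
            int := Function.update (Function.update a.int flag 1) i j
            fld := Function.update a.fld δ d
            stream := rest }
  | toss v, a =>
      { a with fld := Function.update a.fld v (a.coins 0), coins := fun k => a.coins (k + 1) }
  | send x, a => { a with trace := a.trace ++ [.send (x.eval a)], stream := [] }
  | recv v, a =>
      { a with
        fld := Function.update a.fld v (E.peer a.trace)
        trace := a.trace ++ [.recv (E.peer a.trace)]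
        stream := [] }
  | output x, a => { a with out := some (x.eval a) }

/-- The command respects the bounds of the environment. -/
def Ok (E : Env K) (a : Store K) : Cmd → Prop
  | iset _ x => x.Ok E a
  | fset _ x => x.Ok E a
  | istore x y => x.Ok E a ∧ y.Ok E a ∧ x.eval a + 1 ≤ E.M
  | fstore _ x y => x.Ok E a ∧ y.Ok E a ∧ E.Idx (x.eval a)
  | eqf _ x y => x.Ok E a ∧ y.Ok E a
  | send x => x.Ok E a
  | output x => x.Ok E a
  | _ => True

/-- The number of steps of a command. -/
def cost : Cmd → ℕ
  | iset _ x => x.cost + 2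
  | fset _ x => x.cost + 2
  | istore x y => x.cost + y.cost + 1
  | fstore _ x y => x.cost + y.cost + 5
  | eqf _ x y => x.cost + y.cost + 1
  | send x => x.cost + 1
  | output x => x.cost + 1
  | _ => 1

/-- The program of a command. -/
def compile : Cmd → Prog
  | iset v x => .seq (x.compile 64) (.seq (.op (.const 65 0)) (.op (.int .add v.reg 64 65)))
  | fset v x => .seq (x.compile 64) (.seq (.op (.zero 65)) (.op (.field .add v.reg 64 65)))
  | istore x y => .seq (x.compile 64) (.seq (y.compile 65) (.op (.store 64 65)))
  | fstore A x y => .seq (y.compile 64) (.seq ((A.addr x).compile 64) (.op (.fstore 64 64)))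
  | eqf v x y => .seq (x.compile 64) (.seq (y.compile 65) (.op (.isEq v.reg 64 65)))
  | read flag i δ => .op (.read flag.reg i.reg δ.reg)
  | toss v => .op (.toss v.reg)
  | send x => .seq (x.compile 64) (.op (.send 64))
  | recv v => .op (.recv v.reg)
  | output x => .seq (x.compile 64) (.op (.output 64))

/-- The command changes only the listed variables, arrays and components. -/
def within (iv : List IVar) (fv : List FVar) (ar : List Arr) (cs : List Comp) : Cmd → Bool
  | iset v _ => v ∈ iv
  | fset v _ => v ∈ fv
  | istore _ _ => .imem ∈ cs
  | fstore A _ _ => A ∈ ar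
  | eqf v _ _ => v ∈ iv
  | read flag i δ => flag ∈ iv && i ∈ iv && δ ∈ fv && .stream ∈ cs
  | toss v => v ∈ fv && .coins ∈ cs
  | send _ => .trace ∈ cs && .stream ∈ cs
  | recv v => v ∈ fv && .trace ∈ cs && .stream ∈ cs
  | output _ => .out ∈ cs

end Cmd

/-- Structured programs. -/
inductive Code
  | block (l : List Cmd)
  | seq (p q : Code)
  | ite (c : IExp) (p q : Code)
  | loop (c : IExp) (p : Code)

/-- Sequential composition. -/
infixr:60 " ;; " => Code.seq

namespace Code

/-- Translation into programs of the machine. -/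
def compile : Code → Prog
  | block l => l.foldr (fun c p => .seq c.compile p) .skip
  | seq p q => .seq p.compile q.compile
  | ite c p q => .seq (c.compile 64) (.ite 64 p.compile q.compile)
  | loop c p => .seq (c.compile 64) (.loop 64 (.seq p.compile (c.compile 64)))

/-- The program changes only the listed variables, arrays and components. -/
def within (iv : List IVar) (fv : List FVar) (ar : List Arr) (cs : List Comp) : Code → Bool
  | block l => l.all (Cmd.within iv fv ar cs)
  | seq p q => p.within iv fv ar cs && q.within iv fv ar cs
  | ite _ p q => p.within iv fv ar cs && q.within iv fv ar cs
  | loop _ p => p.within iv fv ar cs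

/-- The body `p` is executed for `x = 0, 1, …, b - 1`. -/
def forTo (x : IVar) (b : IExp) (p : Code) : Code :=
  block [.iset x 0] ;; loop (b - x) (p ;; block [.iset x (x + 1)])

end Code

section Exec

variable {K : Type*} [Field K]

/-- Execution of a list of commands. -/
noncomputable def runs (E : Env K) : List Cmd → Store K → Store K
  | [], a => a
  | c :: l, a => runs E l (c.run E a)

/-- The commands of a list respect the bounds of the environment. -/
def Oks (E : Env K) : List Cmd → Store K → Prop
  | [], _ => True
  | c :: l, a => c.Ok E a ∧ Oks E l (c.run E a)

/-- The number of steps of a list of commands. -/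
def costs (l : List Cmd) : ℕ := (l.map Cmd.cost).sum

/-- `Exec E p a t a'`: program `p`, started in the store `a`, halts in the store `a'` after `t`
steps and respects the bounds of the environment. -/
inductive Exec (E : Env K) : Code → Store K → ℕ → Store K → Prop
  | block (l : List Cmd) (a : Store K) : Oks E l a → Exec E (.block l) a (costs l) (runs E l a)
  | seq {p q : Code} {a a' a'' : Store K} {t t' : ℕ} :
      Exec E p a t a' → Exec E q a' t' a'' → Exec E (.seq p q) a (t + t') a''
  | iteTrue {c : IExp} {p q : Code} {a a' : Store K} {t : ℕ} : c.Ok E a → c.eval a ≠ 0 →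
      Exec E p a t a' → Exec E (.ite c p q) a (c.cost + 1 + t) a'
  | iteFalse {c : IExp} {p q : Code} {a a' : Store K} {t : ℕ} : c.Ok E a → c.eval a = 0 →
      Exec E q a t a' → Exec E (.ite c p q) a (c.cost + 1 + t) a'
  | loopTrue {c : IExp} {p : Code} {a a' a'' : Store K} {t t' : ℕ} : c.Ok E a → c.eval a ≠ 0 →
      Exec E p a t a' → Exec E (.loop c p) a' t' a'' →
        Exec E (.loop c p) a (c.cost + 1 + t + t') a''
  | loopFalse {c : IExp} {p : Code} {a : Store K} : c.Ok E a → c.eval a = 0 →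
      Exec E (.loop c p) a (c.cost + 1) a

/-- The state of the machine respects the bounds of the environment. -/
structure Env.Inv (E : Env K) (s : State K) : Prop where
  peak : s.peak ≤ E.B
  ireg : ∀ i, s.ireg i ≤ E.B
  imem : ∀ i, s.imem i ≤ E.B
  stream : ∀ p ∈ s.stream, p.1 ≤ E.B
  space : s.space ≤ E.M
  pos : 1 ≤ E.B

/-- The compiled expression leaves its value in register `d` and changes neither a lower register
nor a memory. -/
theorem IExp.compile_spec (E : Env K) (e : IExp) : ∀ (d : ℕ) (s : State K), 64 ≤ d → E.Inv s →
    e.Ok E s.view → ∃ s', Runs E.peer (e.compile d) s s' ∧ E.Inv s' ∧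
      s'.ireg d = e.eval s.view ∧ (∀ i < d, s'.ireg i = s.ireg i) ∧
      s' = { s with
        ireg := s'.ireg, time := s.time + e.cost, space := s'.space, peak := s'.peak } := by
  induction e with
  | const c =>
    intro d s hd hs hok
    refine ⟨_, .op _ _, ?_, ?_, ?_, rfl⟩
    · refine ⟨max_le hs.peak hok, fun i => ?_, hs.imem, hs.stream, hs.space, hs.pos⟩
      change Function.update s.ireg d c i ≤ _
      rw [Function.update_apply]; split
      · exact hok
      · exact hs.ireg i
    · exact Function.update_self ..
    · exact fun i hi => Function.update_of_ne hi.ne _ _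
  | var v =>
    intro d s hd hs hok
    have hv : v.reg ≠ d := by have := v.reg_lt; omega
    refine ⟨_, .seq (.op _ _) (.op _ _), ?_, ?_, ?_, rfl⟩
    · refine ⟨?_, fun i => ?_, hs.imem, hs.stream, hs.space, hs.pos⟩
      · have := hs.peak; have := hs.ireg v.reg
        simp [Op.effect, State.setInt, State.tick, IntOp.apply, hv]; omega
      · have := hs.ireg v.reg; have := hs.ireg i
        simp only [Op.effect, State.setInt, State.tick, IntOp.apply, Function.update_apply, hv]
        split_ifs <;> simp_all
    · simp [Op.effect, State.setInt, State.tick, IntOp.apply, hv, State.view, IExp.eval]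
    · intro i hi
      simp [Op.effect, State.setInt, State.tick, hi.ne]
  | bin o x y ihx ihy =>
    intro d s hd hs hok
    have hx : x.Ok E s.view := by cases o <;> simp only [IExp.Ok] at hok <;> exact hok.1
    have hy : y.Ok E s.view := by
      cases o <;> simp only [IExp.Ok] at hok <;> first | exact hok.2.1 | exact hok.2
    obtain ⟨s₁, r₁, i₁, v₁, f₁, e₁⟩ := ihx d s hd hs hx
    have hv : s₁.view = s.view := by
      rw [e₁]; simp only [State.view]; congr 1; funext w
      exact f₁ _ (w.reg_lt.trans_le hd)
    obtain ⟨s₂, r₂, i₂, v₂, f₂, e₂⟩ := ihy (d + 1) s₁ (by omega) i₁ (hv ▸ hy)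
    have hval : s₂.ireg d = x.eval s.view := by rw [f₂ d (by omega), v₁]
    rw [hv] at v₂
    have hb : o.apply (s₂.ireg d) (s₂.ireg (d + 1)) ≤ E.B := by
      have hxB := i₂.ireg d
      rw [hval] at hxB
      rw [hval, v₂]
      cases o <;> simp only [IExp.Ok] at hok <;> simp only [IntOp.apply]
      · exact hok.2.2
      · omega
      · exact hok.2.2
      · exact (Nat.div_le_self _ _).trans hxB
      · exact (Nat.mod_le _ _).trans hxB
    refine ⟨_, .seq r₁ (.seq r₂ (.op _ _)), ?_, ?_, ?_, ?_⟩
    · refine ⟨max_le i₂.peak hb, fun i => ?_, i₂.imem, i₂.stream, i₂.space, i₂.pos⟩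
      change Function.update s₂.ireg d _ i ≤ _
      rw [Function.update_apply]; split
      · exact hb
      · exact i₂.ireg i
    · change Function.update s₂.ireg d _ d = _
      rw [Function.update_self, hval, v₂]; rfl
    · intro i hi
      change Function.update s₂.ireg d _ i = _
      rw [Function.update_of_ne hi.ne, f₂ i (by omega), f₁ i hi]
    · simp only [Op.effect, State.setInt, State.tick]
      rw [e₂, e₁]; simp [IExp.cost]; omega
  | load x ih =>
    intro d s hd hs hok
    obtain ⟨s₁, r₁, i₁, v₁, f₁, e₁⟩ := ih d s hd hs hok.1
    refine ⟨_, .seq r₁ (.op _ _), ?_, ?_, ?_, ?_⟩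
    · refine ⟨max_le i₁.peak (i₁.imem _), fun i => ?_, i₁.imem, i₁.stream, ?_, i₁.pos⟩
      · change Function.update s₁.ireg d _ i ≤ _
        rw [Function.update_apply]; split
        · exact i₁.imem _
        · exact i₁.ireg i
      · change max s₁.space (s₁.ireg d + 1) ≤ _
        rw [v₁]
        exact max_le i₁.space hok.2
    · change Function.update s₁.ireg d _ d = _
      rw [Function.update_self, v₁, e₁]; rfl
    · intro i hi
      change Function.update s₁.ireg d _ i = _
      rw [Function.update_of_ne hi.ne, f₁ i hi]
    · simp only [Op.effect, State.setInt, State.tick, State.touch]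
      rw [e₁]; simp [IExp.cost]; omega

theorem State.view_eq_of_ireg {s s' : State K} (f : ∀ i < 64, s'.ireg i = s.ireg i) {t m p}
    (e : s' = { s with ireg := s'.ireg, time := t, space := m, peak := p }) :
    s'.view = s.view := by
  rw [e]; simp only [State.view]; congr 1; funext w
  exact f _ w.reg_lt

/-- An index that the environment allows has an address that it allows. -/
theorem Arr.addr_spec {E : Env K} {A : Arr} {x : IExp} {a : Store K} (hx : x.Ok E a)
    (h : E.Idx (x.eval a)) : (A.addr x).Ok E a ∧ (A.addr x).eval a = 16 * x.eval a + A.num ∧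
      (A.addr x).eval a + 1 ≤ E.M := by
  obtain ⟨h₁, h₂⟩ := h
  have := A.num_lt
  refine ⟨?_, rfl, le_trans ?_ h₂⟩
  · simp only [Arr.addr, IExp.ok_add, IExp.ok_mul, IExp.ok_const, IExp.eval_mul, IExp.eval_const]
    refine ⟨⟨by omega, hx, by omega⟩, by omega, by omega⟩
  · simp only [Arr.addr, IExp.eval_add, IExp.eval_mul, IExp.eval_const]
    omega

/-- The compiled expression leaves its value in field register `d`; the integer registers that it
changes hold no variables. -/
theorem FExp.compile_spec (E : Env K) (e : FExp) : ∀ (d : ℕ) (s : State K), 64 ≤ d → E.Inv s →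
    e.Ok E s.view → ∃ s', Runs E.peer (e.compile d) s s' ∧ E.Inv s' ∧
      s'.freg d = e.eval s.view ∧ (∀ i < d, s'.freg i = s.freg i) ∧
      (∀ i < 64, s'.ireg i = s.ireg i) ∧
      s' = { s with
        ireg := s'.ireg, freg := s'.freg, time := s.time + e.cost, space := s'.space,
        peak := s'.peak } := by
  induction e with
  | zero =>
    intro d s hd hs hok
    refine ⟨_, .op _ _, ⟨hs.peak, hs.ireg, hs.imem, hs.stream, hs.space, hs.pos⟩, ?_, ?_, ?_, rfl⟩
    · exact Function.update_self ..
    · exact fun i hi => Function.update_of_ne hi.ne _ _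
    · exact fun i hi => rfl
  | one =>
    intro d s hd hs hok
    refine ⟨_, .op _ _, ⟨hs.peak, hs.ireg, hs.imem, hs.stream, hs.space, hs.pos⟩, ?_, ?_, ?_, rfl⟩
    · exact Function.update_self ..
    · exact fun i hi => Function.update_of_ne hi.ne _ _
    · exact fun i hi => rfl
  | var v =>
    intro d s hd hs hok
    have hv : v.reg ≠ d := by have := v.reg_lt; omega
    refine ⟨_, .seq (.op _ _) (.op _ _), ⟨hs.peak, hs.ireg, hs.imem, hs.stream, hs.space, hs.pos⟩,
      ?_, ?_, ?_, rfl⟩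
    · simp [Op.effect, State.setField, State.tick, FieldOp.apply, hv, State.view, FExp.eval]
    · intro i hi
      simp [Op.effect, State.setField, State.tick, hi.ne]
    · exact fun i hi => rfl
  | bin o x y ihx ihy =>
    intro d s hd hs hok
    obtain ⟨s₁, r₁, i₁, v₁, f₁, g₁, e₁⟩ := ihx d s hd hs hok.1
    have hv : s₁.view = s.view := by
      rw [e₁]; simp only [State.view]; congr 1
      · funext w; exact g₁ _ w.reg_lt
      · funext w; exact f₁ _ (w.reg_lt.trans_le hd)
    obtain ⟨s₂, r₂, i₂, v₂, f₂, g₂, e₂⟩ := ihy (d + 1) s₁ (by omega) i₁ (hv ▸ hok.2)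
    have hval : s₂.freg d = x.eval s.view := by rw [f₂ d (by omega), v₁]
    rw [hv] at v₂
    refine ⟨_, .seq r₁ (.seq r₂ (.op _ _)),
      ⟨i₂.peak, i₂.ireg, i₂.imem, i₂.stream, i₂.space, i₂.pos⟩, ?_, ?_, ?_, ?_⟩
    · change Function.update s₂.freg d _ d = _
      rw [Function.update_self, hval, v₂]; rfl
    · intro i hi
      change Function.update s₂.freg d _ i = _
      rw [Function.update_of_ne hi.ne, f₂ i (by omega), f₁ i hi]
    · intro i hi
      change s₂.ireg i = _
      rw [g₂ i hi, g₁ i hi]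
    · simp only [Op.effect, State.setField, State.tick]
      rw [e₂, e₁]; simp [FExp.cost]; omega
  | load A x =>
    intro d s hd hs hok
    obtain ⟨h₁, h₂, h₃⟩ := Arr.addr_spec (A := A) hok.1 hok.2
    obtain ⟨s₁, r₁, i₁, v₁, f₁, e₁⟩ := (A.addr x).compile_spec E 64 s le_rfl hs h₁
    refine ⟨_, .seq r₁ (.op _ _), ?_, ?_, ?_, ?_, ?_⟩
    · refine ⟨i₁.peak, i₁.ireg, i₁.imem, i₁.stream, ?_, i₁.pos⟩
      change max s₁.space (s₁.ireg 64 + 1) ≤ _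
      rw [v₁]
      exact max_le i₁.space h₃
    · change Function.update s₁.freg d _ d = _
      rw [Function.update_self, v₁, h₂, e₁]; rfl
    · intro i hi
      change Function.update s₁.freg d _ i = _
      rw [Function.update_of_ne hi.ne, e₁]
    · exact f₁
    · simp only [Op.effect, State.setField, State.tick, State.touch]
      rw [e₁]; simp [FExp.cost]; omega

theorem State.view_eq_of_regs {s s' : State K} (f : ∀ i < 64, s'.freg i = s.freg i)
    (g : ∀ i < 64, s'.ireg i = s.ireg i) {t m p}
    (e : s' = { s with ireg := s'.ireg, freg := s'.freg, time := t, space := m, peak := p }) :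
    s'.view = s.view := by
  rw [e]; simp only [State.view]; congr 1
  · funext w; exact g _ w.reg_lt
  · funext w; exact f _ w.reg_lt

theorem update_reg_int {α : Type*} (f : ℕ → α) (v : IVar) (c : α) :
    (fun w : IVar => Function.update f v.reg c w.reg) =
      Function.update (fun w : IVar => f w.reg) v c := by
  funext w; simp [Function.update_apply, IVar.reg_inj]

theorem update_reg_fld {α : Type*} (f : ℕ → α) (v : FVar) (c : α) :
    (fun w : FVar => Function.update f v.reg c w.reg) =
      Function.update (fun w : FVar => f w.reg) v c := by
  funext w; simp [Function.update_apply, FVar.reg_inj]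

theorem Cmd.compile_spec (E : Env K) (c : Cmd) (s : State K) (hs : E.Inv s)
    (hok : c.Ok E s.view) : ∃ s', Runs E.peer c.compile s s' ∧ E.Inv s' ∧
      s'.view = c.run E s.view ∧ s'.time = s.time + c.cost := by
  have hset : ∀ (s : State K) (i v : ℕ), E.Inv s → v ≤ E.B →
      ∀ j, Function.update s.ireg i v j ≤ E.B := fun s i v h hv j => by
    rw [Function.update_apply]; split
    · exact hv
    · exact h.ireg j
  cases c with
  | iset v x =>
    obtain ⟨s₁, r₁, i₁, v₁, f₁, e₁⟩ := x.compile_spec E 64 s le_rfl hs hok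
    refine ⟨_, .seq r₁ (.seq (.op _ _) (.op _ _)), ?_, ?_, ?_⟩
    · have h64 := i₁.ireg 64
      refine ⟨?_, fun i => ?_, i₁.imem, i₁.stream, i₁.space, i₁.pos⟩
      · have := i₁.peak
        simp [Op.effect, State.setInt, State.tick, IntOp.apply]; omega
      · have := i₁.ireg i
        simp only [Op.effect, State.setInt, State.tick, IntOp.apply, Function.update_apply]
        split_ifs <;> omega
    · have hv := State.view_eq_of_ireg f₁ e₁
      have v₁' : s₁.ireg 64 = x.eval s₁.view := by rw [v₁, hv]
      have h65 : v.reg ≠ 65 := by have := v.reg_lt; omega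
      rw [Cmd.run, ← hv, ← v₁']
      simp only [State.view, Op.effect, State.setInt, State.tick, IntOp.apply]
      congr 1
      funext w
      have : w.reg ≠ 65 := by have := w.reg_lt; omega
      simp [Function.update_apply, IVar.reg_inj, this]
    · simp only [Op.effect, State.setInt, State.tick]
      rw [e₁]; simp [Cmd.cost]; omega
  | fset v x =>
    obtain ⟨s₁, r₁, i₁, v₁, f₁, g₁, e₁⟩ := x.compile_spec E 64 s le_rfl hs hok
    refine ⟨_, .seq r₁ (.seq (.op _ _) (.op _ _)),
      ⟨i₁.peak, i₁.ireg, i₁.imem, i₁.stream, i₁.space, i₁.pos⟩, ?_, ?_⟩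
    · have hv := State.view_eq_of_regs f₁ g₁ e₁
      have v₁' : s₁.freg 64 = x.eval s₁.view := by rw [v₁, hv]
      have h65 : v.reg ≠ 65 := by have := v.reg_lt; omega
      rw [Cmd.run, ← hv, ← v₁']
      simp only [State.view, Op.effect, State.setField, State.tick, FieldOp.apply]
      congr 1
      funext w
      have : w.reg ≠ 65 := by have := w.reg_lt; omega
      simp [Function.update_apply, FVar.reg_inj, this]
    · simp only [Op.effect, State.setField, State.tick]
      rw [e₁]; simp [Cmd.cost]; omega
  | istore x y =>
    obtain ⟨hx, hy, hM⟩ := hok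
    obtain ⟨s₁, r₁, i₁, v₁, f₁, e₁⟩ := x.compile_spec E 64 s le_rfl hs hx
    have hv := State.view_eq_of_ireg f₁ e₁
    obtain ⟨s₂, r₂, i₂, v₂, f₂, e₂⟩ := y.compile_spec E 65 s₁ (by omega) i₁ (hv ▸ hy)
    have hv₂ := State.view_eq_of_ireg (fun i hi => f₂ i (by omega)) e₂
    have hval : s₂.ireg 64 = x.eval s.view := by rw [f₂ 64 (by omega), v₁]
    rw [hv] at v₂
    refine ⟨_, .seq r₁ (.seq r₂ (.op _ _)), ?_, ?_, ?_⟩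
    · refine ⟨i₂.peak, i₂.ireg, fun i => ?_, i₂.stream, ?_, i₂.pos⟩
      · change Function.update s₂.imem _ _ i ≤ _
        rw [Function.update_apply]; split
        · exact i₂.ireg _
        · exact i₂.imem i
      · change max s₂.space (s₂.ireg 64 + 1) ≤ _
        rw [hval]
        exact max_le i₂.space hM
    · rw [Cmd.run, ← v₂, ← hval, ← hv, ← hv₂]; rfl
    · simp only [Op.effect, State.tick, State.touch]
      rw [e₂, e₁]; simp [Cmd.cost]; omega
  | fstore A x y =>
    obtain ⟨hx, hy, hI⟩ := hok
    obtain ⟨s₁, r₁, i₁, v₁, f₁, g₁, e₁⟩ := y.compile_spec E 64 s le_rfl hs hy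
    have hv := State.view_eq_of_regs f₁ g₁ e₁
    obtain ⟨h₁, h₂, h₃⟩ := Arr.addr_spec (A := A) hx hI
    obtain ⟨s₂, r₂, i₂, v₂, f₂, e₂⟩ := (A.addr x).compile_spec E 64 s₁ (by omega) i₁ (hv ▸ h₁)
    have hv₂ := State.view_eq_of_ireg (fun i hi => f₂ i (by omega)) e₂
    have hval : s₂.freg 64 = y.eval s.view := by rw [e₂, ← v₁]
    rw [hv, h₂] at v₂
    refine ⟨_, .seq r₁ (.seq r₂ (.op _ _)), ?_, ?_, ?_⟩
    · refine ⟨i₂.peak, i₂.ireg, i₂.imem, i₂.stream, ?_, i₂.pos⟩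
      change max s₂.space (s₂.ireg 64 + 1) ≤ _
      rw [v₂, ← h₂]
      exact max_le i₂.space h₃
    · rw [Cmd.run, ← hval, ← hv, ← hv₂]
      simp only [State.view, Op.effect, State.tick, State.touch]
      congr 1
      funext A' k
      have hq : x.eval s₂.view = x.eval s.view := by rw [hv₂, hv]
      change Function.update s₂.fmem (s₂.ireg 64) (s₂.freg 64) (16 * k + A'.num) =
        Function.update (fun A k => s₂.fmem (16 * k + A.num)) A
          (Function.update (fun k => s₂.fmem (16 * k + A.num)) (x.eval s₂.view) (s₂.freg 64)) A' k
      rw [hq, v₂]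
      have hA := A.num_lt
      have hA' := A'.num_lt
      by_cases hAA : A' = A
      · subst hAA
        simp only [Function.update_apply, if_true]
        simp
      · have hne : A'.num ≠ A.num := fun h => hAA (Arr.num_inj.1 h)
        rw [Function.update_of_ne (by omega), Function.update_of_ne hAA]
    · simp only [Op.effect, State.tick, State.touch]
      rw [e₂, e₁]
      simp only [Cmd.cost, Arr.addr, IExp.cost_add, IExp.cost_mul, IExp.cost_const]; omega
  | eqf v x y =>
    obtain ⟨hx, hy⟩ := hok
    obtain ⟨s₁, r₁, i₁, v₁, f₁, g₁, e₁⟩ := x.compile_spec E 64 s le_rfl hs hx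
    have hv := State.view_eq_of_regs f₁ g₁ e₁
    obtain ⟨s₂, r₂, i₂, v₂, f₂, g₂, e₂⟩ := y.compile_spec E 65 s₁ (by omega) i₁ (hv ▸ hy)
    have hv₂ := State.view_eq_of_regs (fun i hi => f₂ i (by omega)) g₂ e₂
    have hval : s₂.freg 64 = x.eval s.view := by rw [f₂ 64 (by omega), v₁]
    rw [hv] at v₂
    have hp := i₂.pos
    classical
    have hB : (if s₂.freg 64 = s₂.freg 65 then 1 else 0) ≤ E.B := by split_ifs <;> omega
    refine ⟨_, .seq r₁ (.seq r₂ (.op _ _)), ⟨max_le i₂.peak hB, hset _ _ _ i₂ hB, i₂.imem,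
      i₂.stream, i₂.space, i₂.pos⟩, ?_, ?_⟩
    · rw [Cmd.run, ← v₂, ← hval, ← hv, ← hv₂]
      simp only [State.view, Op.effect, State.tick, State.setInt]
      congr 1
      exact update_reg_int _ _ _
    · simp only [Op.effect, State.tick, State.setInt]
      rw [e₂, e₁]; simp [Cmd.cost]; omega
  | read flag i δ =>
    refine ⟨_, .op _ _, ?_, ?_, ?_⟩
    · rcases h : s.stream with _ | ⟨⟨j, d⟩, rest⟩
      · simp only [Op.effect, h]
        exact ⟨max_le hs.peak (Nat.zero_le _), hset _ _ _ hs (Nat.zero_le _), hs.imem, hs.stream,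
          hs.space, hs.pos⟩
      · simp only [Op.effect, h]
        have hj : j ≤ E.B := hs.stream (j, d) (by simp [h])
        have h' : E.Inv ({ s with stream := rest }.setInt flag.reg 1) :=
          ⟨max_le hs.peak hs.pos, hset s _ _ hs hs.pos, hs.imem,
            fun p hp => hs.stream p (by rw [h]; exact List.mem_cons_of_mem _ hp), hs.space, hs.pos⟩
        exact ⟨max_le h'.peak hj, hset _ _ _ h' hj, h'.imem, h'.stream, h'.space, h'.pos⟩
    · rcases h : s.stream with _ | ⟨⟨j, d⟩, rest⟩
      · have h' : s.view.stream = [] := h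
        simp only [Op.effect, h, Cmd.run, h']
        simp only [State.view, State.tick, State.setInt]
        congr 1
        exact update_reg_int _ _ _
      · have h' : s.view.stream = (j, d) :: rest := h
        simp only [Op.effect, h, Cmd.run, h']
        simp only [State.view, State.tick, State.setInt, State.setField]
        congr 1
        · rw [update_reg_int, update_reg_int]
        · exact update_reg_fld _ _ _
    · simp only [Op.effect]
      split <;> rfl
  | toss v =>
    refine ⟨_, .op _ _, ⟨hs.peak, hs.ireg, hs.imem, hs.stream, hs.space, hs.pos⟩, ?_, rfl⟩
    rw [Cmd.run]
    simp only [State.view, Op.effect, State.tick, State.setField]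
    congr 1
    exact update_reg_fld _ _ _
  | send x =>
    obtain ⟨s₁, r₁, i₁, v₁, f₁, g₁, e₁⟩ := x.compile_spec E 64 s le_rfl hs hok
    have hv := State.view_eq_of_regs f₁ g₁ e₁
    refine ⟨_, .seq r₁ (.op _ _), ⟨i₁.peak, i₁.ireg, i₁.imem, ?_, i₁.space, i₁.pos⟩, ?_, ?_⟩
    · simp [Op.effect, State.say, State.tick]
    · rw [Cmd.run, ← v₁, ← hv]; rfl
    · simp only [Op.effect, State.tick, State.say]
      rw [e₁]; simp [Cmd.cost]; omega
  | recv v =>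
    refine ⟨_, .op _ _, ⟨hs.peak, hs.ireg, hs.imem, ?_, hs.space, hs.pos⟩, ?_, rfl⟩
    · simp [Op.effect, State.say, State.tick, State.setField]
    · rw [Cmd.run]
      simp only [State.view, Op.effect, State.tick, State.setField, State.say]
      congr 1
      exact update_reg_fld _ _ _
  | output x =>
    obtain ⟨s₁, r₁, i₁, v₁, f₁, g₁, e₁⟩ := x.compile_spec E 64 s le_rfl hs hok
    have hv := State.view_eq_of_regs f₁ g₁ e₁
    refine ⟨_, .seq r₁ (.op _ _), ⟨i₁.peak, i₁.ireg, i₁.imem, i₁.stream, i₁.space, i₁.pos⟩, ?_, ?_⟩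
    · rw [Cmd.run, ← v₁, ← hv]; rfl
    · simp only [Op.effect, State.tick]
      rw [e₁]; simp [Cmd.cost]; omega

theorem block_compile_spec (E : Env K) (l : List Cmd) : ∀ (s : State K), E.Inv s →
    Oks E l s.view → ∃ s', Runs E.peer (Code.block l).compile s s' ∧ E.Inv s' ∧
      s'.view = runs E l s.view ∧ s'.time = s.time + costs l := by
  induction l with
  | nil => exact fun s hs _ => ⟨s, .skip s, hs, rfl, by simp [costs]⟩
  | cons c l ih =>
    intro s hs hok
    obtain ⟨s₁, r₁, i₁, v₁, t₁⟩ := c.compile_spec E s hs hok.1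
    obtain ⟨s₂, r₂, i₂, v₂, t₂⟩ := ih s₁ i₁ (v₁ ▸ hok.2)
    refine ⟨s₂, .seq r₁ r₂, i₂, by rw [v₂, v₁]; rfl, ?_⟩
    rw [t₂, t₁]; simp [costs]; omega

/-- The machine simulates the structured program. -/
theorem Exec.compile_spec {E : Env K} {p : Code} {a a' : Store K} {t : ℕ} (h : Exec E p a t a') :
    ∀ s : State K, E.Inv s → s.view = a → ∃ s', Runs E.peer p.compile s s' ∧ E.Inv s' ∧
      s'.view = a' ∧ s'.time = s.time + t := by
  -- evaluation of a condition, followed by the tick of the test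
  have hcond : ∀ (c : IExp) (s : State K), E.Inv s → c.Ok E s.view →
      ∃ s', Runs E.peer (c.compile 64) s s' ∧ s'.ireg 64 = c.eval s.view ∧ E.Inv s'.tick ∧
        s'.tick.view = s.view ∧ s'.tick.time = s.time + (c.cost + 1) := by
    intro c s hs hok
    obtain ⟨s₁, r₁, i₁, v₁, f₁, e₁⟩ := c.compile_spec E 64 s le_rfl hs hok
    refine ⟨s₁, r₁, v₁, ⟨i₁.peak, i₁.ireg, i₁.imem, i₁.stream, i₁.space, i₁.pos⟩,
      ?_, ?_⟩
    · exact State.view_eq_of_ireg (s' := s₁) f₁ e₁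
    · simp only [State.tick]; rw [e₁]; simp; omega
  induction h with
  | block l a hok =>
    rintro s hs rfl
    exact block_compile_spec E l s hs hok
  | seq h₁ h₂ ih₁ ih₂ =>
    intro s hs hv
    obtain ⟨s₁, r₁, i₁, v₁, t₁⟩ := ih₁ s hs hv
    obtain ⟨s₂, r₂, i₂, v₂, t₂⟩ := ih₂ s₁ i₁ v₁
    exact ⟨s₂, .seq r₁ r₂, i₂, v₂, by omega⟩
  | iteTrue hok hne h ih =>
    rintro s hs rfl
    obtain ⟨s₁, r₁, v₁, i₁, w₁, e₁⟩ := hcond _ s hs hok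
    obtain ⟨s₂, r₂, i₂, v₂, t₂⟩ := ih _ i₁ w₁
    exact ⟨s₂, .seq r₁ (.iteTrue (v₁ ▸ hne) r₂), i₂, v₂, by omega⟩
  | iteFalse hok heq h ih =>
    rintro s hs rfl
    obtain ⟨s₁, r₁, v₁, i₁, w₁, e₁⟩ := hcond _ s hs hok
    obtain ⟨s₂, r₂, i₂, v₂, t₂⟩ := ih _ i₁ w₁
    exact ⟨s₂, .seq r₁ (.iteFalse (v₁.trans heq) r₂), i₂, v₂, by omega⟩
  | loopFalse hok heq =>
    rintro s hs rfl
    obtain ⟨s₁, r₁, v₁, i₁, w₁, e₁⟩ := hcond _ s hs hok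
    exact ⟨_, .seq r₁ (.loopFalse (v₁.trans heq)), i₁, w₁, e₁⟩
  | loopTrue hok hne h₁ h₂ ih₁ ih₂ =>
    rintro s hs rfl
    obtain ⟨s₁, r₁, v₁, i₁, w₁, e₁⟩ := hcond _ s hs hok
    obtain ⟨s₂, r₂, i₂, w₂, e₂⟩ := ih₁ _ i₁ w₁
    obtain ⟨s₃, r₃, i₃, w₃, e₃⟩ := ih₂ s₂ i₂ w₂
    cases r₃ with
    | seq r₃ r₄ =>
      exact ⟨s₃, .seq r₁ (.loopTrue (v₁ ▸ hne) (.seq r₂ r₃) r₄), i₃, w₃, by omega⟩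

/-! ### Reasoning about structured programs -/

/-- The store `a'` differs from `a` at most in the listed variables, arrays and components. -/
structure Frame (iv : List IVar) (fv : List FVar) (ar : List Arr) (cs : List Comp)
    (a a' : Store K) : Prop where
  int : ∀ v, v ∉ iv → a'.int v = a.int v
  fld : ∀ v, v ∉ fv → a'.fld v = a.fld v
  arr : ∀ A, A ∉ ar → a'.arr A = a.arr A
  imem : .imem ∉ cs → a'.imem = a.imem
  stream : .stream ∉ cs → a'.stream = a.stream
  coins : .coins ∉ cs → a'.coins = a.coins
  trace : .trace ∉ cs → a'.trace = a.trace
  out : .out ∉ cs → a'.out = a.out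

variable {iv : List IVar} {fv : List FVar} {ar : List Arr} {cs : List Comp}

theorem Frame.refl (a : Store K) : Frame iv fv ar cs a a := by constructor <;> intros <;> rfl

theorem Frame.trans {a b c : Store K} (h : Frame iv fv ar cs a b) (h' : Frame iv fv ar cs b c) :
    Frame iv fv ar cs a c where
  int v hv := (h'.int v hv).trans (h.int v hv)
  fld v hv := (h'.fld v hv).trans (h.fld v hv)
  arr v hv := (h'.arr v hv).trans (h.arr v hv)
  imem hv := (h'.imem hv).trans (h.imem hv)
  stream hv := (h'.stream hv).trans (h.stream hv)
  coins hv := (h'.coins hv).trans (h.coins hv)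
  trace hv := (h'.trace hv).trans (h.trace hv)
  out hv := (h'.out hv).trans (h.out hv)

theorem Frame.mono {iv' : List IVar} {fv' : List FVar} {ar' : List Arr} {cs' : List Comp}
    {a b : Store K} (h : Frame iv fv ar cs a b) (h₁ : iv ⊆ iv') (h₂ : fv ⊆ fv') (h₃ : ar ⊆ ar')
    (h₄ : cs ⊆ cs') : Frame iv' fv' ar' cs' a b where
  int v hv := h.int v fun h => hv (h₁ h)
  fld v hv := h.fld v fun h => hv (h₂ h)
  arr v hv := h.arr v fun h => hv (h₃ h)
  imem hv := h.imem fun h => hv (h₄ h)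
  stream hv := h.stream fun h => hv (h₄ h)
  coins hv := h.coins fun h => hv (h₄ h)
  trace hv := h.trace fun h => hv (h₄ h)
  out hv := h.out fun h => hv (h₄ h)

theorem update_of_notMem {α β : Type*} [DecidableEq α] {l : List α} (f : α → β) {v : α} (b : β)
    (hv : v ∈ l) {w : α} (hw : w ∉ l) : Function.update f v b w = f w :=
  Function.update_of_ne (by rintro rfl; exact hw hv) _ _

theorem Cmd.frame (E : Env K) (c : Cmd) (a : Store K) (h : c.within iv fv ar cs = true) :
    Frame iv fv ar cs a (c.run E a) := by
  cases c with
  | read flag i δ =>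
    simp only [Cmd.within, Bool.and_eq_true, decide_eq_true_eq] at h
    obtain ⟨⟨⟨h₁, h₂⟩, h₃⟩, h₄⟩ := h
    rw [Cmd.run]
    split
    · constructor <;> intros <;> first | rfl | (apply update_of_notMem <;> assumption)
    · constructor
      · intro v hv
        exact (update_of_notMem _ _ h₂ hv).trans (update_of_notMem _ _ h₁ hv)
      all_goals intros
      all_goals first | rfl | contradiction | (apply update_of_notMem <;> assumption)
  | _ =>
    simp only [Cmd.within, Bool.and_eq_true, decide_eq_true_eq] at h
    constructor <;> intros <;>
    first
    | rfl
    | (apply update_of_notMem <;> first | assumption | exact h.1 | exact h.1.1)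
    | (exfalso; tauto)

theorem runs_frame (E : Env K) : ∀ (l : List Cmd) (a : Store K),
    (l.all (Cmd.within iv fv ar cs)) = true → Frame iv fv ar cs a (runs E l a)
  | [], a, _ => Frame.refl a
  | c :: l, a, h => by
    rw [List.all_cons, Bool.and_eq_true] at h
    exact (c.frame E a h.1).trans (runs_frame E l _ h.2)

theorem Exec.frame {E : Env K} {p : Code} {a a' : Store K} {t : ℕ} (h : Exec E p a t a')
    (hp : p.within iv fv ar cs = true) : Frame iv fv ar cs a a' := by
  induction h with
  | block l a _ => exact runs_frame E l a hp
  | seq _ _ ih₁ ih₂ =>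
    rw [Code.within, Bool.and_eq_true] at hp
    exact (ih₁ hp.1).trans (ih₂ hp.2)
  | iteTrue _ _ _ ih => rw [Code.within, Bool.and_eq_true] at hp; exact ih hp.1
  | iteFalse _ _ _ ih => rw [Code.within, Bool.and_eq_true] at hp; exact ih hp.2
  | loopTrue _ _ _ _ ih₁ ih₂ => exact (ih₁ hp).trans (ih₂ hp)
  | loopFalse => exact Frame.refl _

/-- Total correctness: program `p`, started in the store `a`, respects the bounds of the
environment and halts after some number `t` of steps in a store `a'` such that `Q t a'`. -/
def Tr (E : Env K) (p : Code) (a : Store K) (Q : ℕ → Store K → Prop) : Prop :=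
  ∃ t a', Exec E p a t a' ∧ Q t a'

variable {E : Env K} {p q : Code} {a : Store K} {Q : ℕ → Store K → Prop}

theorem Tr.mono {Q' : ℕ → Store K → Prop} (h : Tr E p a Q') (hQ : ∀ t a', Q' t a' → Q t a') :
    Tr E p a Q :=
  let ⟨t, a', h₁, h₂⟩ := h
  ⟨t, a', h₁, hQ t a' h₂⟩

/-- The postcondition may be proved under the assumption that only what the program mentions has
changed. -/
theorem Tr.withFrame (iv : List IVar) (fv : List FVar) (ar : List Arr) (cs : List Comp)
    (hp : p.within iv fv ar cs = true) (h : Tr E p a fun t a' => Frame iv fv ar cs a a' → Q t a') :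
    Tr E p a Q :=
  let ⟨t, a', h₁, h₂⟩ := h
  ⟨t, a', h₁, h₂ (h₁.frame hp)⟩

theorem Tr.block {l : List Cmd} (h : Oks E l a) (hQ : Q (costs l) (runs E l a)) :
    Tr E (.block l) a Q :=
  ⟨_, _, .block l a h, hQ⟩

theorem Tr.seq (h : Tr E p a fun t a' => Tr E q a' fun t' => Q (t + t')) : Tr E (p ;; q) a Q :=
  let ⟨_, _, h₁, _, _, h₂, h₃⟩ := h
  ⟨_, _, .seq h₁ h₂, h₃⟩

theorem Tr.ite {c : IExp} (hok : c.Ok E a)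
    (h₁ : c.eval a ≠ 0 → Tr E p a fun t => Q (c.cost + 1 + t))
    (h₂ : c.eval a = 0 → Tr E q a fun t => Q (c.cost + 1 + t)) : Tr E (.ite c p q) a Q := by
  by_cases hc : c.eval a = 0
  · obtain ⟨t, a', h, hQ⟩ := h₂ hc
    exact ⟨_, _, .iteFalse hok hc h, hQ⟩
  · obtain ⟨t, a', h, hQ⟩ := h₁ hc
    exact ⟨_, _, .iteTrue hok hc h, hQ⟩

theorem Tr.loop_false {c : IExp} (hok : c.Ok E a) (hc : c.eval a = 0) (hQ : Q (c.cost + 1) a) :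
    Tr E (.loop c p) a Q :=
  ⟨_, _, .loopFalse hok hc, hQ⟩

theorem Tr.loop_true {c : IExp} (hok : c.Ok E a) (hc : c.eval a ≠ 0)
    (h : Tr E p a fun t a' => Tr E (.loop c p) a' fun t' => Q (c.cost + 1 + t + t')) :
    Tr E (.loop c p) a Q :=
  let ⟨_, _, h₁, _, _, h₂, h₃⟩ := h
  ⟨_, _, .loopTrue hok hc h₁ h₂, h₃⟩

/-- The loop of `Code.forTo` from execution number `k` of its body on. Each execution costs
`b.cost + 10` steps besides those of the body: the test of `b - x` and the increment of `x`. -/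
theorem Tr.forTo_aux {x : IVar} {b : IExp} (N : ℕ) (I : ℕ → ℕ → Store K → Prop) (hN : N ≤ E.B)
    (hpos : 1 ≤ E.B)
    (hb : ∀ k t a', k ≤ N → I k t a' → a'.int x = k ∧ b.eval a' = N ∧ b.Ok E a')
    (hs : ∀ k t a', k < N → I k t a' → Tr E p a' fun t' a'' => a''.int x = k ∧
      I (k + 1) (t + t' + (b.cost + 10)) { a'' with int := Function.update a''.int x (k + 1) })
    (hQ : ∀ t a', I N t a' → Q (t + (b.cost + 4)) a') :
    ∀ m k t a', k + m = N → I k t a' →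
      Tr E (.loop (b - x) (p ;; .block [.iset x (x + 1)])) a' fun t' => Q (t + t') := by
  intro m
  induction m with
  | zero =>
    rintro k t a' rfl hI
    obtain ⟨h₁, h₂, h₃⟩ := hb _ t a' le_rfl hI
    refine Tr.loop_false (by simp [h₃]) (by simp [h₁, h₂]) ?_
    exact hQ _ _ hI
  | succ m ih =>
    intro k t a' hk hI
    obtain ⟨h₁, h₂, h₃⟩ := hb k t a' (by omega) hI
    refine Tr.loop_true (by simp [h₃]) (by simp [h₁, h₂]; omega) (Tr.seq ?_)
    obtain ⟨t', a'', he, hx, hI'⟩ := hs k t a' (by omega) hI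
    refine ⟨t', a'', he, Tr.block ?_ ?_⟩
    · simp [Oks, Cmd.Ok, hx, hpos]; omega
    · have hrun : runs E [.iset x (x + 1)] a'' =
          { a'' with int := Function.update a''.int x (k + 1) } := by simp [runs, Cmd.run, hx]
      rw [hrun]
      refine (ih (k + 1) _ _ (by omega) hI').mono fun t₁ a₁ h => ?_
      convert h using 1
      simp [costs, Cmd.cost]; ring

/-- Rule for counting loops; the invariant may mention the number of steps made so far. -/
theorem Tr.forTo_time {x : IVar} {b : IExp} (N : ℕ) (I : ℕ → ℕ → Store K → Prop)
    (hN : N ≤ E.B) (hpos : 1 ≤ E.B)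
    (h0 : I 0 3 { a with int := Function.update a.int x 0 })
    (hb : ∀ k t a', k ≤ N → I k t a' → a'.int x = k ∧ b.eval a' = N ∧ b.Ok E a')
    (hs : ∀ k t a', k < N → I k t a' → Tr E p a' fun t' a'' => a''.int x = k ∧
      I (k + 1) (t + t' + (b.cost + 10)) { a'' with int := Function.update a''.int x (k + 1) })
    (hQ : ∀ t a', I N t a' → Q (t + (b.cost + 4)) a') : Tr E (.forTo x b p) a Q := by
  refine Tr.seq (Tr.block (by simp [Oks, Cmd.Ok]) ?_)
  exact Tr.forTo_aux N I hN hpos hb hs hQ N 0 3 _ (by omega) h0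

/-- Rule for counting loops: if execution number `k` of the body takes at most `τ k` steps, then
the loop takes at most `∑ (τ k + b.cost + 10) + b.cost + 7` steps. -/
theorem Tr.forTo {x : IVar} {b : IExp} (iv : List IVar) (fv : List FVar) (ar : List Arr)
    (cs : List Comp) (N : ℕ) (τ : ℕ → ℕ) (I : ℕ → Store K → Prop)
    (hw : p.within iv fv ar cs = true) (hx : x ∈ iv) (hN : N ≤ E.B) (hpos : 1 ≤ E.B)
    (h0 : I 0 { a with int := Function.update a.int x 0 })
    (hb : ∀ k a', k ≤ N → a'.int x = k → Frame iv fv ar cs a a' → I k a' →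
      b.eval a' = N ∧ b.Ok E a')
    (hs : ∀ k a', k < N → a'.int x = k → Frame iv fv ar cs a a' → I k a' →
      Tr E p a' fun t a'' => t ≤ τ k ∧ a''.int x = k ∧
        I (k + 1) { a'' with int := Function.update a''.int x (k + 1) })
    (hQ : ∀ t a', a'.int x = N → Frame iv fv ar cs a a' → I N a' →
      t ≤ ∑ k ∈ Finset.range N, (τ k + (b.cost + 10)) + (b.cost + 7) → Q t a') :
    Tr E (.forTo x b p) a Q := by
  have hfr : ∀ (a a' : Store K) (m : ℕ), Frame iv fv ar cs a a' →
      Frame iv fv ar cs a { a' with int := Function.update a'.int x m } := fun a a' m h => by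
    refine h.trans ?_
    constructor <;> intros <;> first | rfl | skip
    exact Function.update_of_ne (by rintro rfl; contradiction) _ _
  refine Tr.forTo_time N
    (fun k t a' => t ≤ ∑ k ∈ Finset.range k, (τ k + (b.cost + 10)) + 3 ∧ a'.int x = k ∧
      Frame iv fv ar cs a a' ∧ I k a') hN hpos ?_ ?_ ?_ ?_
  · exact ⟨by simp, Function.update_self .., hfr _ _ _ (Frame.refl a), h0⟩
  · rintro k t a' hk ⟨-, h₁, h₂, h₃⟩
    exact ⟨h₁, hb k a' hk h₁ h₂ h₃⟩
  · rintro k t a' hk ⟨h₀, h₁, h₂, h₃⟩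
    obtain ⟨t', a'', he, h₄, h₅, h₆⟩ := hs k a' hk h₁ h₂ h₃
    refine ⟨t', a'', he, h₅, ?_, Function.update_self .., hfr _ _ _ (h₂.trans (he.frame hw)), h₆⟩
    rw [Finset.sum_range_succ]; omega
  · rintro t a' ⟨h₀, h₁, h₂, h₃⟩
    exact hQ _ _ h₁ h₂ h₃ (by omega)

/-- Rule for counting loops when the number of steps is irrelevant. -/
theorem Tr.forTo_untimed {x : IVar} {b : IExp} {Q : Store K → Prop} (iv : List IVar)
    (fv : List FVar) (ar : List Arr) (cs : List Comp) (N : ℕ) (I : ℕ → Store K → Prop)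
    (hw : p.within iv fv ar cs = true) (hx : x ∈ iv) (hN : N ≤ E.B) (hpos : 1 ≤ E.B)
    (h0 : I 0 { a with int := Function.update a.int x 0 })
    (hb : ∀ k a', k ≤ N → a'.int x = k → Frame iv fv ar cs a a' → I k a' →
      b.eval a' = N ∧ b.Ok E a')
    (hs : ∀ k a', k < N → a'.int x = k → Frame iv fv ar cs a a' → I k a' →
      Tr E p a' fun _ a'' => a''.int x = k ∧
        I (k + 1) { a'' with int := Function.update a''.int x (k + 1) })
    (hQ : ∀ a', a'.int x = N → Frame iv fv ar cs a a' → I N a' → Q a') :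
    Tr E (.forTo x b p) a fun _ => Q := by
  have hfr : ∀ (a a' : Store K) (m : ℕ), Frame iv fv ar cs a a' →
      Frame iv fv ar cs a { a' with int := Function.update a'.int x m } := fun a a' m h => by
    refine h.trans ?_
    constructor <;> intros <;> first | rfl | skip
    exact Function.update_of_ne (by rintro rfl; contradiction) _ _
  refine Tr.forTo_time N
    (fun k t a' => a'.int x = k ∧ Frame iv fv ar cs a a' ∧ I k a') hN hpos ?_ ?_ ?_ ?_
  · exact ⟨Function.update_self .., hfr _ _ _ (Frame.refl a), h0⟩
  · rintro k t a' hk ⟨h₁, h₂, h₃⟩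
    exact ⟨h₁, hb k a' hk h₁ h₂ h₃⟩
  · rintro k t a' hk ⟨h₁, h₂, h₃⟩
    obtain ⟨t', a'', he, h₅, h₆⟩ := hs k a' hk h₁ h₂ h₃
    exact ⟨t', a'', he, h₅, Function.update_self .., hfr _ _ _ (h₂.trans (he.frame hw)), h₆⟩
  · rintro t a' ⟨h₁, h₂, h₃⟩
    exact hQ _ h₁ h₂ h₃

end Exec
end GKR

namespace GKR

/-! ### Multilinear extensions evaluated in commutative algebras -/

section Tables

variable {R : Type*} [CommRing R]

/-- The multilinear indicator of the `v`-bit label `j`, evaluated at the point `q`. -/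
def chiE (v j : ℕ) (q : ℕ → R) : R :=
  ∏ k ∈ Finset.range v, if j.testBit k then q k else 1 - q k

/-- The multilinear extension of `g`, evaluated at the point `q`. -/
def mleE (v : ℕ) (g : ℕ → R) (q : ℕ → R) : R := ∑ j ∈ Finset.range (2 ^ v), g j * chiE v j q

/-- The table that results from `g` by fixing the `k` lowest bits of the label to `q 0, …, q (k-1)`
in the multilinear extension. -/
def tab (q : ℕ → R) (g : ℕ → R) : ℕ → ℕ → R
  | 0, y => g y
  | k + 1, y => tab q g k (2 * y) + q k * (tab q g k (2 * y + 1) - tab q g k (2 * y))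

/-- Bit `k` of `b` as an element of a ring. -/
def bitR (b k : ℕ) : R := if b.testBit k then 1 else 0

@[simp] theorem chiE_zero (j : ℕ) (q : ℕ → R) : chiE 0 j q = 1 := rfl

theorem chiE_two_mul (v y : ℕ) (q : ℕ → R) :
    chiE (v + 1) (2 * y) q = (1 - q 0) * chiE v y fun k => q (k + 1) := by
  simp [chiE, Finset.prod_range_succ', Nat.testBit_succ, mul_comm]

theorem chiE_two_mul_add_one (v y : ℕ) (q : ℕ → R) :
    chiE (v + 1) (2 * y + 1) q = q 0 * chiE v y fun k => q (k + 1) := by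
  have : (2 * y + 1) / 2 = y := by omega
  rw [chiE, Finset.prod_range_succ', mul_comm]
  simp [chiE, Nat.testBit_succ, this]

theorem sum_range_two_mul {M : Type*} [AddCommMonoid M] (f : ℕ → M) (m : ℕ) :
    ∑ j ∈ Finset.range (2 * m), f j = ∑ y ∈ Finset.range m, (f (2 * y) + f (2 * y + 1)) := by
  induction m with
  | zero => rfl
  | succ m ih => rw [Nat.mul_succ, Finset.sum_range_succ, Finset.sum_range_succ, ih,
      Finset.sum_range_succ, add_assoc]

theorem mleE_succ (v : ℕ) (g q : ℕ → R) :
    mleE (v + 1) g q =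
      mleE v (fun y => g (2 * y) + q 0 * (g (2 * y + 1) - g (2 * y))) fun k => q (k + 1) := by
  rw [mleE, pow_succ', sum_range_two_mul]
  refine Finset.sum_congr rfl fun y _ => ?_
  rw [chiE_two_mul, chiE_two_mul_add_one]
  ring

theorem tab_succ' (q g : ℕ → R) (k y : ℕ) :
    tab q g (k + 1) y =
      tab (fun i => q (i + 1)) (fun y => g (2 * y) + q 0 * (g (2 * y + 1) - g (2 * y))) k y := by
  induction k generalizing y with
  | zero => rfl
  | succ k ih => rw [tab, ih, ih]; rfl

/-- The lowest `k` variables can be fixed first: the result is the multilinear extension of the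
folded table. -/
theorem mleE_add (k v : ℕ) (g q : ℕ → R) :
    mleE (k + v) g q = mleE v (tab q g k) fun i => q (k + i) := by
  induction k generalizing g q with
  | zero => simp [tab]
  | succ k ih =>
    rw [show k + 1 + v = k + v + 1 by omega, mleE_succ, ih]
    congr 1
    · funext y; exact (tab_succ' q g k y).symm
    · funext i; congr 1; omega

theorem mleE_eq_tab (v : ℕ) (g q : ℕ → R) : mleE v g q = tab q g v 0 := by
  have := mleE_add v 0 g q
  simpa [mleE] using this

theorem chiE_bitR {v j b : ℕ} (hj : j < 2 ^ v) (hb : b < 2 ^ v) :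
    chiE v j (bitR b : ℕ → R) = if j = b then 1 else 0 := by
  split_ifs with h
  · subst h
    refine Finset.prod_eq_one fun k _ => ?_
    unfold bitR; split <;> simp
  · obtain ⟨k, hk⟩ := Nat.exists_testBit_ne_of_ne h
    have hkv : k < v := by
      by_contra hkv
      have h2 : 2 ^ v ≤ 2 ^ k := Nat.pow_le_pow_right (by norm_num) (by omega)
      rw [Nat.testBit_lt_two_pow (hj.trans_le h2), Nat.testBit_lt_two_pow (hb.trans_le h2)] at hk
      exact hk rfl
    refine Finset.prod_eq_zero (Finset.mem_range.2 hkv) ?_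
    unfold bitR
    cases hj : j.testBit k <;> cases hb : b.testBit k <;> simp_all

theorem mleE_bitR {v b : ℕ} (hb : b < 2 ^ v) (g : ℕ → R) : mleE v g (bitR b) = g b := by
  rw [mleE, Finset.sum_eq_single_of_mem b (Finset.mem_range.2 hb)]
  · rw [chiE_bitR hb hb]; simp
  · intro j hj hne
    rw [chiE_bitR (Finset.mem_range.1 hj) hb, if_neg hne, mul_zero]

theorem tab_congr {q q' : ℕ → R} (g : ℕ → R) {k : ℕ} (h : ∀ i < k, q i = q' i) (y : ℕ) :
    tab q g k y = tab q' g k y := by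
  induction k generalizing y with
  | zero => rfl
  | succ k ih =>
    have := ih fun i hi => h i (by omega)
    rw [tab, tab, this, this, h k (by omega)]

theorem chiE_congr {q q' : ℕ → R} {v : ℕ} (h : ∀ i < v, q i = q' i) (j : ℕ) :
    chiE v j q = chiE v j q' :=
  Finset.prod_congr rfl fun k hk => by rw [h k (Finset.mem_range.1 hk)]

theorem mleE_congr {q q' : ℕ → R} {v : ℕ} (g : ℕ → R) (h : ∀ i < v, q i = q' i) :
    mleE v g q = mleE v g q' := by
  rw [mleE_eq_tab, mleE_eq_tab, tab_congr g h]

theorem mleE_congr_left {g g' : ℕ → R} {v : ℕ} (q : ℕ → R) (h : ∀ j < 2 ^ v, g j = g' j) :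
    mleE v g q = mleE v g' q :=
  Finset.sum_congr rfl fun k hk => by rw [h k (Finset.mem_range.1 hk)]

theorem map_tab {S : Type*} [CommRing S] (φ : R →+* S) (q g : ℕ → R) (k y : ℕ) :
    φ (tab q g k y) = tab (fun i => φ (q i)) (fun j => φ (g j)) k y := by
  induction k generalizing y with
  | zero => rfl
  | succ k ih => simp [tab, ih]

theorem map_chiE {S : Type*} [CommRing S] (φ : R →+* S) (v j : ℕ) (q : ℕ → R) :
    φ (chiE v j q) = chiE v j fun i => φ (q i) := by
  simp only [chiE, map_prod]
  refine Finset.prod_congr rfl fun k _ => ?_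
  split <;> simp

theorem map_mleE {S : Type*} [CommRing S] (φ : R →+* S) (v : ℕ) (g q : ℕ → R) :
    φ (mleE v g q) = mleE v (fun j => φ (g j)) fun i => φ (q i) := by
  simp [mleE, map_chiE]

/-- A sum of indicators is the multilinear extension of the function that collects their
coefficients. -/
theorem sum_mul_chiE {v : ℕ} (w : ℕ) (c : ℕ → R) (f : ℕ → ℕ) (hf : ∀ j < w, f j < 2 ^ v)
    (q : ℕ → R) :
    ∑ j ∈ Finset.range w, c j * chiE v (f j) q =
      mleE v (fun l => ∑ j ∈ Finset.range w, if f j = l then c j else 0) q := by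
  simp only [mleE, Finset.sum_mul]
  rw [Finset.sum_comm]
  refine Finset.sum_congr rfl fun j hj => ?_
  rw [Finset.sum_eq_single_of_mem (f j) (Finset.mem_range.2 (hf j (Finset.mem_range.1 hj)))]
  · simp
  · intro l _ hl
    rw [if_neg hl.symm, zero_mul]

/-- The product `β(z, q)` is the multilinear extension, in `q`, of the indicators evaluated at
`z`. -/
theorem mleE_chiE (u : ℕ) (z q : ℕ → R) :
    mleE u (fun j => chiE u j z) q =
      ∏ k ∈ Finset.range u, (z k * q k + (1 - z k) * (1 - q k)) := by
  induction u generalizing z q with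
  | zero => simp [mleE]
  | succ u ih =>
    rw [mleE_succ, Finset.prod_range_succ', ← ih (fun k => z (k + 1)) fun k => q (k + 1)]
    simp only [mleE, Finset.sum_mul]
    refine Finset.sum_congr rfl fun y _ => ?_
    rw [chiE_two_mul, chiE_two_mul_add_one]
    ring

/-- A multilinear extension at `z` as a sum over the labels, in the form in which the sum-check
receives it: `β(z, ·)` selects the value. -/
theorem mleE_comm_chiE (u : ℕ) (z : ℕ → R) (g : ℕ → R) :
    ∑ y ∈ Finset.range (2 ^ u), mleE u (fun j => chiE u j z) (bitR y) * g y = mleE u g z := by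
  refine Finset.sum_congr rfl fun y hy => ?_
  rw [mleE_bitR (Finset.mem_range.1 hy), mul_comm]

/-- Labels of `a + c` bits split into their low part `y` and their high part `x`. -/
theorem sum_range_two_pow_add {M : Type*} [AddCommMonoid M] (a c : ℕ) (f : ℕ → M) :
    ∑ b ∈ Finset.range (2 ^ (a + c)), f b =
      ∑ y ∈ Finset.range (2 ^ a), ∑ x ∈ Finset.range (2 ^ c), f (2 ^ a * x + y) := by
  rw [Finset.sum_comm, pow_add]
  generalize 2 ^ c = m
  induction m with
  | zero => simp
  | succ m ih =>
    rw [Nat.mul_succ, Finset.sum_range_add, Finset.sum_range_succ, ih]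

theorem bitR_add {a y : ℕ} (hy : y < 2 ^ a) (x k : ℕ) :
    (bitR (2 ^ a * x + y) k : R) = if k < a then bitR y k else bitR x (k - a) := by
  unfold bitR
  rw [Nat.testBit_two_pow_mul_add _ hy]
  split_ifs <;> simp_all

end Tables

/-! ### The sum-check polynomials in closed form -/

section Extensions

variable {K : Type*} [Field K] {A : Type*} [CommRing A] [Algebra K A]

theorem aeval_chi (v o j : ℕ) (q : ℕ → A) :
    MvPolynomial.aeval q (chi v o j : MvPolynomial ℕ K) = chiE v j fun k => q (o + k) := by
  simp only [chi, chiE, map_prod]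
  refine Finset.prod_congr rfl fun k _ => ?_
  split <;> simp

theorem aeval_mle (v o : ℕ) (g : ℕ → K) (q : ℕ → A) :
    MvPolynomial.aeval q (mle v o g) =
      mleE v (fun j => algebraMap K A (g j)) fun k => q (o + k) := by
  simp [mle, mleE, aeval_chi]

theorem aeval_beta (u : ℕ) (z : ℕ → K) (q : ℕ → A) :
    MvPolynomial.aeval q (beta u z) =
      mleE u (fun j => chiE u j fun k => algebraMap K A (z k)) q := by
  simp [beta, mleE_chiE]

end Extensions

namespace LayeredCircuit

variable {n : ℕ} (C : LayeredCircuit n)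

theorem width_pos {i : ℕ} (hi : i ≤ C.depth) : 0 < C.width i := by
  induction i with
  | zero => rw [C.width_zero]; exact one_pos
  | succ i ih =>
    exact (Nat.zero_le _).trans_lt (C.left_lt i (by omega) 0 (ih (by omega)))

theorem width_le_two_pow (i : ℕ) : C.width i ≤ 2 ^ C.bits i := Nat.le_pow_clog (by norm_num) _

theorem two_pow_bits_le {i : ℕ} (hi : i ≤ C.depth) : 2 ^ C.bits i ≤ 2 * C.width i := by
  have h := C.width_pos hi
  rcases Nat.lt_or_ge 1 (C.width i) with h1 | h1
  · have := Nat.pow_pred_clog_lt_self (b := 2) (by norm_num) h1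
    have hc : 0 < Nat.clog 2 (C.width i) := Nat.clog_pos (by norm_num) h1
    rw [bits]
    obtain ⟨m, hm⟩ := Nat.exists_eq_succ_of_ne_zero hc.ne'
    rw [hm] at this ⊢
    rw [pow_succ]
    simp only [Nat.pred_succ] at this
    omega
  · have : C.width i = 1 := by omega
    simp [bits, this]

@[simp] theorem bits_zero : C.bits 0 = 0 := by simp [bits, C.width_zero]

section Values

variable {K : Type*} [Field K] (x : Fin n → K)

theorem value_of_lt {i j : ℕ} (hi : i < C.depth) (hj : j < C.width i) :
    C.value x i j =
      if C.isMul i j then C.value x (i + 1) (C.left i j) * C.value x (i + 1) (C.right i j)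
      else C.value x (i + 1) (C.left i j) + C.value x (i + 1) (C.right i j) := by
  unfold value
  obtain ⟨t, ht⟩ : ∃ t, C.depth - i = t + 1 := ⟨C.depth - i - 1, by omega⟩
  have h1 : C.depth - (t + 1) = i := by omega
  have h2 : C.depth - (i + 1) = t := by omega
  rw [ht, h2, upValue, h1, if_pos hj]

theorem value_of_ge {i j : ℕ} (hi : i ≤ C.depth) (hj : C.width i ≤ j) : C.value x i j = 0 := by
  unfold value
  rcases hi.eq_or_lt with rfl | hi
  · rw [Nat.sub_self, upValue, dif_neg]
    rw [C.width_depth] at hj; omega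
  · obtain ⟨t, ht⟩ : ∃ t, C.depth - i = t + 1 := ⟨C.depth - i - 1, by omega⟩
    have h1 : C.depth - (t + 1) = i := by omega
    rw [ht, upValue, h1, if_neg (by omega)]

theorem map_value {L : Type*} [Field L] (φ : K →+* L) (i j : ℕ) :
    φ (C.value x i j) = C.value (fun k => φ (x k)) i j := by
  unfold value
  generalize C.depth - i = t
  induction t generalizing j with
  | zero => simp only [upValue]; split <;> simp
  | succ t ih =>
    simp only [upValue]
    split
    · split <;> simp [ih]
    · simp

end Values

section Algebra

variable {K : Type*} [Field K] (x : Fin n → K) {A : Type*} [CommRing A] [Algebra K A]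

/-- The value of a gate of layer `i` as a function of the values of the two gates that feed it. -/
def gateFn (i j : ℕ) (a b : A) : A := if C.isMul i j then a * b else a + b

theorem aeval_wiringMLE {i : ℕ} (hi : i < C.depth) (mul : Bool) (q : ℕ → A) :
    MvPolynomial.aeval q (C.wiringMLE i mul : MvPolynomial ℕ K) =
      ∑ j ∈ Finset.range (C.width i), if C.isMul i j = mul then
        chiE (C.bits i) j q *
          (chiE (C.bits (i + 1)) (C.left i j) fun k => q (C.bits i + k)) *
          (chiE (C.bits (i + 1)) (C.right i j) fun k => q (C.bits i + C.bits (i + 1) + k))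
      else 0 := by
  have hsub : Finset.range (C.width i) ⊆ Finset.range (2 ^ C.bits i) :=
    Finset.range_subset_range.2 (C.width_le_two_pow i)
  simp only [wiringMLE, map_sum]
  rw [← Finset.sum_subset hsub]
  · refine Finset.sum_congr rfl fun j hj => ?_
    have hj := Finset.mem_range.1 hj
    have hl := (C.left_lt i hi j hj).trans_le (C.width_le_two_pow _)
    have hr := (C.right_lt i hi j hj).trans_le (C.width_le_two_pow _)
    rw [Finset.sum_eq_single_of_mem _ (Finset.mem_range.2 hl),
      Finset.sum_eq_single_of_mem _ (Finset.mem_range.2 hr)]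
    · by_cases h : C.isMul i j = mul
      · simp [Wired, hj, h, aeval_chi]
      · simp [Wired, h]
    · intro b _ hb
      simp [Wired, hb.symm]
    · intro b _ hb
      refine Finset.sum_eq_zero fun c _ => ?_
      simp [Wired, hb.symm]
  · intro j _ hj
    refine Finset.sum_eq_zero fun b _ => Finset.sum_eq_zero fun c _ => ?_
    simp [Wired, Finset.mem_range.not.1 hj]

/-- The polynomial of the sum-check as a sum over the gates of the layer. -/
theorem aeval_layerPoly {i : ℕ} (hi : i < C.depth) (z : ℕ → K) (q : ℕ → A) :
    MvPolynomial.aeval q (C.layerPoly x i z) =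
      mleE (C.bits i) (fun j => algebraMap K A (chiE (C.bits i) j z)) q *
      ∑ j ∈ Finset.range (C.width i), chiE (C.bits i) j q *
          (chiE (C.bits (i + 1)) (C.left i j) fun k => q (C.bits i + k)) *
          (chiE (C.bits (i + 1)) (C.right i j) fun k => q (C.bits i + C.bits (i + 1) + k)) *
          C.gateFn i j
            (mleE (C.bits (i + 1)) (fun j => algebraMap K A (C.value x (i + 1) j))
              fun k => q (C.bits i + k))
            (mleE (C.bits (i + 1)) (fun j => algebraMap K A (C.value x (i + 1) j))
              fun k => q (C.bits i + C.bits (i + 1) + k)) := by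
  simp only [layerPoly, map_mul, map_add, aeval_beta, aeval_mle, C.aeval_wiringMLE hi]
  simp only [map_chiE]
  congr 1
  rw [Finset.sum_mul, Finset.sum_mul, ← Finset.sum_add_distrib]
  refine Finset.sum_congr rfl fun j _ => ?_
  unfold gateFn
  cases C.isMul i j <;> simp

end Algebra

section LayerFn

variable {K : Type*} [Field K] (x : Fin n → K) {A : Type*} [CommRing A] [Algebra K A]

/-- The polynomial of the sum-check of iteration `i` as a function of the three points
`p`, `ω₁` and `ω₂`. -/
def layerFn (i : ℕ) (z : ℕ → K) (p ω₁ ω₂ : ℕ → A) : A :=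
  mleE (C.bits i) (fun j => algebraMap K A (chiE (C.bits i) j z)) p *
    ∑ j ∈ Finset.range (C.width i), chiE (C.bits i) j p *
      chiE (C.bits (i + 1)) (C.left i j) ω₁ * chiE (C.bits (i + 1)) (C.right i j) ω₂ *
      C.gateFn i j
        (mleE (C.bits (i + 1)) (fun j => algebraMap K A (C.value x (i + 1) j)) ω₁)
        (mleE (C.bits (i + 1)) (fun j => algebraMap K A (C.value x (i + 1) j)) ω₂)

theorem layerFn_congr (i : ℕ) (z : ℕ → K) {p p' ω₁ ω₁' ω₂ ω₂' : ℕ → A}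
    (h₀ : ∀ k < C.bits i, p k = p' k) (h₁ : ∀ k < C.bits (i + 1), ω₁ k = ω₁' k)
    (h₂ : ∀ k < C.bits (i + 1), ω₂ k = ω₂' k) :
    C.layerFn x i z p ω₁ ω₂ = C.layerFn x i z p' ω₁' ω₂' := by
  simp only [layerFn, mleE_congr _ h₀, mleE_congr _ h₁, mleE_congr _ h₂, chiE_congr h₀,
    chiE_congr h₁, chiE_congr h₂]

/-- Summation over `ω₂ ∈ {0,1}^v`: only the label of the right input of each gate contributes. -/
theorem sum_layerFn_right {i : ℕ} (hi : i < C.depth) (z : ℕ → K) (p ω₁ : ℕ → A) :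
    ∑ b ∈ Finset.range (2 ^ C.bits (i + 1)), C.layerFn x i z p ω₁ (bitR b) =
      mleE (C.bits i) (fun j => algebraMap K A (chiE (C.bits i) j z)) p *
      ∑ j ∈ Finset.range (C.width i), chiE (C.bits i) j p *
        chiE (C.bits (i + 1)) (C.left i j) ω₁ *
        C.gateFn i j
          (mleE (C.bits (i + 1)) (fun j => algebraMap K A (C.value x (i + 1) j)) ω₁)
          (algebraMap K A (C.value x (i + 1) (C.right i j))) := by
  simp only [layerFn]
  rw [← Finset.mul_sum, Finset.sum_comm]
  congr 1
  refine Finset.sum_congr rfl fun j hj => ?_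
  have hr := (C.right_lt i hi j (Finset.mem_range.1 hj)).trans_le (C.width_le_two_pow _)
  rw [Finset.sum_eq_single_of_mem _ (Finset.mem_range.2 hr)]
  · rw [chiE_bitR hr hr, if_pos rfl, mul_one, mleE_bitR hr]
  · intro b hb hne
    rw [chiE_bitR hr (Finset.mem_range.1 hb), if_neg hne.symm]
    ring

/-- Summation over `ω₁, ω₂ ∈ {0,1}^v`: the wiring predicates disappear, and the multilinear
extension of the layer itself remains. -/
theorem sum_layerFn {i : ℕ} (hi : i < C.depth) (z : ℕ → K) (p : ℕ → A) :
    ∑ a ∈ Finset.range (2 ^ C.bits (i + 1)), ∑ b ∈ Finset.range (2 ^ C.bits (i + 1)),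
      C.layerFn x i z p (bitR a) (bitR b) =
    mleE (C.bits i) (fun j => algebraMap K A (chiE (C.bits i) j z)) p *
      mleE (C.bits i) (fun j => algebraMap K A (C.value x i j)) p := by
  simp only [C.sum_layerFn_right x hi]
  rw [← Finset.mul_sum, Finset.sum_comm]
  congr 1
  rw [mleE, ← Finset.sum_subset (Finset.range_subset_range.2 (C.width_le_two_pow i))]
  · refine Finset.sum_congr rfl fun j hj => ?_
    have hj := Finset.mem_range.1 hj
    have hl := (C.left_lt i hi j hj).trans_le (C.width_le_two_pow _)
    rw [Finset.sum_eq_single_of_mem _ (Finset.mem_range.2 hl)]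
    · rw [chiE_bitR hl hl, if_pos rfl, mul_one, mleE_bitR hl, C.value_of_lt x hi hj, gateFn]
      split <;> simp [mul_comm]
    · intro b hb hne
      rw [chiE_bitR hl (Finset.mem_range.1 hb), if_neg hne.symm]
      ring
  · intro j _ hj
    rw [C.value_of_ge x hi.le (by simpa using hj)]
    simp

/-- Coefficients that are collected from the gates `j` of layer `i` at the labels `f j`: the
multiplier of `Ṽ`. -/
def gatherMul (i : ℕ) (f : ℕ → ℕ) (w s : ℕ → K) (l : ℕ) : K :=
  ∑ j ∈ Finset.range (C.width i), if f j = l then if C.isMul i j then w j * s j else w j else 0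

/-- Coefficients that are collected from the gates `j` of layer `i` at the labels `f j`: the
part that does not depend on `Ṽ`. -/
def gatherAdd (i : ℕ) (f : ℕ → ℕ) (w s : ℕ → K) (l : ℕ) : K :=
  ∑ j ∈ Finset.range (C.width i), if f j = l then if C.isMul i j then 0 else w j * s j else 0

/-- As a function of the point at which one of the inputs is taken, the sum over the gates has the
form `A Ṽ + D` with multilinear `A` and `D`, whose tables are computed in a pass over the gates. -/
theorem sum_gateFn {i v : ℕ} (f : ℕ → ℕ) (hf : ∀ j < C.width i, f j < 2 ^ v) (w s : ℕ → K)
    (q : ℕ → A) (a : A) :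
    ∑ j ∈ Finset.range (C.width i), algebraMap K A (w j) * chiE v (f j) q *
        C.gateFn i j a (algebraMap K A (s j)) =
      mleE v (fun l => algebraMap K A (C.gatherMul i f w s l)) q * a +
        mleE v (fun l => algebraMap K A (C.gatherAdd i f w s l)) q := by
  have h : ∀ g : ℕ → K, (fun l => algebraMap K A (∑ j ∈ Finset.range (C.width i),
      if f j = l then g j else 0)) = fun l => ∑ j ∈ Finset.range (C.width i),
      if f j = l then algebraMap K A (g j) else 0 := fun g => by
    funext l
    rw [map_sum]
    exact Finset.sum_congr rfl fun j _ => by split <;> simp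
  unfold gatherMul gatherAdd
  rw [h, h, ← sum_mul_chiE _ _ _ hf, ← sum_mul_chiE _ _ _ hf, Finset.sum_mul,
    ← Finset.sum_add_distrib]
  refine Finset.sum_congr rfl fun j _ => ?_
  unfold gateFn
  split <;> simp <;> ring

end LayerFn

end LayeredCircuit

section RoundPoly

open Polynomial

variable {K : Type*} [Field K]

/-- The point `(r₀, …, r_{j-1}, X, b)` at which a round polynomial evaluates a polynomial. -/
noncomputable def roundPoint (r : ℕ → K) (j b k : ℕ) : K[X] :=
  if k < j then C (r k) else if k = j then X else if b.testBit (k - (j + 1)) then 1 else 0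

theorem roundPoly_eq (f : MvPolynomial ℕ K) (N : ℕ) (r : ℕ → K) (j : ℕ) :
    LayeredCircuit.roundPoly f N r j =
      ∑ b ∈ Finset.range (2 ^ (N - (j + 1))), MvPolynomial.aeval (roundPoint r j b) f := rfl

/-- The coefficients of the round polynomial `j` of the sum-check over `m` variables of `A B + D`,
where `A`, `B` and `D` are the multilinear polynomials with the given tables of values. -/
def scCoeff (A B D : ℕ → K) (m : ℕ) (r : ℕ → K) (j : ℕ) (e : ℕ) : K :=
  ∑ y ∈ Finset.range (2 ^ (m - (j + 1))),
    if e = 0 then tab r A j (2 * y) * tab r B j (2 * y) + tab r D j (2 * y)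
    else if e = 1 then
      tab r A j (2 * y) * (tab r B j (2 * y + 1) - tab r B j (2 * y)) +
        (tab r A j (2 * y + 1) - tab r A j (2 * y)) * tab r B j (2 * y) +
        (tab r D j (2 * y + 1) - tab r D j (2 * y))
    else (tab r A j (2 * y + 1) - tab r A j (2 * y)) *
      (tab r B j (2 * y + 1) - tab r B j (2 * y))

/-- The round polynomial with the coefficients `scCoeff`. -/
noncomputable def scPoly (A B D : ℕ → K) (m : ℕ) (r : ℕ → K) (j : ℕ) : K[X] :=
  C (scCoeff A B D m r j 0) + C (scCoeff A B D m r j 1) * X + C (scCoeff A B D m r j 2) * X ^ 2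

theorem scPoly_coeff (A B D : ℕ → K) (m : ℕ) (r : ℕ → K) (j : ℕ) {e : ℕ} (he : e < 3) :
    (scPoly A B D m r j).coeff e = scCoeff A B D m r j e := by
  interval_cases e <;> simp [scPoly, coeff_X, coeff_C]

theorem natDegree_scPoly_le (A B D : ℕ → K) (m : ℕ) (r : ℕ → K) (j : ℕ) :
    (scPoly A B D m r j).natDegree ≤ 2 := by
  unfold scPoly; compute_degree

theorem mleE_roundPoint {m j y : ℕ} (hj : j < m) (hy : y < 2 ^ (m - (j + 1))) (r A : ℕ → K) :
    mleE m (fun l => C (A l)) (roundPoint r j y) =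
      C (tab r A j (2 * y)) + X * C (tab r A j (2 * y + 1) - tab r A j (2 * y)) := by
  obtain ⟨c, rfl⟩ : ∃ c, m = j + 1 + c := ⟨m - (j + 1), by omega⟩
  have hy : y < 2 ^ c := by simpa using hy
  have htail : (fun i => roundPoint r j y (j + 1 + i)) = (bitR y : ℕ → K[X]) := by
    funext i
    have h1 : ¬ j + 1 + i < j := by omega
    have h2 : j + 1 + i ≠ j := by omega
    simp [roundPoint, bitR, h1, h2]
  have htab : ∀ l, tab (roundPoint r j y) (fun l => C (A l)) j l = C (tab r A j l) := fun l => by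
    rw [map_tab]
    exact tab_congr _ (fun i hi => by simp [roundPoint, hi]) _
  rw [mleE_add, htail, mleE_bitR hy, tab, htab, htab]
  simp [roundPoint]

theorem sum_mleE_roundPoint {m j : ℕ} (hj : j < m) (r A B D : ℕ → K) :
    ∑ y ∈ Finset.range (2 ^ (m - (j + 1))),
      (mleE m (fun l => C (A l)) (roundPoint r j y) * mleE m (fun l => C (B l)) (roundPoint r j y) +
        mleE m (fun l => C (D l)) (roundPoint r j y)) = scPoly A B D m r j := by
  simp only [scPoly, scCoeff, map_sum, Finset.sum_mul]
  rw [← Finset.sum_add_distrib, ← Finset.sum_add_distrib]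
  refine Finset.sum_congr rfl fun y hy => ?_
  have hy := Finset.mem_range.1 hy
  rw [mleE_roundPoint hj hy, mleE_roundPoint hj hy, mleE_roundPoint hj hy]
  simp
  ring

theorem roundPoint_low {j u : ℕ} (hj : j < u) {y : ℕ} (hy : y < 2 ^ (u - (j + 1))) (r : ℕ → K)
    (a : ℕ) {k : ℕ} (hk : k < u) :
    roundPoint r j (2 ^ (u - (j + 1)) * a + y) k = roundPoint r j y k := by
  unfold roundPoint
  split_ifs with h1 h2 h3 h4 h5 <;> first | rfl | skip
  all_goals
    rw [Nat.testBit_two_pow_mul_add _ hy, if_pos (by omega)] at h3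
    contradiction

theorem roundPoint_high {j u : ℕ} (hj : j < u) {y : ℕ} (hy : y < 2 ^ (u - (j + 1))) (r : ℕ → K)
    (a k : ℕ) : roundPoint r j (2 ^ (u - (j + 1)) * a + y) (u + k) = bitR a k := by
  unfold roundPoint
  have h1 : ¬ u + k < j := by omega
  have h2 : u + k ≠ j := by omega
  have h3 : ¬ u + k - (j + 1) < u - (j + 1) := by omega
  have h4 : u + k - (j + 1) - (u - (j + 1)) = k := by omega
  rw [if_neg h1, if_neg h2, Nat.testBit_two_pow_mul_add _ hy, if_neg h3, h4]
  rfl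

theorem roundPoint_add (r : ℕ → K) (s j b k : ℕ) :
    roundPoint r (s + j) b (s + k) = roundPoint (fun k => r (s + k)) j b k := by
  have : s + k - (s + j + 1) = k - (j + 1) := by omega
  simp [roundPoint, this]

theorem roundPoint_of_lt (r : ℕ → K) {j k : ℕ} (b : ℕ) (h : k < j) :
    roundPoint r j b k = C (r k) := by
  simp [roundPoint, h]

end RoundPoly

namespace LayeredCircuit

open Polynomial

variable {n : ℕ} (C : LayeredCircuit n) {K : Type*} [Field K] (x : Fin n → K)

theorem aeval_layerPoly' {A : Type*} [CommRing A] [Algebra K A] {i : ℕ} (hi : i < C.depth)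
    (z : ℕ → K) (q : ℕ → A) :
    MvPolynomial.aeval q (C.layerPoly x i z) = C.layerFn x i z q (fun k => q (C.bits i + k))
      fun k => q (C.bits i + C.bits (i + 1) + k) :=
  C.aeval_layerPoly x hi z q

/-- The rounds in which the variables `p` are fixed: the sum over `ω₁` and `ω₂` turns the wiring
predicates into the layer itself, and the sum-check is one for `β(z, p) Ṽ(p)`. -/
theorem roundPoly_layerPoly_p {i j : ℕ} (hi : i < C.depth) (hj : j < C.bits i) (z r : ℕ → K) :
    roundPoly (C.layerPoly x i z) (C.rounds i) r j =
      scPoly (fun j => chiE (C.bits i) j z) (C.value x i) (fun _ => 0) (C.bits i) r j := by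
  have hN : C.rounds i - (j + 1) =
      (C.bits i - (j + 1)) + (C.bits (i + 1) + C.bits (i + 1)) := by
    unfold rounds; omega
  rw [roundPoly_eq, ← sum_mleE_roundPoint hj, hN, sum_range_two_pow_add]
  refine Finset.sum_congr rfl fun y hy => ?_
  have hy := Finset.mem_range.1 hy
  have h0 : mleE (C.bits i) (fun _ => Polynomial.C (0 : K)) (roundPoint r j y) = 0 := by
    simp [mleE]
  rw [h0, add_zero]
  refine Eq.trans ?_ (C.sum_layerFn x hi z (roundPoint r j y))
  rw [sum_range_two_pow_add]
  refine Finset.sum_congr rfl fun a ha => Finset.sum_congr rfl fun b _ => ?_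
  have ha := Finset.mem_range.1 ha
  rw [C.aeval_layerPoly' x hi]
  refine C.layerFn_congr x i z (fun k hk => roundPoint_low hj hy r _ hk) (fun k hk => ?_)
    fun k hk => ?_
  · rw [roundPoint_high hj hy, bitR_add ha, if_pos hk]
  · rw [add_assoc, roundPoint_high hj hy, bitR_add ha, if_neg (by omega)]
    congr 1; omega

/-- The weight of gate `j` of layer `i` after the variables `p` have been fixed to `r`. -/
def gateWeight (i : ℕ) (z r : ℕ → K) (j : ℕ) : K :=
  mleE (C.bits i) (fun j => chiE (C.bits i) j z) r * chiE (C.bits i) j r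

/-- The rounds in which the variables `ω₁` are fixed: the sum over `ω₂` replaces the right inputs by
their values, and the sum-check is one for a polynomial `A Ṽ + D` in `ω₁`. -/
theorem roundPoly_layerPoly_left {i j : ℕ} (hi : i < C.depth) (hj : j < C.bits (i + 1))
    (z r : ℕ → K) :
    roundPoly (C.layerPoly x i z) (C.rounds i) r (C.bits i + j) =
      scPoly
        (C.gatherMul i (C.left i) (C.gateWeight i z r) fun j => C.value x (i + 1) (C.right i j))
        (C.value x (i + 1))
        (C.gatherAdd i (C.left i) (C.gateWeight i z r) fun j => C.value x (i + 1) (C.right i j))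
        (C.bits (i + 1)) (fun k => r (C.bits i + k)) j := by
  have hN : C.rounds i - (C.bits i + j + 1) =
      (C.bits (i + 1) - (j + 1)) + C.bits (i + 1) := by
    unfold rounds; omega
  rw [roundPoly_eq, ← sum_mleE_roundPoint hj, hN, sum_range_two_pow_add]
  refine Finset.sum_congr rfl fun y hy => ?_
  have hy := Finset.mem_range.1 hy
  have hf : ∀ j < C.width i, C.left i j < 2 ^ C.bits (i + 1) := fun j hj =>
    (C.left_lt i hi j hj).trans_le (C.width_le_two_pow _)
  set q := roundPoint (fun k => r (C.bits i + k)) j y with hq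
  have hsum := C.sum_gateFn (C.left i) hf (C.gateWeight i z r)
    (fun j => C.value x (i + 1) (C.right i j)) q
    (mleE (C.bits (i + 1)) (fun j => algebraMap K K[X] (C.value x (i + 1) j)) q)
  refine Eq.trans ?_ hsum
  refine Eq.trans (Finset.sum_congr rfl fun b _ => ?_)
    ((C.sum_layerFn_right x hi z (fun k => Polynomial.C (r k)) q).trans ?_)
  · rw [C.aeval_layerPoly' x hi]
    refine C.layerFn_congr x i z (fun k hk => roundPoint_of_lt r _ (by omega)) (fun k hk => ?_)
      fun k hk => ?_
    · rw [roundPoint_add, roundPoint_low hj hy _ _ hk]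
    · rw [add_assoc, roundPoint_add, roundPoint_high hj hy]
  · rw [Finset.mul_sum]
    refine Finset.sum_congr rfl fun j _ => ?_
    have h1 := map_mleE (algebraMap K K[X]) (C.bits i) (fun j => chiE (C.bits i) j z) r
    have h2 := map_chiE (algebraMap K K[X]) (C.bits i) j r
    rw [gateWeight, map_mul, h1, h2]
    simp only [Polynomial.algebraMap_eq]
    ring

/-- The weight of gate `j` of layer `i` after `p` and `ω₁` have been fixed to `r`. -/
def gateWeight' (i : ℕ) (z r : ℕ → K) (j : ℕ) : K :=
  C.gateWeight i z r j * chiE (C.bits (i + 1)) (C.left i j) fun k => r (C.bits i + k)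

/-- The rounds in which the variables `ω₂` are fixed: the left inputs are replaced by `Ṽ(ω₁)`, and
the sum-check is one for a polynomial `A Ṽ + D` in `ω₂`. -/
theorem roundPoly_layerPoly_right {i j : ℕ} (hi : i < C.depth) (hj : j < C.bits (i + 1))
    (z r : ℕ → K) :
    roundPoly (C.layerPoly x i z) (C.rounds i) r (C.bits i + C.bits (i + 1) + j) =
      scPoly
        (C.gatherMul i (C.right i) (C.gateWeight' i z r) fun _ =>
          mleE (C.bits (i + 1)) (C.value x (i + 1)) fun k => r (C.bits i + k))
        (C.value x (i + 1))
        (C.gatherAdd i (C.right i) (C.gateWeight' i z r) fun _ =>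
          mleE (C.bits (i + 1)) (C.value x (i + 1)) fun k => r (C.bits i + k))
        (C.bits (i + 1)) (fun k => r (C.bits i + C.bits (i + 1) + k)) j := by
  have hN : C.rounds i - (C.bits i + C.bits (i + 1) + j + 1) = C.bits (i + 1) - (j + 1) := by
    unfold rounds; omega
  rw [roundPoly_eq, ← sum_mleE_roundPoint hj, hN]
  refine Finset.sum_congr rfl fun y hy => ?_
  have hf : ∀ j < C.width i, C.right i j < 2 ^ C.bits (i + 1) := fun j hj =>
    (C.right_lt i hi j hj).trans_le (C.width_le_two_pow _)
  set q := roundPoint (fun k => r (C.bits i + C.bits (i + 1) + k)) j y with hq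
  have hsum := C.sum_gateFn (C.right i) hf (C.gateWeight' i z r)
    (fun _ => mleE (C.bits (i + 1)) (C.value x (i + 1)) fun k => r (C.bits i + k)) q
    (mleE (C.bits (i + 1)) (fun j => algebraMap K K[X] (C.value x (i + 1) j)) q)
  refine Eq.trans ?_ hsum
  rw [C.aeval_layerPoly' x hi]
  refine (C.layerFn_congr x i z (p' := fun k => Polynomial.C (r k))
    (ω₁' := fun k => Polynomial.C (r (C.bits i + k))) (ω₂' := q)
    (fun k hk => roundPoint_of_lt r _ (by omega)) (fun k hk => roundPoint_of_lt r _ (by omega))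
    fun k hk => roundPoint_add ..).trans ?_
  rw [layerFn, Finset.mul_sum]
  refine Finset.sum_congr rfl fun j _ => ?_
  have h1 := map_mleE (algebraMap K K[X]) (C.bits i) (fun j => chiE (C.bits i) j z) r
  have h2 := map_chiE (algebraMap K K[X]) (C.bits i) j r
  have h3 := map_chiE (algebraMap K K[X]) (C.bits (i + 1)) (C.left i j) fun k => r (C.bits i + k)
  have h4 := map_mleE (algebraMap K K[X]) (C.bits (i + 1)) (C.value x (i + 1))
    fun k => r (C.bits i + k)
  rw [gateWeight', gateWeight, map_mul, map_mul, h1, h2, h3, h4]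
  simp only [Polynomial.algebraMap_eq]
  unfold gateFn
  split <;> ring

theorem natDegree_roundPoly_le {i j : ℕ} (hi : i < C.depth) (hj : j < C.rounds i) (z r : ℕ → K) :
    (roundPoly (C.layerPoly x i z) (C.rounds i) r j).natDegree ≤ 2 := by
  rcases Nat.lt_or_ge j (C.bits i) with h | h
  · rw [C.roundPoly_layerPoly_p x hi h]; exact natDegree_scPoly_le ..
  obtain ⟨k, rfl⟩ := Nat.exists_eq_add_of_le h
  rcases Nat.lt_or_ge k (C.bits (i + 1)) with h' | h'
  · rw [C.roundPoly_layerPoly_left x hi h']; exact natDegree_scPoly_le ..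
  obtain ⟨l, rfl⟩ := Nat.exists_eq_add_of_le h'
  rw [← add_assoc, C.roundPoly_layerPoly_right x hi (by unfold rounds at hj; omega)]
  exact natDegree_scPoly_le ..

/-! ### The line through two points -/

theorem linePoly_eq_tab (r : ℕ → K) (i : ℕ) :
    C.linePoly x r i = tab
      (fun k => Polynomial.C (C.sumcheckPoint r i (C.bits i + k)) +
        X * Polynomial.C (C.sumcheckPoint r i (C.bits i + C.bits (i + 1) + k) -
          C.sumcheckPoint r i (C.bits i + k)))
      (fun j => Polynomial.C (C.value x (i + 1) j)) (C.bits (i + 1)) 0 := by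
  rw [linePoly, aeval_mle, mleE_eq_tab]
  simp [Polynomial.algebraMap_eq]

theorem natDegree_tab_line_le (a b g : ℕ → K) (k y : ℕ) :
    (tab (fun k => Polynomial.C (a k) + X * Polynomial.C (b k)) (fun j => Polynomial.C (g j))
      k y).natDegree ≤ k := by
  induction k generalizing y with
  | zero => simp [tab]
  | succ k ih =>
    rw [tab]
    refine (natDegree_add_le _ _).trans (max_le ((ih _).trans (by omega)) ?_)
    refine natDegree_mul_le.trans ?_
    have h1 : (Polynomial.C (a k) + X * Polynomial.C (b k)).natDegree ≤ 1 := by compute_degree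
    have h2 := (natDegree_sub_le (tab (fun k => Polynomial.C (a k) + X * Polynomial.C (b k))
      (fun j => Polynomial.C (g j)) k (2 * y + 1)) (tab (fun k => Polynomial.C (a k) +
        X * Polynomial.C (b k)) (fun j => Polynomial.C (g j)) k (2 * y))).trans
      (max_le (ih _) (ih _))
    omega

theorem natDegree_linePoly_le (r : ℕ → K) (i : ℕ) :
    (C.linePoly x r i).natDegree ≤ C.bits (i + 1) := by
  rw [linePoly_eq_tab]
  exact natDegree_tab_line_le _ _ _ _ _

theorem eval_linePoly (r : ℕ → K) (i : ℕ) (t : K) :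
    (C.linePoly x r i).eval t = mleE (C.bits (i + 1)) (C.value x (i + 1)) fun k =>
      C.sumcheckPoint r i (C.bits i + k) + t *
        (C.sumcheckPoint r i (C.bits i + C.bits (i + 1) + k) -
          C.sumcheckPoint r i (C.bits i + k)) := by
  rw [linePoly_eq_tab, ← coe_evalRingHom, map_tab, mleE_eq_tab]
  simp

end LayeredCircuit

end GKR

namespace GKR

/-! ### Sum-check claims -/

section PartialSum

open Polynomial

variable {K : Type*} [Field K]

/-- The sum of `f` over the last `N - j` of `N` variables, the first `j` being fixed to `r`. -/
noncomputable def partialSum (f : MvPolynomial ℕ K) (N : ℕ) (r : ℕ → K) (j : ℕ) : K :=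
  ∑ b ∈ Finset.range (2 ^ (N - j)),
    MvPolynomial.eval (fun k => if k < j then r k else bitR b (k - j)) f

theorem eval_roundPoly (f : MvPolynomial ℕ K) (N : ℕ) (r : ℕ → K) (j : ℕ) (c : K) :
    (LayeredCircuit.roundPoly f N r j).eval c = ∑ b ∈ Finset.range (2 ^ (N - (j + 1))),
      MvPolynomial.eval (fun k => if k < j then r k else if k = j then c
        else bitR b (k - (j + 1))) f := by
  rw [roundPoly_eq, eval_finsetSum]
  refine Finset.sum_congr rfl fun b _ => ?_
  rw [← coe_aeval_eq_eval, ← AlgHom.comp_apply, MvPolynomial.comp_aeval,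
    MvPolynomial.aeval_eq_eval]
  congr 2
  funext k
  simp only [roundPoint, bitR]
  split_ifs <;> simp

/-- The claim that follows from a round polynomial is a claim for one sum with one more variable
fixed. -/
theorem eval_roundPoly_self (f : MvPolynomial ℕ K) (N : ℕ) (r : ℕ → K) (j : ℕ) :
    (LayeredCircuit.roundPoly f N r j).eval (r j) = partialSum f N r (j + 1) := by
  rw [eval_roundPoly, partialSum]
  refine Finset.sum_congr rfl fun b _ => ?_
  congr 2
  funext k
  rcases lt_trichotomy k j with h | h | h
  · simp [h, h.trans (Nat.lt_succ_self j)]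
  · simp [h]
  · have h1 : ¬ k < j := by omega
    have h2 : k ≠ j := by omega
    have h3 : ¬ k < j + 1 := by omega
    simp [h1, h2, h3]

/-- The check of a round, for the honest round polynomial. -/
theorem eval_roundPoly_add (f : MvPolynomial ℕ K) {N j : ℕ} (hj : j < N) (r : ℕ → K) :
    (LayeredCircuit.roundPoly f N r j).eval 0 + (LayeredCircuit.roundPoly f N r j).eval 1 =
      partialSum f N r j := by
  rw [eval_roundPoly, eval_roundPoly, partialSum, show N - j = N - (j + 1) + 1 by omega, pow_succ',
    sum_range_two_mul, ← Finset.sum_add_distrib]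
  refine Finset.sum_congr rfl fun b _ => ?_
  congr 3 <;> funext k
  all_goals
    rcases lt_trichotomy k j with h | h | h
    · simp [h]
    · subst h; simp [bitR]
    · have h1 : ¬ k < j := by omega
      have h2 : k ≠ j := by omega
      obtain ⟨l, rfl⟩ : ∃ l, k = j + 1 + l := ⟨k - (j + 1), by omega⟩
      have h3 : j + 1 + l - j = l + 1 := by omega
      have h4 : (2 * b + 1) / 2 = b := by omega
      simp [h1, h2, h3, bitR, Nat.testBit_succ, h4]

end PartialSum

namespace LayeredCircuit

open Polynomial

variable {n : ℕ} (C : LayeredCircuit n) {K : Type*} [Field K] (x : Fin n → K)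

/-- At the start of the sum-check of iteration `i`, the sum is the value of the extension of
layer `i`. -/
theorem partialSum_layerPoly_zero {i : ℕ} (hi : i < C.depth) (z r : ℕ → K) :
    partialSum (C.layerPoly x i z) (C.rounds i) r 0 = mleE (C.bits i) (C.value x i) z := by
  have hN : C.rounds i - 0 = C.bits i + (C.bits (i + 1) + C.bits (i + 1)) := by
    unfold rounds; omega
  rw [partialSum, hN, sum_range_two_pow_add, ← mleE_comm_chiE]
  refine Finset.sum_congr rfl fun y hy => ?_
  have hy := Finset.mem_range.1 hy
  have h := C.sum_layerFn (A := K) x hi z (bitR y)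
  simp only [Algebra.algebraMap_self, RingHom.id_apply] at h
  rw [mleE_bitR hy (C.value x i)] at h
  rw [← h, sum_range_two_pow_add]
  refine Finset.sum_congr rfl fun a ha => Finset.sum_congr rfl fun b _ => ?_
  have ha := Finset.mem_range.1 ha
  rw [← MvPolynomial.aeval_eq_eval, C.aeval_layerPoly' x hi]
  refine C.layerFn_congr x i z (fun k hk => ?_) (fun k hk => ?_) fun k hk => ?_
  · simp [bitR_add hy, hk]
  · simp [bitR_add hy, bitR_add ha, hk]
  · have h1 : ¬ C.bits i + C.bits (i + 1) + k < C.bits i := by omega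
    have h2 : C.bits i + C.bits (i + 1) + k - C.bits i = C.bits (i + 1) + k := by omega
    simp [bitR_add hy, bitR_add ha, h1, h2]

/-- At the end of the sum-check of iteration `i`, the sum consists of one value. -/
theorem partialSum_layerPoly_rounds {i : ℕ} (hi : i < C.depth) (z r : ℕ → K) :
    partialSum (C.layerPoly x i z) (C.rounds i) r (C.rounds i) =
      MvPolynomial.eval r (C.layerPoly x i z) := by
  rw [partialSum, Nat.sub_self, pow_zero, Finset.sum_range_one, ← MvPolynomial.aeval_eq_eval,
    ← MvPolynomial.aeval_eq_eval, C.aeval_layerPoly' x hi, C.aeval_layerPoly' x hi]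
  refine C.layerFn_congr x i z (fun k hk => ?_) (fun k hk => ?_) fun k hk => ?_ <;>
  · rw [if_pos]
    unfold rounds; omega

/-- The value of the sum-check polynomial at the challenges, in terms of the line polynomial. -/
theorem eval_layerPoly_eq_linePoly (r : ℕ → K) (i : ℕ) (z : ℕ → K) :
    MvPolynomial.eval (C.sumcheckPoint r i) (C.layerPoly x i z) =
      MvPolynomial.eval (C.sumcheckPoint r i) (beta (C.bits i) z) *
        (MvPolynomial.eval (C.sumcheckPoint r i) (C.wiringMLE i false) *
            ((C.linePoly x r i).eval 0 + (C.linePoly x r i).eval 1) +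
          MvPolynomial.eval (C.sumcheckPoint r i) (C.wiringMLE i true) *
            ((C.linePoly x r i).eval 0 * (C.linePoly x r i).eval 1)) := by
  have h0 : (C.linePoly x r i).eval 0 = MvPolynomial.eval (C.sumcheckPoint r i)
      (mle (C.bits (i + 1)) (C.bits i) (C.value x (i + 1))) := by
    rw [eval_linePoly, ← MvPolynomial.aeval_eq_eval, aeval_mle]
    simp
  have h1 : (C.linePoly x r i).eval 1 = MvPolynomial.eval (C.sumcheckPoint r i)
      (mle (C.bits (i + 1)) (C.bits i + C.bits (i + 1)) (C.value x (i + 1))) := by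
    rw [eval_linePoly, ← MvPolynomial.aeval_eq_eval, aeval_mle]
    simp
  rw [h0, h1]
  simp [layerPoly]

/-- The true value at the point at which the extension of layer `i` is to be verified. -/
noncomputable def trueClaim (r : ℕ → K) (i : ℕ) : K :=
  mleE (C.bits i) (C.value x i) (C.layerPoint r i)

theorem eval_linePoly_self (r : ℕ → K) (i : ℕ) :
    (C.linePoly x r i).eval (r (C.offset i + C.rounds i)) = C.trueClaim x r (i + 1) :=
  C.eval_linePoly x r i _

theorem trueClaim_zero (r : ℕ → K) : C.trueClaim x r 0 = C.value x 0 0 := by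
  simp [trueClaim, mleE]

theorem eval_mle_layerPoint (r : ℕ → K) (i : ℕ) :
    MvPolynomial.eval (C.layerPoint r i) (mle (C.bits i) 0 (C.value x i)) = C.trueClaim x r i := by
  rw [← MvPolynomial.aeval_eq_eval, aeval_mle]
  simp [trueClaim]

/-- The honest round polynomial. -/
noncomputable def honestRound (r : ℕ → K) (i j : ℕ) : K[X] :=
  roundPoly (C.layerPoly x i (C.layerPoint r i)) (C.rounds i) (C.sumcheckPoint r i) j

/-! ### Soundness -/

/-- If every polynomial that the prover sends either is the honest one or differs from it at the
challenge that follows, then an accepted claim is correct. -/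
theorem claim_eq_of_accepts {P : Strategy K} {r : ℕ → K} (h : C.Accepts x P r)
    (hr : ∀ i < C.depth, ∀ j < C.rounds i,
      (sentPoly P r 2 (C.offset i + j)).eval (r (C.offset i + j)) =
        (C.honestRound x r i j).eval (r (C.offset i + j)) →
      sentPoly P r 2 (C.offset i + j) = C.honestRound x r i j)
    (hl : ∀ i < C.depth,
      (sentPoly P r (C.bits (i + 1)) (C.offset i + C.rounds i)).eval
          (r (C.offset i + C.rounds i)) =
        (C.linePoly x r i).eval (r (C.offset i + C.rounds i)) →
      sentPoly P r (C.bits (i + 1)) (C.offset i + C.rounds i) = C.linePoly x r i) :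
    P [] 0 = C.value x 0 0 := by
  obtain ⟨h₁, h₂⟩ := h
  -- correctness of the claims is propagated backwards, from the input layer to the output
  have main : ∀ m i, i + m = C.depth → C.layerClaim P r i = C.trueClaim x r i := by
    intro m
    induction m with
    | zero =>
      rintro i rfl
      rw [← eval_mle_layerPoint]; exact h₂
    | succ m ih =>
      intro i him
      have hi : i < C.depth := by omega
      obtain ⟨hc, hf⟩ := h₁ i hi
      have hline : sentPoly P r (C.bits (i + 1)) (C.offset i + C.rounds i) = C.linePoly x r i := by
        refine hl i hi ?_
        rw [eval_linePoly_self]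
        exact ih (i + 1) (by omega)
      simp only [hline] at hf
      rw [← eval_layerPoly_eq_linePoly, ← C.partialSum_layerPoly_rounds x hi] at hf
      have hround : ∀ l j, j + l = C.rounds i → C.roundClaim P r i j =
          partialSum (C.layerPoly x i (C.layerPoint r i)) (C.rounds i) (C.sumcheckPoint r i) j := by
        intro l
        induction l with
        | zero => rintro j hj; rw [add_zero] at hj; rw [hj]; exact hf
        | succ l ihl =>
          intro j hj
          have hs : sentPoly P r 2 (C.offset i + j) = C.honestRound x r i j := by
            refine hr i hi j (by omega) ?_
            have := ihl (j + 1) (by omega)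
            rw [← eval_roundPoly_self] at this
            exact this
          rw [← hc j (by omega), hs]
          exact eval_roundPoly_add _ (by omega) _
      have := hround (C.rounds i) 0 (by omega)
      rw [C.partialSum_layerPoly_zero x hi] at this
      exact this
  have := main C.depth 0 (by omega)
  rw [trueClaim_zero] at this
  exact this

theorem offset_succ (i : ℕ) : C.offset (i + 1) = C.offset i + (C.rounds i + 1) :=
  Finset.sum_range_succ _ _

theorem offset_mono {i j : ℕ} (h : i ≤ j) : C.offset i ≤ C.offset j :=
  Finset.sum_le_sum_of_subset (Finset.range_subset_range.2 h)

theorem offset_add_lt {i j : ℕ} (hi : i < C.depth) (hj : j < C.rounds i + 1) :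
    C.offset i + j < C.numChallenges := by
  have h1 := C.offset_mono (show i + 1 ≤ C.depth from hi)
  rw [offset_succ] at h1
  unfold numChallenges; omega

theorem layerPoint_congr {r r' : ℕ → K} {i : ℕ} (h : ∀ k < C.offset i, r k = r' k) {k : ℕ}
    (hk : k < C.bits i) : C.layerPoint r i k = C.layerPoint r' i k := by
  cases i with
  | zero => rfl
  | succ i =>
    rw [offset_succ] at h
    simp only [layerPoint, sumcheckPoint]
    rw [h, h, h] <;> unfold rounds <;> omega

theorem layerPoly_congr {z z' : ℕ → K} {i : ℕ} (h : ∀ k < C.bits i, z k = z' k) :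
    C.layerPoly x i z = C.layerPoly x i z' := by
  have : beta (C.bits i) z = beta (C.bits i) z' := by
    refine Finset.prod_congr rfl fun k hk => ?_
    rw [h k (Finset.mem_range.1 hk)]
  simp [layerPoly, this]

theorem roundPoly_congr (f : MvPolynomial ℕ K) (N : ℕ) {r r' : ℕ → K} {j : ℕ}
    (h : ∀ k < j, r k = r' k) : roundPoly f N r j = roundPoly f N r' j := by
  unfold roundPoly
  refine Finset.sum_congr rfl fun b _ => ?_
  congr 2
  funext k
  split_ifs with hk
  · rw [h k hk]
  all_goals rfl

theorem honestRound_congr {r r' : ℕ → K} {i j : ℕ} (h : ∀ k < C.offset i + j, r k = r' k) :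
    C.honestRound x r i j = C.honestRound x r' i j := by
  unfold honestRound
  rw [C.layerPoly_congr x fun k hk =>
    C.layerPoint_congr (r := r) (r' := r') (fun k hk => h k (by omega)) hk]
  exact roundPoly_congr _ _ fun k hk => h _ (by omega)

theorem linePoly_congr {r r' : ℕ → K} {i : ℕ} (h : ∀ k < C.offset i + C.rounds i, r k = r' k) :
    C.linePoly x r i = C.linePoly x r' i := by
  rw [linePoly_eq_tab, linePoly_eq_tab]
  refine tab_congr _ (fun k hk => ?_) _
  simp only [sumcheckPoint]
  rw [h, h] <;> unfold rounds <;> omega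

theorem sentPoly_congr (P : Strategy K) {r r' : ℕ → K} (m : ℕ) {k : ℕ}
    (h : ∀ i < k, r i = r' i) : sentPoly P r m k = sentPoly P r' m k := by
  have : (List.range k).map r = (List.range k).map r' :=
    List.map_congr_left fun i hi => h i (List.mem_range.1 hi)
  simp [sentPoly, this]

theorem natDegree_sentPoly_le (P : Strategy K) (r : ℕ → K) (m k : ℕ) :
    (sentPoly P r m k).natDegree ≤ m := by
  refine natDegree_sum_le_of_forall_le _ _ fun e he => ?_
  have := Finset.mem_range.1 he
  exact (natDegree_C_mul_X_pow_le _ _).trans (by omega)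

end LayeredCircuit

open Polynomial in
/-- Two polynomials that depend on the challenges before number `k` only and that are different
agree at challenge `k` with probability at most their degree over the number of challenges. -/
theorem card_agree_mul_le {K : Type*} [Field K] {T : ℕ} (Ω : Finset K) (k : Fin T) (D : ℕ)
    (s g : (Fin T → Ω) → K[X])
    (hs : ∀ ρ ρ', (∀ i < k, ρ i = ρ' i) → s ρ = s ρ')
    (hg : ∀ ρ ρ', (∀ i < k, ρ i = ρ' i) → g ρ = g ρ')
    (hsD : ∀ ρ, (s ρ).natDegree ≤ D) (hgD : ∀ ρ, (g ρ).natDegree ≤ D)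
    (B : Finset (Fin T → Ω))
    (hB : ∀ ρ ∈ B, s ρ ≠ g ρ ∧ (s ρ).eval (ρ k : K) = (g ρ).eval (ρ k : K)) :
    B.card * Ω.card ≤ D * Fintype.card (Fin T → Ω) := by
  classical
  -- coordinate `k` of a tape `ρ` in `B` is exchanged for an arbitrary challenge; the polynomials
  -- of the new tape are those of `ρ`, so the old coordinate is a root of their difference, and the
  -- new tape has at most `D` of these
  let f : (Fin T → Ω) × Ω → (Fin T → Ω) × Ω := fun p => (Function.update p.1 k p.2, p.1 k)
  have hf : Function.Injective f := by
    rintro ⟨ρ, c⟩ ⟨ρ', c'⟩ h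
    simp only [f, Prod.mk.injEq] at h
    obtain ⟨h1, h2⟩ := h
    have hc : c = c' := by simpa using congrFun h1 k
    refine Prod.ext (funext fun i => ?_) hc
    rcases eq_or_ne i k with rfl | hi
    · exact h2
    · simpa [hi] using congrFun h1 i
  let S : Finset ((Fin T → Ω) × Ω) := Finset.univ.filter fun p =>
    s p.1 ≠ g p.1 ∧ (s p.1).eval (p.2 : K) = (g p.1).eval (p.2 : K)
  have hmap : ∀ p ∈ B ×ˢ (Finset.univ : Finset Ω), f p ∈ S := by
    rintro ⟨ρ, c⟩ hp
    have hρ := (Finset.mem_product.1 hp).1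
    have h1 : ∀ i < k, Function.update ρ k c i = ρ i := fun i hi => Function.update_of_ne hi.ne _ _
    simp only [S, f, Finset.mem_filter, Finset.mem_univ, true_and]
    rw [hs _ ρ h1, hg _ ρ h1]
    exact hB ρ hρ
  have hcard := Finset.card_le_card_of_injOn f hmap hf.injOn
  rw [Finset.card_product, Finset.card_univ, Fintype.card_coe] at hcard
  refine hcard.trans ?_
  have hS : S = Finset.univ.biUnion fun ρ : Fin T → Ω =>
      (S.filter fun p => p.1 = ρ) := by
    ext p; simp
  rw [hS]
  refine (Finset.card_biUnion_le).trans ?_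
  rw [mul_comm, ← Finset.card_univ, ← smul_eq_mul, ← Finset.sum_const]
  refine Finset.sum_le_sum fun ρ _ => ?_
  by_cases hne : s ρ = g ρ
  · rw [Finset.card_eq_zero.2]
    · exact Nat.zero_le _
    · ext p
      simp only [S, Finset.mem_filter, Finset.mem_univ, true_and, Finset.notMem_empty, iff_false]
      rintro ⟨⟨h1, -⟩, rfl⟩
      exact h1 hne
  · have hne' : s ρ - g ρ ≠ 0 := sub_ne_zero.2 hne
    calc _ ≤ (s ρ - g ρ).roots.toFinset.card := by
          refine Finset.card_le_card_of_injOn (fun p => (p.2 : K)) ?_ ?_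
          · intro p hp
            simp only [S, Finset.coe_filter, Finset.mem_filter, Finset.mem_univ, true_and,
              Set.mem_ofPred_eq] at hp
            obtain ⟨⟨-, h2⟩, rfl⟩ := hp
            simp [hne', h2]
          · rintro ⟨ρ₁, c₁⟩ h₁ ⟨ρ₂, c₂⟩ h₂ h
            simp only [Finset.coe_filter, Set.mem_ofPred_eq] at h₁ h₂
            exact Prod.ext (h₁.2.trans h₂.2.symm) (Subtype.ext h)
      _ ≤ Multiset.card (s ρ - g ρ).roots := Multiset.toFinset_card_le _
      _ ≤ (s ρ - g ρ).natDegree := card_roots' _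
      _ ≤ D := (natDegree_sub_le _ _).trans (max_le (hsD ρ) (hgD ρ))

section Sound

variable {n : ℕ} {F K : Type*} [Field F] [Field K] [Algebra F K] (C : LayeredCircuit n)

theorem answer_eq (σ : List (Fin n × F)) :
    answer C K σ = C.value (fun i => algebraMap F K (freq σ i)) 0 0 :=
  C.map_value _ (algebraMap F K) 0 0

theorem ofTape_congr {Ω : Finset K} {T : ℕ} {k : Fin T} {ρ ρ' : Fin T → Ω}
    (h : ∀ i < k, ρ i = ρ' i) {i : ℕ} (hi : i < k) :
    ofTape (fun k => (ρ k : K)) i = ofTape (fun k => (ρ' k : K)) i := by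
  simp [ofTape, hi.trans k.2, h ⟨i, hi.trans k.2⟩ hi]

open Classical in
/-- A wrong output is accepted only if some polynomial that was sent differs from the honest one but
agrees with it at the challenge that follows; the probabilities of these events add up to at most
`totalDegree / |Ω|`. -/
theorem sound (Ω : Finset K) (σ : List (Fin n × F)) (hΩ : Ω.Nonempty)
    (hcard : 3 * C.totalDegree ≤ Ω.card) : Sound C Ω σ := by
  intro P
  set x : Fin n → K := fun i => algebraMap F K (freq σ i)
  set B := Finset.univ.filter fun ρ : Fin C.numChallenges → Ω =>
    protocolOut C σ P ρ ≠ some (answer C K σ) ∧ protocolOut C σ P ρ ≠ none with hB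
  -- the challenges, indexed by the iteration and the round
  let tp : (Fin C.numChallenges → Ω) → ℕ → K := fun ρ => ofTape fun k => (ρ k : K)
  let badR (i j : ℕ) : Finset (Fin C.numChallenges → Ω) := Finset.univ.filter fun ρ =>
    LayeredCircuit.sentPoly P (tp ρ) 2 (C.offset i + j) ≠ C.honestRound x (tp ρ) i j ∧
    (LayeredCircuit.sentPoly P (tp ρ) 2 (C.offset i + j)).eval (tp ρ (C.offset i + j)) =
      (C.honestRound x (tp ρ) i j).eval (tp ρ (C.offset i + j))
  let badL (i : ℕ) : Finset (Fin C.numChallenges → Ω) := Finset.univ.filter fun ρ =>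
    LayeredCircuit.sentPoly P (tp ρ) (C.bits (i + 1)) (C.offset i + C.rounds i) ≠
      C.linePoly x (tp ρ) i ∧
    (LayeredCircuit.sentPoly P (tp ρ) (C.bits (i + 1)) (C.offset i + C.rounds i)).eval
        (tp ρ (C.offset i + C.rounds i)) =
      (C.linePoly x (tp ρ) i).eval (tp ρ (C.offset i + C.rounds i))
  have hsub : B ⊆ (Finset.range C.depth).biUnion fun i =>
      ((Finset.range (C.rounds i)).biUnion fun j => badR i j) ∪ badL i := by
    intro ρ hρ
    obtain ⟨h1, h2⟩ := (Finset.mem_filter.1 hρ).2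
    by_contra hcon
    simp only [Finset.mem_biUnion, Finset.mem_union, Finset.mem_range, not_exists, not_and, not_or]
      at hcon
    unfold protocolOut LayeredCircuit.output at h1 h2
    split_ifs at h1 h2 with hacc
    · refine h1 ?_
      rw [answer_eq]
      refine congrArg some (C.claim_eq_of_accepts x hacc (fun i hi j hj he => ?_) fun i hi he => ?_)
      · by_contra hne
        exact (hcon i hi).1 j hj (Finset.mem_filter.2 ⟨Finset.mem_univ _, hne, he⟩)
      · by_contra hne
        exact (hcon i hi).2 (Finset.mem_filter.2 ⟨Finset.mem_univ _, hne, he⟩)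
    · exact h2 rfl
  have htp : ∀ (ρ : Fin C.numChallenges → Ω) (k : Fin C.numChallenges), tp ρ k = ρ k :=
    fun ρ k => by simp [tp, ofTape]
  have hR : ∀ i < C.depth, ∀ j < C.rounds i,
      (badR i j).card * Ω.card ≤ 2 * Fintype.card (Fin C.numChallenges → Ω) := by
    intro i hi j hj
    have hk := C.offset_add_lt hi (show j < C.rounds i + 1 by omega)
    refine card_agree_mul_le Ω ⟨C.offset i + j, hk⟩ 2
      (fun ρ => LayeredCircuit.sentPoly P (tp ρ) 2 (C.offset i + j))
      (fun ρ => C.honestRound x (tp ρ) i j) (fun ρ ρ' h => ?_) (fun ρ ρ' h => ?_)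
      (fun ρ => LayeredCircuit.natDegree_sentPoly_le ..)
      (fun ρ => C.natDegree_roundPoly_le x hi hj _ _) _ fun ρ hρ => ?_
    · exact LayeredCircuit.sentPoly_congr P 2 fun i hi => ofTape_congr h hi
    · exact C.honestRound_congr x fun i hi => ofTape_congr h hi
    · rw [← htp]; exact (Finset.mem_filter.1 hρ).2
  have hL : ∀ i < C.depth, (badL i).card * Ω.card ≤
      C.bits (i + 1) * Fintype.card (Fin C.numChallenges → Ω) := by
    intro i hi
    have hk := C.offset_add_lt hi (show C.rounds i < C.rounds i + 1 by omega)
    refine card_agree_mul_le Ω ⟨C.offset i + C.rounds i, hk⟩ (C.bits (i + 1))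
      (fun ρ => LayeredCircuit.sentPoly P (tp ρ) (C.bits (i + 1)) (C.offset i + C.rounds i))
      (fun ρ => C.linePoly x (tp ρ) i) (fun ρ ρ' h => ?_) (fun ρ ρ' h => ?_)
      (fun ρ => LayeredCircuit.natDegree_sentPoly_le ..)
      (fun ρ => C.natDegree_linePoly_le x _ _) _ fun ρ hρ => ?_
    · exact LayeredCircuit.sentPoly_congr P _ fun i hi => ofTape_congr h hi
    · exact C.linePoly_congr x fun i hi => ofTape_congr h hi
    · rw [← htp]; exact (Finset.mem_filter.1 hρ).2
  have hunion : B.card * Ω.card ≤ C.totalDegree * Fintype.card (Fin C.numChallenges → Ω) := by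
    calc B.card * Ω.card
        ≤ (∑ i ∈ Finset.range C.depth, ((∑ j ∈ Finset.range (C.rounds i), (badR i j).card) +
            (badL i).card)) * Ω.card := by
          refine Nat.mul_le_mul_right _ ((Finset.card_le_card hsub).trans
            (Finset.card_biUnion_le.trans (Finset.sum_le_sum fun i _ => ?_)))
          exact (Finset.card_union_le _ _).trans (Nat.add_le_add_right Finset.card_biUnion_le _)
      _ ≤ _ := by
          rw [Finset.sum_mul, LayeredCircuit.totalDegree, Finset.sum_mul]
          refine Finset.sum_le_sum fun i hi => ?_
          have hi := Finset.mem_range.1 hi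
          rw [add_mul, add_mul, Finset.sum_mul]
          refine Nat.add_le_add ?_ (hL i hi)
          calc _ ≤ ∑ j ∈ Finset.range (C.rounds i),
                2 * Fintype.card (Fin C.numChallenges → Ω) :=
                Finset.sum_le_sum fun j hj => hR i hi j (Finset.mem_range.1 hj)
            _ = _ := by rw [Finset.sum_const, Finset.card_range, smul_eq_mul]; ring
  have hΩ' : Nonempty Ω := hΩ.to_subtype
  have hT : 0 < Fintype.card (Fin C.numChallenges → Ω) := Fintype.card_pos
  have hpos : 0 < Ω.card := hΩ.card_pos
  have key : 3 * B.card ≤ Fintype.card (Fin C.numChallenges → Ω) := by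
    have h1 : (3 * B.card) * Ω.card ≤ Ω.card * Fintype.card (Fin C.numChallenges → Ω) := by
      calc (3 * B.card) * Ω.card = 3 * (B.card * Ω.card) := by ring
        _ ≤ 3 * (C.totalDegree * Fintype.card (Fin C.numChallenges → Ω)) :=
            Nat.mul_le_mul_left _ hunion
        _ = (3 * C.totalDegree) * Fintype.card (Fin C.numChallenges → Ω) := by ring
        _ ≤ _ := Nat.mul_le_mul_right _ hcard
    rw [mul_comm Ω.card] at h1
    exact Nat.le_of_mul_le_mul_right h1 hpos
  rw [div_le_iff₀ (by exact_mod_cast hT)]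
  have : (3 * B.card : ℚ) ≤ Fintype.card (Fin C.numChallenges → Ω) := by exact_mod_cast key
  linarith

end Sound

end GKR

namespace GKR

/-! ### Completeness -/

theorem length_flatMap_range {α : Type*} (f : ℕ → List α) (d : ℕ) :
    ((List.range d).flatMap f).length = ∑ i ∈ Finset.range d, (f i).length := by
  induction d with
  | zero => rfl
  | succ d ih => simp [List.range_succ, List.flatMap_append, ih, Finset.sum_range_succ]

theorem getD_flatMap_range {α : Type*} (f : ℕ → List α) (a : α) {d i j : ℕ} (hi : i < d)
    (hj : j < (f i).length) :
    ((List.range d).flatMap f).getD (∑ i ∈ Finset.range i, (f i).length + j) a =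
      (f i).getD j a := by
  induction d with
  | zero => omega
  | succ d ih =>
    rw [List.range_succ, List.flatMap_append]
    rcases Nat.lt_or_ge i d with h | h
    · rw [List.getD_append]
      · exact ih h
      · rw [length_flatMap_range]
        have := Finset.sum_le_sum_of_subset (f := fun i => (f i).length)
          (Finset.range_subset_range.2 (show i + 1 ≤ d from h))
        rw [Finset.sum_range_succ] at this
        omega
    · obtain rfl : i = d := by omega
      rw [List.getD_append_right]
      · rw [length_flatMap_range]; simp
      · rw [length_flatMap_range]; omega

theorem getD_modifyHead_cons {α : Type*} (c a : α) (L : List (List α)) {k : ℕ} (hk : k < L.length)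
    (e : ℕ) :
    ((L.modifyHead (c :: ·)).getD k []).getD (e + if k = 0 then 1 else 0) a =
      (L.getD k []).getD e a := by
  cases L with
  | nil => simp at hk
  | cons m L => cases k <;> simp

theorem getD_map_range {α : Type*} (f : ℕ → α) (a : α) {m e : ℕ} (he : e < m) :
    ((List.range m).map f).getD e a = f e := by
  simp [he]

namespace LayeredCircuit

open Polynomial

variable {n : ℕ} (C : LayeredCircuit n) {K : Type*} [Field K] (x : Fin n → K)

/-- The messages of iteration `i`, without the claimed output. -/
noncomputable def iterMsgs (r : ℕ → K) (i : ℕ) : List (List K) :=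
  (List.range (C.rounds i)).map (fun j => (List.range 3).map (C.honestRound x r i j).coeff) ++
    [(List.range (C.bits (i + 1) + 1)).map (C.linePoly x r i).coeff]

theorem honestMsgs_eq (r : ℕ → K) : C.honestMsgs x r =
    ((List.range C.depth).flatMap (C.iterMsgs x r)).modifyHead (C.value x 0 0 :: ·) := rfl

@[simp] theorem length_iterMsgs (r : ℕ → K) (i : ℕ) :
    (C.iterMsgs x r i).length = C.rounds i + 1 := by
  simp [iterMsgs]

theorem length_flatMap_iterMsgs (r : ℕ → K) :
    ((List.range C.depth).flatMap (C.iterMsgs x r)).length = C.numChallenges := by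
  rw [length_flatMap_range]
  simp [numChallenges, offset]

/-- Coefficient `e` of polynomial number `offset i + j`; the first polynomial is preceded by the
claimed output. -/
theorem honestProver_apply (r : ℕ → K) {i j : ℕ} (hi : i < C.depth) (hj : j < C.rounds i + 1)
    (e : ℕ) :
    C.honestProver x ((List.range (C.offset i + j)).map r) (e + if C.offset i + j = 0 then 1 else 0)
      = ((C.iterMsgs x (fun k => ((List.range (C.offset i + j)).map r).getD k 0) i).getD j
          []).getD e 0 := by
  unfold honestProver
  rw [honestMsgs_eq]
  simp only [List.length_map, List.length_range]
  rw [getD_modifyHead_cons]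
  · have h := getD_flatMap_range
      (C.iterMsgs x (fun k => ((List.range (C.offset i + j)).map r).getD k 0)) [] hi
      (j := j) (by simpa using hj)
    simp only [length_iterMsgs] at h
    rw [← h]; rfl
  · rw [length_flatMap_iterMsgs]; exact C.offset_add_lt hi hj

theorem sum_coeff_eq {p : K[X]} {m : ℕ} (h : p.natDegree ≤ m) :
    ∑ e ∈ Finset.range (m + 1), Polynomial.C (p.coeff e) * X ^ e = p :=
  (p.as_sum_range_C_mul_X_pow' (by omega)).symm

theorem sentPoly_honest_round (r : ℕ → K) {i j : ℕ} (hi : i < C.depth) (hj : j < C.rounds i) :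
    sentPoly (C.honestProver x) r 2 (C.offset i + j) = C.honestRound x r i j := by
  refine Eq.trans ?_ (sum_coeff_eq (C.natDegree_roundPoly_le x hi hj (C.layerPoint r i)
    (C.sumcheckPoint r i)))
  refine Finset.sum_congr rfl fun e he => ?_
  rw [C.honestProver_apply x r hi (by omega), iterMsgs,
    List.getD_append _ _ _ _ (by simpa using hj), getD_map_range _ _ hj, getD_map_range _ _ (Finset.mem_range.1 he)]
  rw [C.honestRound_congr x fun k hk => getD_map_range r 0 hk]

theorem sentPoly_honest_line (r : ℕ → K) {i : ℕ} (hi : i < C.depth) :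
    sentPoly (C.honestProver x) r (C.bits (i + 1)) (C.offset i + C.rounds i) =
      C.linePoly x r i := by
  refine Eq.trans ?_ (sum_coeff_eq (C.natDegree_linePoly_le x r i))
  refine Finset.sum_congr rfl fun e he => ?_
  rw [C.honestProver_apply x r hi (by omega), iterMsgs, List.getD_append_right _ _ _ _ (by simp)]
  simp only [List.length_map, List.length_range, Nat.sub_self, List.getD_cons_zero]
  rw [getD_map_range _ _ (Finset.mem_range.1 he)]
  rw [C.linePoly_congr x fun k hk => getD_map_range r 0 hk]

theorem honestProver_zero : C.honestProver x [] 0 = C.value x 0 0 := by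
  unfold honestProver
  rw [honestMsgs_eq]
  have h := C.length_flatMap_iterMsgs x fun k => ([] : List K).getD k 0
  have hpos : 0 < C.numChallenges :=
    (Nat.zero_le _).trans_lt (C.offset_add_lt C.depth_pos (Nat.succ_pos _))
  generalize (List.range C.depth).flatMap _ = L at h
  cases L with
  | nil => simp at h; omega
  | cons m L => simp

/-- All checks succeed for the honest prover. -/
theorem accepts_honestProver (r : ℕ → K) : C.Accepts x (C.honestProver x) r := by
  have hclaim : ∀ i ≤ C.depth, C.layerClaim (C.honestProver x) r i = C.trueClaim x r i := by
    intro i hi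
    cases i with
    | zero => rw [layerClaim, honestProver_zero, trueClaim_zero]
    | succ i =>
      have h := C.eval_linePoly_self x r i
      rw [← C.sentPoly_honest_line x r hi] at h
      exact h
  have hround : ∀ i < C.depth, ∀ j ≤ C.rounds i, C.roundClaim (C.honestProver x) r i j =
      partialSum (C.layerPoly x i (C.layerPoint r i)) (C.rounds i) (C.sumcheckPoint r i) j := by
    intro i hi j hj
    cases j with
    | zero => rw [roundClaim, hclaim i hi.le, C.partialSum_layerPoly_zero x hi]; rfl
    | succ j =>
      have h := eval_roundPoly_self (C.layerPoly x i (C.layerPoint r i)) (C.rounds i)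
        (C.sumcheckPoint r i) j
      rw [← h]
      exact congrArg (Polynomial.eval _) (C.sentPoly_honest_round x r hi hj)
  refine ⟨fun i hi => ⟨fun j hj => ?_, ?_⟩, ?_⟩
  · rw [hround i hi j hj.le, C.sentPoly_honest_round x r hi hj]
    exact eval_roundPoly_add _ hj _
  · simp only [C.sentPoly_honest_line x r hi]
    rw [← eval_layerPoly_eq_linePoly, hround i hi _ le_rfl, C.partialSum_layerPoly_rounds x hi]
  · rw [hclaim _ le_rfl, eval_mle_layerPoint]

end LayeredCircuit

/-- The honest prover is always accepted, and its claimed output is the output of the circuit on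
`K`-valued inputs, which is that of `F`-valued ones. -/
theorem complete {n : ℕ} {F K : Type*} [Field F] [Field K] [Algebra F K] (C : LayeredCircuit n)
    (Ω : Finset K) (σ : List (Fin n × F)) : Complete C Ω σ := by
  intro ρ
  rw [protocolOut, LayeredCircuit.output, if_pos (C.accepts_honestProver _ _),
    LayeredCircuit.honestProver_zero, answer_eq]

end GKR

namespace GKR

/-! ### Subroutines of the prover -/

-- blocks of commands are executed symbolically by the simplifier
attribute [simp] Oks runs costs Cmd.Ok Cmd.run Cmd.cost

/-- `W` is a bound for the indices of the entries in use. -/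
def Env.Bd {K : Type*} (E : Env K) (W : ℕ) : Prop := 16 * (W + 1) ≤ E.B ∧ 16 * (W + 1) ≤ E.M

theorem Env.Bd.idx {K : Type*} {E : Env K} {W k : ℕ} (h : E.Bd W) (hk : k ≤ W) : E.Idx k := by
  obtain ⟨h1, h2⟩ := h
  constructor <;> omega

open IVar in
/-- Fills the array `X` with a binary tree: entry `1` is the root with value `c`, the children of
entry `h` are `2 * h` and `2 * h + 1`, and the leaf `2 ^ m + j` receives `c` times the indicator
of the label `j`, evaluated at the point stored in `Y` from index `idx` on; `m` is the value of
`len`. -/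
def eqTable (X Y : Arr) (c : FExp) : Code :=
  .block [.fstore X 1 c, .iset pow 1] ;;
  .forTo k len (
    .forTo y pow (.block [
      .fstore X (2 * (pow + y) + 1) (.load X (pow + y) * .load Y (idx + (len - 1 - k))),
      .fstore X (2 * (pow + y)) (.load X (pow + y) - .load X (2 * (pow + y) + 1))]) ;;
    .block [.iset pow (2 * pow)])

variable {K : Type*} [Field K] {E : Env K} {a : Store K}

theorem sum_two_pow_le (c d m : ℕ) :
    ∑ k ∈ Finset.range m, (c * 2 ^ k + d) ≤ (c + d) * 2 ^ m := by
  induction m with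
  | zero => simp
  | succ m ih =>
    rw [Finset.sum_range_succ, pow_succ]
    have : d * 1 ≤ d * 2 ^ m := Nat.mul_le_mul_left _ Nat.one_le_two_pow
    nlinarith

/-- The number of steps is proportional to the number of leaves, because the levels of the tree grow
geometrically. The numerical constants in this bound and in all later ones are round numbers with
plenty of slack. -/
theorem eqTable_spec {X Y : Arr} (hXY : Y ≠ X) {c : FExp} {W o mv : ℕ}
    (hW : E.Bd W) (h1 : 2 * 2 ^ mv ≤ W) (h2 : o + mv ≤ W)
    (hoff : a.int .idx = o) (hm : a.int .len = mv) (hc : c.Ok E a) :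
    Tr E (eqTable X Y c) a fun t a' => t ≤ c.cost + 300 * 2 ^ mv ∧
      Frame [.k, .y, .pow] [] [X] [] a a' ∧
      ∀ j < 2 ^ mv, a'.arr X (2 ^ mv + j) = c.eval a * chiE mv j fun i => a.arr Y (o + i) := by
  obtain ⟨hB, hM⟩ := hW
  have hmv : mv < 2 ^ mv := Nat.lt_two_pow_self
  refine Tr.withFrame [.k, .y, .pow] [] [X] []
    (by simp [eqTable, Code.forTo, Code.within, Cmd.within]) (Tr.seq (Tr.block ?_ ?_))
  · simp [hc, Env.Idx]; omega
  refine Tr.forTo [.k, .y, .pow] [] [X] [] mv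
    (fun κ => 130 * 2 ^ κ + 40)
    (fun κ a' => a'.int .pow = 2 ^ κ ∧
      ∀ j < 2 ^ κ, a'.arr X (2 ^ κ + j) = c.eval a * chiE κ j fun i => a.arr Y (o + (mv - κ + i)))
    (by simp [Code.forTo, Code.within, Cmd.within]) (by simp) (by omega) (by omega) ?_ ?_ ?_ ?_
  · simp
  · intro κ a' _ _ hF _
    simp [hF.int, hm]
  · rintro κ a' hκ hka hF ⟨hp, hI⟩
    have hpow : 2 ^ (κ + 1) ≤ 2 ^ mv := Nat.pow_le_pow_right (by norm_num) hκ
    rw [pow_succ] at hpow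
    refine Tr.seq (Tr.forTo [.y] [] [X] [] (2 ^ κ) (fun _ => 100)
      (fun υ a'' => (∀ j < 2 ^ κ, a''.arr X (2 ^ κ + j) = a'.arr X (2 ^ κ + j)) ∧
        ∀ j < 2 * υ, a''.arr X (2 ^ (κ + 1) + j) =
          c.eval a * chiE (κ + 1) j fun i => a.arr Y (o + (mv - (κ + 1) + i)))
      (by simp [Code.within, Cmd.within]) (by simp) (by omega) (by omega) ?_ ?_ ?_ ?_)
    · simp
    · intro υ a'' _ _ hF' _
      simp [hF'.int, hp]
    · rintro υ a'' hυ hya hF' ⟨hJ1, hJ2⟩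
      have hYw : a''.arr Y = a.arr Y := by
        rw [hF'.arr _ (by simpa using hXY), hF.arr _ (by simpa using hXY)]; simp [hXY]
      refine Tr.block ?_ ?_
      · simp [hya, hF'.int, hF.int, hp, hka, hoff, hm, Env.Idx]
        omega
      · have e1 : ∀ j, j < 2 ^ κ → 2 ^ κ + j ≠ 2 * (2 ^ κ + υ) := fun j hj => by omega
        have e2 : ∀ j, j < 2 ^ κ → 2 ^ κ + j ≠ 2 * (2 ^ κ + υ) + 1 := fun j hj => by omega
        have e3 : 2 ^ κ + υ ≠ 2 * (2 ^ κ + υ) + 1 := by omega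
        have e4 : o + (mv - (κ + 1)) = o + (mv - 1 - κ) := by omega
        simp [hya, hF'.int, hF.int, hp, hka, hoff, hm, hYw]
        refine ⟨fun j hj => ?_, fun j hj => ?_⟩
        · rw [Function.update_of_ne (e1 j hj), Function.update_of_ne (e2 j hj), hJ1 j hj]
        · have hυ' := (hJ1 υ hυ).trans (hI υ hυ)
          have hq : (fun i => a.arr Y (o + (mv - κ + i))) =
              fun i => a.arr Y (o + (mv - (κ + 1) + (i + 1))) := by
            funext i; congr 1; omega
          rw [hq] at hυ'
          rcases (by omega : j < 2 * υ ∨ j = 2 * υ ∨ j = 2 * υ + 1) with h | rfl | rfl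
          · rw [Function.update_of_ne (by rw [pow_succ]; omega),
              Function.update_of_ne (by rw [pow_succ]; omega), hJ2 j h]
          · rw [show 2 ^ (κ + 1) + 2 * υ = 2 * (2 ^ κ + υ) by rw [pow_succ]; ring,
              Function.update_self, Function.update_of_ne e3, hυ', chiE_two_mul, add_zero, e4]
            ring
          · rw [show 2 ^ (κ + 1) + (2 * υ + 1) = 2 * (2 ^ κ + υ) + 1 by rw [pow_succ]; ring,
              Function.update_of_ne (by omega), Function.update_self, hυ', chiE_two_mul_add_one,
              add_zero, e4]
            ring
    · intro t a'' hya hF' hI' ht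
      refine Tr.block ?_ ?_
      · simp [hF'.int, hp]; omega
      · simp at ht
        simp [hF'.int, hp, hka]
        exact ⟨by omega, by rw [pow_succ]; ring,
          fun j hj => hI'.2 j (by rw [pow_succ] at hj; omega)⟩
  · rintro t a' hka hF ⟨hp, hI⟩ ht hF'
    have hsum := sum_two_pow_le 130 52 mv
    simp [add_assoc] at ht hI ⊢
    exact ⟨by omega, hF', hI⟩

theorem sum_two_pow_reflect_le (c d m : ℕ) :
    ∑ k ∈ Finset.range m, (c * 2 ^ (m - (k + 1)) + d) ≤ (c + d) * 2 ^ m := by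
  refine le_trans (le_of_eq ?_) (sum_two_pow_le c d m)
  rw [← Finset.sum_range_reflect]
  refine Finset.sum_congr rfl fun k hk => ?_
  have := Finset.mem_range.1 hk
  congr 3; omega

/-- The conversation in which the messages `L` are sent, each followed by a challenge; the first
challenge is number `k`. -/
def conv {K : Type*} (r : ℕ → K) : ℕ → List (List K) → List (Event K)
  | _, [] => []
  | k, m :: L => m.map Event.send ++ Event.recv (r k) :: conv r (k + 1) L

theorem conv_append {K : Type*} (r : ℕ → K) (k : ℕ) (L L' : List (List K)) :
    conv r k (L ++ L') = conv r k L ++ conv r (k + L.length) L' := by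
  induction L generalizing k with
  | nil => simp [conv]
  | cons m L ih => simp [conv, ih, add_assoc, add_comm 1]

theorem numReceived_append {K : Type*} (l l' : List (Event K)) :
    numReceived (l ++ l') = numReceived l + numReceived l' := by
  simp [numReceived]

@[simp] theorem numReceived_map_send {K : Type*} (l : List K) :
    numReceived (l.map Event.send) = 0 := by
  simp [numReceived, List.countP_eq_zero]

@[simp] theorem numReceived_nil {K : Type*} : numReceived ([] : List (Event K)) = 0 := rfl

@[simp] theorem numReceived_send_cons {K : Type*} (w : K) (l : List (Event K)) :
    numReceived (.send w :: l) = numReceived l := by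
  simp [numReceived]

@[simp] theorem numReceived_recv_cons {K : Type*} (w : K) (l : List (Event K)) :
    numReceived (.recv w :: l) = numReceived l + 1 := by
  simp [numReceived]

theorem numReceived_conv {K : Type*} (r : ℕ → K) (k : ℕ) (L : List (List K)) :
    numReceived (conv r k L) = L.length := by
  induction L generalizing k with
  | nil => rfl
  | cons m L ih => simp [conv, numReceived_append, ih]

open IVar FVar in
/-- One round of the sum-check for `A * B + C`. Before round `k` the tables with the first `k`
variables fixed form a level of the trees. The coefficients of the round polynomial are sums over
the pairs of siblings; after the challenge has been received, the folded tables are written to the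
level above. -/
def sumcheckRound : Code :=
  .block [.iset pow (pow / 2), .fset c0 0, .fset c1 0, .fset c2 0] ;;
  .forTo y pow (.block [
    .iset ptr (2 * (pow + y)),
    .fset c0 (c0 + (.load .A ptr * .load .B ptr + .load .C ptr)),
    .fset c1 (c1 + (.load .A ptr * (.load .B (ptr + 1) - .load .B ptr) +
      (.load .A (ptr + 1) - .load .A ptr) * .load .B ptr +
      (.load .C (ptr + 1) - .load .C ptr))),
    .fset c2 (c2 + (.load .A (ptr + 1) - .load .A ptr) * (.load .B (ptr + 1) - .load .B ptr))]) ;;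
  .block [.send c0, .send c1, .send c2, .recv rho, .fstore .R (idx + k) rho] ;;
  .forTo y pow (.block [
    .iset ptr (2 * (pow + y)),
    .fstore .A (pow + y) (.load .A ptr + rho * (.load .A (ptr + 1) - .load .A ptr)),
    .fstore .B (pow + y) (.load .B ptr + rho * (.load .B (ptr + 1) - .load .B ptr)),
    .fstore .C (pow + y) (.load .C ptr + rho * (.load .C (ptr + 1) - .load .C ptr))])

open IVar in
/-- The sum-check for `A * B + C` in `len` variables, where `A`, `B` and `C` are given by the
leaves of binary trees; `pow` is the number of leaves. The challenges are stored in `R` from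
index `idx` on. -/
def sumcheck : Code := .forTo k len sumcheckRound

theorem sumcheckRound_spec {W m κ o q : ℕ} {r : ℕ → K} {fA fB fC : ℕ → K}
    (hpeer : E.peer = challengePeer r) (hW : E.Bd W) (h1 : 2 * 2 ^ m ≤ W) (h2 : o + m ≤ W)
    (hκ : κ < m) (hk : a.int .k = κ) (hidx : a.int .idx = o) (hpow : a.int .pow = 2 ^ (m - κ))
    (hA : ∀ j < 2 ^ (m - κ), a.arr .A (2 ^ (m - κ) + j) = tab (fun i => r (q + i)) fA κ j)
    (hB : ∀ j < 2 ^ (m - κ), a.arr .B (2 ^ (m - κ) + j) = tab (fun i => r (q + i)) fB κ j)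
    (hC : ∀ j < 2 ^ (m - κ), a.arr .C (2 ^ (m - κ) + j) = tab (fun i => r (q + i)) fC κ j)
    (hq : numReceived a.trace = q + κ) :
    Tr E sumcheckRound a fun t a' => t ≤ 500 * 2 ^ (m - (κ + 1)) + 200 ∧
      Frame [.y, .pow, .ptr] [.c0, .c1, .c2, .rho] [.A, .B, .C, .R] [.stream, .trace] a a' ∧
      a'.int .pow = 2 ^ (m - (κ + 1)) ∧
      (∀ j < 2 ^ (m - (κ + 1)),
        a'.arr .A (2 ^ (m - (κ + 1)) + j) = tab (fun i => r (q + i)) fA (κ + 1) j) ∧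
      (∀ j < 2 ^ (m - (κ + 1)),
        a'.arr .B (2 ^ (m - (κ + 1)) + j) = tab (fun i => r (q + i)) fB (κ + 1) j) ∧
      (∀ j < 2 ^ (m - (κ + 1)),
        a'.arr .C (2 ^ (m - (κ + 1)) + j) = tab (fun i => r (q + i)) fC (κ + 1) j) ∧
      (∀ j, 2 ^ (m - κ) ≤ j → a'.arr .B j = a.arr .B j) ∧
      a'.arr .R = Function.update (a.arr .R) (o + κ) (r (q + κ)) ∧
      a'.trace = a.trace ++ (((List.range 3).map (scCoeff fA fB fC m (fun i => r (q + i)) κ)).map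
        Event.send ++ [.recv (r (q + κ))]) := by
  obtain ⟨hWB, hWM⟩ := hW
  have hmv : m < 2 ^ m := Nat.lt_two_pow_self
  obtain ⟨c, rfl⟩ : ∃ c, m = κ + 1 + c := ⟨m - (κ + 1), by omega⟩
  have e1 : κ + 1 + c - κ = c + 1 := by omega
  have e2 : κ + 1 + c - (κ + 1) = c := by omega
  simp only [e1, e2] at *
  have hP : 2 ^ (c + 1) = 2 * 2 ^ c := pow_succ' 2 c
  have hP' : 2 ^ (c + 1) ≤ 2 ^ (κ + 1 + c) := Nat.pow_le_pow_right (by norm_num) (by omega)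
  simp only [hP] at hpow hA hB hC hP' ⊢
  set s : ℕ → K := fun i => r (q + i) with hs
  have hEq : ∀ {X : Arr} {f : ℕ → K},
      (∀ j < 2 * 2 ^ c, a.arr X (2 * 2 ^ c + j) = tab s f κ j) → ∀ j < 2 ^ c,
      a.arr X (2 * (2 ^ c + j)) = tab s f κ (2 * j) ∧
      a.arr X (2 * (2 ^ c + j) + 1) = tab s f κ (2 * j + 1) := by
    intro X f h j hj
    rw [← h _ (by omega), ← h _ (by omega)]
    exact ⟨by congr 1; ring, by congr 1; ring⟩
  refine Tr.withFrame [.y, .pow, .ptr] [.c0, .c1, .c2, .rho] [.A, .B, .C, .R] [.stream, .trace]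
    (by simp [sumcheckRound, Code.forTo, Code.within, Cmd.within]) (Tr.seq (Tr.block ?_ ?_))
  · simp; omega
  refine Tr.seq (Tr.forTo [.y, .ptr] [.c0, .c1, .c2] [] [] (2 ^ c) (fun _ => 200)
    (fun υ a' => a'.fld .c0 = ∑ y ∈ Finset.range υ,
        (tab s fA κ (2 * y) * tab s fB κ (2 * y) + tab s fC κ (2 * y)) ∧
      a'.fld .c1 = ∑ y ∈ Finset.range υ,
        (tab s fA κ (2 * y) * (tab s fB κ (2 * y + 1) - tab s fB κ (2 * y)) +
          (tab s fA κ (2 * y + 1) - tab s fA κ (2 * y)) * tab s fB κ (2 * y) +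
          (tab s fC κ (2 * y + 1) - tab s fC κ (2 * y))) ∧
      a'.fld .c2 = ∑ y ∈ Finset.range υ, (tab s fA κ (2 * y + 1) - tab s fA κ (2 * y)) *
        (tab s fB κ (2 * y + 1) - tab s fB κ (2 * y)))
    (by simp [Code.within, Cmd.within]) (by simp) (by omega) (by omega) ?_ ?_ ?_ ?_)
  · simp
  · intro υ a' _ _ hF _
    simp [hF.int, hpow]
  · rintro υ a' hυ hy hF ⟨i0, i1, i2⟩
    refine Tr.block ?_ ?_
    · simp [hy, hF.int, hpow, Env.Idx]; omega
    · simp [hy, hF.int, hF.arr, hpow, hEq hA υ hυ, hEq hB υ hυ, hEq hC υ hυ, i0, i1, i2,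
        Finset.sum_range_succ]
  rintro t a' hy hF ⟨i0, i1, i2⟩ ht
  refine Tr.seq (Tr.block ?_ ?_)
  · simp [hF.int, hidx, hk, Env.Idx]; omega
  have htr : numReceived (a'.trace ++ [Event.send (a'.fld .c0), .send (a'.fld .c1),
      .send (a'.fld .c2)]) = q + κ := by
    rw [numReceived_append, hF.trace (by simp)]; simp [hq]
  refine Tr.forTo [.y, .ptr] [] [.A, .B, .C] [] (2 ^ c) (fun _ => 200)
    (fun υ a'' => (∀ j < υ, a''.arr .A (2 ^ c + j) = tab s fA (κ + 1) j) ∧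
      (∀ j < υ, a''.arr .B (2 ^ c + j) = tab s fB (κ + 1) j) ∧
      (∀ j < υ, a''.arr .C (2 ^ c + j) = tab s fC (κ + 1) j) ∧
      (∀ j, 2 * 2 ^ c ≤ j → a''.arr .A j = a.arr .A j) ∧
      (∀ j, 2 * 2 ^ c ≤ j → a''.arr .B j = a.arr .B j) ∧
      (∀ j, 2 * 2 ^ c ≤ j → a''.arr .C j = a.arr .C j))
    (by simp [Code.within, Cmd.within]) (by simp) (by omega) (by omega) ?_ ?_ ?_ ?_
  · simp [hF.arr]
  · intro υ a'' _ _ hF' _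
    simp [hF'.int, hF.int, hpow]
  · rintro υ a'' hυ hy' hF' ⟨j1, j2, j3, j4, j5, j6⟩
    have hrho : a''.fld .rho = s κ := by
      rw [hF'.fld _ (by simp)]
      simp [hpeer, challengePeer, htr, hs]
    have n1 : ∀ j, j < υ + 1 → j ≠ υ → j < υ := fun j h h' => by omega
    have n2 : ∀ j, 2 * 2 ^ c ≤ j → j ≠ 2 ^ c + υ := fun j h => by omega
    have n3 : 2 * 2 ^ c ≤ 2 * (2 ^ c + υ) := by omega
    have n4 : 2 * 2 ^ c ≤ 2 * (2 ^ c + υ) + 1 := by omega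
    have n5 : 2 * (2 ^ c + υ) ≠ 2 ^ c + υ := by omega
    have n6 : 2 * (2 ^ c + υ) + 1 ≠ 2 ^ c + υ := by omega
    refine Tr.block ?_ ?_
    · simp [hy', hF'.int, hF.int, hpow, Env.Idx]; omega
    · simp [hy', hF'.int, hF.int, hpow, hrho, j4 _ n3, j5 _ n3, j6 _ n3, j4 _ n4, j5 _ n4, j6 _ n4,
        hEq hA υ hυ, hEq hB υ hυ, hEq hC υ hυ, Function.update_apply]
      refine ⟨fun j hj => ?_, fun j hj => ?_, fun j hj => ?_, fun j hj => ?_, fun j hj => ?_,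
        fun j hj => ?_⟩
      · split_ifs with h
        · subst h; rfl
        · exact j1 j (n1 j (by omega) h)
      · split_ifs with h
        · subst h; rfl
        · exact j2 j (n1 j (by omega) h)
      · split_ifs with h
        · subst h; rfl
        · exact j3 j (n1 j (by omega) h)
      · rw [if_neg (n2 j hj), j4 j hj]
      · rw [if_neg (n2 j hj), j5 j hj]
      · rw [if_neg (n2 j hj), j6 j hj]
  · rintro t' a'' hy' hF' ⟨j1, j2, j3, j4, j5, j6⟩ ht' hF''
    simp at ht ht'
    refine ⟨?_, hF'', ?_, j1, j2, j3, j5, ?_, ?_⟩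
    · simp; omega
    · simp [hF'.int, hF.int, hpow]
    · rw [hF'.arr _ (by simp)]
      simp [hF.int, hF.arr, hidx, hk, hpeer, challengePeer, htr]
    · rw [hF'.trace (by simp)]
      simp [hpeer, challengePeer, numReceived_append, hq, hF.trace, List.range_succ,
        scCoeff, i0, i1, i2]

end GKR

namespace GKR

variable {K : Type*} [Field K] {E : Env K} {a : Store K}

/-- The rounds take a number of steps that is linear in the size of the tables, because the tables
are halved in every round. The leaves of `B` survive, because the folded tables are written to the
nodes above them. -/
theorem sumcheck_spec {W m o q : ℕ} {r : ℕ → K} {fA fB fC : ℕ → K}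
    (hpeer : E.peer = challengePeer r) (hW : E.Bd W) (h1 : 2 * 2 ^ m ≤ W) (h2 : o + m ≤ W)
    (hlen : a.int .len = m) (hidx : a.int .idx = o) (hpow : a.int .pow = 2 ^ m)
    (hA : ∀ j < 2 ^ m, a.arr .A (2 ^ m + j) = fA j)
    (hB : ∀ j < 2 ^ m, a.arr .B (2 ^ m + j) = fB j)
    (hC : ∀ j < 2 ^ m, a.arr .C (2 ^ m + j) = fC j)
    (hq : numReceived a.trace = q) :
    Tr E sumcheck a fun t a' => t ≤ 800 * 2 ^ m ∧
      Frame [.k, .y, .pow, .ptr] [.c0, .c1, .c2, .rho] [.A, .B, .C, .R] [.stream, .trace] a a' ∧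
      a'.arr .A 1 = mleE m fA (fun i => r (q + i)) ∧
      a'.arr .B 1 = mleE m fB (fun i => r (q + i)) ∧
      (∀ j < 2 ^ m, a'.arr .B (2 ^ m + j) = fB j) ∧
      (∀ k < m, a'.arr .R (o + k) = r (q + k)) ∧
      (∀ k, (k < o ∨ o + m ≤ k) → a'.arr .R k = a.arr .R k) ∧
      numReceived a'.trace = q + m ∧
      a'.trace = a.trace ++ conv r q ((List.range m).map fun κ =>
        (List.range 3).map (scCoeff fA fB fC m (fun i => r (q + i)) κ)) := by
  have hmv : m < 2 ^ m := Nat.lt_two_pow_self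
  refine Tr.forTo [.k, .y, .pow, .ptr] [.c0, .c1, .c2, .rho] [.A, .B, .C, .R] [.stream, .trace] m
    (fun κ => 500 * 2 ^ (m - (κ + 1)) + 200)
    (fun κ a' => a'.int .pow = 2 ^ (m - κ) ∧
      (∀ j < 2 ^ (m - κ), a'.arr .A (2 ^ (m - κ) + j) = tab (fun i => r (q + i)) fA κ j) ∧
      (∀ j < 2 ^ (m - κ), a'.arr .B (2 ^ (m - κ) + j) = tab (fun i => r (q + i)) fB κ j) ∧
      (∀ j < 2 ^ (m - κ), a'.arr .C (2 ^ (m - κ) + j) = tab (fun i => r (q + i)) fC κ j) ∧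
      (κ ≠ 0 → ∀ j < 2 ^ m, a'.arr .B (2 ^ m + j) = fB j) ∧
      (∀ k < κ, a'.arr .R (o + k) = r (q + k)) ∧
      (∀ k, (k < o ∨ o + κ ≤ k) → a'.arr .R k = a.arr .R k) ∧
      a'.trace = a.trace ++ conv r q ((List.range κ).map fun κ =>
        (List.range 3).map (scCoeff fA fB fC m (fun i => r (q + i)) κ)))
    (by simp [sumcheckRound, Code.forTo, Code.within, Cmd.within]) (by simp)
    (by have := hW.1; omega) (by have := hW.1; omega) ?_ ?_ ?_ ?_
  · simp [hpow, conv, tab]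
    exact ⟨hA, hB, hC⟩
  · intro κ a' _ _ hF _
    simp [hF.int, hlen]
  · rintro κ a' hκ hk hF ⟨hp, iA, iB, iC, iL, iR, iR', iT⟩
    have hn : numReceived a'.trace = q + κ := by
      rw [iT, numReceived_append, numReceived_conv, hq]; simp
    refine (sumcheckRound_spec hpeer hW h1 h2 hκ hk (by simp [hF.int, hidx]) hp iA iB iC hn).mono ?_
    rintro t a'' ⟨ht, hF', hp', jA, jB, jC, jL, jR, jT⟩
    refine ⟨ht, by simp [hF'.int, hk], by simpa using hp', jA, jB, jC, fun _ j hj => ?_,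
      fun k hk' => ?_, fun k hk' => ?_, ?_⟩
    · have : (2 : ℕ) ^ (m - κ) ≤ 2 ^ m := Nat.pow_le_pow_right (by norm_num) (by omega)
      simp only
      rw [jL _ (by omega)]
      by_cases h : κ = 0
      · subst h; simpa [tab] using iB j (by simpa using hj)
      · exact iL h j hj
    · simp only [jR, Function.update_apply]
      split_ifs with h
      · congr 2; omega
      · exact iR k (by omega)
    · simp only [jR]
      rw [Function.update_of_ne (by omega), iR' k (by omega)]
    · simp only [jT, iT]
      rw [List.range_succ (n := κ), List.map_append, conv_append]
      simp [conv]
  · rintro t a' hk hF ⟨hp, iA, iB, iC, iL, iR, iR', iT⟩ ht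
    have hsum := sum_two_pow_reflect_le 500 212 m
    simp [add_assoc] at ht hsum iA iB
    have h0 : 1 ≤ 2 ^ m := Nat.one_le_two_pow
    refine ⟨by omega, hF, ?_, ?_, ?_, iR, iR', ?_, iT⟩
    · rw [mleE_eq_tab, iA]
    · rw [mleE_eq_tab, iB]
    · by_cases h : m = 0
      · subst h; intro j hj; obtain rfl : j = 0 := by simpa using hj
        simpa [tab] using iB
      · exact iL h
    · rw [iT, numReceived_append, numReceived_conv, hq]; simp

/-- Computes the number of bits that a label below `w` needs, and the corresponding power
of two. -/
def logCode (b p w : IVar) : Code :=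
  .block [.iset b 0, .iset p 1] ;; .loop (w - p) (.block [.iset p (2 * p), .iset b (b + 1)])

theorem logCode_spec {b p w : IVar} (hbp : b ≠ p) (hwp : w ≠ p) (hwb : w ≠ b) {w0 : ℕ}
    (hw : a.int w = w0) (hB : 2 * w0 + 2 ≤ E.B) :
    Tr E (logCode b p w) a fun t a' => t ≤ 60 * 2 ^ Nat.clog 2 w0 ∧ Frame [b, p] [] [] [] a a' ∧
      a'.int b = Nat.clog 2 w0 ∧ a'.int p = 2 ^ Nat.clog 2 w0 := by
  refine Tr.withFrame [b, p] [] [] [] (by simp [logCode, Code.within, Cmd.within])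
    (Tr.seq (Tr.block (by simp; omega) ?_))
  set L := Nat.clog 2 w0 with hL
  have key : ∀ m k t (a' : Store K), k + m = L → t ≤ 30 * k + 10 → a'.int w = w0 →
      a'.int b = k → a'.int p = 2 ^ k →
      Tr E (.loop (w - p) (.block [.iset p (2 * p), .iset b (b + 1)])) a' fun t' a'' =>
        t + t' ≤ 30 * L + 20 ∧ a''.int b = L ∧ a''.int p = 2 ^ L := by
    intro m
    induction m with
    | zero =>
      rintro k t a' hk ht hw hb hp
      have : w0 ≤ 2 ^ L := Nat.le_pow_clog (by norm_num) _
      obtain rfl : k = L := by omega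
      exact Tr.loop_false (by simp) (by simp [hw, hp]; omega) ⟨by simp; omega, hb, hp⟩
    | succ m ih =>
      rintro k t a' hk ht hw hb hp
      have hlt : 2 ^ k < w0 := (Nat.lt_clog_iff_pow_lt (by norm_num)).1 (by omega)
      have hk2 : k < 2 ^ k := Nat.lt_two_pow_self
      refine Tr.loop_true (by simp) (by simp [hw, hp]; omega) (Tr.block ?_ ?_)
      · simp [hp, hb, hbp]; omega
      · refine (ih (k + 1) (t + 20) _ (by omega) (by omega) ?_ ?_ ?_).mono ?_
        · simp [hwp, hwb, hw]
        · simp [hbp, hb]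
        · simp [hbp.symm, hp, pow_succ']
        · rintro t' a'' ⟨h1, h2⟩
          refine ⟨?_, h2⟩
          simp; omega
  refine (key L 0 10 _ (by omega) (by omega) ?_ ?_ ?_).mono ?_
  · simp [hw, hwp, hwb]
  · simp [hbp]
  · simp
  · rintro t a' ⟨h1, h2⟩ hF
    have : L < 2 ^ L := Nat.lt_two_pow_self
    refine ⟨?_, hF, h2⟩
    simp; omega

open IVar in
/-- Prepares the leaves for a sum-check: the `wd` values from index `bs` on, followed by zeros,
become the `sz` leaves of `B`, and the leaves of `A` and `C` are set to zero. The difference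
`wd - x` is truncated, and not zero exactly as long as `x < wd`. -/
def fill (sz bs wd : IVar) : Code :=
  .forTo x sz (.block [.fstore .A (sz + x) 0, .fstore .C (sz + x) 0] ;;
    .ite (wd - x) (.block [.fstore .B (sz + x) (.load .val (bs + x))])
      (.block [.fstore .B (sz + x) 0]))

theorem fill_spec {sz bs wd : IVar} (hs : sz ≠ .x) (hb : bs ≠ .x) (hw : wd ≠ .x) {W s b w : ℕ}
    (hW : E.Bd W) (h1 : 2 * s ≤ W) (h2 : b + s ≤ W) (hsz : a.int sz = s) (hbs : a.int bs = b)
    (hwd : a.int wd = w) :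
    Tr E (fill sz bs wd) a fun t a' => t ≤ 100 * s + 20 ∧ Frame [.x] [] [.A, .B, .C] [] a a' ∧
      (∀ j < s, a'.arr .A (s + j) = 0) ∧ (∀ j < s, a'.arr .C (s + j) = 0) ∧
      ∀ j < s, a'.arr .B (s + j) = if j < w then a.arr .val (b + j) else 0 := by
  obtain ⟨hWB, hWM⟩ := hW
  refine Tr.forTo [.x] [] [.A, .B, .C] [] s (fun _ => 85)
    (fun κ a' => (∀ j < κ, a'.arr .A (s + j) = 0) ∧ (∀ j < κ, a'.arr .C (s + j) = 0) ∧
      ∀ j < κ, a'.arr .B (s + j) = if j < w then a.arr .val (b + j) else 0)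
    (by simp [Code.within, Cmd.within]) (by simp) (by omega) (by omega) ?_ ?_ ?_ ?_
  · simp
  · intro κ a' _ _ hF _
    simp [hF.int, hs, hsz]
  · rintro κ a' hκ hk hF ⟨iA, iC, iB⟩
    have n1 : ∀ j, j ≤ κ → j ≠ κ → j < κ := fun j h h' => by omega
    refine Tr.seq (Tr.block ?_ (Tr.ite ?_ (fun h => Tr.block ?_ ?_) fun h => Tr.block ?_ ?_))
    · simp [hF.int, hs, hsz, hk, Env.Idx]; omega
    · simp
    · simp [hF.int, hs, hsz, hb, hbs, hk, Env.Idx]; omega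
    · simp [hF.int, hw, hwd, hk] at h
      simp [hF.int, hF.arr, hs, hsz, hb, hbs, hk, Function.update_apply]
      refine ⟨fun j hj hne => iA j (n1 j (by omega) hne), fun j hj hne => iC j (n1 j (by omega) hne),
        fun j hj => ?_⟩
      split_ifs with h3 h4 h5
      · rw [h3]
      · omega
      · rw [iB j (n1 j (by omega) h3), if_pos h5]
      · rw [iB j (n1 j (by omega) h3), if_neg h5]
    · simp [hF.int, hs, hsz, hk, Env.Idx]; omega
    · simp [hF.int, hw, hwd, hk] at h
      simp [hF.int, hs, hsz, hk, Function.update_apply]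
      refine ⟨fun j hj hne => iA j (n1 j (by omega) hne), fun j hj hne => iC j (n1 j (by omega) hne),
        fun j hj => ?_⟩
      split_ifs with h3 h4 h5
      · omega
      · rfl
      · rw [iB j (n1 j (by omega) h3), if_pos h5]
      · rw [iB j (n1 j (by omega) h3), if_neg h5]
  · rintro t a' hk hF ⟨iA, iC, iB⟩ ht
    simp at ht
    exact ⟨by omega, hF, iA, iC, iB⟩

open IVar FVar in
/-- Computes the tables `gatherMul` and `gatherAdd` in `A` and `C`: every gate adds its weight `w`,
or its weight times the value `s`, to the entries for the gate that is named by `tgt`. -/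
def gather (tgt : IVar) (w s : FExp) : Code :=
  .forTo j width (
    .block [.iset ptr (depth + 2 + 3 * (base + j)), .iset kind (.load ptr),
      .iset lft (.load (ptr + 1)), .iset rgt (.load (ptr + 2)), .fset wt w, .fset .chi s] ;;
    .ite kind
      (.block [.fstore .A (size' + tgt) (.load .A (size' + tgt) + wt * FVar.chi)])
      (.block [.fstore .A (size' + tgt) (.load .A (size' + tgt) + wt),
        .fstore .C (size' + tgt) (.load .C (size' + tgt) + wt * FVar.chi)]))

/-- The integer memory holds the description of the gates of layer `i`, and the registers hold
the data that are needed to find it. -/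
structure GateMem {n : ℕ} (C : LayeredCircuit n) (i : ℕ) (a : Store K) : Prop where
  depth : a.int .depth = C.depth
  width : a.int .width = C.width i
  base : a.int .base = ∑ i' ∈ Finset.range i, C.width i'
  kind : ∀ j < C.width i, a.imem (C.depth + 2 + 3 * (∑ i' ∈ Finset.range i, C.width i' + j)) =
    (C.isMul i j).toNat
  lft : ∀ j < C.width i, a.imem (C.depth + 2 + 3 * (∑ i' ∈ Finset.range i, C.width i' + j) + 1) =
    C.left i j
  rgt : ∀ j < C.width i, a.imem (C.depth + 2 + 3 * (∑ i' ∈ Finset.range i, C.width i' + j) + 2) =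
    C.right i j

theorem gather_spec {n : ℕ} {C : LayeredCircuit n} {i W s : ℕ} {tgt : IVar}
    {f : ℕ → ℕ} {w' s' : FExp} {fw fs : ℕ → K}
    (htgt : tgt = .lft ∧ f = C.left i ∨ tgt = .rgt ∧ f = C.right i)
    (hW : E.Bd W) (h1 : 2 * s ≤ W)
    (h2 : C.depth + 2 + 3 * (∑ i' ∈ Finset.range i, C.width i' + C.width i) ≤ W)
    (hf : ∀ j < C.width i, f j < s) (hG : GateMem C i a) (hs : a.int .size' = s)
    (hA : ∀ j < s, a.arr .A (s + j) = 0) (hC : ∀ j < s, a.arr .C (s + j) = 0)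
    (hcw : w'.cost ≤ 50) (hcs : s'.cost ≤ 50)
    (hw : ∀ j a', j < C.width i → Frame [.j, .ptr, .kind, .lft, .rgt] [.wt, .chi] [.A, .C] [] a a' →
      a'.int .j = j → a'.int .lft = C.left i j → a'.int .rgt = C.right i j →
      w'.Ok E a' ∧ w'.eval a' = fw j ∧ s'.Ok E a' ∧ s'.eval a' = fs j) :
    Tr E (gather tgt w' s') a fun t a' => t ≤ 400 * C.width i + 20 ∧
      Frame [.j, .ptr, .kind, .lft, .rgt] [.wt, .chi] [.A, .C] [] a a' ∧
      (∀ l < s, a'.arr .A (s + l) = C.gatherMul i f fw fs l) ∧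
      (∀ l < s, a'.arr .C (s + l) = C.gatherAdd i f fw fs l) := by
  have hW' := hW
  obtain ⟨hWB, hWM⟩ := hW'
  refine Tr.forTo [.j, .ptr, .kind, .lft, .rgt] [.wt, .chi] [.A, .C] [] (C.width i) (fun _ => 350)
    (fun κ a' => (∀ l < s, a'.arr .A (s + l) =
        ∑ j ∈ Finset.range κ, if f j = l then if C.isMul i j then fw j * fs j else fw j else 0) ∧
      ∀ l < s, a'.arr .C (s + l) =
        ∑ j ∈ Finset.range κ, if f j = l then if C.isMul i j then 0 else fw j * fs j else 0)
    (by simp [Code.within, Cmd.within]) (by simp) (by omega) (by omega) ?_ ?_ ?_ ?_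
  · simpa using ⟨hA, hC⟩
  · intro κ a' _ _ hF _
    simp [hF.int, hG.width]
  · rintro κ a' hκ hk hF ⟨iA, iC⟩
    have e1 : a'.imem = a.imem := hF.imem (by simp)
    -- the store after the description of the gate has been loaded
    set b0 : Store K := runs E [.iset .ptr (IVar.depth + 2 + 3 * (IVar.base + IVar.j)),
      .iset .kind (.load IVar.ptr), .iset .lft (.load (IVar.ptr + 1)),
      .iset .rgt (.load (IVar.ptr + 2))] a' with hb0
    have hF0 : Frame [.j, .ptr, .kind, .lft, .rgt] [.wt, .chi] [.A, .C] [] a b0 :=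
      hF.trans (runs_frame E _ _ (by simp [Cmd.within]))
    have b0l : b0.int .lft = C.left i κ := by
      simp [hb0, hF.int, hG.depth, hG.base, hk, e1, hG.lft κ hκ]
    have b0r : b0.int .rgt = C.right i κ := by
      simp [hb0, hF.int, hG.depth, hG.base, hk, e1, hG.rgt κ hκ]
    have b0k : b0.int .kind = (C.isMul i κ).toNat := by
      simp [hb0, hF.int, hG.depth, hG.base, hk, e1, hG.kind κ hκ]
    have b0j : b0.int .j = κ := by simp [hb0, hk]
    have b0A : b0.arr = a'.arr := by simp [hb0]
    obtain ⟨w1, w2, -, -⟩ := hw κ b0 hκ hF0 b0j b0l b0r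
    set b1 : Store K := { b0 with fld := Function.update b0.fld .wt (fw κ) } with hb1
    have hb1' : Cmd.run E (.fset .wt w') b0 = b1 := by rw [hb1, ← w2]; rfl
    have hF1 : Frame [.j, .ptr, .kind, .lft, .rgt] [.wt, .chi] [.A, .C] [] a b1 := by
      rw [← hb1']
      exact hF0.trans (Cmd.frame E _ _ (by simp [Cmd.within]))
    obtain ⟨-, -, x3, x4⟩ := hw κ b1 hκ hF1 b0j b0l b0r
    set b2 : Store K := { b1 with fld := Function.update b1.fld .chi (fs κ) } with hb2
    have hfκ := hf κ hκ
    have ht : b2.int tgt = f κ := by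
      rcases htgt with ⟨rfl, rfl⟩ | ⟨rfl, rfl⟩
      · exact b0l
      · exact b0r
    refine Tr.seq (Tr.block ?_ ?_)
    · change _ ∧ _ ∧ _ ∧ _ ∧ w'.Ok E b0 ∧ s'.Ok E (Cmd.run E (.fset .wt w') b0) ∧ True
      rw [hb1']
      simp [w1, x3, hF.int, hG.depth, hG.base, hk]; omega
    have hb2' : runs E [.iset .ptr (IVar.depth + 2 + 3 * (IVar.base + IVar.j)),
        .iset .kind (.load IVar.ptr), .iset .lft (.load (IVar.ptr + 1)),
        .iset .rgt (.load (IVar.ptr + 2)), .fset .wt w', .fset .chi s'] a' = b2 := by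
      rw [hb2, ← x4, hb1, ← w2]; rfl
    rw [hb2']
    have b2s : b2.int .size' = s := by
      change b0.int .size' = s
      rw [hF0.int _ (by simp), hs]
    have b2k : b2.int .kind = (C.isMul i κ).toNat := b0k
    have b2j : b2.int .j = κ := b0j
    have b2w : b2.fld .wt = fw κ := by simp [hb2, hb1]
    have b2c : b2.fld .chi = fs κ := by simp [hb2]
    have b2A : b2.arr = a'.arr := b0A
    clear_value b2
    have hidx : E.Idx (s + f κ) := hW.idx (by omega)
    have hidx' := hidx.1
    refine Tr.ite (by simp) (fun h => Tr.block ?_ ?_) fun h => Tr.block ?_ ?_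
    · simp [ht, b2s, hidx]; omega
    · have hm : C.isMul i κ = true := by simpa [b2k] using h
      simp [ht, b2s, b2j, b2w, b2c, b2A, iA _ hfκ, Finset.sum_range_succ, hm, Function.update_apply]
      refine ⟨by omega, fun l hl => ?_, iC⟩
      split_ifs with h3 h4 h5
      · rw [h3]
      · omega
      · omega
      · rw [iA l hl, add_zero]
    · simp [ht, b2s, hidx]; omega
    · have hm : C.isMul i κ = false := by simpa [b2k] using h
      simp [ht, b2s, b2j, b2w, b2c, b2A, iA _ hfκ, iC _ hfκ, Finset.sum_range_succ, hm,
        Function.update_apply]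
      refine ⟨by omega, fun l hl => ?_, fun l hl => ?_⟩
      · split_ifs with h3 h4 h5
        · rw [h3]
        · omega
        · omega
        · rw [iA l hl, add_zero]
      · split_ifs with h3 h4 h5
        · rw [h3]
        · omega
        · omega
        · rw [iC l hl, add_zero]
  · rintro t a' hk hF ⟨iA, iC⟩ ht
    simp at ht
    exact ⟨by omega, hF, iA, iC⟩

end GKR

namespace GKR

/-! ### Computation of the line polynomial -/

variable {K : Type*} [Field K] {E : Env K} {a : Store K}

open IVar FVar in
/-- Computes the coefficients of the restriction of a multilinear extension to a line, in a binary
tree of polynomials: the coefficients of node `h` are the entries `h * len + e` of `G`, where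
`len` is `bits' + 1`. The leaves are the constants in `B`. -/
def lineTable : Code :=
  .forTo y size' (
    .forTo e len (.block [.fstore .G ((size' + y) * len + e) 0]) ;;
    .block [.fstore .G ((size' + y) * len) (.load .B (size' + y))]) ;;
  .block [.iset pow size'] ;;
  .forTo k bits' (
    .block [.iset pow (pow / 2), .fset c0 (.load .R (bits + k)),
      .fset c1 (.load .R (bits + bits' + k) - c0)] ;;
    .forTo y pow (
      .forTo e len (
        .block [.iset ptr (2 * (pow + y) * len + e), .iset x ((pow + y) * len + e),
          .fstore .G x (.load .G ptr + c0 * (.load .G (ptr + len) - .load .G ptr))] ;;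
        .ite e
          (.block [.fstore .G x
            (.load .G x + c1 * (.load .G (ptr + len - 1) - .load .G (ptr - 1)))])
          (.block []))))

/-- Coefficient `e` of node `h` and coefficient `e'` of node `h'` have the same index only if they
are the same. -/
theorem flat_inj {l h h' e e' : ℕ} (he : e < l) (he' : e' < l) :
    h * l + e = h' * l + e' ↔ h = h' ∧ e = e' := by
  refine ⟨fun hh => ?_, by rintro ⟨rfl, rfl⟩; rfl⟩
  have h1 : h = h' := by
    have := congrArg (· / l) hh
    have hl : 0 < l := by omega
    simpa [Nat.mul_comm _ l, Nat.mul_add_div hl, Nat.div_eq_of_lt he, Nat.div_eq_of_lt he']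
      using this
  subst h1
  exact ⟨rfl, by omega⟩

theorem coeff_line_step (a b : K) (p q : Polynomial K) (e : ℕ) :
    (p + (Polynomial.C a + Polynomial.X * Polynomial.C b) * (q - p)).coeff e =
      p.coeff e + a * (q.coeff e - p.coeff e) +
        if e = 0 then 0 else b * (q.coeff (e - 1) - p.coeff (e - 1)) := by
  rw [add_mul, mul_assoc, Polynomial.coeff_add, Polynomial.coeff_add, Polynomial.coeff_C_mul]
  cases e with
  | zero => simp
  | succ e => simp [Polynomial.coeff_X_mul]; ring

open Polynomial in
/-- The polynomials of the binary tree that ends with the restriction to a line. -/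
noncomputable def lineTab (p d g : ℕ → K) (k y : ℕ) : K[X] :=
  tab (fun k => C (p k) + X * C (d k)) (fun j => C (g j)) k y

/-- All polynomials are treated as having `v + 1` coefficients; as the levels of the tree shrink
geometrically, the number of steps is still of the order of the number of coefficients at the
leaves. -/
theorem lineTable_spec {W u v : ℕ} {g : ℕ → K} (hW : E.Bd W) (h1 : 2 * 2 ^ v * (v + 1) ≤ W)
    (h2 : u + 2 * v ≤ W) (hu : a.int .bits = u) (hv : a.int .bits' = v)
    (hs : a.int .size' = 2 ^ v) (hl : a.int .len = v + 1)
    (hB : ∀ j < 2 ^ v, a.arr .B (2 ^ v + j) = g j) :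
    Tr E lineTable a fun t a' => t ≤ 1000 * (2 ^ v * (v + 1)) ∧
      Frame [.y, .e, .k, .pow, .ptr, .x] [.c0, .c1] [.G] [] a a' ∧
      ∀ e < v + 1, a'.arr .G (v + 1 + e) = (lineTab (fun k => a.arr .R (u + k))
        (fun k => a.arr .R (u + v + k) - a.arr .R (u + k)) g v 0).coeff e := by
  have hvv : v < 2 ^ v := Nat.lt_two_pow_self
  have hWW : v + 1 ≤ W ∧ 2 * 2 ^ v ≤ W := by constructor <;> nlinarith
  set p : ℕ → K := fun k => a.arr .R (u + k) with hp
  set d : ℕ → K := fun k => a.arr .R (u + v + k) - a.arr .R (u + k) with hd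
  obtain ⟨hWB, hWM⟩ := hW
  have hlt : ∀ h e, h < 2 * 2 ^ v → e < v + 1 → h * (v + 1) + e + 1 ≤ W := fun h e hh he => by
    nlinarith
  refine Tr.withFrame [.y, .e, .k, .pow, .ptr, .x] [.c0, .c1] [.G] []
    (by simp [lineTable, Code.forTo, Code.within, Cmd.within]) (Tr.seq ?_)
  -- the leaves
  refine Tr.forTo [.y, .e] [] [.G] [] (2 ^ v) (fun _ => 50 * (v + 1) + 50)
    (fun υ a' => ∀ j < υ, ∀ e < v + 1,
      a'.arr .G ((2 ^ v + j) * (v + 1) + e) = (lineTab p d g 0 j).coeff e)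
    (by simp [Code.forTo, Code.within, Cmd.within]) (by simp) (by omega) (by omega) ?_ ?_ ?_ ?_
  · simp
  · intro υ a' _ _ hF _
    simp [hF.int, hs]
  · rintro υ a' hυ hy hF hI
    refine Tr.seq (Tr.forTo [.e] [] [.G] [] (v + 1) (fun _ => 35)
      (fun ε a'' => (∀ j < υ, ∀ e < v + 1,
          a''.arr .G ((2 ^ v + j) * (v + 1) + e) = (lineTab p d g 0 j).coeff e) ∧
        ∀ e < ε, a''.arr .G ((2 ^ v + υ) * (v + 1) + e) = 0)
      (by simp [Code.within, Cmd.within]) (by simp) (by omega) (by omega) ?_ ?_ ?_ ?_)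
    · simpa using hI
    · intro ε a'' _ _ hF' _
      simp [hF'.int, hF.int, hl]
    · rintro ε a'' hε he hF' ⟨j1, j2⟩
      have := hlt (2 ^ v + υ) ε (by omega) hε
      refine Tr.block ?_ ?_
      · simp [hF'.int, hF.int, hs, hy, hl, he, Env.Idx]
        omega
      · simp [hF'.int, hF.int, hs, hy, hl, he, Function.update_apply]
        refine ⟨fun j hj e he => ?_, fun e he hne => j2 e (by omega)⟩
        rw [if_neg, j1 j hj e (by omega)]
        rw [flat_inj (by omega) hε]
        omega
    · rintro t a'' he hF' ⟨j1, j2⟩ ht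
      have := hlt (2 ^ v + υ) 0 (by omega) (by omega)
      simp at ht
      refine Tr.block ?_ ?_
      · simp [hF'.int, hF.int, hs, hy, hl, Env.Idx]; omega
      · have hb : a''.arr .B (2 ^ v + υ) = g υ := by
          rw [hF'.arr _ (by simp), hF.arr _ (by simp), hB υ hυ]
        simp [hF'.int, hF.int, hs, hy, hl, hb, Function.update_apply]
        refine ⟨by omega, fun j hj e he => ?_⟩
        have hfl := flat_inj (l := v + 1) (h := 2 ^ v + j) (h' := 2 ^ v + υ) (e := e) (e' := 0)
          (by omega) (by omega)
        rw [add_zero] at hfl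
        simp only [hfl]
        split_ifs with hc
        · obtain ⟨hc1, rfl⟩ := hc
          obtain rfl : j = υ := by omega
          simp [lineTab, tab]
        · by_cases hjυ : j = υ
          · subst hjυ
            have : e ≠ 0 := by rintro rfl; exact hc ⟨rfl, rfl⟩
            simp [lineTab, tab, Polynomial.coeff_C, this, j2 e (by omega)]
          · exact j1 j (by omega) e (by omega)
  rintro t0 a0 - hF0 hI0 ht0
  refine Tr.seq (Tr.block (by simp) ?_)
  refine Tr.forTo [.y, .e, .k, .pow, .ptr, .x] [.c0, .c1] [.G] [] v
    (fun κ => (400 * (v + 1)) * 2 ^ (v - (κ + 1)) + 100)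
    (fun κ a' => a'.int .pow = 2 ^ (v - κ) ∧ ∀ j < 2 ^ (v - κ), ∀ e < v + 1,
      a'.arr .G ((2 ^ (v - κ) + j) * (v + 1) + e) = (lineTab p d g κ j).coeff e)
    (by simp [Code.forTo, Code.within, Cmd.within]) (by simp) (by omega) (by omega) ?_ ?_ ?_ ?_
  · simpa [hF0.int, hs] using hI0
  · intro κ a' _ _ hF _
    simp [hF.int, hF0.int, hv]
  · rintro κ a' hκ hk hF ⟨hpw, hI⟩
    obtain ⟨c, hc⟩ : ∃ c, v = κ + 1 + c := ⟨v - (κ + 1), by omega⟩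
    have e1 : v - κ = c + 1 := by omega
    have e2 : v - (κ + 1) = c := by omega
    have hP : 2 ^ (c + 1) = 2 * 2 ^ c := pow_succ' 2 c
    have hP' : 2 ^ (c + 1) ≤ 2 ^ v := Nat.pow_le_pow_right (by norm_num) (by omega)
    rw [e1, hP] at hpw hI
    rw [e2]
    rw [hP] at hP'
    have hR : a'.arr .R = a.arr .R := by rw [hF.arr _ (by simp)]; simp [hF0.arr]
    refine Tr.seq (Tr.block ?_ ?_)
    · simp [hF.int, hF0.int, hu, hv, hk, Env.Idx]; omega
    refine Tr.forTo [.y, .e, .ptr, .x] [] [.G] [] (2 ^ c) (fun _ => 200 * (v + 1) + 30)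
      (fun υ a'' => (∀ j < υ, ∀ e < v + 1,
          a''.arr .G ((2 ^ c + j) * (v + 1) + e) = (lineTab p d g (κ + 1) j).coeff e) ∧
        ∀ h e, 2 * 2 ^ c ≤ h → e < v + 1 →
          a''.arr .G (h * (v + 1) + e) = a'.arr .G (h * (v + 1) + e))
      (by simp [Code.forTo, Code.within, Cmd.within]) (by simp) (by omega) (by omega) ?_ ?_ ?_ ?_
    · simp
    · intro υ a'' _ _ hF' _
      simp [hF'.int, hF.int, hF0.int, hpw]
    · rintro υ a'' hυ hy hF' ⟨j1, j2⟩
      refine Tr.forTo [.e, .ptr, .x] [] [.G] [] (v + 1) (fun _ => 160)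
        (fun ε b => (∀ j < υ, ∀ e < v + 1,
            b.arr .G ((2 ^ c + j) * (v + 1) + e) = (lineTab p d g (κ + 1) j).coeff e) ∧
          (∀ e < ε,
            b.arr .G ((2 ^ c + υ) * (v + 1) + e) = (lineTab p d g (κ + 1) υ).coeff e) ∧
          ∀ h e, 2 * 2 ^ c ≤ h → e < v + 1 →
            b.arr .G (h * (v + 1) + e) = a'.arr .G (h * (v + 1) + e))
        (by simp [Code.within, Cmd.within]) (by simp) (by omega) (by omega) ?_ ?_ ?_ ?_
      · exact ⟨j1, by simp, j2⟩
      · intro ε b _ _ hFb _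
        simp [hFb.int, hF'.int, hF.int, hF0.int, hl]
      · rintro ε b hε he hFb ⟨l1, l2, l3⟩
        -- the two children of the node
        have hch : ∀ e < v + 1,
            b.arr .G (2 * (2 ^ c + υ) * (v + 1) + e) = (lineTab p d g κ (2 * υ)).coeff e ∧
            b.arr .G (2 * (2 ^ c + υ) * (v + 1) + e + (v + 1)) =
              (lineTab p d g κ (2 * υ + 1)).coeff e := fun e he => by
          constructor
          · rw [l3 _ _ (by omega) he, ← hI _ (by omega) e he]
            congr 1; ring
          · rw [show 2 * (2 ^ c + υ) * (v + 1) + e + (v + 1) =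
              (2 * (2 ^ c + υ) + 1) * (v + 1) + e by ring, l3 _ _ (by omega) he,
              ← hI _ (by omega) e he]
            congr 1; ring
        have hne : ∀ h e, (2 ^ c + υ) ≠ h → e < v + 1 →
            h * (v + 1) + e ≠ (2 ^ c + υ) * (v + 1) + ε := fun h e hh he hc => by
          rw [flat_inj he hε] at hc; exact hh hc.1.symm
        have hne' : ∀ e, e < v + 1 → 2 * (2 ^ c + υ) * (v + 1) + e ≠ (2 ^ c + υ) * (v + 1) + ε ∧
            2 * (2 ^ c + υ) * (v + 1) + e + (v + 1) ≠ (2 ^ c + υ) * (v + 1) + ε := fun e he => by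
          refine ⟨hne _ e (by have := Nat.one_le_two_pow (n := c); omega) he, ?_⟩
          rw [show 2 * (2 ^ c + υ) * (v + 1) + e + (v + 1) =
              (2 * (2 ^ c + υ) + 1) * (v + 1) + e by ring]
          exact hne _ e (by omega) he
        have hstep : (lineTab p d g (κ + 1) υ).coeff ε = _ := coeff_line_step (p κ) (d κ)
          (lineTab p d g κ (2 * υ)) (lineTab p d g κ (2 * υ + 1)) ε
        have hb1 := hlt (2 ^ c + υ) ε (by omega) hε
        have hb2 := hlt (2 * (2 ^ c + υ) + 1) ε (by omega) hε
        have hb3 : 2 * (2 ^ c + υ) * (v + 1) + ε + (v + 1) + 1 ≤ W := by linarith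
        have f1 : b.fld .c0 = p κ := by
          simp [hFb.fld, hF'.fld, hF.int, hF0.int, hu, hk, hR, hp]
        have f2 : b.fld .c1 = d κ := by
          simp [hFb.fld, hF'.fld, hF.int, hF0.int, hu, hv, hk, hR, hd]
        have i1 : b.int .pow = 2 ^ c := by simp [hFb.int, hF'.int, hpw]
        have i2 : b.int .y = υ := by simp [hFb.int, hy]
        have i3 : b.int .len = v + 1 := by simp [hFb.int, hF'.int, hF.int, hF0.int, hl]
        have hmul : (2 ^ c + υ) * (v + 1) ≤ 2 * (2 ^ c + υ) * (v + 1) := by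
          apply Nat.mul_le_mul_right; omega
        have hsm : 2 * (2 ^ c + υ) ≤ W := by omega
        have hfin : ∀ (t : ℕ) (b' : Store K), t ≤ 160 → b'.int .e = ε →
            b'.arr .G = Function.update (b.arr .G) ((2 ^ c + υ) * (v + 1) + ε)
              ((lineTab p d g (κ + 1) υ).coeff ε) → t ≤ 160 ∧ b'.int .e = ε ∧
            (∀ j < υ, ∀ e < v + 1,
              b'.arr .G ((2 ^ c + j) * (v + 1) + e) = (lineTab p d g (κ + 1) j).coeff e) ∧
            (∀ e < ε + 1,
              b'.arr .G ((2 ^ c + υ) * (v + 1) + e) = (lineTab p d g (κ + 1) υ).coeff e) ∧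
            ∀ h e, 2 * 2 ^ c ≤ h → e < v + 1 →
              b'.arr .G (h * (v + 1) + e) = a'.arr .G (h * (v + 1) + e) := by
          intro t b' ht hbe hbG
          simp only [hbG]
          refine ⟨ht, hbe, fun j hj e he => ?_, fun e he => ?_, fun h e hh he => ?_⟩
          · rw [Function.update_of_ne (hne _ _ (by omega) he), l1 j hj e he]
          · by_cases heε : e = ε
            · rw [heε, Function.update_self]
            · rw [Function.update_of_ne (by omega), l2 e (by omega)]
          · rw [Function.update_of_ne (hne _ _ (by omega) he), l3 h e hh he]
        refine Tr.seq (Tr.block ?_ (Tr.ite (by simp) (fun h => Tr.block ?_ ?_)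
          fun h => Tr.block ?_ ?_))
        · simp [i1, i2, i3, he, Env.Idx]; omega
        · simp [i1, i2, i3, he, Env.Idx]; omega
        · simp [he] at h
          obtain ⟨ε', rfl⟩ := Nat.exists_eq_succ_of_ne_zero h
          have q1 := hch (ε' + 1) hε
          have q2 := hch ε' (by omega)
          have n1 := (hne' (ε' + 1) hε)
          have n2 := (hne' ε' (by omega))
          have r1 : 2 * (2 ^ c + υ) * (v + 1) + (ε' + 1) - 1 =
            2 * (2 ^ c + υ) * (v + 1) + ε' := by omega
          have r2 : 2 * (2 ^ c + υ) * (v + 1) + (ε' + 1) + (v + 1) - 1 =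
            2 * (2 ^ c + υ) * (v + 1) + ε' + (v + 1) := by omega
          refine hfin _ _ (by simp) (by simp [he]) ?_
          rw [hstep]
          simp [i1, i2, i3, he, f1, f2, r1, r2, n2.1, n2.2,
            q1.1, q1.2, q2.1, q2.2]
        · trivial
        · simp [he] at h
          subst h
          have q1 := hch 0 (by omega)
          refine hfin _ _ (by simp) (by simp [he]) ?_
          rw [hstep]
          rw [add_zero] at q1
          simp [i1, i2, i3, he, f1, q1.1, q1.2]
      · rintro t b he hFb ⟨l1, l2, l3⟩ ht
        simp at ht
        refine ⟨by omega, by simp [hFb.int, hy], fun j hj e he => ?_, by simpa using l3⟩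
        by_cases hjυ : j = υ
        · subst hjυ; exact l2 e he
        · exact l1 j (by omega) e he
    · rintro t b he hFb ⟨l1, l2⟩ ht
      simp at ht
      refine ⟨?_, by simp [hFb.int, hk], by simp [hFb.int, hpw], by simpa [e2] using l1⟩
      simp
      have : 1 ≤ 2 ^ c := Nat.one_le_two_pow
      nlinarith
  · rintro t a' hk hF ⟨hpw, hI⟩ ht hF'
    have hsum := sum_two_pow_reflect_le (400 * (v + 1)) 112 v
    simp [add_assoc] at ht hI ht0 hsum
    refine ⟨?_, hF', fun e he => ?_⟩
    · simp
      have : 1 ≤ 2 ^ v := Nat.one_le_two_pow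
      nlinarith
    · rw [← hI e (by omega), add_assoc]

end GKR

namespace GKR

/-! ### An iteration of the prover -/

variable {K : Type*} [Field K] {E : Env K} {a : Store K} {n : ℕ} {C : LayeredCircuit n}
  {x : Fin n → K} {r : ℕ → K} {i W : ℕ}

/-- The number of gates above layer `i`, which is the index of the first gate of layer `i` in the
list of all gates. -/
def LayeredCircuit.above {n : ℕ} (C : LayeredCircuit n) (i : ℕ) : ℕ :=
  ∑ i' ∈ Finset.range i, C.width i'

/-- The data on which iteration `i` of the prover operates. -/
structure IterCtx (C : LayeredCircuit n) (x : Fin n → K) (i : ℕ) (a : Store K) : Prop where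
  gate : GateMem C i a
  base' : a.int .base' = C.above (i + 1)
  width' : a.int .width' = C.width (i + 1)
  bits : a.int .bits = C.bits i
  bits' : a.int .bits' = C.bits (i + 1)
  size : a.int .size = 2 ^ C.bits i
  size' : a.int .size' = 2 ^ C.bits (i + 1)
  val : ∀ j < C.width i, a.arr .val (C.above i + j) = C.value x i j
  val' : ∀ j < C.width (i + 1), a.arr .val (C.above (i + 1) + j) = C.value x (i + 1) j

theorem GateMem.frame {iv : List IVar} {fv : List FVar} {ar : List Arr} {cs : List Comp}
    {a a' : Store K} (h : GateMem C i a) (hF : Frame iv fv ar cs a a')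
    (h1 : ∀ v ∈ [IVar.depth, .width, .base], v ∉ iv) (h3 : .imem ∉ cs) : GateMem C i a' := by
  simp at h1
  have := hF.imem h3
  obtain ⟨d, w, b, k, l, r⟩ := h
  constructor
  · rw [hF.int _ h1.1, d]
  · rw [hF.int _ h1.2.1, w]
  · rw [hF.int _ h1.2.2, b]
  all_goals rwa [this]

theorem IterCtx.frame {iv : List IVar} {fv : List FVar} {ar : List Arr} {cs : List Comp}
    {a a' : Store K} (h : IterCtx C x i a) (hF : Frame iv fv ar cs a a')
    (h1 : ∀ v ∈ [IVar.depth, .width, .base, .base', .width', .bits, .bits', .size, .size'], v ∉ iv)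
    (h2 : .val ∉ ar) (h3 : .imem ∉ cs) : IterCtx C x i a' := by
  simp at h1
  obtain ⟨g, b', w', bi, bi', s, s', v, v'⟩ := h
  constructor
  · exact g.frame hF (by simp [h1]) h3
  · rw [hF.int _ (by simp [h1]), b']
  · rw [hF.int _ (by simp [h1]), w']
  · rw [hF.int _ (by simp [h1]), bi]
  · rw [hF.int _ (by simp [h1]), bi']
  · rw [hF.int _ (by simp [h1]), s]
  · rw [hF.int _ (by simp [h1]), s']
  · rwa [hF.arr _ h2]
  · rwa [hF.arr _ h2]

open IVar in
/-- The rounds in which the variables `p` are fixed. Afterwards the leaves of `E` are the weights of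
the gates: the root of `A` has become `β(z, p)`. -/
def phaseOut : Code :=
  .block [.iset idx 0, .iset len bits] ;; fill size base width ;; eqTable .A .Z 1 ;;
  .block [.iset pow size] ;; sumcheck ;; eqTable .E .R (.load .A 1)

open IVar FVar in
/-- The rounds in which the variables `ω₁` are fixed. Afterwards `val1` is `Ṽ(ω₁)`, the root of `B`,
and the leaves of `D` are the indicators at `ω₁`. -/
def phaseLeft : Code :=
  fill size' base' width' ;;
  gather lft (.load .E (size + j)) (.load .val (base' + rgt)) ;;
  .block [.iset idx bits, .iset len bits', .iset pow size'] ;; sumcheck ;;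
  .block [.fset val1 (.load .B 1)] ;; eqTable .D .R 1

open IVar FVar in
/-- The rounds in which the variables `ω₂` are fixed. -/
def phaseRight : Code :=
  fill size' base' width' ;;
  gather rgt (.load .E (size + j) * .load .D (size' + lft)) val1 ;;
  .block [.iset idx (bits + bits'), .iset len bits', .iset pow size'] ;; sumcheck

open IVar FVar in
/-- The message about the line, and the point that results from the last challenge. -/
def phaseLine : Code :=
  .block [.iset len (bits' + 1)] ;; lineTable ;;
  .forTo e len (.block [.send (.load .G (len + e))]) ;;
  .block [.recv rho] ;;
  .forTo k bits' (.block [.fstore .Z k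
    (.load .R (bits + k) + rho * (.load .R (bits + bits' + k) - .load .R (bits + k)))])

/-- The addresses that are used in iteration `i` are below the bound `W`. -/
structure IterBound (C : LayeredCircuit n) (i W : ℕ) : Prop where
  h1 : 2 * 2 ^ C.bits i ≤ W
  h2 : 2 * 2 ^ C.bits (i + 1) * (C.bits (i + 1) + 1) ≤ W
  h3 : C.bits i + 2 * C.bits (i + 1) + 1 ≤ W
  h4 : C.above (i + 1) + 2 ^ C.bits (i + 1) ≤ W
  h5 : C.above i + 2 ^ C.bits i ≤ W
  h6 : C.depth + 2 + 3 * (C.above i + C.width i) ≤ W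

theorem IterBound.h2' (h : IterBound C i W) : 2 * 2 ^ C.bits (i + 1) ≤ W := by
  have := h.h2; nlinarith [Nat.one_le_two_pow (n := C.bits (i + 1))]

theorem phaseOut_spec (hpeer : E.peer = challengePeer r) (hW : E.Bd W) (hb : IterBound C i W)
    (hi : i ≤ C.depth) (hc : IterCtx C x i a)
    (hZ : ∀ k < C.bits i, a.arr .Z k = C.layerPoint r i k)
    (hq : numReceived a.trace = C.offset i) :
    Tr E phaseOut a fun t a' => t ≤ 2000 * 2 ^ C.bits i ∧
      Frame [.idx, .len, .x, .k, .y, .pow, .ptr] [.c0, .c1, .c2, .rho] [.A, .B, .C, .R, .E]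
        [.stream, .trace] a a' ∧
      (∀ j < 2 ^ C.bits i, a'.arr .E (2 ^ C.bits i + j) =
        C.gateWeight i (C.layerPoint r i) (C.sumcheckPoint r i) j) ∧
      (∀ k < C.bits i, a'.arr .R k = C.sumcheckPoint r i k) ∧
      numReceived a'.trace = C.offset i + C.bits i ∧
      a'.trace = a.trace ++ conv r (C.offset i) ((List.range (C.bits i)).map fun κ =>
        (List.range 3).map (scCoeff (fun j => chiE (C.bits i) j (C.layerPoint r i)) (C.value x i)
          (fun _ => 0) (C.bits i) (C.sumcheckPoint r i) κ)) := by
  obtain ⟨h1, h2, h3, h4, h5, h6⟩ := hb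
  have hBp := hW.1
  set u := C.bits i with hu
  have hpu : u < 2 ^ u := Nat.lt_two_pow_self
  refine Tr.withFrame [.idx, .len, .x, .k, .y, .pow, .ptr] [.c0, .c1, .c2, .rho]
    [.A, .B, .C, .R, .E] [.stream, .trace]
    (by simp [phaseOut, sumcheck, sumcheckRound, fill, eqTable, Code.forTo, Code.within,
      Cmd.within])
    (Tr.seq (Tr.block (by simp) ?_))
  set a1 : Store K := runs E _ a with ha1
  have F1 : Frame [.idx, .len] [] [] [] a a1 := runs_frame E _ _ (by simp [Cmd.within])
  have i1 : a1.int .idx = 0 := by simp [ha1]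
  have i2 : a1.int .len = u := by simp [ha1, hc.bits, hu]
  clear_value a1
  refine Tr.seq ((fill_spec (by simp) (by simp) (by simp) hW h1 h5
    (by rw [F1.int _ (by simp), hc.size]) (by rw [F1.int _ (by simp), hc.gate.base]; rfl)
    (by rw [F1.int _ (by simp), hc.gate.width])).mono ?_)
  rintro t2 a2 ⟨ht2, F2, zA, zC, vB⟩
  refine Tr.seq ((eqTable_spec (X := .A) (Y := .Z) (c := 1) (by simp) hW h1 (o := 0) (mv := u)
    (by omega) (by rw [F2.int _ (by simp), i1]) (by rw [F2.int _ (by simp), i2]) (by simp)).mono ?_)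
  rintro t3 a3 ⟨ht3, F3, vA⟩
  refine Tr.seq (Tr.block (by simp) ?_)
  set a4 : Store K := runs E _ a3 with ha4
  have F4 : Frame [.pow] [] [] [] a3 a4 := runs_frame E _ _ (by simp [Cmd.within])
  have i4 : a4.int .pow = 2 ^ u := by
    simp [ha4, F3.int, F2.int, F1.int, hc.size, ← hu]
  clear_value a4
  have hZ' : (a2.arr .Z) = a.arr .Z := by rw [F2.arr _ (by simp), F1.arr _ (by simp)]
  refine Tr.seq ((sumcheck_spec (m := u) (o := 0) (q := C.offset i)
    (fA := fun j => chiE u j (C.layerPoint r i)) (fB := C.value x i) (fC := fun _ => 0)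
    hpeer hW h1 (by omega) (by simp [F4.int, F3.int, F2.int, i2])
    (by simp [F4.int, F3.int, F2.int, i1]) i4 ?_ ?_ ?_ ?_).mono ?_)
  · intro j hj
    rw [F4.arr _ (by simp), vA j hj]
    simp only [FExp.eval_one, one_mul, zero_add, hZ']
    exact chiE_congr (fun k hk => hZ k hk) j
  · intro j hj
    rw [F4.arr _ (by simp), F3.arr _ (by simp), vB j hj, F1.arr _ (by simp)]
    split_ifs with h
    · exact hc.val j h
    · exact (C.value_of_ge x hi (by omega)).symm
  · intro j hj
    rw [F4.arr _ (by simp), F3.arr _ (by simp), zC j hj]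
  · rw [F4.trace (by simp), F3.trace (by simp), F2.trace (by simp), F1.trace (by simp), hq]
  rintro t5 a5 ⟨ht5, F5, wA, wB, -, wR, -, wn, wt⟩
  refine (eqTable_spec (X := .E) (Y := .R) (c := .load .A 1) (by simp) hW h1 (o := 0) (mv := u)
    (by omega) (by simp [F5.int, F4.int, F3.int, F2.int, i1])
    (by simp [F5.int, F4.int, F3.int, F2.int, i2])
    (by simp [Env.Idx]; have := hW.2; omega)).mono ?_
  rintro t6 a6 ⟨ht6, F6, vE⟩ hF
  refine ⟨?_, hF, fun j hj => ?_, fun k hk => ?_, ?_, ?_⟩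
  · simp at ht3 ht6 ⊢
    omega
  · rw [vE j hj]
    simp only [FExp.eval_load, IExp.eval_ofNat, wA]
    unfold LayeredCircuit.gateWeight
    congr 1
    exact chiE_congr (fun k hk => by rw [wR k hk]; rfl) j
  · rw [F6.arr _ (by simp)]
    have := wR k hk
    rwa [zero_add] at this
  · rw [F6.trace (by simp), wn]
  · rw [F6.trace (by simp), wt, F4.trace (by simp), F3.trace (by simp), F2.trace (by simp),
      F1.trace (by simp)]
    rfl

theorem phaseLeft_spec (hpeer : E.peer = challengePeer r) (hW : E.Bd W) (hb : IterBound C i W)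
    (hi : i < C.depth) (hc : IterCtx C x i a)
    (hE : ∀ j < 2 ^ C.bits i, a.arr .E (2 ^ C.bits i + j) =
        C.gateWeight i (C.layerPoint r i) (C.sumcheckPoint r i) j)
    (hR : ∀ k < C.bits i, a.arr .R k = C.sumcheckPoint r i k)
    (hq : numReceived a.trace = C.offset i + C.bits i) :
    Tr E phaseLeft a fun t a' => t ≤ 2000 * 2 ^ C.bits (i + 1) + 500 * C.width i ∧
      Frame [.idx, .len, .x, .k, .y, .pow, .ptr, .j, .kind, .lft, .rgt]
        [.c0, .c1, .c2, .rho, .wt, .chi, .val1] [.A, .B, .C, .R, .D] [.stream, .trace] a a' ∧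
      a'.fld .val1 = mleE (C.bits (i + 1)) (C.value x (i + 1))
        (fun k => C.sumcheckPoint r i (C.bits i + k)) ∧
      (∀ j < 2 ^ C.bits (i + 1), a'.arr .D (2 ^ C.bits (i + 1) + j) =
        chiE (C.bits (i + 1)) j fun k => C.sumcheckPoint r i (C.bits i + k)) ∧
      (∀ k < C.bits i + C.bits (i + 1), a'.arr .R k = C.sumcheckPoint r i k) ∧
      numReceived a'.trace = C.offset i + C.bits i + C.bits (i + 1) ∧
      a'.trace = a.trace ++ conv r (C.offset i + C.bits i)
        ((List.range (C.bits (i + 1))).map fun κ => (List.range 3).map (scCoeff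
          (C.gatherMul i (C.left i) (C.gateWeight i (C.layerPoint r i) (C.sumcheckPoint r i))
            fun j => C.value x (i + 1) (C.right i j))
          (C.value x (i + 1))
          (C.gatherAdd i (C.left i) (C.gateWeight i (C.layerPoint r i) (C.sumcheckPoint r i))
            fun j => C.value x (i + 1) (C.right i j)) (C.bits (i + 1))
          (fun k => C.sumcheckPoint r i (C.bits i + k)) κ)) := by
  have hb2 := hb.h2'
  obtain ⟨h1, h2, h3, h4, h5, h6⟩ := hb
  have hBp := hW.1
  set u := C.bits i with hu
  set v := C.bits (i + 1) with hv
  have hpv : v < 2 ^ v := Nat.lt_two_pow_self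
  have hwu : C.width i ≤ 2 ^ u := C.width_le_two_pow i
  have hwv : C.width (i + 1) ≤ 2 ^ v := C.width_le_two_pow (i + 1)
  refine Tr.withFrame [.idx, .len, .x, .k, .y, .pow, .ptr, .j, .kind, .lft, .rgt]
        [.c0, .c1, .c2, .rho, .wt, .chi, .val1] [.A, .B, .C, .R, .D] [.stream, .trace]
    (by simp [phaseLeft, sumcheck, sumcheckRound, fill, gather, eqTable, Code.forTo, Code.within,
      Cmd.within])
    (Tr.seq ((fill_spec (by simp) (by simp) (by simp) hW hb2 h4 hc.size' hc.base'
      hc.width').mono ?_))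
  rintro t2 a2 ⟨ht2, F2, zA, zC, vB⟩
  have hc2 := hc.frame F2 (by simp) (by simp) (by simp)
  refine Tr.seq ((gather_spec (f := C.left i)
    (fw := C.gateWeight i (C.layerPoint r i) (C.sumcheckPoint r i))
    (fs := fun j => C.value x (i + 1) (C.right i j)) (.inl ⟨rfl, rfl⟩) hW hb2 h6
    (fun j hj => (C.left_lt i hi j hj).trans_le hwv) hc2.gate hc2.size' zA zC
    (by simp) (by simp) ?_).mono ?_)
  · intro j b hj hF hbj hbl hbr
    have hcb := hc2.frame hF (by simp) (by simp) (by simp)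
    have hr := C.right_lt i hi j hj
    have e1 : b.arr .E = a.arr .E := by rw [hF.arr _ (by simp), F2.arr _ (by simp)]
    simp [hcb.size, hcb.base', hbj, hbr, e1, hcb.val' _ hr, hE j (by omega), ← hu]
    refine ⟨⟨by omega, hW.idx (by omega)⟩, by omega, hW.idx (by omega)⟩
  rintro t3 a3 ⟨ht3, F3, gA, gC⟩
  have hc3 := hc2.frame F3 (by simp) (by simp) (by simp)
  refine Tr.seq (Tr.block (by simp) ?_)
  set a4 : Store K := runs E _ a3 with ha4
  have F4 : Frame [.idx, .len, .pow] [] [] [] a3 a4 := runs_frame E _ _ (by simp [Cmd.within])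
  have i1 : a4.int .idx = u := by simp [ha4, hc3.bits, hu]
  have i2 : a4.int .len = v := by simp [ha4, hc3.bits', hv]
  have i3 : a4.int .pow = 2 ^ v := by simp [ha4, hc3.size', hv]
  clear_value a4
  refine Tr.seq ((sumcheck_spec (q := C.offset i + u) (fB := C.value x (i + 1))
    hpeer hW hb2 (by omega) i2 i1 i3 (fun j hj => by rw [F4.arr _ (by simp), gA j hj]) ?_
    (fun j hj => by rw [F4.arr _ (by simp), gC j hj]) ?_).mono ?_)
  · intro j hj
    rw [F4.arr _ (by simp), F3.arr _ (by simp), vB j hj]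
    split_ifs with h
    · exact hc.val' j h
    · exact (C.value_of_ge x (i := i + 1) hi (by omega)).symm
  · rw [F4.trace (by simp), F3.trace (by simp), F2.trace (by simp), hq]
  rintro t5 a5 ⟨ht5, F5, wA, wB, -, wR, wR', wn, wt⟩
  refine Tr.seq (Tr.block (by simp [Env.Idx]; have := hW.2; omega) ?_)
  set a6 : Store K := runs E _ a5 with ha6
  have F6 : Frame [] [.val1] [] [] a5 a6 := runs_frame E _ _ (by simp [Cmd.within])
  have i6 : a6.fld .val1 = a5.arr .B 1 := by simp [ha6]
  clear_value a6
  refine (eqTable_spec (X := .D) (Y := .R) (c := 1) (by simp) hW hb2 (o := u) (mv := v)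
    (by omega) (by simp [F6.int, F5.int, i1]) (by simp [F6.int, F5.int, i2]) (by simp)).mono ?_
  rintro t7 a7 ⟨ht7, F7, vD⟩ hF
  have hRk : ∀ k < v, a5.arr .R (u + k) = C.sumcheckPoint r i (u + k) := fun k hk => by
    rw [wR k hk, LayeredCircuit.sumcheckPoint, add_assoc]
  refine ⟨?_, hF, ?_, fun j hj => ?_, fun k hk => ?_, ?_, ?_⟩
  · simp at ht3 ht7 ⊢
    omega
  · rw [F7.fld _ (by simp), i6, wB]
    simp only [LayeredCircuit.sumcheckPoint, add_assoc]
  · rw [vD j hj]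
    simp only [FExp.eval_one, one_mul, F6.arr _ (by simp : Arr.R ∉ [])]
    exact chiE_congr hRk j
  · rw [F7.arr _ (by simp), F6.arr _ (by simp)]
    rcases Nat.lt_or_ge k u with h | h
    · rw [wR' k (.inl h), F4.arr _ (by simp), F3.arr _ (by simp), F2.arr _ (by simp), hR k h]
    · obtain ⟨k, rfl⟩ := Nat.exists_eq_add_of_le h
      exact hRk k (by omega)
  · rw [F7.trace (by simp), F6.trace (by simp), wn]
  · rw [F7.trace (by simp), F6.trace (by simp), wt, F4.trace (by simp), F3.trace (by simp),
      F2.trace (by simp)]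
    simp only [LayeredCircuit.sumcheckPoint, add_assoc]

theorem phaseRight_spec (hpeer : E.peer = challengePeer r) (hW : E.Bd W) (hb : IterBound C i W)
    (hi : i < C.depth) (hc : IterCtx C x i a)
    (hE : ∀ j < 2 ^ C.bits i, a.arr .E (2 ^ C.bits i + j) =
        C.gateWeight i (C.layerPoint r i) (C.sumcheckPoint r i) j)
    (hv1 : a.fld .val1 = mleE (C.bits (i + 1)) (C.value x (i + 1))
        (fun k => C.sumcheckPoint r i (C.bits i + k)))
    (hD : ∀ j < 2 ^ C.bits (i + 1), a.arr .D (2 ^ C.bits (i + 1) + j) =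
        chiE (C.bits (i + 1)) j fun k => C.sumcheckPoint r i (C.bits i + k))
    (hR : ∀ k < C.bits i + C.bits (i + 1), a.arr .R k = C.sumcheckPoint r i k)
    (hq : numReceived a.trace = C.offset i + C.bits i + C.bits (i + 1)) :
    Tr E phaseRight a fun t a' => t ≤ 2000 * 2 ^ C.bits (i + 1) + 500 * C.width i ∧
      Frame [.idx, .len, .x, .k, .y, .pow, .ptr, .j, .kind, .lft, .rgt]
        [.c0, .c1, .c2, .rho, .wt, .chi] [.A, .B, .C, .R] [.stream, .trace] a a' ∧
      (∀ j < 2 ^ C.bits (i + 1), a'.arr .B (2 ^ C.bits (i + 1) + j) = C.value x (i + 1) j) ∧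
      (∀ k < C.rounds i, a'.arr .R k = C.sumcheckPoint r i k) ∧
      numReceived a'.trace = C.offset i + C.rounds i ∧
      a'.trace = a.trace ++ conv r (C.offset i + C.bits i + C.bits (i + 1))
        ((List.range (C.bits (i + 1))).map fun κ => (List.range 3).map (scCoeff
          (C.gatherMul i (C.right i) (C.gateWeight' i (C.layerPoint r i) (C.sumcheckPoint r i))
            fun _ => mleE (C.bits (i + 1)) (C.value x (i + 1))
              fun k => C.sumcheckPoint r i (C.bits i + k))
          (C.value x (i + 1))
          (C.gatherAdd i (C.right i) (C.gateWeight' i (C.layerPoint r i) (C.sumcheckPoint r i))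
            fun _ => mleE (C.bits (i + 1)) (C.value x (i + 1))
              fun k => C.sumcheckPoint r i (C.bits i + k)) (C.bits (i + 1))
          (fun k => C.sumcheckPoint r i (C.bits i + C.bits (i + 1) + k)) κ)) := by
  have hb2 := hb.h2'
  obtain ⟨h1, h2, h3, h4, h5, h6⟩ := hb
  have hBp := hW.1
  have hN : C.rounds i = C.bits i + C.bits (i + 1) + C.bits (i + 1) := by
    unfold LayeredCircuit.rounds; omega
  set u := C.bits i with hu
  set v := C.bits (i + 1) with hv
  have hpv : v < 2 ^ v := Nat.lt_two_pow_self
  have hwu : C.width i ≤ 2 ^ u := C.width_le_two_pow i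
  have hwv : C.width (i + 1) ≤ 2 ^ v := C.width_le_two_pow (i + 1)
  refine Tr.withFrame [.idx, .len, .x, .k, .y, .pow, .ptr, .j, .kind, .lft, .rgt]
        [.c0, .c1, .c2, .rho, .wt, .chi] [.A, .B, .C, .R] [.stream, .trace]
    (by simp [phaseRight, sumcheck, sumcheckRound, fill, gather, Code.forTo, Code.within,
      Cmd.within])
    (Tr.seq ((fill_spec (by simp) (by simp) (by simp) hW hb2 h4 hc.size' hc.base'
      hc.width').mono ?_))
  rintro t2 a2 ⟨ht2, F2, zA, zC, vB⟩
  have hc2 := hc.frame F2 (by simp) (by simp) (by simp)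
  refine Tr.seq ((gather_spec (f := C.right i)
    (fw := C.gateWeight' i (C.layerPoint r i) (C.sumcheckPoint r i))
    (fs := fun _ => mleE v (C.value x (i + 1)) fun k => C.sumcheckPoint r i (u + k))
    (.inr ⟨rfl, rfl⟩) hW hb2 h6
    (fun j hj => (C.right_lt i hi j hj).trans_le hwv) hc2.gate hc2.size' zA zC
    (by simp) (by simp) ?_).mono ?_)
  · intro j b hj hF hbj hbl hbr
    have hcb := hc2.frame hF (by simp) (by simp) (by simp)
    have hl := C.left_lt i hi j hj
    have e1 : b.arr .E = a.arr .E := by rw [hF.arr _ (by simp), F2.arr _ (by simp)]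
    have e2 : b.arr .D = a.arr .D := by rw [hF.arr _ (by simp), F2.arr _ (by simp)]
    have e3 : b.fld .val1 = a.fld .val1 := by rw [hF.fld _ (by simp), F2.fld _ (by simp)]
    simp [hcb.size, hcb.size', hbj, hbl, e1, e2, e3, hv1, hE j (by omega), ← hu, ← hv,
      hD _ (hl.trans_le hwv)]
    refine ⟨⟨⟨by omega, hW.idx (by omega)⟩, by omega, hW.idx (by omega)⟩, rfl⟩
  rintro t3 a3 ⟨ht3, F3, gA, gC⟩
  have hc3 := hc2.frame F3 (by simp) (by simp) (by simp)
  refine Tr.seq (Tr.block (by simp [hc3.bits, hc3.bits']; omega) ?_)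
  set a4 : Store K := runs E _ a3 with ha4
  have F4 : Frame [.idx, .len, .pow] [] [] [] a3 a4 := runs_frame E _ _ (by simp [Cmd.within])
  have i1 : a4.int .idx = u + v := by simp [ha4, hc3.bits, hu, hc3.bits', hv]
  have i2 : a4.int .len = v := by simp [ha4, hc3.bits', hv]
  have i3 : a4.int .pow = 2 ^ v := by simp [ha4, hc3.size', hv]
  clear_value a4
  refine (sumcheck_spec (q := C.offset i + u + v) (fB := C.value x (i + 1))
    hpeer hW hb2 (by omega) i2 i1 i3 (fun j hj => by rw [F4.arr _ (by simp), gA j hj]) ?_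
    (fun j hj => by rw [F4.arr _ (by simp), gC j hj]) ?_).mono ?_
  · intro j hj
    rw [F4.arr _ (by simp), F3.arr _ (by simp), vB j hj]
    split_ifs with h
    · exact hc.val' j h
    · exact (C.value_of_ge x (i := i + 1) hi (by omega)).symm
  · rw [F4.trace (by simp), F3.trace (by simp), F2.trace (by simp), hq]
  rintro t5 a5 ⟨ht5, F5, wA, wB, wL, wR, wR', wn, wt⟩ hF
  refine ⟨?_, hF, wL, fun k hk => ?_, ?_, ?_⟩
  · simp at ht3 ⊢
    omega
  · rcases Nat.lt_or_ge k (u + v) with h | h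
    · rw [wR' k (.inl h), F4.arr _ (by simp), F3.arr _ (by simp), F2.arr _ (by simp), hR k h]
    · obtain ⟨k, rfl⟩ := Nat.exists_eq_add_of_le h
      rw [wR k (by omega), LayeredCircuit.sumcheckPoint]
      congr 1; omega
  · rw [wn, hN]; omega
  · rw [wt, F4.trace (by simp), F3.trace (by simp), F2.trace (by simp)]
    simp only [LayeredCircuit.sumcheckPoint, add_assoc]

end GKR

namespace GKR

variable {K : Type*} [Field K] {E : Env K} {a : Store K} {n : ℕ} {C : LayeredCircuit n}
  {x : Fin n → K} {r : ℕ → K} {i W : ℕ}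

theorem phaseLine_spec (hpeer : E.peer = challengePeer r) (hW : E.Bd W) (hb : IterBound C i W)
    (hc : IterCtx C x i a)
    (hB : ∀ j < 2 ^ C.bits (i + 1), a.arr .B (2 ^ C.bits (i + 1) + j) = C.value x (i + 1) j)
    (hR : ∀ k < C.rounds i, a.arr .R k = C.sumcheckPoint r i k)
    (hq : numReceived a.trace = C.offset i + C.rounds i) :
    Tr E phaseLine a fun t a' => t ≤ 2000 * (2 ^ C.bits (i + 1) * (C.bits (i + 1) + 1)) ∧
      Frame [.len, .y, .e, .k, .pow, .ptr, .x] [.c0, .c1, .rho] [.G, .Z] [.stream, .trace] a a' ∧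
      (∀ k < C.bits (i + 1), a'.arr .Z k = C.layerPoint r (i + 1) k) ∧
      numReceived a'.trace = C.offset (i + 1) ∧
      a'.trace = a.trace ++ conv r (C.offset i + C.rounds i)
        [(List.range (C.bits (i + 1) + 1)).map (C.linePoly x r i).coeff] := by
  have hb2 := hb.h2'
  obtain ⟨h1, h2, h3, h4, h5, h6⟩ := hb
  have hBp := hW.1
  have hN : C.rounds i = C.bits i + C.bits (i + 1) + C.bits (i + 1) := by
    unfold LayeredCircuit.rounds; omega
  set u := C.bits i with hu
  set v := C.bits (i + 1) with hv
  have hpv : v < 2 ^ v := Nat.lt_two_pow_self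
  have hvW : v + 1 + v + 1 ≤ W + 1 := by omega
  refine Tr.withFrame [.len, .y, .e, .k, .pow, .ptr, .x] [.c0, .c1, .rho] [.G, .Z] [.stream, .trace]
    (by simp [phaseLine, lineTable, Code.forTo, Code.within, Cmd.within])
    (Tr.seq (Tr.block (by simp [hc.bits']; omega) ?_))
  set a1 : Store K := runs E _ a with ha1
  have F1 : Frame [.len] [] [] [] a a1 := runs_frame E _ _ (by simp [Cmd.within])
  have i1 : a1.int .len = v + 1 := by simp [ha1, hc.bits', hv]
  clear_value a1
  refine Tr.seq ((lineTable_spec (u := u) (v := v) (g := C.value x (i + 1)) hW h2 (by omega)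
    (by rw [F1.int _ (by simp), hc.bits]) (by rw [F1.int _ (by simp), hc.bits'])
    (by rw [F1.int _ (by simp), hc.size']) i1
    (fun j hj => by rw [F1.arr _ (by simp), hB j hj])).mono ?_)
  rintro t2 a2 ⟨ht2, F2, hG⟩
  have hcoef : ∀ e < v + 1, a2.arr .G (v + 1 + e) = (C.linePoly x r i).coeff e := fun e he => by
    rw [hG e he, C.linePoly_eq_tab, lineTab]
    congr 1
    refine tab_congr _ (fun k hk => ?_) _
    rw [F1.arr _ (by simp), hR _ (by omega), hR _ (by omega), ← hu, ← hv]
  refine Tr.seq (Tr.forTo [.e] [] [] [.stream, .trace] (v + 1) (fun _ => 20)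
    (fun ε b => b.trace = a2.trace ++
      ((List.range ε).map (C.linePoly x r i).coeff).map Event.send)
    (by simp [Code.within, Cmd.within]) (by simp) (by omega) (by omega) ?_ ?_ ?_ ?_)
  · simp
  · intro ε b _ _ hF _
    simp [hF.int, F2.int, i1]
  · rintro ε b hε he hF hI
    refine Tr.block ?_ ?_
    · simp [hF.int, F2.int, i1, he, Env.Idx]; have := hW.2; omega
    · simp [hF.int, F2.int, i1, he, hF.arr, hI, hcoef ε hε, List.range_succ]
  rintro t3 a3 - F3 hT ht3
  have hn3 : numReceived a3.trace = C.offset i + C.rounds i := by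
    rw [hT, numReceived_append, F2.trace (by simp), F1.trace (by simp), numReceived_map_send, hq]
    rfl
  refine Tr.seq (Tr.block (by simp) ?_)
  set a4 : Store K := runs E _ a3 with ha4
  have F4 : Frame [] [.rho] [] [.stream, .trace] a3 a4 := runs_frame E _ _ (by simp [Cmd.within])
  have i4 : a4.fld .rho = r (C.offset i + C.rounds i) := by
    simp [ha4, hpeer, challengePeer, hn3]
  have i5 : a4.trace = a3.trace ++ [.recv (r (C.offset i + C.rounds i))] := by
    simp [ha4, hpeer, challengePeer, hn3]
  clear_value a4
  refine Tr.forTo [.k] [] [.Z] [] v (fun _ => 70)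
    (fun κ b => ∀ k < κ, b.arr .Z k = C.layerPoint r (i + 1) k)
    (by simp [Code.within, Cmd.within]) (by simp) (by omega) (by omega) ?_ ?_ ?_ ?_
  · simp
  · intro κ b _ _ hF _
    simp [hF.int, F4.int, F3.int, F2.int, F1.int, hc.bits', ← hv]
  · rintro κ b hκ hk hF hI
    have e1 : b.int .bits = u := by simp [hF.int, F4.int, F3.int, F2.int, F1.int, hc.bits, ← hu]
    have e2 : b.int .bits' = v := by simp [hF.int, F4.int, F3.int, F2.int, F1.int, hc.bits', ← hv]
    have e3 : b.arr .R = a.arr .R := by simp [hF.arr, F4.arr, F3.arr, F2.arr, F1.arr]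
    refine Tr.block ?_ ?_
    · simp [e1, e2, hk, Env.Idx]; have := hW.2; omega
    · simp [e1, e2, e3, hk, hF.fld, i4, hR (u + κ) (by omega), hR (u + v + κ) (by omega),
        Function.update_apply]
      intro k hk'
      split_ifs with h
      · rw [h, LayeredCircuit.layerPoint, ← hu, ← hv]
      · exact hI k (by omega)
  · rintro t5 a5 - F5 hZ ht5 hF
    have hpow1 : 1 ≤ 2 ^ v := Nat.one_le_two_pow
    refine ⟨?_, hF, hZ, ?_, ?_⟩
    · simp at ht3 ht5 ⊢
      nlinarith
    · rw [F5.trace (by simp), i5, numReceived_append, hn3, C.offset_succ]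
      simp [add_assoc]
    · rw [F5.trace (by simp), i5, hT, F2.trace (by simp), F1.trace (by simp)]
      simp [conv]

open IVar in
/-- One iteration of the honest prover. -/
def proverIter : Code :=
  .block [.iset width (.load (1 + layer)), .iset width' (.load (2 + layer)),
    .iset base' (base + width)] ;;
  logCode bits size width ;; logCode bits' size' width' ;;
  phaseOut ;; phaseLeft ;; phaseRight ;; phaseLine ;; .block [.iset base base']

/-- The messages of an iteration, in the closed form in which the prover computes them. -/
theorem LayeredCircuit.iterMsgs_eq (hi : i < C.depth) :
    C.iterMsgs x r i =
      ((List.range (C.bits i)).map fun κ =>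
        (List.range 3).map (scCoeff (fun j => chiE (C.bits i) j (C.layerPoint r i)) (C.value x i)
          (fun _ => 0) (C.bits i) (C.sumcheckPoint r i) κ)) ++
      (((List.range (C.bits (i + 1))).map fun κ =>
        (List.range 3).map (scCoeff
          (C.gatherMul i (C.left i) (C.gateWeight i (C.layerPoint r i) (C.sumcheckPoint r i))
            fun j => C.value x (i + 1) (C.right i j))
          (C.value x (i + 1))
          (C.gatherAdd i (C.left i) (C.gateWeight i (C.layerPoint r i) (C.sumcheckPoint r i))
            fun j => C.value x (i + 1) (C.right i j)) (C.bits (i + 1))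
          (fun k => C.sumcheckPoint r i (C.bits i + k)) κ)) ++
      (((List.range (C.bits (i + 1))).map fun κ => (List.range 3).map (scCoeff
          (C.gatherMul i (C.right i) (C.gateWeight' i (C.layerPoint r i) (C.sumcheckPoint r i))
            fun _ => mleE (C.bits (i + 1)) (C.value x (i + 1))
              fun k => C.sumcheckPoint r i (C.bits i + k))
          (C.value x (i + 1))
          (C.gatherAdd i (C.right i) (C.gateWeight' i (C.layerPoint r i) (C.sumcheckPoint r i))
            fun _ => mleE (C.bits (i + 1)) (C.value x (i + 1))
              fun k => C.sumcheckPoint r i (C.bits i + k)) (C.bits (i + 1))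
          (fun k => C.sumcheckPoint r i (C.bits i + C.bits (i + 1) + k)) κ)) ++
      [(List.range (C.bits (i + 1) + 1)).map (C.linePoly x r i).coeff])) := by
  have hN : C.rounds i = C.bits i + (C.bits (i + 1) + C.bits (i + 1)) := by
    unfold rounds; omega
  have h3 : ∀ (p : Polynomial K) (f : ℕ → K), (∀ e < 3, p.coeff e = f e) →
      (List.range 3).map p.coeff = (List.range 3).map f := fun p f h =>
    List.map_congr_left fun e he => h e (List.mem_range.1 he)
  rw [iterMsgs, hN, List.range_add, List.range_add, List.map_append, List.map_append, List.map_map,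
    List.map_append, List.map_map, List.map_map, List.append_assoc, List.append_assoc]
  congr 1
  · refine List.map_congr_left fun κ hκ => h3 _ _ fun e he => ?_
    rw [honestRound, C.roundPoly_layerPoly_p x hi (List.mem_range.1 hκ),
      scPoly_coeff _ _ _ _ _ _ he]
  congr 1
  · refine List.map_congr_left fun κ hκ => h3 _ _ fun e he => ?_
    rw [honestRound, C.roundPoly_layerPoly_left x hi (List.mem_range.1 hκ),
      scPoly_coeff _ _ _ _ _ _ he]
  congr 1
  · refine List.map_congr_left fun κ hκ => h3 _ _ fun e he => ?_
    simp only [Function.comp_apply]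
    rw [honestRound, ← add_assoc, C.roundPoly_layerPoly_right x hi (List.mem_range.1 hκ),
      scPoly_coeff _ _ _ _ _ _ he]

/-- The invariant of the iterations of the prover. -/
structure ProverInv (C : LayeredCircuit n) (x : Fin n → K) (r : ℕ → K) (i : ℕ) (a : Store K) :
    Prop where
  depth : a.int .depth = C.depth
  base : a.int .base = C.above i
  imem : a.imem = fun k => C.code.getD k 0
  val : ∀ i' ≤ C.depth, ∀ j < C.width i', a.arr .val (C.above i' + j) = C.value x i' j
  Z : ∀ k < C.bits i, a.arr .Z k = C.layerPoint r i k
  recv : numReceived a.trace = C.offset i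

theorem LayeredCircuit.above_succ (i : ℕ) : C.above (i + 1) = C.above i + C.width i :=
  Finset.sum_range_succ ..

theorem LayeredCircuit.code_width (C : LayeredCircuit n) {i : ℕ} (hi : i ≤ C.depth) :
    C.code.getD (1 + i) 0 = C.width i := by
  simp only [code, List.cons_append]
  rw [add_comm 1 i, List.getD_cons_succ, List.getD_append _ _ _ _ (by simp; omega),
    getD_map_range _ _ (by omega)]

theorem LayeredCircuit.length_gateList (C : LayeredCircuit n) (i : ℕ) :
    ((List.range (C.width i)).flatMap fun j =>
      [(C.isMul i j).toNat, C.left i j, C.right i j]).length = 3 * C.width i := by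
  rw [length_flatMap_range]; simp [mul_comm]

/-- The description of gate `j` of layer `i` follows the depth, the `depth + 1` widths, and the
three numbers for each of the earlier gates. -/
theorem LayeredCircuit.code_gate (C : LayeredCircuit n) {i j e : ℕ} (hi : i < C.depth)
    (hj : j < C.width i) (he : e < 3) :
    C.code.getD (C.depth + 2 + 3 * (C.above i + j) + e) 0 =
      [(C.isMul i j).toNat, C.left i j, C.right i j].getD e 0 := by
  simp only [code, List.cons_append]
  rw [show C.depth + 2 + 3 * (C.above i + j) + e =
      C.depth + 1 + (3 * C.above i + (3 * j + e)) + 1 by ring, List.getD_cons_succ,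
    List.getD_append_right _ _ _ _ (by simp)]
  simp only [List.length_map, List.length_range, Nat.add_sub_cancel_left]
  have h1 : 3 * C.above i = ∑ i' ∈ Finset.range i, ((List.range (C.width i')).flatMap fun j =>
      [(C.isMul i' j).toNat, C.left i' j, C.right i' j]).length := by
    rw [above, Finset.mul_sum]
    exact Finset.sum_congr rfl fun i' _ => (C.length_gateList i').symm
  have h2 : 3 * j = ∑ j' ∈ Finset.range j,
      [(C.isMul i j').toNat, C.left i j', C.right i j'].length := by
    simp [mul_comm]
  rw [h1, getD_flatMap_range _ _ hi (by rw [C.length_gateList]; omega), h2,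
    getD_flatMap_range _ _ hj (by simpa using he)]

theorem proverIter_spec (hpeer : E.peer = challengePeer r) (hW : E.Bd W) (hb : IterBound C i W)
    (hi : i < C.depth) (hl : a.int .layer = i) (hI : ProverInv C x r i a) :
    Tr E proverIter a fun t a' =>
      t ≤ 10000 * (2 ^ C.bits i + 2 ^ C.bits (i + 1) * (C.bits (i + 1) + 1)) ∧
      a'.int .layer = i ∧ ProverInv C x r (i + 1) a' ∧
      a'.trace = a.trace ++ conv r (C.offset i) (C.iterMsgs x r i) := by
  have hBp := hW.1
  have hMp := hW.2
  have hb2 := hb.h2'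
  have hb' := hb
  obtain ⟨h1, h2, h3, h4, h5, h6⟩ := hb
  have hwu : C.width i ≤ 2 ^ C.bits i := C.width_le_two_pow i
  have hwv : C.width (i + 1) ≤ 2 ^ C.bits (i + 1) := C.width_le_two_pow (i + 1)
  have hN : C.rounds i = C.bits i + C.bits (i + 1) + C.bits (i + 1) := by
    unfold LayeredCircuit.rounds; omega
  have m1 : a.imem (1 + i) = C.width i := by rw [hI.imem]; exact C.code_width hi.le
  have m2 : a.imem (2 + i) = C.width (i + 1) := by
    rw [hI.imem, show 2 + i = 1 + (i + 1) by ring]; exact C.code_width hi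
  refine Tr.withFrame [.width, .width', .base', .base, .bits, .bits', .size, .size', .idx, .len, .x,
    .k, .y, .e, .pow, .ptr, .j, .kind, .lft, .rgt] [.c0, .c1, .c2, .rho, .wt, .chi, .val1]
    [.A, .B, .C, .R, .E, .D, .G, .Z] [.stream, .trace]
    (by simp [proverIter, logCode, phaseOut, phaseLeft, phaseRight, phaseLine, sumcheck,
      sumcheckRound, fill, gather, lineTable, eqTable, Code.forTo, Code.within, Cmd.within])
    (Tr.seq (Tr.block ?_ ?_))
  · simp [hl, m1, m2, hI.base]; omega
  set a1 : Store K := runs E _ a with ha1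
  have F1 : Frame [.width, .width', .base'] [] [] [] a a1 := runs_frame E _ _ (by simp [Cmd.within])
  have i1 : a1.int .width = C.width i := by simp [ha1, hl, m1]
  have i2 : a1.int .width' = C.width (i + 1) := by simp [ha1, hl, m2]
  have i3 : a1.int .base' = C.above (i + 1) := by
    simp [ha1, hl, m1, m2, hI.base, C.above_succ]
  clear_value a1
  refine Tr.seq ((logCode_spec (by simp) (by simp) (by simp) i1 (by omega)).mono ?_)
  rintro t2 a2 ⟨ht2, F2, b1, b2⟩
  refine Tr.seq ((logCode_spec (by simp) (by simp) (by simp)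
    (by rw [F2.int _ (by simp), i2]) (by omega)).mono ?_)
  rintro t3 a3 ⟨ht3, F3, b3, b4⟩
  have F13 : Frame [.width, .width', .base', .bits, .bits', .size, .size'] [] [] [] a a3 :=
    ((F1.mono (by simp) (by simp) (by simp) (by simp)).trans
      (F2.mono (by simp) (by simp) (by simp) (by simp))).trans
      (F3.mono (by simp) (by simp) (by simp) (by simp))
  have hc : IterCtx C x i a3 := by
    have e1 : a3.imem = fun k => C.code.getD k 0 := by rw [F13.imem (by simp), hI.imem]
    refine ⟨⟨?_, ?_, ?_, ?_, ?_, ?_⟩, ?_, ?_, ?_, b3, ?_, b4, ?_, ?_⟩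
    · rw [F13.int _ (by simp), hI.depth]
    · simp [F3.int, F2.int, i1]
    · rw [F13.int _ (by simp), hI.base]; rfl
    · intro j hj; rw [e1]; exact C.code_gate (e := 0) hi hj (by norm_num)
    · intro j hj; rw [e1]; exact C.code_gate (e := 1) hi hj (by norm_num)
    · intro j hj; rw [e1]; exact C.code_gate (e := 2) hi hj (by norm_num)
    · simp [F3.int, F2.int, i3]
    · simp [F3.int, F2.int, i2]
    · rw [F3.int _ (by simp), b1]; rfl
    · rw [F3.int _ (by simp), b2]; rfl
    · intro j hj; rw [F13.arr _ (by simp)]; exact hI.val i hi.le j hj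
    · intro j hj; rw [F13.arr _ (by simp)]; exact hI.val (i + 1) hi j hj
  refine Tr.seq ((phaseOut_spec hpeer hW hb' hi.le hc
    (fun k hk => by rw [F13.arr _ (by simp), hI.Z k hk])
    (by rw [F13.trace (by simp), hI.recv])).mono ?_)
  rintro t4 a4 ⟨ht4, F4, p1, p2, p3, p4⟩
  have hc4 := hc.frame F4 (by simp) (by simp) (by simp)
  refine Tr.seq ((phaseLeft_spec hpeer hW hb' hi hc4 p1 p2 p3).mono ?_)
  rintro t5 a5 ⟨ht5, F5, q1, q2, q3, q4, q5⟩
  have hc5 := hc4.frame F5 (by simp) (by simp) (by simp)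
  refine Tr.seq ((phaseRight_spec hpeer hW hb' hi hc5
    (fun j hj => by rw [F5.arr _ (by simp), p1 j hj]) q1 q2 q3 q4).mono ?_)
  rintro t6 a6 ⟨ht6, F6, s1, s2, s3, s4⟩
  have hc6 := hc5.frame F6 (by simp) (by simp) (by simp)
  refine Tr.seq ((phaseLine_spec hpeer hW hb' hc6 s1 s2 s3).mono ?_)
  rintro t7 a7 ⟨ht7, F7, u1, u2, u3⟩
  have hc7 := hc6.frame F7 (by simp) (by simp) (by simp)
  refine Tr.block (by simp) fun hF => ⟨?_, ?_, ⟨?_, ?_, ?_, ?_, ?_, ?_⟩, ?_⟩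
  · have hpow1 : 1 ≤ 2 ^ C.bits (i + 1) := Nat.one_le_two_pow
    have hm : 2 ^ C.bits (i + 1) ≤ 2 ^ C.bits (i + 1) * (C.bits (i + 1) + 1) :=
      Nat.le_mul_of_pos_right _ (by omega)
    have e2 : C.bits i = Nat.clog 2 (C.width i) := rfl
    have e3 : C.bits (i + 1) = Nat.clog 2 (C.width (i + 1)) := rfl
    rw [← e2] at ht2
    rw [← e3] at ht3
    simp
    omega
  · rw [hF.int _ (by simp), hl]
  · rw [hF.int _ (by simp), hI.depth]
  · simp [hc7.base']
  · rw [hF.imem (by simp), hI.imem]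
  · rw [hF.arr _ (by simp)]; exact hI.val
  · simpa using u1
  · simpa using u2
  · rw [C.iterMsgs_eq hi, conv_append, conv_append, conv_append]
    simp only [runs, Cmd.run, List.length_map, List.length_range]
    rw [u3, s4, q5, p4, F13.trace (by simp)]
    simp only [List.append_assoc, hN, add_assoc]

end GKR

namespace GKR

/-! ### The stream and the evaluation of the circuit -/

section Stream

variable {K : Type*} [Field K] {E : Env K} {a : Store K}

open IVar FVar in
/-- Executes `p` for every element of the stream, whose index and increment are in `idx` and
`delta`. -/
def streamLoop (p : Code) : Code :=
  .block [.read flag idx delta] ;; .loop flag (p ;; .block [.read flag idx delta])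

/-- Rule for `streamLoop`: the invariant relates what is left of the stream to the store. -/
theorem streamLoop_spec {p : Code} {τ : ℕ} {Q : ℕ → Store K → Prop}
    (I : List (ℕ × K) → Store K → Prop) (h0 : I a.stream a)
    (hs : ∀ j d rest a', a'.stream = (j, d) :: rest → I ((j, d) :: rest) a' →
      Tr E p { a' with
          int := Function.update (Function.update a'.int .flag 1) .idx j
          fld := Function.update a'.fld .delta d
          stream := rest }
        fun t b => t ≤ τ ∧ b.stream = rest ∧ I rest b)
    (hQ : ∀ t a', a'.stream = [] → I [] a' → t ≤ (τ + 10) * a.stream.length + 10 →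
      Q t { a' with int := Function.update a'.int .flag 0 }) :
    Tr E (streamLoop p) a Q := by
  have key : ∀ (l : List (ℕ × K)) (a' : Store K) (t : ℕ), a'.stream = l → I l a' →
      t + (τ + 10) * l.length ≤ (τ + 10) * a.stream.length + 1 →
      Tr E (.loop (IVar.flag : IExp) (p ;; .block [.read .flag .idx .delta]))
        (runs E [.read .flag .idx .delta] a') fun t' => Q (t + t') := by
    intro l
    induction l with
    | nil =>
      intro a' t hl hI ht
      have hr : runs E [.read .flag .idx .delta] a' =
          { a' with int := Function.update a'.int .flag 0 } := by simp [hl]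
      rw [hr]
      refine Tr.loop_false (by simp) (by simp) (hQ _ _ hl hI ?_)
      simp at ht ⊢; omega
    | cons q rest ih =>
      obtain ⟨j, d⟩ := q
      intro a' t hl hI ht
      have hr : runs E [.read .flag .idx .delta] a' = { a' with
          int := Function.update (Function.update a'.int .flag 1) .idx j
          fld := Function.update a'.fld .delta d
          stream := rest } := by simp [hl]
      rw [hr]
      refine Tr.loop_true (by simp) (by simp) (Tr.seq ((hs j d rest a' hl hI).mono ?_))
      rintro t1 b ⟨ht1, hb, hIb⟩
      refine Tr.block (by simp) ?_
      refine (ih b (t + t1 + 4) hb hIb ?_).mono fun t' c hc => ?_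
      · simp [mul_add] at ht ⊢; omega
      · convert hc using 1
        simp; ring
  refine Tr.seq (Tr.block (by simp) ?_)
  refine (key _ a 1 rfl h0 (by omega)).mono fun t' c hc => ?_
  convert hc using 1
  simp

end Stream

section Freq

variable {n : ℕ} {F K : Type*} [Field F] [Field K] [Algebra F K]

theorem freq_cons (p : Fin n × F) (σ : List (Fin n × F)) (i : Fin n) :
    freq (p :: σ) i = (if p.1 = i then p.2 else 0) + freq σ i := by
  unfold freq
  split_ifs with h <;> simp [h]

end Freq

variable {K : Type*} [Field K] {E : Env K} {a : Store K} {n : ℕ} {C : LayeredCircuit n}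
  {x : Fin n → K} {r : ℕ → K} {i W : ℕ}

open IVar FVar in
/-- Adds the updates of the stream to the values from index `base` on, where the values of the input
wires belong. -/
def readInput : Code :=
  streamLoop (.block [.fstore .val (base + idx) (.load .val (base + idx) + delta)])

/-- The updates of a stream as the machine receives them. -/
def updates {n : ℕ} {F : Type*} (K : Type*) [Field F] [Field K] [Algebra F K]
    (σ : List (Fin n × F)) : List (ℕ × K) :=
  σ.map fun p => (p.1.val, algebraMap F K p.2)

theorem readInput_spec {F : Type*} [Field F] [Algebra F K] {σ : List (Fin n × F)} {b : ℕ}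
    (hW : E.Bd W) (hb : a.int .base = b) (h1 : b + n ≤ W) (hs : a.stream = updates K σ)
    (hz : ∀ k, a.arr .val k = 0) :
    Tr E readInput a fun t a' => t ≤ 60 * σ.length + 10 ∧
      Frame [.flag, .idx] [.delta] [.val] [.stream] a a' ∧
      ∀ j, a'.arr .val (b + j) =
        if h : j < n then algebraMap F K (freq σ ⟨j, h⟩) else 0 := by
  refine Tr.withFrame [.flag, .idx] [.delta] [.val] [.stream]
    (by simp [readInput, streamLoop, Code.within, Cmd.within]) ?_
  refine streamLoop_spec (τ := 45) (fun l a' => ∃ σ' : List (Fin n × F), l = updates K σ' ∧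
      a'.int .base = b ∧ ∀ j, a'.arr .val (b + j) + (if h : j < n then
        algebraMap F K (freq σ' ⟨j, h⟩) else 0) =
      if h : j < n then algebraMap F K (freq σ ⟨j, h⟩) else 0) ?_ ?_ ?_
  · exact ⟨σ, hs, hb, fun j => by rw [hz]; simp⟩
  · rintro j d rest a' hst ⟨σ', hl, hb', hv⟩
    cases σ' with
    | nil => simp [updates] at hl
    | cons p σ' =>
      simp [updates] at hl
      obtain ⟨⟨rfl, rfl⟩, rfl⟩ := hl
      have hp := p.1.isLt
      refine Tr.block ?_ ?_
      · simp [hb', hW.idx (by omega : b + p.1.val ≤ W)]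
        have := hW.1
        omega
      · simp [hb']
        refine ⟨σ', rfl, fun j => ?_⟩
        rw [← hv j]
        by_cases hj : j = p.1
        · subst hj
          simp [freq_cons]; ring
        · have hne : ∀ h, p.1 ≠ ⟨j, h⟩ := fun h hh => hj (by rw [hh])
          rw [Function.update_of_ne (by omega)]
          simp [freq_cons, hne]
  · rintro t a' hst ⟨σ', hl, hb', hv⟩ ht hF
    have : σ' = [] := by
      cases σ' with
      | nil => rfl
      | cons p σ' => simp [updates] at hl
    subst this
    refine ⟨?_, hF, fun j => ?_⟩
    · rw [hs] at ht; simp [updates] at ht; omega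
    · rw [← hv j]; simp [freq]

open IVar FVar in
/-- Evaluates the circuit layer by layer. -/
def evaluate : Code :=
  .forTo k depth (
    .block [.iset layer (depth - 1 - k), .iset base' base, .iset width (.load (1 + layer)),
      .iset base (base - width)] ;;
    .forTo j width (
      .block [.iset ptr (depth + 2 + 3 * (base + j)), .iset kind (.load ptr),
        .iset lft (.load (ptr + 1)), .iset rgt (.load (ptr + 2))] ;;
      .ite kind
        (.block [.fstore .val (base + j) (.load .val (base' + lft) * .load .val (base' + rgt))])
        (.block [.fstore .val (base + j) (.load .val (base' + lft) + .load .val (base' + rgt))])))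

theorem LayeredCircuit.above_mono {i i' : ℕ} (h : i ≤ i') : C.above i ≤ C.above i' :=
  Finset.sum_le_sum_of_subset (Finset.range_subset_range.2 h)

theorem LayeredCircuit.size_eq : C.size = C.above C.depth + n := by
  rw [size, Finset.sum_range_succ, C.width_depth]; rfl

theorem evaluate_spec (hW : E.Bd W) (hW' : C.depth + 2 + 3 * C.size ≤ W)
    (hd : a.int .depth = C.depth) (hb : a.int .base = C.above C.depth)
    (hm : a.imem = fun k => C.code.getD k 0)
    (hv : ∀ j < n, a.arr .val (C.above C.depth + j) = C.value x C.depth j) :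
    Tr E evaluate a fun t a' => t ≤ 500 * C.size + 20 ∧
      Frame [.k, .j, .layer, .base, .base', .width, .ptr, .kind, .lft, .rgt] [] [.val] [] a a' ∧
      a'.int .base = 0 ∧
      ∀ i' ≤ C.depth, ∀ j < C.width i', a'.arr .val (C.above i' + j) = C.value x i' j := by
  obtain ⟨hWB, hWM⟩ := hW
  have hS := C.size_eq
  refine Tr.forTo [.k, .j, .layer, .base, .base', .width, .ptr, .kind, .lft, .rgt] [] [.val] []
    C.depth (fun κ => 300 * C.width (C.depth - 1 - κ) + 100)
    (fun κ a' => a'.int .base = C.above (C.depth - κ) ∧ ∀ i', C.depth - κ ≤ i' → i' ≤ C.depth →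
      ∀ j < C.width i', a'.arr .val (C.above i' + j) = C.value x i' j)
    (by simp [Code.forTo, Code.within, Cmd.within]) (by simp) (by omega) (by omega) ?_ ?_ ?_ ?_
  · simp [hb]
    intro i' h1 h2 j hj
    obtain rfl : i' = C.depth := by omega
    exact hv j (by rwa [C.width_depth] at hj)
  · intro κ a' _ _ hF _
    simp [hF.int, hd]
  · rintro κ a' hκ hk hF ⟨hba, hI⟩
    obtain ⟨i, hi⟩ : ∃ i, i = C.depth - 1 - κ := ⟨_, rfl⟩
    have e1 : C.depth - κ = i + 1 := by omega
    have e2 : C.depth - (κ + 1) = i := by omega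
    have hid : i < C.depth := by omega
    rw [e1] at hba hI
    have hm' : a'.imem = fun k => C.code.getD k 0 := by rw [hF.imem (by simp), hm]
    have hwi : a'.imem (1 + i) = C.width i := by rw [hm']; exact C.code_width hid.le
    have hab : C.above (i + 1) ≤ C.above C.depth := C.above_mono hid
    have has := C.above_succ i
    refine Tr.seq (Tr.block ?_ ?_)
    · simp [hF.int, hd, hk, ← hi]; omega
    set a1 : Store K := runs E _ a' with ha1
    have F1 : Frame [.layer, .base', .width, .base] [] [] [] a' a1 :=
      runs_frame E _ _ (by simp [Cmd.within])
    have i1 : a1.int .width = C.width i := by simp [ha1, hF.int, hd, hk, ← hi, hwi]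
    have i2 : a1.int .base' = C.above (i + 1) := by simp [ha1, hba]
    have i3 : a1.int .base = C.above i := by
      simp [ha1, hF.int, hd, hk, ← hi, hwi, hba, has]
    have i4 : a1.int .depth = C.depth := by simp [ha1, hF.int, hd]
    have i5 : a1.int .k = κ := by simp [ha1, hk]
    clear_value a1
    refine Tr.forTo [.j, .ptr, .kind, .lft, .rgt] [] [.val] [] (C.width i) (fun _ => 200)
      (fun υ b => (∀ j < υ, b.arr .val (C.above i + j) = C.value x i j) ∧
        ∀ k, C.above (i + 1) ≤ k → b.arr .val k = a'.arr .val k)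
      (by simp [Code.within, Cmd.within]) (by simp) (by omega) (by omega) ?_ ?_ ?_ ?_
    · simp [F1.arr]
    · intro υ b _ _ hFb _
      simp [hFb.int, i1]
    · rintro υ b hυ hj hFb ⟨j1, j2⟩
      have g1 : b.imem (C.depth + 2 + 3 * (C.above i + υ)) = (C.isMul i υ).toNat := by
        rw [hFb.imem (by simp), F1.imem (by simp), hm']
        exact C.code_gate (e := 0) hid hυ (by norm_num)
      have g2 : b.imem (C.depth + 2 + 3 * (C.above i + υ) + 1) = C.left i υ := by
        rw [hFb.imem (by simp), F1.imem (by simp), hm']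
        exact C.code_gate (e := 1) hid hυ (by norm_num)
      have g3 : b.imem (C.depth + 2 + 3 * (C.above i + υ) + 2) = C.right i υ := by
        rw [hFb.imem (by simp), F1.imem (by simp), hm']
        exact C.code_gate (e := 2) hid hυ (by norm_num)
      have c1 : b.int .depth = C.depth := by simp [hFb.int, i4]
      have c2 : b.int .base = C.above i := by simp [hFb.int, i3]
      have c3 : b.int .base' = C.above (i + 1) := by simp [hFb.int, i2]
      have hl := C.left_lt i hid υ hυ
      have hr := C.right_lt i hid υ hυ
      have hab2 : C.above (i + 1) + C.width (i + 1) ≤ C.size := by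
        rw [← C.above_succ]
        exact C.above_mono (by omega : i + 1 + 1 ≤ C.depth + 1)
      have v1 : b.arr .val (C.above (i + 1) + C.left i υ) = C.value x (i + 1) (C.left i υ) := by
        rw [j2 _ (by omega), hI _ (by omega) (by omega) _ hl]
      have v2 : b.arr .val (C.above (i + 1) + C.right i υ) = C.value x (i + 1) (C.right i υ) := by
        rw [j2 _ (by omega), hI _ (by omega) (by omega) _ hr]
      have hfin : ∀ b' : Store K, b'.int .j = υ →
          b'.arr .val = Function.update (b.arr .val) (C.above i + υ) (C.value x i υ) →
          b'.int .j = υ ∧ (∀ j < υ + 1, b'.arr .val (C.above i + j) = C.value x i j) ∧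
            ∀ k, C.above (i + 1) ≤ k → b'.arr .val k = a'.arr .val k := by
        intro b' hbj hbv
        simp only [hbv]
        refine ⟨hbj, fun j hj => ?_, fun k hk => ?_⟩
        · by_cases h : j = υ
          · rw [h, Function.update_self]
          · rw [Function.update_of_ne (by omega), j1 j (by omega)]
        · rw [Function.update_of_ne (by omega), j2 k hk]
      refine Tr.seq (Tr.block ?_ (Tr.ite (by simp) (fun h => Tr.block ?_ ⟨by simp, ?_⟩)
        fun h => Tr.block ?_ ⟨by simp, ?_⟩))
      · simp [c1, c2, hj]; omega
      · simp [c1, c2, c3, hj, g2, g3, Env.Idx]; omega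
      · have hmul : C.isMul i υ = true := by simpa [c1, c2, hj, g1] using h
        refine hfin _ (by simp [hj]) ?_
        rw [C.value_of_lt x hid hυ]
        simp [c1, c2, c3, hj, g2, g3, v1, v2, hmul]
      · simp [c1, c2, c3, hj, g2, g3, Env.Idx]; omega
      · have hmul : C.isMul i υ = false := by simpa [c1, c2, hj, g1] using h
        refine hfin _ (by simp [hj]) ?_
        rw [C.value_of_lt x hid hυ]
        simp [c1, c2, c3, hj, g2, g3, v1, v2, hmul]
    · rintro t b hj hFb ⟨j1, j2⟩ ht
      simp at ht
      refine ⟨?_, ?_, ?_, ?_⟩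
      · simp [← hi]; omega
      · simp [hFb.int, i5]
      · simp [hFb.int, i3, e2]
      · intro i' hi1 hi2 j hj
        rw [e2] at hi1
        rcases hi1.eq_or_lt with rfl | hlt
        · exact j1 j hj
        · simp only
          rw [j2 _ ((C.above_mono hlt).trans (by omega)), hI i' hlt hi2 j hj]
  · rintro t a' hk hF ⟨hba, hI⟩ ht
    refine ⟨?_, hF, ?_, fun i' hi' j hj => hI i' (by omega) hi' j hj⟩
    · have h1 : ∑ κ ∈ Finset.range C.depth, (300 * C.width (C.depth - 1 - κ) + 100 + 12) ≤
          ∑ κ ∈ Finset.range C.depth, 412 * C.width (C.depth - 1 - κ) := by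
        refine Finset.sum_le_sum fun κ hκ => ?_
        have := C.width_pos (i := C.depth - 1 - κ) (by omega)
        omega
      rw [Finset.sum_range_reflect (fun κ => 412 * C.width κ), ← Finset.mul_sum] at h1
      have h2 : ∑ κ ∈ Finset.range C.depth, C.width κ = C.above C.depth := rfl
      simp at ht
      rw [h2] at h1
      omega
    · rw [hba]; simp [LayeredCircuit.above]

open IVar FVar in
/-- The honest prover. The values of all gates are kept in `val`, in the order of the list of
gates. -/
def proverCode : Code :=
  .block [.iset depth (.load 0), .iset base 0] ;;
  .forTo k depth (.block [.iset base (base + .load (1 + k))]) ;;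
  readInput ;; evaluate ;; .block [.send (.load .val 0)] ;;
  .forTo layer depth proverIter

end GKR

namespace GKR

/-! ### The prover -/

theorem conv_eq_flatMap {K : Type*} (r : ℕ → K) (L : List (List K)) : ∀ k : ℕ,
    conv r k L = (List.range L.length).flatMap fun j =>
      (L.getD j []).map Event.send ++ [Event.recv (r (k + j))] := by
  induction L with
  | nil => simp [conv]
  | cons m L ih =>
    intro k
    rw [List.length_cons, List.range_succ_eq_map]
    simp [conv, ih, List.flatMap_map, add_assoc, add_comm 1]

theorem conv_modifyHead {K : Type*} (r : ℕ → K) (c : K) {L : List (List K)} (hL : L ≠ []) :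
    conv r 0 (L.modifyHead (c :: ·)) = Event.send c :: conv r 0 L := by
  cases L with
  | nil => exact absurd rfl hL
  | cons m L => rfl

namespace LayeredCircuit

variable {n : ℕ} (C : LayeredCircuit n)

theorem width_le_size {i : ℕ} (hi : i ≤ C.depth) : C.width i ≤ C.size :=
  Finset.single_le_sum (f := C.width) (fun _ _ => Nat.zero_le _) (Finset.mem_range.2 (by omega))

theorem above_le_size {i : ℕ} (hi : i ≤ C.depth + 1) : C.above i ≤ C.size := C.above_mono hi

theorem depth_lt_size : C.depth < C.size := by
  have : ∑ i ∈ Finset.range (C.depth + 1), 1 ≤ C.size :=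
    Finset.sum_le_sum fun i hi => C.width_pos (by have := Finset.mem_range.1 hi; omega)
  simpa using this

theorem two_le_size : 2 ≤ C.size := by
  have := C.depth_lt_size
  have := C.depth_pos
  omega

theorem one_le_log : 1 ≤ Nat.log 2 C.size :=
  Nat.log_pos (by norm_num) C.two_le_size

theorem log_lt_size : Nat.log 2 C.size < C.size :=
  Nat.log_lt_self _ (by have := C.two_le_size; omega)

theorem bits_le {i : ℕ} (hi : i ≤ C.depth) : C.bits i ≤ Nat.log 2 C.size + 1 := by
  refine Nat.clog_le_of_le_pow ?_
  exact (C.width_le_size hi).trans (Nat.lt_pow_succ_log_self (by norm_num) _).le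

theorem numChallenges_pos : 0 < C.numChallenges := by
  have : C.offset 1 ≤ C.offset C.depth := C.offset_mono C.depth_pos
  rw [offset_succ] at this
  unfold numChallenges
  omega

/-- All arrays have at most `12 S ^ 2` entries; the largest one holds the polynomials of
`lineTable`. -/
theorem iterBound {i : ℕ} (hi : i < C.depth) : IterBound C i (12 * C.size ^ 2) := by
  have h2 := C.two_le_size
  have a1 := C.two_pow_bits_le hi.le
  have a2 := C.two_pow_bits_le (i := i + 1) hi
  have a3 := C.width_le_size hi.le
  have a4 := C.width_le_size (i := i + 1) hi
  have a5 := C.above_le_size (i := i + 1) (by omega)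
  have a6 := C.above_succ i
  have a7 := C.depth_lt_size
  have a8 := C.bits_le (i := i + 1) hi
  have a9 := C.log_lt_size
  have a10 := C.one_le_log
  have a11 : C.bits i < 2 ^ C.bits i := Nat.lt_two_pow_self
  have a12 : C.bits (i + 1) < 2 ^ C.bits (i + 1) := Nat.lt_two_pow_self
  have hs : 2 * C.size ≤ C.size ^ 2 := by nlinarith
  constructor
  · omega
  · have : C.bits (i + 1) + 1 ≤ 2 * C.size := by omega
    calc 2 * 2 ^ C.bits (i + 1) * (C.bits (i + 1) + 1) ≤ (4 * C.size) * (2 * C.size) := by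
          apply Nat.mul_le_mul <;> omega
      _ ≤ 12 * C.size ^ 2 := by nlinarith
  all_goals omega

/-- The addresses of the entries of the arrays are polynomial in the size; the exponent is
generous. -/
theorem bound_le : 16 * (12 * C.size ^ 2 + 1) ≤ C.size ^ 10 := by
  have h2 := C.two_le_size
  have h3 : 2 ^ 8 ≤ C.size ^ 8 := Nat.pow_le_pow_left h2 8
  calc 16 * (12 * C.size ^ 2 + 1) ≤ 2 ^ 8 * C.size ^ 2 := by nlinarith
    _ ≤ C.size ^ 8 * C.size ^ 2 := Nat.mul_le_mul_right _ h3
    _ = C.size ^ 10 := by ring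

/-- All numbers in the description of the circuit are at most its size. -/
theorem code_le (k : ℕ) : C.code.getD k 0 ≤ C.size := by
  have hs := C.two_le_size
  by_cases hk : k < C.code.length
  · rw [List.getD_eq_getElem _ _ hk]
    have hmem := List.getElem_mem hk
    generalize C.code[k] = m at hmem
    simp only [code, List.cons_append, List.mem_cons, List.mem_append, List.mem_map, List.mem_range,
      List.mem_flatMap, List.not_mem_nil, or_false] at hmem
    rcases hmem with rfl | ⟨i, hi, rfl⟩ | ⟨i, hi, j, hj, rfl | rfl | rfl⟩
    · exact C.depth_lt_size.le
    · exact C.width_le_size (by omega)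
    · have := Bool.toNat_le (C.isMul i j); omega
    · exact (C.left_lt i hi j hj).le.trans (C.width_le_size hi)
    · exact (C.right_lt i hi j hj).le.trans (C.width_le_size hi)
  · rw [List.getD_eq_default _ _ (by omega)]; omega

end LayeredCircuit

/-- The steps of the iterations of the prover add up to `O(S log S)`. -/
theorem LayeredCircuit.sum_iteration_cost_le {n : ℕ} (C : LayeredCircuit n) (c : ℕ) :
    ∑ i ∈ Finset.range C.depth,
      (c * (2 ^ C.bits i + 2 ^ C.bits (i + 1) * (C.bits (i + 1) + 1))) ≤
        8 * c * (C.size * Nat.log 2 C.size) := by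
  set L := Nat.log 2 C.size with hL
  have hL1 : 1 ≤ L := C.one_le_log
  have h1 : ∀ i ∈ Finset.range C.depth,
      c * (2 ^ C.bits i + 2 ^ C.bits (i + 1) * (C.bits (i + 1) + 1)) ≤
        c * (2 * C.width i + 6 * L * C.width (i + 1)) := fun i hi => by
    have hi := Finset.mem_range.1 hi
    have a1 := C.two_pow_bits_le hi.le
    have a2 := C.two_pow_bits_le (i := i + 1) hi
    have a3 := C.bits_le (i := i + 1) hi
    have : 2 ^ C.bits (i + 1) * (C.bits (i + 1) + 1) ≤ (2 * C.width (i + 1)) * (3 * L) :=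
      Nat.mul_le_mul a2 (by omega)
    apply Nat.mul_le_mul_left
    nlinarith
  refine (Finset.sum_le_sum h1).trans ?_
  rw [← Finset.mul_sum, Finset.sum_add_distrib, ← Finset.mul_sum, ← Finset.mul_sum]
  have h2 : ∑ i ∈ Finset.range C.depth, C.width i ≤ C.size := C.above_mono (by omega)
  have h3 : ∑ i ∈ Finset.range C.depth, C.width (i + 1) ≤ C.size := by
    rw [size, Finset.sum_range_succ']; omega
  have h4 : 2 * ∑ i ∈ Finset.range C.depth, C.width i + 6 * L * ∑ i ∈ Finset.range C.depth,
      C.width (i + 1) ≤ 2 * C.size * L + 6 * L * C.size := by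
    apply Nat.add_le_add
    · calc _ ≤ 2 * C.size * 1 := by omega
        _ ≤ 2 * C.size * L := Nat.mul_le_mul_left _ hL1
    · exact Nat.mul_le_mul_left _ h3
  calc _ ≤ c * (2 * C.size * L + 6 * L * C.size) := Nat.mul_le_mul_left _ h4
    _ = _ := by ring

variable {n : ℕ} {F K : Type*} [Field F] [Field K] [Algebra F K]

theorem proverCode_spec (C : LayeredCircuit n) (σ : List (Fin n × F)) (r : ℕ → K) {E : Env K}
    (hpeer : E.peer = challengePeer r) (hW : E.Bd (12 * C.size ^ 2)) {a : Store K}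
    (hm : a.imem = fun k => C.code.getD k 0)
    (hv : ∀ k, a.arr .val k = 0) (hs : a.stream = updates K σ) (ht : a.trace = []) :
    Tr E proverCode a fun t a' =>
      t ≤ 100000 * (C.size * Nat.log 2 C.size) + 100000 * σ.length ∧
      a'.trace = proverTrace C (fun i => algebraMap F K (freq σ i)) r := by
  set x : Fin n → K := fun i => algebraMap F K (freq σ i) with hx
  have hS2 := C.two_le_size
  have hS := C.size_eq
  have hdS := C.depth_lt_size
  have hsq : 2 * C.size ≤ C.size ^ 2 := by nlinarith
  have hBp := hW.1
  have hMp := hW.2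
  refine Tr.seq (Tr.block (by simp; omega) ?_)
  set a1 : Store K := runs E _ a with ha1
  have F1 : Frame [.depth, .base] [] [] [] a a1 := runs_frame E _ _ (by simp [Cmd.within])
  have hd1 : a1.int .depth = C.depth := by simp [ha1, hm, LayeredCircuit.code]
  have hb1 : a1.int .base = 0 := by simp [ha1]
  clear_value a1
  refine Tr.seq (Tr.forTo [.k, .base] [] [] [] C.depth (fun _ => 20)
    (fun κ b => b.int .base = C.above κ) (by simp [Code.within, Cmd.within]) (by simp) (by omega)
    (by omega) ?_ ?_ ?_ ?_)
  · simp [hb1, LayeredCircuit.above]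
  · intro κ b _ _ hF _
    simp [hF.int, hd1]
  · intro κ b hκ hk hF hI
    have e1 : b.imem (1 + κ) = C.width κ := by
      rw [hF.imem (by simp), F1.imem (by simp), hm]; exact C.code_width hκ.le
    have := C.above_le_size (i := κ + 1) (by omega)
    rw [C.above_succ] at this
    refine Tr.block ?_ ?_
    · simp [hI, hk, e1]; omega
    · simp [hI, hk, e1, C.above_succ]
  rintro t2 a2 - F2 hb2 ht2
  have hv2 : a2.arr .val = a.arr .val := by rw [F2.arr _ (by simp), F1.arr _ (by simp)]
  refine Tr.seq ((readInput_spec (σ := σ) hW hb2 (by omega)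
    (by rw [F2.stream (by simp), F1.stream (by simp), hs]) (fun k => by rw [hv2, hv])).mono ?_)
  rintro t3 a3 ⟨ht3, F3, hv3⟩
  refine Tr.seq ((evaluate_spec (C := C) (x := x) hW (by omega) (by simp [F3.int, F2.int, hd1])
    (by simp [F3.int, hb2])
    (by rw [F3.imem (by simp), F2.imem (by simp), F1.imem (by simp), hm]) ?_).mono ?_)
  · intro j hj
    rw [hv3 j, dif_pos hj, LayeredCircuit.value, Nat.sub_self, LayeredCircuit.upValue, dif_pos hj]
  rintro t4 a4 ⟨ht4, F4, hb4, hv4⟩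
  refine Tr.seq (Tr.block (by simp [Env.Idx]; omega) ?_)
  set a5 : Store K := runs E _ a4 with ha5
  have F5 : Frame [] [] [] [.trace, .stream] a4 a5 := runs_frame E _ _ (by simp [Cmd.within])
  have ht5 : a5.trace = [.send (C.value x 0 0)] := by
    have h0 := hv4 0 (by omega) 0 (by rw [C.width_zero]; omega)
    simp [LayeredCircuit.above] at h0
    simp [ha5, F4.trace, F3.trace, F2.trace, F1.trace, ht, h0]
  clear_value a5
  -- an iteration takes `10000 * (…)` steps, and the loop adds `12`
  refine Tr.forTo_time C.depth (fun i t b =>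
    t ≤ ∑ i ∈ Finset.range i,
      (10012 * (2 ^ C.bits i + 2 ^ C.bits (i + 1) * (C.bits (i + 1) + 1))) + 3 ∧
    b.int .layer = i ∧ ProverInv C x r i b ∧
    b.trace = .send (C.value x 0 0) :: conv r 0 ((List.range i).flatMap (C.iterMsgs x r)))
    (by omega) (by omega) ?_ ?_ ?_ ?_
  · refine ⟨by simp, by simp, ⟨?_, ?_, ?_, ?_, ?_, ?_⟩, ?_⟩
    · simp [F5.int, F4.int, F3.int, F2.int, hd1]
    · simp [F5.int, hb4, LayeredCircuit.above]
    · simp [F5.imem, F4.imem, F3.imem, F2.imem, F1.imem, hm]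
    · simpa [F5.arr] using hv4
    · simp
    · simp [ht5, LayeredCircuit.offset]
    · simp [ht5, conv]
  · rintro i t b hi ⟨-, hl, hI, -⟩
    exact ⟨hl, by simp [hI.depth]⟩
  · rintro i t b hi ⟨htb, hl, hI, hT⟩
    refine (proverIter_spec hpeer hW (C.iterBound hi) hi hl hI).mono ?_
    rintro t' b' ⟨ht', hl', hI', hT'⟩
    refine ⟨hl', ?_, by simp, ⟨?_, ?_, ?_, ?_, ?_, ?_⟩, ?_⟩
    · rw [Finset.sum_range_succ]
      have : 1 ≤ 2 ^ C.bits i := Nat.one_le_two_pow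
      simp; omega
    · simp [hI'.depth]
    · simp [hI'.base]
    · exact hI'.imem
    · exact hI'.val
    · exact hI'.Z
    · exact hI'.recv
    · have hlen : ((List.range i).flatMap (C.iterMsgs x r)).length = C.offset i := by
        rw [length_flatMap_range]; simp [LayeredCircuit.offset]
      simp only [hT', hT, List.range_succ, List.flatMap_append, conv_append, hlen]
      simp
  · rintro t b ⟨htb, hl, hI, hT⟩
    have hsum := C.sum_iteration_cost_le 10012
    have hL := C.one_le_log
    have hSL : C.size ≤ C.size * Nat.log 2 C.size := Nat.le_mul_of_pos_right _ hL
    refine ⟨?_, ?_⟩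
    · simp at ht2 ⊢
      omega
    · have hlen := C.length_flatMap_iterMsgs x r
      have hne : (List.range C.depth).flatMap (C.iterMsgs x r) ≠ [] := by
        intro h
        rw [h] at hlen
        have := C.numChallenges_pos
        simp at hlen
        omega
      rw [hT, ← conv_modifyHead r _ hne, ← C.honestMsgs_eq, conv_eq_flatMap, proverTrace]
      have hl2 : (C.honestMsgs x r).length = C.numChallenges := by
        rw [C.honestMsgs_eq]; simpa using hlen
      rw [hl2]
      simp

/-- The prover is correct and efficient on the machine itself: the addresses and integers in use are
bounded by a power of the size. -/
theorem implementsProver (C : LayeredCircuit n) (σ : List (Fin n × F)) :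
    ImplementsProver proverCode.compile C K σ
      (100000 * (C.size * Nat.log 2 C.size) + 100000 * σ.length) (C.size ^ 10) := by
  intro r
  have hB := C.bound_le
  have hn : n ≤ C.size := by have := C.size_eq; omega
  have hS2 := C.two_le_size
  have hsq : 2 * C.size ≤ C.size ^ 2 := by nlinarith
  set E : Env K := ⟨challengePeer r, C.size ^ 10, C.size ^ 10⟩ with hE
  set s0 : State K := State.start n C.code σ fun _ => 0 with hs0
  have hInv : E.Inv s0 := by
    refine ⟨Nat.zero_le _, fun i => ?_, fun i => ?_, fun p hp => ?_, Nat.zero_le _, ?_⟩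
    · change Function.update (fun _ => 0) 0 n i ≤ C.size ^ 10
      rw [Function.update_apply]
      split <;> omega
    · change C.code.getD i 0 ≤ C.size ^ 10
      have := C.code_le i
      omega
    · change p.1 ≤ C.size ^ 10
      simp [hs0, State.start] at hp
      obtain ⟨i, d, -, rfl⟩ := hp
      simp only
      omega
    · change 1 ≤ C.size ^ 10
      omega
  obtain ⟨t, a', hex, ht, htr⟩ := proverCode_spec C σ r (E := E) (a := s0.view) rfl ⟨hB, hB⟩
    rfl (fun _ => rfl) rfl rfl
  obtain ⟨s', h1, h2, h3, h4⟩ := hex.compile_spec s0 hInv rfl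
  refine ⟨s', h1, ?_, ?_, h2.peak⟩
  · rw [← htr, ← h3]; rfl
  · rw [h4]
    change 0 + t ≤ _
    omega

end GKR

namespace GKR

/-! ### Simulation of the transducer -/

/-- The code `f k`, where `k ≤ m` is the value of `e`; the difference `m + 1 - e` is truncated, and
zero only for `e = m + 1`. -/
def switch (e : IExp) (f : ℕ → Code) : ℕ → Code
  | 0 => f 0
  | m + 1 => .ite (.const (m + 1) - e) (switch e f m) (f (m + 1))

/-- A move of the head whose position is in the variable `v`. -/
def Move.exp : Move → IVar → IExp
  | .left, v => v - 1
  | .stay, v => v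
  | .right, v => v + 1

open IVar in
/-- Processes a printed symbol: `cur` is the number that is being printed, `cnt` the number of
numbers printed before, and number `query` is kept in `ans`. Of the two truncated differences of
`cnt` and `query`, one is not zero unless they are equal. -/
def emit : Option OutSym → Code
  | none => .block []
  | some (.bit b) => .block [.iset cur (2 * cur + .const b.toNat)]
  | some .sep => .ite ((cnt - query) + (query - cnt)) (.block []) (.block [.iset ans cur]) ;;
      .block [.iset cnt (cnt + 1), .iset cur 0]

open IVar in
/-- Performs a transition. Truncated differences compute the minimum of the new position of the
input head and `n + 1`, and the maximum of `wmax` and the new position of the work head. -/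
def act {s g : ℕ} : Option (Fin s × Fin g × Move × Move × Option OutSym) → Code
  | none => .block [.iset run 0]
  | some (q, b, mi, mw, o) =>
      .block [.iset state (.const q), .istore whead (.const b), .iset ihead (mi.exp ihead),
        .iset ihead (ihead - (ihead - (n + 1))), .iset whead (mw.exp whead),
        .iset wmax (wmax + (whead - wmax))] ;; emit o

/-- The input symbols are numbered from `0` to `2`. -/
def InSym.ofIdx : ℕ → InSym
  | 0 => .leftEnd
  | 1 => .one
  | _ => .rightEnd

open IVar in
/-- One step of the transducer: a branch for each state, input symbol and work symbol. The input
symbol under the head is determined by truncated differences: `1 - (1 - m)` is `0` for `m = 0` and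
`1` otherwise. -/
def stepCode (M : Transducer) : Code :=
  switch state (fun q =>
    switch ((1 - (1 - ihead)) + (1 - (1 - (ihead - n)))) (fun b =>
      switch (.load whead) (fun g =>
        act (M.trans (Fin.ofNat _ q) (InSym.ofIdx b) (Fin.ofNat _ g))) M.numSymbols) 2)
    M.numStates

open IVar in
/-- Computes number `query` of the output of the transducer, by running it from the start. The
work tape is the integer memory; the cells up to `wmax` have been visited. -/
def queryCode (M : Transducer) : Code :=
  .forTo x (wmax + 1) (.block [.istore x 0]) ;;
  .block [.iset state 0, .iset ihead 0, .iset whead 0, .iset wmax 0, .iset cnt 0, .iset cur 0,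
    .iset ans 0, .iset run 1] ;;
  .loop run (stepCode M)

open IVar in
/-- Stores number `e` of the output of the transducer in `v`. -/
def ask (M : Transducer) (e : IExp) (v : IVar) : Code :=
  .block [.iset query e] ;; queryCode M ;; .block [.iset v ans]

/-- The effect of a printed symbol on the number of complete numbers, the number that is being
printed, and the answer to the query `q`. -/
def decStep (q : ℕ) : ℕ × ℕ × ℕ → OutSym → ℕ × ℕ × ℕ
  | (c, u, a), .bit b => (c, 2 * u + b.toNat, a)
  | (c, u, a), .sep => (c + 1, 0, if c = q then u else a)

/-- The bits of a number change only the number that is being printed. -/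
theorem foldl_decStep_bits (q c u a : ℕ) (l : List Bool) :
    (l.map OutSym.bit).foldl (decStep q) (c, u, a) =
      (c, l.foldl (fun u b => 2 * u + b.toNat) u, a) := by
  induction l generalizing u with
  | nil => rfl
  | cons b l ih => simp [decStep, ih]

theorem foldl_bits_mono (l : List Bool) (u : ℕ) :
    u ≤ l.foldl (fun u b => 2 * u + b.toNat) u := by
  induction l generalizing u with
  | nil => exact le_rfl
  | cons b l ih => exact le_trans (by show u ≤ 2 * u + b.toNat; omega) (ih _)

theorem foldl_bits_reverse (m : ℕ) :
    (Nat.bits m).reverse.foldl (fun u b => 2 * u + b.toNat) 0 = m := by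
  rw [List.foldl_reverse]
  induction m using Nat.binaryRec' with
  | zero => simp
  | bit b m h ih => rw [Nat.bits_append_bit m b h, List.foldr_cons, ih, Nat.bit_val]

/-- On the complete output the decoder finds the answer to the query. -/
theorem foldl_decStep_printed (q : ℕ) (l : List ℕ) : ∀ c a : ℕ,
    (printed l).foldl (decStep q) (c, 0, a) =
      (c + l.length, 0, if c ≤ q ∧ q < c + l.length then l.getD (q - c) 0 else a) := by
  induction l with
  | nil => intro c a; simp [printed]
  | cons m l ih =>
    intro c a
    rw [printed, List.flatMap_cons, List.foldl_append, List.foldl_append, foldl_decStep_bits,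
      foldl_bits_reverse]
    simp only [List.foldl_cons, List.foldl_nil, decStep]
    refine (ih (c + 1) _).trans ?_
    refine Prod.ext (by simp; ring) (Prod.ext rfl ?_)
    simp only [List.length_cons]
    rcases lt_trichotomy c q with h | rfl | h
    · obtain ⟨e, rfl⟩ : ∃ e, q = c + 1 + e := ⟨q - (c + 1), by omega⟩
      have e1 : c + 1 + e - (c + 1) = e := by omega
      have e2 : c + 1 + e - c = e + 1 := by omega
      have h1 : (c + 1 ≤ c + 1 + e ∧ c + 1 + e < c + 1 + l.length) ↔ e < l.length := by omega
      have h2 : (c ≤ c + 1 + e ∧ c + 1 + e < c + (l.length + 1)) ↔ e < l.length := by omega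
      have h3 : ¬ c = c + 1 + e := by omega
      rw [e1, e2, List.getD_cons_succ]
      simp only [h1, h2, if_neg h3]
    · rw [if_neg (by omega), if_pos rfl, if_pos (by omega)]
      simp
    · rw [if_neg (by omega), if_neg (by omega), if_neg (by omega)]

/-- On a part of the output the numbers of the decoder stay below the bounds for the numbers that
are printed, so that the simulation needs no large integers. -/
theorem foldl_decStep_le (q B : ℕ) (l : List ℕ) (hl : ∀ m ∈ l, m ≤ B) : ∀ (c a : ℕ)
    (p : List OutSym), p <+: printed l →
      (p.foldl (decStep q) (c, 0, a)).1 ≤ c + l.length ∧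
      (p.foldl (decStep q) (c, 0, a)).2.1 ≤ B := by
  induction l with
  | nil =>
    intro c a p hp
    obtain rfl : p = [] := by simpa [printed] using hp
    simp
  | cons m l ih =>
    intro c a p hp
    rw [printed, List.flatMap_cons] at hp
    rcases List.prefix_or_prefix_of_prefix hp (List.prefix_append _ _) with h | ⟨p', rfl⟩
    · -- the number `m` is being printed
      rcases List.prefix_concat_iff.1 h with rfl | h
      · rw [List.foldl_append, foldl_decStep_bits, foldl_bits_reverse]
        simp [decStep]
      · obtain ⟨p'', rfl, hp''⟩ : ∃ p'', p = p''.map OutSym.bit ∧ p'' <+: (Nat.bits m).reverse := by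
          refine ⟨(Nat.bits m).reverse.take p.length, ?_, List.take_prefix _ _⟩
          rw [List.map_take]
          exact (List.prefix_iff_eq_take.1 h)
        rw [foldl_decStep_bits]
        obtain ⟨t, ht⟩ := hp''
        have h1 := foldl_bits_reverse m
        rw [← ht, List.foldl_append] at h1
        have h2 := foldl_bits_mono t (p''.foldl (fun u b => 2 * u + b.toNat) 0)
        have h3 := hl m (by simp)
        refine ⟨by simp, ?_⟩
        simp only
        omega
    · rw [List.prefix_append_right_inj] at hp
      rw [List.foldl_append, List.foldl_append, foldl_decStep_bits]
      simp only [List.foldl_cons, List.foldl_nil, decStep, List.length_cons]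
      obtain ⟨h1, h2⟩ := ih (fun m hm => hl m (by simp [hm])) (c + 1)
        (if c = q then (Nat.bits m).reverse.foldl (fun u b => 2 * u + b.toNat) 0 else a) p' hp
      exact ⟨by omega, h2⟩

variable {K : Type*} [Field K] {E : Env K} {a : Store K}

theorem switch_spec {e : IExp} {f : ℕ → Code} {m k : ℕ} {Q : Store K → Prop} (hk : k ≤ m)
    (he : e.eval a = k) (hok : e.Ok E a) (hm : m ≤ E.B) (h : Tr E (f k) a fun _ => Q) :
    Tr E (switch e f m) a fun _ => Q := by
  induction m with
  | zero =>
    obtain rfl : k = 0 := by omega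
    exact h
  | succ m ih =>
    refine Tr.ite (by simp [hok]; omega) (fun hc => ?_) fun hc => ?_
    · exact ih (by simp [he] at hc; omega) (by omega)
    · simp [he] at hc
      obtain rfl : k = m + 1 := by omega
      exact h

theorem emit_spec {o : Option OutSym} {c u v q : ℕ} (hq : a.int .query = q) (h1 : a.int .cnt = c)
    (h2 : a.int .cur = u) (h3 : a.int .ans = v) (hu : 2 * u + 2 ≤ E.B) (hc : c + q + 1 ≤ E.B) :
    Tr E (emit o) a fun _ a' => (a'.int .cnt, a'.int .cur, a'.int .ans) =
      o.toList.foldl (decStep q) (c, u, v) := by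
  match o with
  | none => exact Tr.block trivial (by simp [h1, h2, h3])
  | some (.bit b) =>
    have := Bool.toNat_le b
    refine Tr.block ?_ ?_
    · simp [h2]; omega
    · simp [h1, h2, h3, decStep]
  | some .sep =>
    refine Tr.seq (Tr.ite ?_ (fun h => Tr.block trivial (Tr.block ?_ ?_))
      fun h => Tr.block (by simp) (Tr.block ?_ ?_))
    · simp [h1, hq]; omega
    · simp [h1]; omega
    · simp [h1, hq] at h
      simp [h1, h3, decStep]; omega
    · simp [h1]; omega
    · simp [h1, hq] at h
      simp [h1, h2, decStep]; omega

/-- The store represents the configuration `c` of the transducer; `s` bounds the positions of the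
head of the work tape. -/
structure Sim (M : Transducer) (n s q : ℕ) (c : M.Config) (a : Store K) : Prop where
  n : a.int .n = n
  query : a.int .query = q
  state : a.int .state = c.state
  ihead : a.int .ihead = c.inputHead
  whead : a.int .whead = c.workHead
  tape : ∀ p, a.imem p = c.tape p
  dec : (a.int .cnt, a.int .cur, a.int .ans) = c.out.foldl (decStep q) (0, 0, 0)
  le : c.workHead ≤ a.int .wmax
  lt : a.int .wmax < s
  zero : ∀ p, a.int .wmax < p → a.imem p = 0

theorem Move.eval_exp (m : Move) (v : IVar) : (m.exp v).eval a = m.apply (a.int v) := by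
  cases m <;> simp [Move.exp, Move.apply]

theorem Move.ok_exp (m : Move) (v : IVar) (h : a.int v + 1 ≤ E.B) : (m.exp v).Ok E a := by
  cases m <;> simp [Move.exp] <;> omega

theorem stepCode_spec {M : Transducer} {n s q : ℕ} {c : M.Config} (h : Sim M n s q c a)
    (hh : c.inputHead ≤ n + 1) (hB : M.numStates + M.numSymbols + n + s + q + 3 ≤ E.B)
    (hM : s ≤ E.M) (hcur : 2 * a.int .cur + 2 ≤ E.B) (hcnt : a.int .cnt + q + 1 ≤ E.B)
    (hs : ∀ c', M.step n c = some c' → c'.workHead < s) :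
    Tr E (stepCode M) a fun _ a' => match M.step n c with
      | none => a'.int .run = 0 ∧ Sim M n s q c a'
      | some c' => a'.int .run = a.int .run ∧ Sim M n s q c' a' := by
  obtain ⟨hn, hq, hst, hih, hwh, htp, hdec, hle, hlt, hz⟩ := h
  have hin : ((1 - (1 - (IVar.ihead : IExp))) +
      (1 - (1 - ((IVar.ihead : IExp) - (IVar.n : IExp)))) : IExp).eval a = if c.inputHead = 0 then 0 else if c.inputHead ≤ n then 1 else 2 := by
    simp [hih, hn]
    split_ifs <;> omega
  refine switch_spec (k := c.state) (by have := c.state.isLt; omega) (by simp [hst]) (by simp)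
    (by omega) ?_
  refine switch_spec (k := if c.inputHead = 0 then 0 else if c.inputHead ≤ n then 1 else 2)
    (by split_ifs <;> omega) hin (by simp; omega) (by omega) ?_
  refine switch_spec (k := c.tape c.workHead) (by have := (c.tape c.workHead).isLt; omega)
    (by simp [hwh, htp]) (by simp [hwh]; omega) (by omega) ?_
  have hsym : InSym.ofIdx (if c.inputHead = 0 then 0 else if c.inputHead ≤ n then 1 else 2) =
      Transducer.inputCell n c.inputHead := by
    unfold Transducer.inputCell
    split_ifs <;> rfl
  have hfin : ∀ {k : ℕ} (i : Fin (k + 1)), Fin.ofNat (k + 1) i.val = i := fun i => by simp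
  rw [hsym, hfin, hfin]
  unfold Transducer.step at hs ⊢
  generalize M.trans c.state (Transducer.inputCell n c.inputHead) (c.tape c.workHead) = tr at hs ⊢
  match tr with
  | none =>
    refine Tr.block (by simp) ⟨by simp, ?_⟩
    constructor <;> simp [hn, hq, hst, hih, hwh, hdec, hle, hlt]
    · exact htp
    · exact hz
  | some (q', b, mi, mw, o) =>
    simp only [Option.map_some] at hs ⊢
    have hw' := hs _ rfl
    simp only at hw'
    have hb := b.isLt
    have hq' := q'.isLt
    refine Tr.seq (Tr.withFrame [.state, .ihead, .whead, .wmax] [] [] [.imem]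
      (by simp [Code.within, Cmd.within]) (Tr.block ?_ ?_))
    · simp only [Oks, Cmd.Ok, IExp.ok_const, IExp.ok_var, and_true, true_and]
      refine ⟨by omega, ⟨by omega, by simp [hwh]; omega⟩,
        Move.ok_exp _ _ (by simp [hih]; omega), ?_, Move.ok_exp _ _ (by simp [hwh]; omega), ?_⟩
      · simp [hn]; omega
      · simp [Move.eval_exp, hwh]; omega
    intro F1
    set a1 : Store K := runs E _ a with ha1
    have i1 : a1.int .state = q' := by simp [ha1]
    have i2 : a1.int .ihead = min (mi.apply c.inputHead) (n + 1) := by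
      simp [ha1, Move.eval_exp, hih, hn]; omega
    have i3 : a1.int .whead = mw.apply c.workHead := by simp [ha1, Move.eval_exp, hwh]
    have i4 : a1.int .wmax = max (a.int .wmax) (mw.apply c.workHead) := by
      simp [ha1, Move.eval_exp, hwh]; omega
    have i5 : a1.imem = Function.update a.imem c.workHead b := by simp [ha1, hwh]
    clear_value a1
    refine Tr.withFrame [.cnt, .cur, .ans] [] [] []
      (by rcases o with _ | _ | _ <;> simp [emit, Code.within, Cmd.within])
      ((emit_spec (o := o) (q := q) (c := a.int .cnt) (u := a.int .cur) (v := a.int .ans)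
        (by simp [F1.int, hq]) (by simp [F1.int]) (by simp [F1.int]) (by simp [F1.int]) (by omega)
        (by omega)).mono ?_)
    intro t a2 hd F2
    refine ⟨by simp [F2.int, F1.int], ?_⟩
    constructor
    · simp [F2.int, F1.int, hn]
    · simp [F2.int, F1.int, hq]
    · simp [F2.int, i1]
    · simp [F2.int, i2]
    · simp [F2.int, i3]
    · intro p
      rw [F2.imem (by simp), i5]
      simp only [Function.update_apply]
      split_ifs <;> simp [htp]
    · rw [hd, hdec, List.foldl_append]
    · simp [F2.int, i4]
    · simp [F2.int, i4]; omega
    · intro p hp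
      simp [F2.int, i4] at hp
      rw [F2.imem (by simp), i5, Function.update_of_ne (by omega), hz p hp.1]

theorem Transducer.out_prefix (M : Transducer) (n : ℕ) {t t' : ℕ} (h : t ≤ t') :
    (M.run n t).out <+: (M.run n t').out := by
  induction t', h using Nat.le_induction with
  | base => exact List.prefix_rfl
  | succ t' _ ih =>
    refine ih.trans ?_
    rw [run]
    cases hs : M.step n (M.run n t') with
    | none => exact List.prefix_rfl
    | some c =>
      unfold step at hs
      obtain ⟨⟨q, b, mi, mw, o⟩, -, rfl⟩ := Option.map_eq_some_iff.1 hs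
      exact List.prefix_append _ _

theorem Transducer.inputHead_le (M : Transducer) (n t : ℕ) : (M.run n t).inputHead ≤ n + 1 := by
  induction t with
  | zero => exact Nat.zero_le _
  | succ t ih =>
    rw [run]
    cases hs : M.step n (M.run n t) with
    | none => exact ih
    | some c =>
      unfold step at hs
      obtain ⟨⟨q, b, mi, mw, o⟩, -, rfl⟩ := Option.map_eq_some_iff.1 hs
      exact min_le_right _ _

theorem Transducer.run_of_halted (M : Transducer) (n : ℕ) {t t' : ℕ} (h : t ≤ t')
    (hs : M.step n (M.run n t) = none) : M.run n t' = M.run n t := by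
  induction t', h using Nat.le_induction with
  | base => rfl
  | succ t' _ ih => rw [run, ih, hs]; rfl

/-- The work tape in the integer memory is blank beyond `wmax`. -/
structure TapeInv (n s : ℕ) (a : Store K) : Prop where
  n : a.int .n = n
  lt : a.int .wmax < s
  zero : ∀ p, a.int .wmax < p → a.imem p = 0

/-- The environment suffices for the simulation of a transducer that prints the list `l` in space
`s`. -/
structure SimBound (M : Transducer) (n s : ℕ) (l : List ℕ) (E : Env K) : Prop where
  b1 : M.numStates + M.numSymbols + n + s + 2 * l.length + 5 ≤ E.B
  b2 : ∀ m ∈ l, 2 * m + 2 ≤ E.B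
  b3 : s ≤ E.M

/-- The answer to a query is found in the space of the transducer, which can be reused for the next
query. The number of steps is not bounded. -/
theorem queryCode_spec {M : Transducer} {n s q : ℕ} {l : List ℕ}
    (hM : M.PrintsInSpace n (printed l) s) (hE : SimBound M n s l E) (hI : TapeInv n s a)
    (hq : a.int .query = q) (hql : q < l.length) :
    Tr E (queryCode M) a fun _ a' => TapeInv n s a' ∧ a'.int .ans = l.getD q 0 := by
  obtain ⟨⟨T, hT, hout⟩, hsp⟩ := hM
  obtain ⟨hB, hl, hEM⟩ := hE
  obtain ⟨hn, hlt, hz⟩ := hI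
  refine Tr.seq (Tr.forTo_untimed [.x] [] [] [.imem] (a.int .wmax + 1)
    (fun κ b => ∀ p, p < κ ∨ a.int .wmax < p → b.imem p = 0)
    (by simp [Code.within, Cmd.within]) (by simp) (by omega) (by omega) ?_ ?_ ?_ ?_)
  · intro p hp
    exact hz p (by omega)
  · intro κ b _ _ hF _
    simp [hF.int]; omega
  · intro κ b hκ hk hF hI
    refine Tr.block ?_ ?_
    · simp [hk]; omega
    · simp only [runs, Cmd.run, IExp.eval_var, hk, IExp.eval_ofNat, true_and]
      intro p hp
      rw [Function.update_apply]
      split_ifs with h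
      · rfl
      · exact hI p (by omega)
  rintro a1 - F1 hz1
  have hz1 : ∀ p, a1.imem p = 0 := fun p => hz1 p (by omega)
  refine Tr.seq (Tr.block (by simp; omega) ?_)
  set a2 : Store K := runs E _ a1 with ha2
  have hsim : Sim M n s q (M.run n 0) a2 := by
    have := hsp 0
    constructor <;> simp [ha2, F1.int, hn, hq, hz1, Transducer.run, Transducer.start] at this ⊢
    omega
  have hrun : a2.int .run ≠ 0 := by simp [ha2]
  clear_value a2
  have hfin : ∀ b : Store K, Sim M n s q (M.run n T) b →
      TapeInv n s b ∧ b.int .ans = l.getD q 0 := by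
    intro b hb
    refine ⟨⟨hb.n, hb.lt, hb.zero⟩, ?_⟩
    have h := hb.dec
    rw [hout, foldl_decStep_printed] at h
    have h3 : b.int .ans = _ := congrArg (fun p => p.2.2) h
    rw [h3, if_pos (by omega), Nat.sub_zero]
  have key : ∀ m t (b : Store K), t + m = T → Sim M n s q (M.run n t) b → b.int .run ≠ 0 →
      Tr E (.loop (IVar.run : IExp) (stepCode M)) b fun _ b' =>
        TapeInv n s b' ∧ b'.int .ans = l.getD q 0 := by
    intro m
    induction m with
    | zero =>
      rintro t b htT hb hr
      obtain rfl : t = T := by omega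
      refine Tr.loop_true (by simp) (by simpa using hr) ?_
      have hp := foldl_decStep_le q (E.B / 2 - 1) l (fun m hm => by have := hl m hm; omega) 0 0
        (M.run n t).out (by rw [hout])
      rw [← hb.dec] at hp
      refine (stepCode_spec hb (M.inputHead_le n t) (by omega) hEM (by simp at hp; omega)
        (by simp at hp; omega) (fun c' hc' => ?_)).mono fun _ b' hb' => ?_
      · rw [hT] at hc'; cases hc'
      · rw [hT] at hb'
        exact Tr.loop_false (by simp) (by simpa using hb'.1) (hfin _ hb'.2)
    | succ m ih =>
      rintro t b htm hb hr
      refine Tr.loop_true (by simp) (by simpa using hr) ?_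
      have hp := foldl_decStep_le q (E.B / 2 - 1) l (fun m hm => by have := hl m hm; omega) 0 0
        (M.run n t).out (by rw [← hout]; exact M.out_prefix n (by omega))
      rw [← hb.dec] at hp
      refine (stepCode_spec hb (M.inputHead_le n t) (by omega) hEM (by simp at hp; omega)
        (by simp at hp; omega) (fun c' hc' => ?_)).mono fun _ b' hb' => ?_
      · have := hsp (t + 1)
        rwa [Transducer.run, hc'] at this
      · cases hs : M.step n (M.run n t) with
        | none =>
          rw [hs] at hb'
          refine Tr.loop_false (by simp) (by simpa using hb'.1) (hfin _ ?_)
          rw [M.run_of_halted n (by omega : t ≤ T) hs]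
          exact hb'.2
        | some c' =>
          rw [hs] at hb'
          refine ih (t + 1) b' (by omega) ?_ (by rw [hb'.1]; exact hr)
          rw [Transducer.run, hs]
          exact hb'.2
  exact key T 0 a2 (by omega) hsim hrun

theorem stepCode_within (M : Transducer) :
    (stepCode M).within [.state, .ihead, .whead, .wmax, .cnt, .cur, .ans, .run] [] [] [.imem] := by
  have hsw : ∀ (e : IExp) (f : ℕ → Code) (m : ℕ), (∀ k, (f k).within
      [.state, .ihead, .whead, .wmax, .cnt, .cur, .ans, .run] [] [] [.imem]) →
      (switch e f m).within
        [.state, .ihead, .whead, .wmax, .cnt, .cur, .ans, .run] [] [] [.imem] := by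
    intro e f m h
    induction m with
    | zero => exact h 0
    | succ m ih => simp [switch, Code.within, ih, h]
  refine hsw _ _ _ fun q => hsw _ _ _ fun b => hsw _ _ _ fun g => ?_
  generalize M.trans _ _ _ = o
  rcases o with _ | ⟨q', b, mi, mw, _ | _ | _⟩ <;> simp [act, emit, Code.within, Cmd.within]

/-- The variables that are changed by a query, other than the one that receives the answer. -/
def queryVars : List IVar :=
  [.query, .x, .state, .ihead, .whead, .wmax, .cnt, .cur, .ans, .run]

theorem Code.within_mono {iv iv' : List IVar} {fv fv' : List FVar} {ar ar' : List Arr}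
    {cs cs' : List Comp} (h₁ : iv ⊆ iv') (h₂ : fv ⊆ fv') (h₃ : ar ⊆ ar') (h₄ : cs ⊆ cs') {p : Code}
    (h : p.within iv fv ar cs = true) : p.within iv' fv' ar' cs' = true := by
  induction p with
  | block l =>
    rw [Code.within, List.all_eq_true] at h ⊢
    intro c hc
    have := h c hc
    cases c <;> simp only [Cmd.within, Bool.and_eq_true, decide_eq_true_eq] at this ⊢ <;> tauto
  | seq p q ih₁ ih₂ => simp only [Code.within, Bool.and_eq_true] at h ⊢; tauto
  | ite c p q ih₁ ih₂ => simp only [Code.within, Bool.and_eq_true] at h ⊢; tauto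
  | loop c p ih => exact ih h

theorem ask_within (M : Transducer) (e : IExp) {v : IVar} {iv : List IVar} {fv : List FVar}
    {ar : List Arr} {cs : List Comp} (h₁ : v :: queryVars ⊆ iv) (h₂ : .imem ∈ cs) :
    (ask M e v).within iv fv ar cs = true := by
  refine Code.within_mono (iv := v :: queryVars) (fv := []) (ar := []) (cs := [.imem]) h₁ (by simp)
    (by simp) (by simpa using h₂) ?_
  simp [ask, queryCode, Code.forTo, Code.within, Cmd.within, queryVars]
  exact Code.within_mono (by simp) (by simp) (by simp) (by simp) (stepCode_within M)

theorem ask_spec {M : Transducer} {n s q : ℕ} {l : List ℕ} {e : IExp} {v : IVar}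
    (hM : M.PrintsInSpace n (printed l) s) (hE : SimBound M n s l E) (hI : TapeInv n s a)
    (hok : e.Ok E a) (hq : e.eval a = q) (hql : q < l.length) (hv : v ∉ IVar.n :: queryVars) :
    Tr E (ask M e v) a fun _ a' => Frame (v :: queryVars) [] [] [.imem] a a' ∧ TapeInv n s a' ∧
      a'.int v = l.getD q 0 := by
  simp [queryVars] at hv
  refine Tr.withFrame (v :: queryVars) [] [] [.imem] (ask_within M e (fun _ h => h) (by simp))
    (Tr.seq (Tr.block (by simpa using hok) (Tr.seq ?_)))
  refine (queryCode_spec (q := q) hM hE ⟨?_, ?_, ?_⟩ ?_ hql).mono ?_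
  · simpa using hI.n
  · simpa using hI.lt
  · simpa using hI.zero
  · simp [hq]
  · rintro t a' ⟨⟨i1, i2, i3⟩, h2⟩
    refine Tr.block (by simp) fun hF => ⟨hF, ⟨?_, ?_, ?_⟩, ?_⟩
    · simpa [Ne.symm hv.1] using i1
    · simpa [Ne.symm hv.2.2.2.2.2.2.1] using i2
    · simpa [Ne.symm hv.2.2.2.2.2.2.1] using i3
    · simpa using h2

end GKR

namespace GKR

/-! ### Subroutines of the verifier -/

open IVar FVar in
/-- Fills the array `X` up to index `len` with challenges. -/
def tossAll (X : Arr) : Code := .forTo k (len + 1) (.block [.toss rho, .fstore X k rho])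

open IVar in
/-- Multiplies `chi` by the indicator of the label `x` of `size` bits, evaluated at the point that
is stored in `X` from index `y` on. -/
def mulIndicator (X : Arr) : Code :=
  .forTo k size (.ite (x % 2) (.block [.fset FVar.chi (FVar.chi * .load X (y + k))])
    (.block [.fset FVar.chi (FVar.chi * (1 - .load X (y + k)))]) ;; .block [.iset x (x / 2)])

open IVar in
/-- Stores in `Z` the point of the line that is given by the challenges of an iteration, which are
stored in `X`. -/
def storePoint (X : Arr) : Code :=
  .forTo k bits' (.block [.fstore .Z k (.load X (bits + k) +
    .load X len * (.load X (bits + bits' + k) - .load X (bits + k)))])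

open IVar FVar in
/-- Computes `β` at the points stored in `Z` and `R`. -/
def computeBeta : Code :=
  .block [.fset FVar.beta 1] ;;
  .forTo k bits (.block [.fset FVar.beta (FVar.beta * (.load .Z k * .load .R k +
    (1 - .load .Z k) * (1 - .load .R k)))])

open IVar FVar in
/-- Computes the extension of the frequency vector at the point stored in `Z`. By linearity, an
update `(i, δ)` adds `δ` times the indicator of `i`. -/
def readStream : Code :=
  .block [.fset acc 0] ;;
  streamLoop (.block [.fset FVar.chi 1, .iset x idx, .iset y 0, .iset size bits'] ;;
    mulIndicator .Z ;; .block [.fset acc (acc + delta * FVar.chi)])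

open IVar in
/-- Obtains the parameters of iteration number `layer` from the transducer. -/
def layerSetup (M : Transducer) : Code :=
  ask M (1 + layer) width ;; ask M (2 + layer) width' ;; logCode bits pow width ;;
  logCode bits' pow width' ;; .block [.iset len (bits + 2 * bits')]

open IVar FVar in
/-- Computes the extensions of the wiring predicates of a layer at the point stored in `R`. The
description of its gates starts at number `gates` of the output of the transducer. -/
def wiringSums (M : Transducer) : Code :=
  .block [.fset addSum 0, .fset mulSum 0] ;;
  .forTo j width (
    ask M (gates + 3 * j) kind ;; ask M (gates + 3 * j + 1) lft ;; ask M (gates + 3 * j + 2) rgt ;;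
    .block [.fset FVar.chi 1, .iset x j, .iset y 0, .iset size bits] ;; mulIndicator .R ;;
    .block [.iset x lft, .iset y bits, .iset size bits'] ;; mulIndicator .R ;;
    .block [.iset x rgt, .iset y (bits + bits'), .iset size bits'] ;; mulIndicator .R ;;
    .ite kind (.block [.fset mulSum (mulSum + FVar.chi)])
      (.block [.fset addSum (addSum + FVar.chi)]))

variable {K : Type*} [Field K] {E : Env K} {a : Store K} {W : ℕ}

theorem tossAll_spec {X : Arr} {m : ℕ} (hW : E.Bd W) (hm : a.int .len = m) (h1 : m ≤ W) :
    Tr E (tossAll X) a fun _ a' => Frame [.k] [.rho] [X] [.coins] a a' ∧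
      (∀ j < m + 1, a'.arr X j = a.coins j) ∧ ∀ j, a'.coins j = a.coins (m + 1 + j) := by
  have hB := hW.1
  refine Tr.forTo_untimed [.k] [.rho] [X] [.coins] (m + 1)
    (fun κ b => (∀ j < κ, b.arr X j = a.coins j) ∧ ∀ j, b.coins j = a.coins (κ + j))
    (by simp [Code.within, Cmd.within]) (by simp) (by omega) (by omega) (by simp) ?_ ?_ ?_
  · intro κ b _ _ hF _
    simp [hF.int, hm]; omega
  · rintro κ b hκ hk hF ⟨i1, i2⟩
    refine Tr.block (by simpa [hk] using hW.idx (by omega)) ?_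
    simp [hk, i2]
    refine ⟨fun j hj => ?_, fun j => by congr 1; omega⟩
    rw [Function.update_apply]
    split_ifs with h
    · rw [h]
    · exact i1 j (by omega)
  · rintro b - F ⟨i1, i2⟩
    exact ⟨F, i1, i2⟩

theorem mulIndicator_spec {X : Arr} {m o l : ℕ} (hW : E.Bd W) (hl : a.int .x = l)
    (ho : a.int .y = o) (hm : a.int .size = m) (h1 : o + m ≤ W) :
    Tr E (mulIndicator X) a fun t a' => t ≤ 100 * m + 20 ∧ Frame [.k, .x] [.chi] [] [] a a' ∧
      a'.fld .chi = a.fld .chi * chiE m l fun k => a.arr X (o + k) := by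
  have hB := hW.1
  refine Tr.forTo [.k, .x] [.chi] [] [] m (fun _ => 80)
    (fun κ b => b.int .x = l / 2 ^ κ ∧
      b.fld .chi = a.fld .chi * chiE κ l fun k => a.arr X (o + k))
    (by simp [Code.within, Cmd.within]) (by simp) (by omega) (by omega) (by simp [hl]) ?_ ?_ ?_
  · intro κ b _ _ hF _
    simp [hF.int, hm]
  · rintro κ b hκ hk hF ⟨i1, i2⟩
    have hidx : E.Idx (o + κ) := hW.idx (by omega)
    have hx : l / 2 ^ κ / 2 = l / 2 ^ (κ + 1) := by rw [Nat.div_div_eq_div_mul, pow_succ]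
    refine Tr.seq (Tr.ite (by simp; omega) (fun h => Tr.block ?_ (Tr.block (by simp; omega) ?_))
      fun h => Tr.block ?_ (Tr.block (by simp; omega) ?_))
    · simp [hF.int, ho, hk, hidx]; omega
    · simp [i1] at h
      have ht : l.testBit κ = true := by
        rw [Nat.testBit_eq_decide_div_mod_eq]; simp; omega
      simp [hF.int, hF.arr, ho, hk, i1, i2, hx, chiE, Finset.prod_range_succ, ht, mul_assoc]
    · simp [hF.int, ho, hk, hidx]; omega
    · simp [i1] at h
      have ht : l.testBit κ = false := by
        rw [Nat.testBit_eq_decide_div_mod_eq]; simp; omega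
      simp [hF.int, hF.arr, ho, hk, i1, i2, hx, chiE, Finset.prod_range_succ, ht, mul_assoc]
  · rintro t b - F ⟨i1, i2⟩ ht
    refine ⟨?_, F, i2⟩
    simp at ht
    omega

theorem storePoint_spec {X : Arr} (hX : X ≠ .Z) {u v : ℕ} (hW : E.Bd W) (hu : a.int .bits = u)
    (hv : a.int .bits' = v) (hm : a.int .len = u + 2 * v) (h1 : u + 2 * v ≤ W) :
    Tr E (storePoint X) a fun _ a' => Frame [.k] [] [.Z] [] a a' ∧
      ∀ j < v, a'.arr .Z j = a.arr X (u + j) +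
        a.arr X (u + 2 * v) * (a.arr X (u + v + j) - a.arr X (u + j)) := by
  have hB := hW.1
  refine Tr.forTo_untimed [.k] [] [.Z] [] v
    (fun κ b => ∀ j < κ, b.arr .Z j = a.arr X (u + j) +
        a.arr X (u + 2 * v) * (a.arr X (u + v + j) - a.arr X (u + j)))
    (by simp [Code.within, Cmd.within]) (by simp) (by omega) (by omega) (by simp) ?_ ?_ ?_
  · intro κ b _ _ hF _
    simp [hF.int, hv]
  · intro κ b hκ hk hF i1
    have k1 : E.Idx (u + κ) := hW.idx (by omega)
    have k2 : E.Idx (u + v + κ) := hW.idx (by omega)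
    have k3 : E.Idx (u + 2 * v) := hW.idx (by omega)
    have k4 : E.Idx κ := hW.idx (by omega)
    refine Tr.block ?_ ?_
    · simp [hF.int, hu, hv, hm, hk, k1, k2, k3, k4]; omega
    · simp [hF.int, hF.arr, hX, hu, hv, hm, hk]
      intro j hj
      rw [Function.update_apply]
      split_ifs with h
      · rw [h]
      · exact i1 j (by omega)
  · rintro b - F i1
    exact ⟨F, i1⟩

theorem computeBeta_spec {u : ℕ} (hW : E.Bd W) (hu : a.int .bits = u) (h1 : u ≤ W) :
    Tr E computeBeta a fun _ a' => Frame [.k] [.beta] [] [] a a' ∧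
      a'.fld .beta = MvPolynomial.eval (a.arr .R) (beta u (a.arr .Z)) := by
  have hB := hW.1
  refine Tr.withFrame [.k] [.beta] [] []
    (by simp [computeBeta, Code.forTo, Code.within, Cmd.within]) (Tr.seq (Tr.block (by simp) (Tr.forTo_untimed [.k] [.beta] [] [] u
    (fun κ b => b.fld .beta = MvPolynomial.eval (a.arr .R) (beta κ (a.arr .Z)))
    (by simp [Code.within, Cmd.within]) (by simp) (by omega) (by omega) (by simp [beta]) ?_ ?_ ?_)))
  · intro κ b _ _ hF _
    simp [hF.int, hu]
  · intro κ b hκ hk hF i1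
    have k4 : E.Idx κ := hW.idx (by omega)
    refine Tr.block ?_ ?_
    · simp [hk, k4]
    · simp [hF.arr, hk, i1, beta, Finset.prod_range_succ]
  · rintro b - F i1 F'
    exact ⟨F', i1⟩

/-- The extension of a vector to which a multiple of a unit vector is added. -/
theorem mleE_single_add {v i : ℕ} (hi : i < 2 ^ v) (δ : K) (g q : ℕ → K) :
    mleE v (fun j => (if j = i then δ else 0) + g j) q = δ * chiE v i q + mleE v g q := by
  simp only [mleE, add_mul, Finset.sum_add_distrib]
  congr 1
  rw [Finset.sum_eq_single_of_mem i (Finset.mem_range.2 hi)]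
  · simp
  · intro j _ hj
    rw [if_neg hj, zero_mul]

theorem readStream_spec {n : ℕ} {F : Type*} [Field F] [Algebra F K] {σ : List (Fin n × F)} {v : ℕ}
    (hW : E.Bd W) (hv : a.int .bits' = v) (hn : n ≤ 2 ^ v) (h1 : v ≤ W)
    (hs : a.stream = updates K σ) :
    Tr E readStream a fun _ a' =>
      Frame [.flag, .idx, .x, .y, .size, .k] [.chi, .delta, .acc] [] [.stream] a a' ∧
      a'.fld .acc = mleE v (fun j => if h : j < n then algebraMap F K (freq σ ⟨j, h⟩) else 0)
        (a.arr .Z) := by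
  set g : List (Fin n × F) → ℕ → K := fun σ j =>
    if h : j < n then algebraMap F K (freq σ ⟨j, h⟩) else 0 with hg
  have hg0 : g [] = fun _ => 0 := by funext j; simp [hg, freq]
  have hgc : ∀ (p : Fin n × F) (σ : List (Fin n × F)), g (p :: σ) = fun j =>
      (if j = p.1.val then algebraMap F K p.2 else 0) + g σ j := by
    intro p σ
    funext j
    simp only [hg]
    by_cases hj : j = p.1
    · subst hj; simp [freq_cons]
    · have hne : ∀ h, p.1 ≠ ⟨j, h⟩ := fun h hh => hj (by rw [hh])
      simp [freq_cons, hne, hj]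
  have hB := hW.1
  refine Tr.withFrame [.flag, .idx, .x, .y, .size, .k] [.chi, .delta, .acc] [] [.stream]
    (by simp [readStream, streamLoop, mulIndicator, Code.forTo, Code.within, Cmd.within])
    (Tr.seq (Tr.block (by simp) ?_))
  set a1 : Store K := runs E _ a with ha1
  have F1 : Frame [] [.acc] [] [] a a1 := runs_frame E _ _ (by simp [Cmd.within])
  have hacc : a1.fld .acc = 0 := by simp [ha1]
  clear_value a1
  refine streamLoop_spec (τ := 100 * v + 100) (Q := fun _ a' =>
      Frame [.flag, .idx, .x, .y, .size, .k] [.chi, .delta, .acc] [] [.stream] a a' → Frame [.flag, .idx, .x, .y, .size, .k]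
      [.chi, .delta, .acc] [] [.stream] a a' ∧ a'.fld .acc = mleE v (g σ) (a.arr .Z))
    (fun l b => ∃ σ' : List (Fin n × F), l = updates K σ' ∧
      b.int .bits' = v ∧ b.arr .Z = a.arr .Z ∧
      b.fld .acc + mleE v (g σ') (a.arr .Z) = mleE v (g σ) (a.arr .Z)) ?_ ?_ ?_
  · exact ⟨σ, by rw [F1.stream (by simp), hs], by simp [F1.int, hv], F1.arr _ (by simp),
      by rw [hacc, zero_add]⟩
  · rintro j d rest b hst ⟨σ', hl, hb', hZ, hv'⟩
    cases σ' with
    | nil => simp [updates] at hl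
    | cons p σ' =>
      simp [updates] at hl
      obtain ⟨⟨rfl, rfl⟩, rfl⟩ := hl
      have hp := p.1.isLt
      refine Tr.seq (Tr.block (by simp) ?_)
      refine Tr.seq ((mulIndicator_spec (l := p.1) (o := 0) (m := v) hW (by simp) (by simp)
        (by simp [hb']) (by omega)).mono ?_)
      rintro t1 b1 ⟨ht1, F2, hchi⟩
      refine Tr.block (by simp) ⟨?_, ?_, σ', rfl, ?_, ?_, ?_⟩
      · simp; omega
      · simp [F2.stream]
      · simp [F2.int, hb']
      · simp [F2.arr, hZ]
      · rw [← hv', hgc, mleE_single_add (by omega)]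
        simp [F2.fld, hchi, hZ]
        ring
  · rintro t b hst ⟨σ', hl, hb', hZ, hv⟩ ht hF
    have : σ' = [] := by
      cases σ' with
      | nil => rfl
      | cons p σ' => simp [updates] at hl
    subst this
    refine ⟨hF, ?_⟩
    rw [← hv, hg0]
    simp [mleE]

end GKR

namespace GKR

/-! ### The circuit as seen by the verifier -/

theorem LayeredCircuit.length_code {n : ℕ} (C : LayeredCircuit n) :
    C.code.length = C.depth + 2 + 3 * C.above C.depth := by
  simp only [code, List.cons_append, List.length_cons, List.length_append, List.length_map,
    List.length_range, length_flatMap_range (fun i => (List.range (C.width i)).flatMap fun j =>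
      [(C.isMul i j).toNat, C.left i j, C.right i j]), C.length_gateList, above]
  rw [← Finset.mul_sum]
  ring

variable {K : Type*} [Field K] {E : Env K} {a : Store K} {W n s i : ℕ} {M : Transducer}
  {C : LayeredCircuit n}

/-- The transducer `M` prints the description of the circuit `C` in space `s`, and the environment
suffices for the simulation and for entries of arrays up to index `W`. -/
structure VerifierBound (M : Transducer) (C : LayeredCircuit n) (s W : ℕ) (E : Env K) : Prop where
  prints : M.PrintsInSpace n (printed C.code) s
  sim : SimBound M n s C.code E
  arr : E.Bd W
  size : 20 * C.size + 20 ≤ E.B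
  rounds : ∀ i < C.depth, C.rounds i ≤ W

theorem TapeInv.frame {iv : List IVar} {fv : List FVar} {ar : List Arr} {cs : List Comp}
    {a' : Store K} (h : TapeInv n s a) (F : Frame iv fv ar cs a a') (h₁ : .n ∉ iv) (h₂ : .wmax ∉ iv)
    (h₃ : .imem ∉ cs) : TapeInv n s a' := by
  refine ⟨?_, ?_, ?_⟩
  · rw [F.int _ h₁, h.n]
  · rw [F.int _ h₂]; exact h.lt
  · rw [F.int _ h₂, F.imem h₃]; exact h.zero

/-- The parameters of iteration `i` are in the variables. -/
structure LayerVars (C : LayeredCircuit n) (i : ℕ) (a : Store K) : Prop where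
  width : a.int .width = C.width i
  bits : a.int .bits = C.bits i
  bits' : a.int .bits' = C.bits (i + 1)
  len : a.int .len = C.rounds i

theorem LayerVars.frame {iv : List IVar} {fv : List FVar} {ar : List Arr} {cs : List Comp}
    {a' : Store K} (h : LayerVars C i a) (F : Frame iv fv ar cs a a') (h₁ : .width ∉ iv)
    (h₂ : .bits ∉ iv) (h₃ : .bits' ∉ iv) (h₄ : .len ∉ iv) : LayerVars C i a' := by
  refine ⟨?_, ?_, ?_, ?_⟩
  · rw [F.int _ h₁, h.width]
  · rw [F.int _ h₂, h.bits]
  · rw [F.int _ h₃, h.bits']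
  · rw [F.int _ h₄, h.len]

theorem layerSetup_spec (hb : VerifierBound M C s W E) (hi : i < C.depth) (hI : TapeInv n s a)
    (hl : a.int .layer = i) :
    Tr E (layerSetup M) a fun _ a' =>
      Frame (.width :: .width' :: .bits :: .bits' :: .pow :: .len :: queryVars) [] [] [.imem] a a' ∧
      TapeInv n s a' ∧ LayerVars C i a' := by
  have hS := hb.size
  have hdS := C.depth_lt_size
  have hlen := C.length_code
  have w1 := C.width_le_size hi.le
  have w2 := C.width_le_size (i := i + 1) hi
  have b1 := C.bits_le hi.le
  have b2 := C.bits_le (i := i + 1) hi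
  have hL := C.log_lt_size
  refine Tr.withFrame (.width :: .width' :: .bits :: .bits' :: .pow :: .len :: queryVars) [] []
    [.imem] ?_ ?_
  · simp [layerSetup, logCode, Code.within, Cmd.within, queryVars]
    exact ⟨ask_within M _ (by decide) (by decide), ask_within M _ (by decide) (by decide)⟩
  refine Tr.seq ((ask_spec (q := 1 + i) hb.prints hb.sim hI (by simp [hl]; omega) (by simp [hl])
    (by omega) (by simp [queryVars])).mono ?_)
  rintro t1 a1 ⟨F1, I1, e1⟩
  rw [C.code_width hi.le] at e1
  have l1 : a1.int .layer = i := by simp [F1.int, queryVars, hl]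
  refine Tr.seq ((ask_spec (q := 2 + i) hb.prints hb.sim I1 (by simp [l1]; omega) (by simp [l1])
    (by omega) (by simp [queryVars])).mono ?_)
  rintro t2 a2 ⟨F2, I2, e2⟩
  rw [show 2 + i = 1 + (i + 1) by ring, C.code_width hi] at e2
  have e3 : a2.int .width = C.width i := by simp [F2.int, queryVars, e1]
  refine Tr.seq ((logCode_spec (by simp) (by simp) (by simp) e3 (by omega)).mono ?_)
  rintro t3 a3 ⟨-, F3, h3, -⟩
  have e4 : a3.int .width' = C.width (i + 1) := by simp [F3.int, e2]
  refine Tr.seq ((logCode_spec (by simp) (by simp) (by simp) e4 (by omega)).mono ?_)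
  rintro t4 a4 ⟨-, F4, h4, -⟩
  have h3' : a4.int .bits = C.bits i := by simp [F4.int, h3]; rfl
  have h4' : a4.int .bits' = C.bits (i + 1) := h4
  have I4 := (I2.frame F3 (by simp) (by simp) (by simp)).frame F4 (by simp) (by simp) (by simp)
  refine Tr.block (by simp [h3', h4']; omega) fun F => ⟨F, ?_, ?_, ?_, ?_, ?_⟩
  · exact I4.frame (runs_frame (iv := [.len]) (fv := []) (ar := []) (cs := []) E _ _
      (by simp [Cmd.within])) (by simp) (by simp) (by simp)
  · simp [F4.int, F3.int, e3]
  · simp [h3']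
  · simp [h4']
  · simp [h3', h4', LayeredCircuit.rounds]

theorem wiringSums_spec (hb : VerifierBound M C s W E) (hi : i < C.depth) (hI : TapeInv n s a)
    (hv : LayerVars C i a) (hg : a.int .gates = C.depth + 2 + 3 * C.above i) :
    Tr E (wiringSums M) a fun _ a' =>
      Frame (.kind :: .lft :: .rgt :: .y :: .size :: .k :: .j :: queryVars)
        [.chi, .addSum, .mulSum] [] [.imem] a a' ∧
      TapeInv n s a' ∧
      a'.fld .addSum = MvPolynomial.eval (a.arr .R) (C.wiringMLE i false) ∧
      a'.fld .mulSum = MvPolynomial.eval (a.arr .R) (C.wiringMLE i true) := by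
  have hS := hb.size
  have hdS := C.depth_lt_size
  have hlen := C.length_code
  have w1 := C.width_le_size hi.le
  have hW := hb.arr
  have hr : C.rounds i ≤ W := hb.rounds i hi
  have hab := C.above_le_size (i := i + 1) (by omega)
  have hab' := C.above_mono (show i + 1 ≤ C.depth from hi)
  rw [C.above_succ] at hab hab'
  unfold LayeredCircuit.rounds at hr
  have b1 := C.bits_le hi.le
  have b2 := C.bits_le (i := i + 1) hi
  have hL := C.log_lt_size
  set g : ℕ → K := fun j => chiE (C.bits i) j (a.arr .R) *
    (chiE (C.bits (i + 1)) (C.left i j) fun k => a.arr .R (C.bits i + k)) *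
    (chiE (C.bits (i + 1)) (C.right i j) fun k => a.arr .R (C.bits i + C.bits (i + 1) + k)) with hgd
  have hmle : ∀ mul, MvPolynomial.eval (a.arr .R) (C.wiringMLE i mul) =
      ∑ j ∈ Finset.range (C.width i), if C.isMul i j = mul then g j else 0 := by
    intro mul
    rw [← MvPolynomial.aeval_eq_eval]
    exact C.aeval_wiringMLE hi mul _
  refine Tr.withFrame (.kind :: .lft :: .rgt :: .y :: .size :: .k :: .j :: queryVars)
    [.chi, .addSum, .mulSum] [] [.imem] ?_ ?_
  · simp [wiringSums, mulIndicator, Code.forTo, Code.within, Cmd.within, queryVars]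
    exact ⟨ask_within M _ (by decide) (by decide), ask_within M _ (by decide) (by decide),
      ask_within M _ (by decide) (by decide)⟩
  refine Tr.seq (Tr.block (by simp) (Tr.forTo_untimed
    (.kind :: .lft :: .rgt :: .y :: .size :: .k :: .j :: queryVars)
    [.chi, .addSum, .mulSum] [] [.imem] (C.width i)
    (fun κ b => TapeInv n s b ∧
      b.fld .addSum = ∑ j ∈ Finset.range κ, (if C.isMul i j = false then g j else 0) ∧
      b.fld .mulSum = ∑ j ∈ Finset.range κ, (if C.isMul i j = true then g j else 0))
    ?_ (by simp) (by omega) (by omega) ?_ ?_ ?_ ?_))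
  · simp [mulIndicator, Code.forTo, Code.within, Cmd.within, queryVars]
    exact ⟨ask_within M _ (by decide) (by decide), ask_within M _ (by decide) (by decide),
      ask_within M _ (by decide) (by decide)⟩
  · refine ⟨⟨?_, ?_, ?_⟩, ?_⟩
    · simpa using hI.n
    · simpa using hI.lt
    · simpa using hI.zero
    · simp
  · intro κ b _ _ hF _
    simp [hF.int, hv.width, queryVars]
  · rintro κ b hκ hk hF ⟨I0, ha, hm⟩
    have g0 : b.int .gates = C.depth + 2 + 3 * C.above i := by simp [hF.int, hg, queryVars]
    have n0 : b.int .bits = C.bits i := by simp [hF.int, hv.bits, queryVars]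
    have m0 : b.int .bits' = C.bits (i + 1) := by simp [hF.int, hv.bits', queryVars]
    have R0 : b.arr .R = a.arr .R := by simp [hF.arr]
    clear hF
    refine Tr.seq ((ask_spec (q := C.depth + 2 + 3 * (C.above i + κ) + 0) hb.prints hb.sim I0
      (by simp [g0, hk]; omega) (by simp [g0, hk]; ring) (by omega) (by simp [queryVars])).mono ?_)
    rintro t1 a1 ⟨F1, I1, e1⟩
    rw [C.code_gate hi hκ (by norm_num)] at e1
    refine Tr.seq ((ask_spec (q := C.depth + 2 + 3 * (C.above i + κ) + 1) hb.prints hb.sim I1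
      (by simp [F1.int, queryVars, g0, hk]; omega) (by simp [F1.int, queryVars, g0, hk]; ring)
      (by omega) (by simp [queryVars])).mono ?_)
    rintro t2 a2 ⟨F2, I2, e2⟩
    rw [C.code_gate hi hκ (by norm_num)] at e2
    refine Tr.seq ((ask_spec (q := C.depth + 2 + 3 * (C.above i + κ) + 2) hb.prints hb.sim I2
      (by simp [F2.int, F1.int, queryVars, g0, hk]; omega)
      (by simp [F2.int, F1.int, queryVars, g0, hk]; ring)
      (by omega) (by simp [queryVars])).mono ?_)
    rintro t3 a3 ⟨F3, I3, e3⟩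
    rw [C.code_gate hi hκ (by norm_num)] at e3
    simp at e1 e2 e3
    have F03 := (F1.mono (iv' := .kind :: .lft :: .rgt :: queryVars) (fv' := []) (ar' := [])
      (cs' := [.imem]) (by simp [queryVars]) (by simp) (by simp) (by simp)).trans
      ((F2.mono (by simp [queryVars]) (by simp) (by simp) (by simp)).trans
        (F3.mono (by simp [queryVars]) (by simp) (by simp) (by simp)))
    have v1 : a3.int .kind = (C.isMul i κ).toNat := by simp [F3.int, F2.int, queryVars, e1]
    have v2 : a3.int .lft = C.left i κ := by simp [F3.int, queryVars, e2]
    clear F1 F2 F3 I1 I2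
    refine Tr.seq (Tr.block (by simp) ?_)
    set a4 : Store K := runs E _ a3 with ha4
    have F4 : Frame [.x, .y, .size] [.chi] [] [] a3 a4 := runs_frame E _ _ (by simp [Cmd.within])
    have R4 : a4.arr .R = a.arr .R := by rw [F4.arr _ (by simp), F03.arr _ (by simp), R0]
    have c4 : a4.fld .chi = 1 := by simp [ha4]
    have x4 : a4.int .x = κ := by simp [ha4, F03.int, queryVars, hk]
    have y4 : a4.int .y = 0 := by simp [ha4]
    have s4 : a4.int .size = C.bits i := by simp [ha4, F03.int, queryVars, n0]
    clear_value a4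
    refine Tr.seq ((mulIndicator_spec (X := .R) hW x4 y4 s4 (by omega)).mono ?_)
    rintro t5 a5 ⟨-, F5, c5⟩
    refine Tr.seq (Tr.block (by simp) ?_)
    set a6 : Store K := runs E _ a5 with ha6
    have F6 : Frame [.x, .y, .size] [] [] [] a5 a6 := runs_frame E _ _ (by simp [Cmd.within])
    have x6 : a6.int .x = C.left i κ := by simp [ha6, F5.int, F4.int, v2]
    have y6 : a6.int .y = C.bits i := by
      simp [ha6, F5.int, F4.int, F03.int, queryVars, n0]
    have s6 : a6.int .size = C.bits (i + 1) := by
      simp [ha6, F5.int, F4.int, F03.int, queryVars, m0]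
    clear_value a6
    refine Tr.seq ((mulIndicator_spec (X := .R) hW x6 y6 s6 (by omega)).mono ?_)
    rintro t7 a7 ⟨-, F7, c7⟩
    refine Tr.seq (Tr.block ?_ ?_)
    · simp [F7.int, F6.int, F5.int, F4.int, F03.int, queryVars, n0, m0]; omega
    set a8 : Store K := runs E _ a7 with ha8
    have F8 : Frame [.x, .y, .size] [] [] [] a7 a8 := runs_frame E _ _ (by simp [Cmd.within])
    have x8 : a8.int .x = C.right i κ := by simp [ha8, F7.int, F6.int, F5.int, F4.int, e3]
    have y8 : a8.int .y = C.bits i + C.bits (i + 1) := by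
      simp [ha8, F7.int, F6.int, F5.int, F4.int, F03.int, queryVars, n0, m0]
    have s8 : a8.int .size = C.bits (i + 1) := by
      simp [ha8, F7.int, F6.int, F5.int, F4.int, F03.int, queryVars, m0]
    clear_value a8
    refine Tr.seq ((mulIndicator_spec (X := .R) hW x8 y8 s8 (by omega)).mono ?_)
    rintro t9 a9 ⟨-, F9, c9⟩
    have F49 : Frame [.x, .y, .size, .k] [.chi] [] [] a3 a9 :=
      (F4.mono (by simp) (by simp) (by simp) (by simp)).trans
      ((F5.mono (by simp) (by simp) (by simp) (by simp)).trans
      ((F6.mono (by simp) (by simp) (by simp) (by simp)).trans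
      ((F7.mono (by simp) (by simp) (by simp) (by simp)).trans
      ((F8.mono (by simp) (by simp) (by simp) (by simp)).trans
      (F9.mono (by simp) (by simp) (by simp) (by simp))))))
    have hchi : a9.fld .chi = g κ := by
      simp [c9, F8.fld, F8.arr, F7.arr, c7, F6.fld, F6.arr, F5.arr, c5, c4, R4, hgd]
    have I9 := I3.frame F49 (by simp) (by simp) (by simp)
    have k9 : a9.int .kind = (C.isMul i κ).toNat := by simp [F49.int, v1]
    have j9 : a9.int .j = κ := by simp [F49.int, F03.int, queryVars, hk]
    have a9' : a9.fld .addSum = b.fld .addSum := by simp [F49.fld, F03.fld]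
    have m9' : a9.fld .mulSum = b.fld .mulSum := by simp [F49.fld, F03.fld]
    clear_value g
    clear F49 F03 F4 F5 F6 F7 F8 F9
    refine Tr.ite (by simp) (fun h => Tr.block (by simp) ?_) fun h => Tr.block (by simp) ?_
    · have hk : C.isMul i κ = true := by
        simp [k9] at h; simpa using h
      refine ⟨by simp [j9], ⟨?_, ?_, ?_⟩, ?_⟩
      · simpa using I9.n
      · simpa using I9.lt
      · simpa using I9.zero
      · simp [Finset.sum_range_succ, hk, a9', m9', ha, hm, hchi]
    · have hk : C.isMul i κ = false := by
        simp [k9] at h; simpa using h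
      refine ⟨by simp [j9], ⟨?_, ?_, ?_⟩, ?_⟩
      · simpa using I9.n
      · simpa using I9.lt
      · simpa using I9.zero
      · simp [Finset.sum_range_succ, hk, a9', m9', ha, hm, hchi]
  · rintro b - F ⟨I, ha, hm⟩ F'
    exact ⟨F', I, by rw [ha, hmle], by rw [hm, hmle]⟩

end GKR

namespace GKR

open LayeredCircuit (sentPoly)

/-! ### The conversation of the verifier -/

/-- The number of words that precede the coefficients in message number `k`: the claimed output
belongs to the first message. -/
def shift (k : ℕ) : ℕ := if k = 0 then 1 else 0

section Conversation

variable {n : ℕ} (C : LayeredCircuit n) {K : Type*} [Field K] (P : Strategy K) (r : ℕ → K)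

/-- The conversation of the verifier up to word number `e` of message number `k`. -/
def partialTrace (k e : ℕ) : List (Event K) :=
  ((List.range k).flatMap fun k =>
    (List.range (C.msgLengths.getD k 0)).map (fun e => Event.recv (P ((List.range k).map r) e)) ++
      [Event.send (r k)]) ++
    (List.range e).map fun e => Event.recv (P ((List.range k).map r) e)

theorem partialTrace_succ (k e : ℕ) :
    partialTrace C P r k e ++ [.recv (P ((List.range k).map r) e)] =
      partialTrace C P r k (e + 1) := by
  simp [partialTrace, List.range_succ]

theorem partialTrace_send {k e : ℕ} (h : C.msgLengths.getD k 0 = e) :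
    partialTrace C P r k e ++ [.send (r k)] = partialTrace C P r (k + 1) 0 := by
  subst h
  simp [partialTrace, List.range_succ, List.flatMap_append]

theorem verifierTrace_eq : verifierTrace C P r = partialTrace C P r C.numChallenges 0 := by
  simp [partialTrace, verifierTrace]

theorem sentWords_append (l l' : List (Event K)) :
    sentWords (l ++ l') = sentWords l ++ sentWords l' := by
  simp [sentWords]

theorem sentWords_map_recv {α : Type*} (l : List α) (f : α → K) :
    sentWords (l.map fun e => Event.recv (f e)) = [] := by
  simp [sentWords]

theorem receivedSinceSend_append (l : List (Event K)) (w : K) {α : Type*} (l' : List α)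
    (f : α → K) :
    receivedSinceSend (l ++ [.send w] ++ l'.map fun e => Event.recv (f e)) = l'.length := by
  simp only [receivedSinceSend, List.reverse_append, ← List.map_reverse]
  rw [List.takeWhile_append_of_pos]
  · simp
  · simp

theorem receivedSinceSend_map_recv {α : Type*} (l : List α) (f : α → K) :
    receivedSinceSend (l.map fun e => Event.recv (f e)) = l.length := by
  simp only [receivedSinceSend, ← List.map_reverse]
  rw [List.takeWhile_eq_self_iff.2 (by simp)]
  simp

theorem sentWords_partialTrace (k e : ℕ) :
    sentWords (partialTrace C P r k e) = (List.range k).map r := by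
  have h : ∀ k, sentWords (partialTrace C P r k 0) = (List.range k).map r := by
    intro k
    induction k with
    | zero => rfl
    | succ k ih =>
      rw [← partialTrace_send C P r rfl, sentWords_append, partialTrace, sentWords_append,
        sentWords_map_recv]
      rw [partialTrace] at ih
      simp only [List.range_zero, List.map_nil, List.append_nil] at ih
      rw [ih]
      simp [sentWords, List.range_succ]
  have := h k
  rw [partialTrace] at this ⊢
  rw [sentWords_append, sentWords_map_recv]
  simpa using this

/-- The next word that the verifier receives is determined by the challenges sent so far and the
number of words received since. -/
theorem proverPeer_partialTrace (k e : ℕ) :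
    proverPeer P (partialTrace C P r k e) = P ((List.range k).map r) e := by
  rw [proverPeer, sentWords_partialTrace]
  congr 1
  cases k with
  | zero => simpa [partialTrace] using receivedSinceSend_map_recv (List.range e) fun e => P [] e
  | succ k =>
    have := receivedSinceSend_append (partialTrace C P r k (C.msgLengths.getD k 0)) (r k)
      (List.range e) fun e => P ((List.range (k + 1)).map r) e
    rw [partialTrace_send C P r rfl] at this
    simpa [partialTrace] using this

theorem eval_sentPoly (m k : ℕ) (t : K) : (sentPoly P r m k).eval t =
    ∑ e ∈ Finset.range (m + 1), P ((List.range k).map r) (shift k + e) * t ^ e := by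
  simp [sentPoly, Polynomial.eval_finsetSum, shift, add_comm]

end Conversation

namespace LayeredCircuit

variable {n : ℕ} (C : LayeredCircuit n)

theorem getD_modifyHead_succ (l : List ℕ) {k : ℕ} (hk : k < l.length) :
    (l.modifyHead (· + 1)).getD k 0 = shift k + l.getD k 0 := by
  cases l with
  | nil => simp at hk
  | cons m l => cases k <;> simp [shift, add_comm]

/-- Every message of the sum-check has three words, and every message about a line as many as the
line polynomial has coefficients; the first message also contains the claimed output. -/
theorem msgLengths_getD {i j : ℕ} (hi : i < C.depth) (hj : j < C.rounds i + 1) :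
    C.msgLengths.getD (C.offset i + j) 0 =
      shift (C.offset i + j) + if j < C.rounds i then 3 else C.bits (i + 1) + 1 := by
  set f : ℕ → List ℕ := fun i => List.replicate (C.rounds i) 3 ++ [C.bits (i + 1) + 1] with hf
  have hlen : ∀ i, (f i).length = C.rounds i + 1 := fun i => by simp [hf]
  have hoff : ∀ i, C.offset i = ∑ i ∈ Finset.range i, (f i).length := fun i =>
    Finset.sum_congr rfl fun i _ => (hlen i).symm
  rw [msgLengths, getD_modifyHead_succ, hoff, getD_flatMap_range f 0 hi (by rw [hlen]; exact hj)]
  · congr 1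
    simp only [hf]
    split_ifs with h
    · rw [List.getD_append _ _ _ _ (by simpa using h)]
      simp [h]
    · obtain rfl : j = C.rounds i := by omega
      rw [List.getD_append_right _ _ _ _ (by simp)]
      simp
  · rw [length_flatMap_range]
    have h1 := C.offset_add_lt hi hj
    rw [numChallenges, hoff C.depth] at h1
    exact h1

end LayeredCircuit

/-! ### The checks of the verifier -/

/-- The number `v` is a truth value of the proposition `p`. -/
def IsFlag (v : ℕ) (p : Prop) : Prop := v ≤ 1 ∧ (v ≠ 0 ↔ p)

open Classical in
theorem IsFlag.mul {v : ℕ} {p q : Prop} (h : IsFlag v p) :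
    IsFlag (v * if q then 1 else 0) (p ∧ q) := by
  obtain ⟨h1, h2⟩ := h
  by_cases hq : q
  · simpa [hq, IsFlag] using ⟨h1, h2⟩
  · simp [hq, IsFlag]

open IVar FVar in
/-- One round of the sum-check: the check of the claim, and the claim for the next round. -/
def roundCheck : Code :=
  .block [.recv c0, .recv c1, .recv c2] ;;
  .block [.eqf flag (c0 + (c0 + c1 + c2)) claim, .iset ok (ok * flag), .fset rho (.load .R k),
    .fset claim (c0 + rho * (c1 + rho * c2)), .send rho]

open IVar FVar in
/-- Receives the polynomial of the line and evaluates it at `0`, at `1` and at the challenge. -/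
def receiveLine : Code :=
  .block [.recv q0, .fset q1 q0, .fset qt q0, .fset rho (.load .R len), .fset tpow rho] ;;
  .forTo k bits' (.block [.recv c0, .fset q1 (q1 + c0), .fset qt (qt + c0 * tpow),
    .fset tpow (tpow * rho)])

variable {K : Type*} [Field K] {E : Env K} {a : Store K} {W n i : ℕ} {C : LayeredCircuit n}
  {P : Strategy K} {r : ℕ → K}

theorem roundCheck_spec {q κ : ℕ} {p : Prop} (hpeer : E.peer = proverPeer P)
    (htr : a.trace = partialTrace C P r q (shift q)) (hq : C.msgLengths.getD q 0 = shift q + 3)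
    (hκ : a.int .k = κ) (hR : a.arr .R κ = r q) (hidx : E.Idx κ) (hok : IsFlag (a.int .ok) p) :
    Tr E roundCheck a fun _ a' =>
      a'.int .k = κ ∧ a'.trace = partialTrace C P r (q + 1) (shift (q + 1)) ∧
      a'.fld .claim = (sentPoly P r 2 q).eval (r q) ∧
      IsFlag (a'.int .ok) (p ∧
        (sentPoly P r 2 q).eval 0 + (sentPoly P r 2 q).eval 1 = a.fld .claim) := by
  have hB := hidx.1
  refine Tr.seq (Tr.block (by simp) ?_)
  set a1 : Store K := runs E _ a with ha1
  have F1 : Frame [] [.c0, .c1, .c2] [] [.trace, .stream] a a1 :=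
    runs_frame E _ _ (by simp [Cmd.within])
  have e0 : a1.fld .c0 = P ((List.range q).map r) (shift q) := by
    simp [ha1, hpeer, htr, proverPeer_partialTrace]
  have e1 : a1.fld .c1 = P ((List.range q).map r) (shift q + 1) := by
    simp [ha1, hpeer, htr, proverPeer_partialTrace, partialTrace_succ]
  have e2 : a1.fld .c2 = P ((List.range q).map r) (shift q + 2) := by
    simp only [ha1, hpeer, htr, runs, Cmd.run, proverPeer_partialTrace, partialTrace_succ]
    simp
  have e3 : a1.trace = partialTrace C P r q (shift q + 3) := by
    simp only [ha1, hpeer, htr, runs, Cmd.run, proverPeer_partialTrace, partialTrace_succ]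
  clear_value a1
  have hs1 : shift (q + 1) = 0 := rfl
  refine Tr.block ?_ ?_
  · simp [F1.int, hκ, hidx]
    exact hok.mul.1.trans (by omega)
  · simp only [eval_sentPoly, Finset.sum_range_succ, Finset.sum_range_zero]
    simp [F1.int, F1.fld, F1.arr, hκ, hR, e0, e1, e2, e3, partialTrace_send _ _ _ hq, hs1]
    refine ⟨by ring, ?_⟩
    rw [← e0, ← e1, ← e2, ← F1.fld .claim (by simp)]
    exact hok.mul

theorem receiveLine_spec {q v m : ℕ} (hpeer : E.peer = proverPeer P)
    (htr : a.trace = partialTrace C P r q (shift q)) (hv : a.int .bits' = v) (hm : a.int .len = m)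
    (hR : a.arr .R m = r q) (hidx : E.Idx m) (hB : v ≤ E.B) :
    Tr E receiveLine a fun _ a' =>
      Frame [.k] [.q0, .q1, .qt, .rho, .tpow, .c0] [] [.trace, .stream] a a' ∧
      a'.trace = partialTrace C P r q (shift q + (v + 1)) ∧
      a'.fld .q0 = (sentPoly P r v q).eval 0 ∧ a'.fld .q1 = (sentPoly P r v q).eval 1 ∧
      a'.fld .qt = (sentPoly P r v q).eval (r q) := by
  have hB1 := hidx.1
  refine Tr.withFrame [.k] [.q0, .q1, .qt, .rho, .tpow, .c0] [] [.trace, .stream]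
    (by simp [receiveLine, Code.forTo, Code.within, Cmd.within])
    (Tr.seq (Tr.block (by simp [hm, hidx]) ?_))
  set a1 : Store K := runs E _ a with ha1
  have F1 : Frame [] [.q0, .q1, .qt, .rho, .tpow] [] [.trace, .stream] a a1 :=
    runs_frame E _ _ (by simp [Cmd.within])
  have e0 : a1.fld .q0 = P ((List.range q).map r) (shift q) := by
    simp [ha1, hpeer, htr, proverPeer_partialTrace]
  have e1 : a1.fld .q1 = P ((List.range q).map r) (shift q) := by
    simp [ha1, hpeer, htr, proverPeer_partialTrace]
  have e2 : a1.fld .qt = P ((List.range q).map r) (shift q) := by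
    simp [ha1, hpeer, htr, proverPeer_partialTrace]
  have e3 : a1.fld .rho = r q := by simp [ha1, hm, hR]
  have e4 : a1.fld .tpow = r q := by simp [ha1, hm, hR]
  have e5 : a1.trace = partialTrace C P r q (shift q + 1) := by
    simp [ha1, hpeer, htr, proverPeer_partialTrace, partialTrace_succ]
  clear_value a1
  refine Tr.forTo_untimed [.k] [.q1, .qt, .tpow, .c0] [] [.trace, .stream] v
    (fun κ b => b.trace = partialTrace C P r q (shift q + (κ + 1)) ∧
      b.fld .tpow = r q ^ (κ + 1) ∧
      b.fld .q1 = ∑ e ∈ Finset.range (κ + 1), P ((List.range q).map r) (shift q + e) ∧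
      b.fld .qt = ∑ e ∈ Finset.range (κ + 1), P ((List.range q).map r) (shift q + e) * r q ^ e)
    (by simp [Code.within, Cmd.within]) (by simp) (by omega) (by omega) ?_ ?_ ?_ ?_
  · simp [e1, e2, e4, e5]
  · intro κ b _ _ hF _
    simp [hF.int, F1.int, hv]
  · rintro κ b hκ hk hF ⟨j1, j2, j3, j4⟩
    refine Tr.block (by simp) ?_
    simp [hpeer, j1, proverPeer_partialTrace, partialTrace_succ, hF.fld, e3, hk]
    refine ⟨by congr 1, by rw [j2, ← pow_succ], ?_, ?_⟩
    · rw [j3, Finset.sum_range_succ _ (κ + 1)]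
    · rw [j4, j2, Finset.sum_range_succ _ (κ + 1)]
  · rintro b - F ⟨j1, j2, j3, j4⟩ F'
    refine ⟨F', j1, ?_, ?_, ?_⟩
    · rw [F.fld _ (by simp), e0, eval_sentPoly, Finset.sum_range_succ']
      simp
    · simp [j3, eval_sentPoly]
    · rw [j4, eval_sentPoly]

end GKR

namespace GKR

open LayeredCircuit (sentPoly)

/-! ### An iteration of the verifier -/

open IVar FVar in
/-- The checks of an iteration whose challenges are stored in `R`. -/
def layerCheck (M : Transducer) : Code :=
  .forTo k len roundCheck ;; receiveLine ;; computeBeta ;; wiringSums M ;;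
  .block [.eqf flag claim (FVar.beta * (addSum * (q0 + q1) + mulSum * (q0 * q1))),
    .iset ok (ok * flag), .fset claim qt, .send (.load .R len)] ;;
  storePoint .R ;; .block [.iset gates (gates + 3 * width)]

open IVar in
/-- One iteration. The challenges of the last iteration have been drawn before the stream is read,
and are stored in `L`; in the other iterations the difference in the condition is not zero, and
fresh challenges are drawn. -/
def verifierIter (M : Transducer) : Code :=
  layerSetup M ;;
  .ite (depth - (layer + 1)) (tossAll .R)
    (.forTo k (len + 1) (.block [.fstore .R k (.load .L k)])) ;;
  layerCheck M

namespace LayeredCircuit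

variable {n : ℕ} (C : LayeredCircuit n) {K : Type*} [Field K] (P : Strategy K) (r : ℕ → K)

/-- The check of round `j` of iteration `i` succeeds. -/
def RoundAccepts (i j : ℕ) : Prop :=
  (sentPoly P r 2 (C.offset i + j)).eval 0 + (sentPoly P r 2 (C.offset i + j)).eval 1 =
    C.roundClaim P r i j

/-- The check of the last claim of iteration `i` succeeds. -/
def LineAccepts (i : ℕ) : Prop :=
  let q := sentPoly P r (C.bits (i + 1)) (C.offset i + C.rounds i)
  let ev := MvPolynomial.eval (C.sumcheckPoint r i)
  C.roundClaim P r i (C.rounds i) =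
    ev (beta (C.bits i) (C.layerPoint r i)) *
      (ev (C.wiringMLE i false) * (q.eval 0 + q.eval 1) +
        ev (C.wiringMLE i true) * (q.eval 0 * q.eval 1))

/-- All checks of iteration `i` succeed. -/
def LayerAccepts (i : ℕ) : Prop :=
  (∀ j < C.rounds i, C.RoundAccepts P r i j) ∧ C.LineAccepts P r i

theorem eval_beta_congr {u : ℕ} {z z' q q' : ℕ → K} (hz : ∀ k < u, z k = z' k)
    (hq : ∀ k < u, q k = q' k) :
    MvPolynomial.eval q (beta u z) = MvPolynomial.eval q' (beta u z') := by
  simp only [beta, map_prod]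
  refine Finset.prod_congr rfl fun k hk => ?_
  have hk := Finset.mem_range.1 hk
  simp [hz k hk, hq k hk]

theorem eval_wiringMLE_congr {i : ℕ} (hi : i < C.depth) (mul : Bool) {q q' : ℕ → K}
    (hq : ∀ k < C.rounds i, q k = q' k) :
    MvPolynomial.eval q (C.wiringMLE i mul) = MvPolynomial.eval q' (C.wiringMLE i mul) := by
  unfold rounds at hq
  rw [← MvPolynomial.aeval_eq_eval, ← MvPolynomial.aeval_eq_eval]
  rw [C.aeval_wiringMLE hi, C.aeval_wiringMLE hi]
  refine Finset.sum_congr rfl fun j _ => ?_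
  rw [chiE_congr (fun k hk => hq k (by omega)) j, chiE_congr (fun k hk => hq _ (by omega)) _,
    chiE_congr (fun k hk => hq _ (by omega)) _]

end LayeredCircuit

variable {K : Type*} [Field K] {E : Env K} {a : Store K} {W n s i : ℕ} {M : Transducer}
  {C : LayeredCircuit n} {P : Strategy K} {r : ℕ → K}

/-- The situation before iteration `i` of the verifier. -/
structure VerifierInv (C : LayeredCircuit n) (P : Strategy K) (r : ℕ → K) (s i : ℕ)
    (a : Store K) : Prop where
  tape : TapeInv n s a
  gates : a.int .gates = C.depth + 2 + 3 * C.above i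
  Z : ∀ k < C.bits i, a.arr .Z k = C.layerPoint r i k
  claim : a.fld .claim = C.layerClaim P r i
  ok : IsFlag (a.int .ok) (∀ i' < i, C.LayerAccepts P r i')
  trace : a.trace = partialTrace C P r (C.offset i) (shift (C.offset i))

/-- The integer variables that are changed by `layerCheck`. -/
def checkVars : List IVar :=
  .kind :: .lft :: .rgt :: .y :: .size :: .k :: .j :: .flag :: .ok :: .gates :: queryVars

/-- The field variables that are changed by `layerCheck`. -/
def checkFields : List FVar :=
  [.c0, .c1, .c2, .rho, .claim, .q0, .q1, .qt, .tpow, .beta, .chi, .addSum, .mulSum]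

theorem layerCheck_spec (hb : VerifierBound M C s W E) (hpeer : E.peer = proverPeer P)
    (hi : i < C.depth) (hI : VerifierInv C P r s i a) (hv : LayerVars C i a)
    (hR : ∀ k < C.rounds i + 1, a.arr .R k = r (C.offset i + k)) :
    Tr E (layerCheck M) a fun _ a' =>
      Frame checkVars checkFields [.Z] [.imem, .trace, .stream] a a' ∧
      VerifierInv C P r s (i + 1) a' := by
  have hW := hb.arr
  have hB := hW.1
  have hr := hb.rounds i hi
  have hS := hb.size
  have hr' : C.rounds i = C.bits i + 2 * C.bits (i + 1) := rfl
  have hdS := C.depth_lt_size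
  have w1 := C.width_le_size hi.le
  have hab := C.above_le_size (i := i + 1) (by omega)
  rw [C.above_succ] at hab
  refine Tr.withFrame checkVars checkFields [.Z] [.imem, .trace, .stream] ?_ ?_
  · simp [layerCheck, roundCheck, receiveLine, computeBeta, wiringSums, storePoint, mulIndicator,
      Code.forTo, Code.within, Cmd.within, checkVars, checkFields, queryVars]
    exact ⟨ask_within M _ (by decide) (by decide), ask_within M _ (by decide) (by decide),
      ask_within M _ (by decide) (by decide)⟩
  refine Tr.seq (Tr.forTo_untimed [.k, .flag, .ok] [.c0, .c1, .c2, .rho, .claim] []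
    [.trace, .stream] (C.rounds i)
    (fun κ b => b.trace = partialTrace C P r (C.offset i + κ) (shift (C.offset i + κ)) ∧
      b.fld .claim = C.roundClaim P r i κ ∧
      IsFlag (b.int .ok) ((∀ i' < i, C.LayerAccepts P r i') ∧ ∀ j < κ, C.RoundAccepts P r i j))
    (by simp [roundCheck, Code.within, Cmd.within]) (by simp) (by omega) (by omega) ?_ ?_ ?_ ?_)
  · refine ⟨hI.trace, hI.claim, ?_⟩
    simpa using hI.ok
  · intro κ b _ _ hF _
    simp [hF.int, hv.len]
  · rintro κ b hκ hk hF ⟨i1, i2, i3⟩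
    refine (roundCheck_spec hpeer i1 ?_ hk ?_ (hW.idx (by omega)) i3).mono ?_
    · rw [C.msgLengths_getD hi (by omega), if_pos hκ]
    · rw [hF.arr _ (by simp), hR κ (by omega)]
    · rintro t b' ⟨j1, j2, j3, j4⟩
      refine ⟨j1, j2, j3, ?_⟩
      rw [i2, and_assoc] at j4
      simp only [Nat.forall_lt_succ_right]
      exact j4
  rintro a1 - F1 ⟨i1, i2, i3⟩
  refine Tr.seq ((receiveLine_spec (v := C.bits (i + 1)) (m := C.rounds i) hpeer i1
    (by simp [F1.int, hv.bits']) (by simp [F1.int, hv.len])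
    (by rw [F1.arr _ (by simp), hR _ (by omega)]) (hW.idx hr) (by omega)).mono ?_)
  rintro t2 a2 ⟨F2, tr2, q0, q1, qt⟩
  refine Tr.seq ((computeBeta_spec (u := C.bits i) hW (by simp [F2.int, F1.int, hv.bits])
    (by omega)).mono ?_)
  rintro t3 a3 ⟨F3, b3⟩
  have F13 : Frame [.k, .flag, .ok]
      [.c0, .c1, .c2, .rho, .claim, .q0, .q1, .qt, .tpow, .beta] [] [.trace, .stream] a a3 :=
    (F1.mono (by simp) (by simp) (by simp) (by simp)).trans
      ((F2.mono (by simp) (by simp) (by simp) (by simp)).trans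
      (F3.mono (by simp) (by simp) (by simp) (by simp)))
  refine Tr.seq ((wiringSums_spec (i := i) hb hi
    (hI.tape.frame F13 (by simp) (by simp) (by simp))
    (hv.frame F13 (by simp) (by simp) (by simp) (by simp))
    (by simp [F13.int, hI.gates])).mono ?_)
  rintro t4 a4 ⟨F4, I4, e4, e4'⟩
  have hok : a4.int .ok = a1.int .ok := by simp [F4.int, F3.int, F2.int, queryVars]
  have hlen : a4.int .len = C.rounds i := by simp [F4.int, F13.int, queryVars, hv.len]
  have hR4 : a4.arr .R = a.arr .R := by simp [F4.arr, F13.arr]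
  refine Tr.seq (Tr.block ?_ ?_)
  · simp [hlen, hW.idx hr, hok]
    exact i3.mul.1.trans (by omega)
  set a5 : Store K := runs E _ a4 with ha5
  have F5 : Frame [.flag, .ok] [.claim] [] [.trace, .stream] a4 a5 :=
    runs_frame E _ _ (by simp [Cmd.within])
  have tr5 : a5.trace = partialTrace C P r (C.offset (i + 1)) (shift (C.offset (i + 1))) := by
    have h := partialTrace_send C P r (k := C.offset i + C.rounds i) (by
      rw [C.msgLengths_getD hi (by omega), if_neg (by omega)])
    rw [C.offset_succ, ← add_assoc]
    refine Eq.trans ?_ h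
    simp [ha5, F4.trace, F3.trace, tr2, hlen, hR4, hR]
  have c5 : a5.fld .claim = C.layerClaim P r (i + 1) := by
    simp [ha5, F4.fld, F3.fld, qt, LayeredCircuit.layerClaim]
  have o5 : IsFlag (a5.int .ok) (∀ i' < i + 1, C.LayerAccepts P r i') := by
    have hZ3 : a2.arr .Z = a.arr .Z := by simp [F2.arr, F1.arr]
    have hR3 : a2.arr .R = a.arr .R := by simp [F2.arr, F1.arr]
    have v1 : a4.fld .claim = C.roundClaim P r i (C.rounds i) := by
      simp [F4.fld, F3.fld, F2.fld, i2]
    have v2 : a4.fld .beta =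
        MvPolynomial.eval (C.sumcheckPoint r i) (beta (C.bits i) (C.layerPoint r i)) := by
      rw [F4.fld _ (by simp), b3, hZ3, hR3]
      exact LayeredCircuit.eval_beta_congr hI.Z fun k hk => hR k (by omega)
    have v3 : a4.fld .addSum = MvPolynomial.eval (C.sumcheckPoint r i) (C.wiringMLE i false) := by
      rw [e4, F13.arr _ (by simp)]
      exact C.eval_wiringMLE_congr hi _ fun k hk => hR k (by omega)
    have v4 : a4.fld .mulSum = MvPolynomial.eval (C.sumcheckPoint r i) (C.wiringMLE i true) := by
      rw [e4', F13.arr _ (by simp)]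
      exact C.eval_wiringMLE_congr hi _ fun k hk => hR k (by omega)
    have v5 := ((F4.fld .q0 (by simp)).trans (F3.fld _ (by simp))).trans q0
    have v6 := ((F4.fld .q1 (by simp)).trans (F3.fld _ (by simp))).trans q1
    have hline : C.LineAccepts P r i ↔ a4.fld .claim = a4.fld .beta *
        (a4.fld .addSum * (a4.fld .q0 + a4.fld .q1) +
          a4.fld .mulSum * (a4.fld .q0 * a4.fld .q1)) := by
      simp only [LayeredCircuit.LineAccepts]
      rw [v1, v2, v3, v4, v5, v6]
    have hlayer : C.LayerAccepts P r i ↔ (∀ j < C.rounds i, C.RoundAccepts P r i j) ∧ _ :=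
      and_congr_right fun _ => hline
    have h : IsFlag (a5.int .ok) _ := (hok ▸ i3).mul
    rw [Nat.forall_lt_succ_right, hlayer, ← and_assoc]
    exact h
  clear_value a5
  have I5 := I4.frame F5 (by simp) (by simp) (by simp)
  refine Tr.seq ((storePoint_spec (X := .R) (u := C.bits i) (v := C.bits (i + 1)) (by simp) hW
    (by simp [F5.int, F4.int, F13.int, queryVars, hv.bits])
    (by simp [F5.int, F4.int, F13.int, queryVars, hv.bits'])
    (by simp [F5.int, hlen, hr']) (by omega)).mono ?_)
  rintro t6 a6 ⟨F6, z6⟩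
  have g6 : a6.int .gates = C.depth + 2 + 3 * C.above i := by
    simp [F6.int, F5.int, F4.int, F13.int, queryVars, hI.gates]
  have w6 : a6.int .width = C.width i := by
    simp [F6.int, F5.int, F4.int, F13.int, queryVars, hv.width]
  have I6 := I5.frame F6 (by simp) (by simp) (by simp)
  refine Tr.block ?_ fun F => ⟨F, ⟨?_, ?_, ?_⟩, ?_, ?_, ?_, ?_, ?_⟩
  · simp [g6, w6]; omega
  · simpa using I6.n
  · simpa using I6.lt
  · simpa using I6.zero
  · simp [g6, w6, C.above_succ]; ring
  · intro k hk
    have hR5 : a5.arr .R = a.arr .R := by rw [F5.arr _ (by simp), hR4]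
    simp [z6 k hk, hR5, LayeredCircuit.layerPoint, LayeredCircuit.sumcheckPoint]
    rw [hR _ (by omega), hR _ (by omega), hR _ (by omega), ← hr']
  · simp [F6.fld, c5]
  · simpa [F6.int] using o5
  · simpa [F6.trace] using tr5

theorem verifierIter_spec (hb : VerifierBound M C s W E) (hpeer : E.peer = proverPeer P)
    (hi : i < C.depth) (hd : a.int .depth = C.depth) (hl : a.int .layer = i)
    (hI : VerifierInv C P r s i a)
    (hc : ∀ k, C.offset i + k < C.offset (C.depth - 1) → a.coins k = r (C.offset i + k))
    (hL : ∀ k < C.rounds (C.depth - 1) + 1, a.arr .L k = r (C.offset (C.depth - 1) + k)) :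
    Tr E (verifierIter M) a fun _ a' => VerifierInv C P r s (i + 1) a' ∧
      ∀ k, C.offset (i + 1) + k < C.offset (C.depth - 1) →
        a'.coins k = r (C.offset (i + 1) + k) := by
  have hW := hb.arr
  have hB := hW.1
  have hr := hb.rounds i hi
  have hS := hb.size
  have hdS := C.depth_lt_size
  refine Tr.seq ((layerSetup_spec hb hi hI.tape hl).mono ?_)
  rintro t1 a1 ⟨F1, I1, hv⟩
  -- the checks, once the challenges of the iteration are in `R`
  have key : ∀ a2 : Store K, Frame [.k] [.rho] [.R] [.coins] a1 a2 →
      (∀ k < C.rounds i + 1, a2.arr .R k = r (C.offset i + k)) →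
      (∀ k, C.offset (i + 1) + k < C.offset (C.depth - 1) →
        a2.coins k = r (C.offset (i + 1) + k)) →
      Tr E (layerCheck M) a2 fun _ a' => VerifierInv C P r s (i + 1) a' ∧
        ∀ k, C.offset (i + 1) + k < C.offset (C.depth - 1) →
          a'.coins k = r (C.offset (i + 1) + k) := by
    intro a2 F2 hR hc2
    refine (layerCheck_spec hb hpeer hi ⟨?_, ?_, ?_, ?_, ?_, ?_⟩
      (hv.frame F2 (by simp) (by simp) (by simp) (by simp)) hR).mono ?_
    · exact I1.frame F2 (by simp) (by simp) (by simp)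
    · simp [F2.int, F1.int, queryVars, hI.gates]
    · simpa [F2.arr, F1.arr] using hI.Z
    · simp [F2.fld, F1.fld, hI.claim]
    · simpa [F2.int, F1.int, queryVars] using hI.ok
    · simp [F2.trace, F1.trace, hI.trace]
    · rintro t a' ⟨F, I⟩
      refine ⟨I, fun k hk => ?_⟩
      rw [F.coins (by simp), hc2 k hk]
  have hd1 : a1.int .depth = C.depth := by simp [F1.int, queryVars, hd]
  have hl1 : a1.int .layer = i := by simp [F1.int, queryVars, hl]
  refine Tr.seq (Tr.ite (by simp [hl1]; omega) (fun h => ?_) fun h => ?_)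
  · simp [hd1, hl1] at h
    have hoff := C.offset_mono (show i + 1 ≤ C.depth - 1 by omega)
    have hcoins : a1.coins = a.coins := F1.coins (by simp)
    rw [C.offset_succ] at hoff
    refine (tossAll_spec (X := .R) (m := C.rounds i) hW hv.len hr).mono ?_
    rintro t2 a2 ⟨F2, h2, h2'⟩
    refine key a2 F2 (fun k hk => ?_) fun k hk => ?_
    · rw [h2 k hk, hcoins, hc k (by omega)]
    · rw [C.offset_succ] at hk ⊢
      rw [h2' k, hcoins, hc _ (by omega)]
      congr 1; omega
  · simp [hd1, hl1] at h
    obtain rfl : i = C.depth - 1 := by omega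
    have hL1 : a1.arr .L = a.arr .L := F1.arr _ (by simp)
    refine Tr.forTo_untimed [.k] [] [.R] [] (C.rounds (C.depth - 1) + 1)
      (fun κ b => ∀ k < κ, b.arr .R k = a.arr .L k) (by simp [Code.within, Cmd.within]) (by simp)
      (by omega) (by omega) (by simp) ?_ ?_ ?_
    · intro κ b _ _ hF _
      simp [hF.int, hv.len]; omega
    · intro κ b hκ hk hF hJ
      refine Tr.block (by simpa [hk] using hW.idx (by omega)) ?_
      simp [hk, hF.arr, hL1]
      intro j hj
      rw [Function.update_apply]
      split_ifs with h
      · rw [h]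
      · exact hJ j (by omega)
    · rintro a2 - F2 h2
      refine key a2 (F2.mono (by simp) (by simp) (by simp) (by simp)) (fun k hk => ?_)
        fun k hk => ?_
      · rw [h2 k hk, hL k hk]
      · rw [C.offset_succ] at hk; omega

end GKR

namespace GKR

/-! ### The verifier -/

open IVar FVar in
/-- The verifier. It draws the challenges of the last iteration first, so that the extension of
the input at the point that they determine can be computed while the stream is read. -/
def verifierCode (M : Transducer) : Code :=
  ask M 0 depth ;; .block [.iset layer (depth - 1)] ;; layerSetup M ;; tossAll .L ;;
  storePoint .L ;; readStream ;;
  .block [.recv claim, .fset claim0 claim, .iset ok 1, .iset gates (depth + 2)] ;;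
  .forTo layer depth (verifierIter M) ;;
  .block [.eqf flag claim acc, .iset ok (ok * flag)] ;;
  .ite ok (.block [.output claim0]) (.block [])

/-- The integer variables that are changed by the iterations of the verifier. -/
def iterVars : List IVar :=
  .layer :: .width :: .width' :: .bits :: .bits' :: .pow :: .len :: checkVars

variable {n : ℕ} {F K : Type*} [Field F] [Field K] [Algebra F K] {E : Env K} {a : Store K}
  {W s : ℕ} {M : Transducer}

theorem verifierCode_spec (C : LayeredCircuit n) (σ : List (Fin n × F)) {P : Strategy K}
    {r : ℕ → K} (hb : VerifierBound M C s W E) (hpeer : E.peer = proverPeer P)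
    (hI : TapeInv n s a) (hs : a.stream = updates K σ) (htr : a.trace = []) (hout : a.out = none)
    (hc : ∀ k < C.rounds (C.depth - 1) + 1, a.coins k = r (C.offset (C.depth - 1) + k))
    (hc' : ∀ k < C.offset (C.depth - 1), a.coins (C.rounds (C.depth - 1) + 1 + k) = r k) :
    Tr E (verifierCode M) a fun _ a' => a'.trace = verifierTrace C P r ∧
      a'.out = C.output (fun i => algebraMap F K (freq σ i)) P r := by
  set x : Fin n → K := fun i => algebraMap F K (freq σ i) with hx
  obtain ⟨d, hd⟩ : ∃ d, C.depth = d + 1 := ⟨C.depth - 1, by have := C.depth_pos; omega⟩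
  have hd1 : C.depth - 1 = d := by omega
  have hdlt : d < C.depth := by omega
  rw [hd1] at hc hc'
  have hW := hb.arr
  have hB := hW.1
  have hr := hb.rounds d hdlt
  have hr' : C.rounds d = C.bits d + 2 * C.bits (d + 1) := rfl
  have hS := hb.size
  have hdS := C.depth_lt_size
  have hlen := C.length_code
  refine Tr.seq ((ask_spec (q := 0) hb.prints hb.sim hI (by simp) (by simp) (by omega)
    (by simp [queryVars])).mono ?_)
  rintro t1 a1 ⟨F1, I1, e1⟩
  replace e1 : a1.int .depth = C.depth := e1
  refine Tr.seq (Tr.block (by simp; omega) ?_)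
  set a2 : Store K := runs E _ a1 with ha2
  have F2 : Frame [.layer] [] [] [] a1 a2 := runs_frame E _ _ (by simp [Cmd.within])
  have l2 : a2.int .layer = d := by simp [ha2, e1, hd]
  clear_value a2
  have I2 := I1.frame F2 (by simp) (by simp) (by simp)
  refine Tr.seq ((layerSetup_spec hb hdlt I2 l2).mono ?_)
  rintro t3 a3 ⟨F3, I3, hv⟩
  refine Tr.seq ((tossAll_spec (X := .L) hW hv.len hr).mono ?_)
  rintro t4 a4 ⟨F4, h4, h4'⟩
  have hcoins : a3.coins = a.coins := by simp [F3.coins, F2.coins, F1.coins]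
  have hL4 : ∀ k < C.rounds d + 1, a4.arr .L k = r (C.offset d + k) := fun k hk => by
    rw [h4 k hk, hcoins, hc k hk]
  have hv4 := hv.frame F4 (by simp) (by simp) (by simp) (by simp)
  refine Tr.seq ((storePoint_spec (X := .L) (by simp) hW hv4.bits hv4.bits' hv4.len hr).mono ?_)
  rintro t5 a5 ⟨F5, h5⟩
  have hZ5 : ∀ k < C.bits C.depth, a5.arr .Z k = C.layerPoint r C.depth k := by
    rw [hd]
    intro k hk
    simp only [h5 k hk, LayeredCircuit.layerPoint, LayeredCircuit.sumcheckPoint]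
    rw [hL4 _ (by omega), hL4 _ (by omega), hL4 _ (by omega), ← hr']
  refine Tr.seq ((readStream_spec (σ := σ) (v := C.bits (d + 1)) hW
    (by simp [F5.int, hv4.bits']) ?_ (by omega)
    (by simp [F5.stream, F4.stream, F3.stream, F2.stream, F1.stream, hs])).mono ?_)
  · have := C.width_le_two_pow C.depth
    rwa [C.width_depth, hd] at this
  rintro t6 a6 ⟨F6, h6⟩
  have hacc : a6.fld .acc = C.trueClaim x r C.depth := by
    rw [h6, ← hd]
    refine (mleE_congr _ hZ5).trans (mleE_congr_left _ fun j _ => ?_)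
    rw [LayeredCircuit.value, Nat.sub_self, LayeredCircuit.upValue]
  have d6 : a6.int .depth = C.depth := by
    simp [F6.int, F5.int, F4.int, F3.int, F2.int, queryVars, e1]
  have I6 : TapeInv n s a6 := ((I3.frame F4 (by simp) (by simp) (by simp)).frame F5 (by simp)
    (by simp) (by simp)).frame F6 (by simp) (by simp) (by simp)
  have tr6 : a6.trace = [] := by
    simp [F6.trace, F5.trace, F4.trace, F3.trace, F2.trace, F1.trace, htr]
  refine Tr.seq (Tr.block (by simp [d6]; omega) ?_)
  set a7 : Store K := runs E _ a6 with ha7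
  have F7 : Frame [.ok, .gates] [.claim, .claim0] [] [.trace, .stream] a6 a7 :=
    runs_frame E _ _ (by simp [Cmd.within])
  have hpeer0 : proverPeer P [] = P [] 0 := rfl
  have I7 : VerifierInv C P r s 0 a7 := by
    refine ⟨I6.frame F7 (by simp) (by simp) (by simp), ?_, ?_, ?_, ?_, ?_⟩
    · simp [ha7, d6, LayeredCircuit.above]
    · simp
    · simp [ha7, hpeer, tr6, hpeer0, LayeredCircuit.layerClaim]
    · simp [ha7, IsFlag]
    · simp [ha7, hpeer, tr6, hpeer0, LayeredCircuit.offset, shift, partialTrace]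
  have c7 : a7.fld .claim0 = P [] 0 := by simp [ha7, hpeer, tr6, hpeer0]
  clear_value a7
  have co7 : ∀ k, a7.coins k = a.coins (C.rounds d + 1 + k) := fun k => by
    rw [F7.coins (by simp), F6.coins (by simp), F5.coins (by simp), h4' k, hcoins]
  have L7 : a7.arr .L = a4.arr .L := by
    simp [F7.arr, F6.arr, F5.arr]
  refine Tr.seq (Tr.forTo_untimed iterVars checkFields [.Z, .R] [.imem, .trace, .stream, .coins]
    C.depth (fun i b => VerifierInv C P r s i b ∧
      ∀ k, C.offset i + k < C.offset d → b.coins k = r (C.offset i + k))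
    ?_ (by decide) (by omega) (by omega) ?_ ?_ ?_ ?_)
  · simp [verifierIter, layerSetup, logCode, tossAll, layerCheck, roundCheck, receiveLine,
      computeBeta, wiringSums, storePoint, mulIndicator, Code.forTo, Code.within, Cmd.within,
      iterVars, checkVars, checkFields, queryVars]
    exact ⟨⟨ask_within M _ (by decide) (by decide), ask_within M _ (by decide) (by decide)⟩,
      ask_within M _ (by decide) (by decide), ask_within M _ (by decide) (by decide),
      ask_within M _ (by decide) (by decide)⟩
  · refine ⟨⟨⟨?_, ?_, ?_⟩, ?_, ?_, ?_, ?_, ?_⟩, ?_⟩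
    · simpa using I7.tape.n
    · simpa using I7.tape.lt
    · simpa using I7.tape.zero
    · simpa using I7.gates
    · simp
    · simpa using I7.claim
    · simpa using I7.ok
    · simpa using I7.trace
    · intro k hk
      have h0 : C.offset 0 = 0 := rfl
      rw [h0, zero_add] at hk ⊢
      exact (co7 k).trans (hc' k hk)
  · intro i b _ _ hF _
    simp [hF.int, iterVars, checkVars, queryVars, F7.int, d6]
  · rintro i b hi hl hF ⟨J, hJ⟩
    refine Tr.withFrame (iterVars.erase .layer) checkFields [.Z, .R]
      [.imem, .trace, .stream, .coins] ?_ ((verifierIter_spec hb hpeer hi ?_ hl J ?_ ?_).mono ?_)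
    · simp [verifierIter, layerSetup, logCode, tossAll, layerCheck, roundCheck, receiveLine,
        computeBeta, wiringSums, storePoint, mulIndicator, Code.forTo, Code.within, Cmd.within,
        iterVars, checkVars, checkFields, queryVars]
      exact ⟨⟨ask_within M _ (by decide) (by decide), ask_within M _ (by decide) (by decide)⟩,
        ask_within M _ (by decide) (by decide), ask_within M _ (by decide) (by decide),
        ask_within M _ (by decide) (by decide)⟩
    · simp [hF.int, iterVars, checkVars, queryVars, F7.int, d6]
    · rwa [hd1]
    · rw [hd1, hF.arr _ (by simp), L7]
      exact hL4
    · rintro t b' ⟨J', hJ'⟩ hF'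
      rw [hd1] at hJ'
      refine ⟨(hF'.int .layer (by decide)).trans hl, ⟨⟨?_, ?_, ?_⟩, ?_, ?_, ?_, ?_, ?_⟩, hJ'⟩
      · simpa using J'.tape.n
      · simpa using J'.tape.lt
      · simpa using J'.tape.zero
      · simpa using J'.gates
      · simpa using J'.Z
      · simpa using J'.claim
      · simpa using J'.ok
      · simpa using J'.trace
  rintro a8 - F8 ⟨I8, -⟩
  have acc8 : a8.fld .acc = C.trueClaim x r C.depth := by
    rw [F8.fld _ (by decide), F7.fld _ (by simp), hacc]
  have cl8 : a8.fld .claim0 = P [] 0 := by rw [F8.fld _ (by decide), c7]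
  have out8 : a8.out = none := by
    simp [F8.out, F7.out, F6.out, F5.out, F4.out, F3.out, F2.out, F1.out, hout]
  have tr8 : a8.trace = verifierTrace C P r := by
    rw [verifierTrace_eq, I8.trace]
    have h := C.numChallenges_pos
    rw [LayeredCircuit.numChallenges] at h ⊢
    rw [shift, if_neg (by omega)]
  have hflag := I8.ok.mul (q := a8.fld .claim = a8.fld .acc)
  have hacc : C.Accepts x P r ↔ (∀ i < C.depth, C.LayerAccepts P r i) ∧
      a8.fld .claim = a8.fld .acc := by
    rw [acc8, I8.claim, ← C.eval_mle_layerPoint]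
    exact Iff.rfl
  rw [← hacc] at hflag
  refine Tr.seq (Tr.block ?_ ?_)
  · simp
    exact hflag.1.trans (by omega)
  set a9 : Store K := runs E _ a8 with ha9
  have F9 : Frame [.flag, .ok] [] [] [] a8 a9 := runs_frame E _ _ (by simp [Cmd.within])
  have ok9 : IsFlag (a9.int .ok) (C.Accepts x P r) := hflag
  clear_value a9
  refine Tr.ite (by simp) (fun h => Tr.block (by simp) ⟨?_, ?_⟩)
    fun h => Tr.block (by simp) ⟨?_, ?_⟩
  · simp [F9.trace, tr8]
  · rw [LayeredCircuit.output, if_pos (ok9.2.1 h)]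
    simp [F9.fld, cl8]
  · simp [F9.trace, tr8]
  · rw [LayeredCircuit.output, if_neg fun h' => ok9.2.2 h' h]
    simp [F9.out, out8]

/-- The order in which the verifier uses the elements of the random tape: the challenges of the
last iteration come first. -/
def LayeredCircuit.coinOrder (C : LayeredCircuit n) : Equiv.Perm (Fin C.numChallenges) :=
  have h : C.offset (C.depth - 1) + (C.rounds (C.depth - 1) + 1) = C.numChallenges := by
    rw [← C.offset_succ, LayeredCircuit.numChallenges, Nat.sub_add_cancel C.depth_pos]
  { toFun := fun k => if hk : k < C.offset (C.depth - 1) then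
      ⟨k + (C.rounds (C.depth - 1) + 1), by omega⟩ else ⟨k - C.offset (C.depth - 1), by omega⟩
    invFun := fun k => if hk : k < C.rounds (C.depth - 1) + 1 then
      ⟨k + C.offset (C.depth - 1), by omega⟩ else ⟨k - (C.rounds (C.depth - 1) + 1), by omega⟩
    left_inv := fun k => by
      have := k.isLt
      ext
      by_cases hk : k < C.offset (C.depth - 1)
      · have : ¬ k + (C.rounds (C.depth - 1) + 1) ≤ C.rounds (C.depth - 1) := by omega
        simp [hk, this]
      · have : k - C.offset (C.depth - 1) < C.rounds (C.depth - 1) + 1 := by omega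
        simp [hk, this]; omega
    right_inv := fun k => by
      have := k.isLt
      ext
      by_cases hk : k < C.rounds (C.depth - 1) + 1
      · simp [hk]
      · have : k - (C.rounds (C.depth - 1) + 1) < C.offset (C.depth - 1) := by omega
        simp [hk, this]; omega }

theorem LayeredCircuit.rounds_le (C : LayeredCircuit n) {i : ℕ} (hi : i < C.depth) :
    C.rounds i ≤ 6 * Nat.log 2 C.size := by
  have h1 := C.bits_le hi.le
  have h2 := C.bits_le (i := i + 1) hi
  have h3 := C.one_le_log
  unfold rounds
  omega

/-- The space of the verifier is that of the transducer, plus the arrays with indices up to the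
number `6 log S` of challenges of an iteration, of which each takes `16` addresses:
`16 * (6 log S + 1) ≤ 112 log S`. -/
theorem implementsVerifier (C : LayeredCircuit n) {c : ℕ}
    (hM : M.PrintsInSpace n (printed C.code) (c * Nat.log 2 C.size)) (σ : List (Fin n × F)) :
    ImplementsVerifier (verifierCode M).compile C C.coinOrder K σ
      ((c + 112) * Nat.log 2 C.size)
      (C.size ^ (M.numStates + M.numSymbols + c + 201)) := by
  intro P ρ
  set L := Nat.log 2 C.size with hL
  set A := M.numStates + M.numSymbols + c + 200 with hA
  have hS2 := C.two_le_size
  have hL1 : 1 ≤ L := C.one_le_log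
  have hLS : L < C.size := C.log_lt_size
  -- the integers in use are at most `A * S`, which `A ≤ 2 ^ A ≤ S ^ A` turns into a power of `S`
  have hB : A * C.size ≤ C.size ^ (A + 1) := by
    rw [pow_succ]
    refine Nat.mul_le_mul_right _ (Nat.lt_two_pow_self.le.trans (Nat.pow_le_pow_left hS2 A))
  have hn : n ≤ C.size := by have := C.size_eq; omega
  have hdS := C.depth_lt_size
  have hlen := C.length_code
  have hab := C.above_le_size (i := C.depth) (by omega)
  have hAS : A * C.size = M.numStates * C.size + M.numSymbols * C.size + c * C.size +
      200 * C.size := by rw [hA]; ring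
  have hs1 : M.numStates ≤ M.numStates * C.size := Nat.le_mul_of_pos_right _ (by omega)
  have hs2 : M.numSymbols ≤ M.numSymbols * C.size := Nat.le_mul_of_pos_right _ (by omega)
  have hs3 : c * L ≤ c * C.size := Nat.mul_le_mul_left _ hLS.le
  have hAe : M.numStates + M.numSymbols + c + 201 = A + 1 := by omega
  have hMe : (c + 112) * L = c * L + 112 * L := by ring
  rw [hAe]
  set E : Env K := ⟨proverPeer P, C.size ^ (A + 1), (c + 112) * L⟩ with hE
  have hbound : VerifierBound M C (c * L) (6 * L) E := by
    refine ⟨hM, ⟨?_, fun m hm => ?_, ?_⟩, ⟨?_, ?_⟩, ?_, fun i hi => C.rounds_le hi⟩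
    · simp only [hE]; omega
    · simp only [hE]
      obtain ⟨k, hk, rfl⟩ := List.getElem_of_mem hm
      have := C.code_le k
      rw [List.getD_eq_getElem _ _ hk] at this
      omega
    · simp only [hE]; omega
    · simp only [hE]; omega
    · simp only [hE]; omega
    · simp only [hE]; omega
  set s0 : State K := State.start n [] σ (ofTape ρ) with hs0
  have hInv : E.Inv s0 := by
    refine ⟨Nat.zero_le _, fun i => ?_, fun i => Nat.zero_le _, fun p hp => ?_, Nat.zero_le _, ?_⟩
    · change Function.update (fun _ => 0) 0 n i ≤ C.size ^ (A + 1)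
      rw [Function.update_apply]
      split <;> omega
    · change p.1 ≤ C.size ^ (A + 1)
      simp [hs0, State.start] at hp
      obtain ⟨i, d, -, rfl⟩ := hp
      simp only
      omega
    · change 1 ≤ C.size ^ (A + 1)
      omega
  have hT : C.offset (C.depth - 1) + (C.rounds (C.depth - 1) + 1) = C.numChallenges := by
    rw [← C.offset_succ, LayeredCircuit.numChallenges, Nat.sub_add_cancel C.depth_pos]
  have hc : ∀ k < C.rounds (C.depth - 1) + 1,
      ofTape ρ k = ofTape (ρ ∘ C.coinOrder) (C.offset (C.depth - 1) + k) := fun k hk => by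
    rw [ofTape, ofTape, dif_pos (by omega), dif_pos (by omega)]
    simp [LayeredCircuit.coinOrder]
  have hc' : ∀ k < C.offset (C.depth - 1),
      ofTape ρ (C.rounds (C.depth - 1) + 1 + k) = ofTape (ρ ∘ C.coinOrder) k := fun k hk => by
    rw [ofTape, ofTape, dif_pos (by omega), dif_pos (by omega)]
    simp [LayeredCircuit.coinOrder, hk, add_comm]
  obtain ⟨t, a', hex, htr, hout⟩ := verifierCode_spec C σ (E := E) (a := s0.view) hbound rfl
    ⟨rfl, (hM.2 0).trans_le' (Nat.zero_le _), fun _ _ => rfl⟩ rfl rfl rfl hc hc'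
  obtain ⟨s', h1, h2, h3, h4⟩ := hex.compile_spec s0 hInv rfl
  refine ⟨s', h1, ?_, ?_, h2.space, h2.peak⟩
  · rw [← htr, ← h3]; rfl
  · rw [← hout, ← h3]; rfl

end GKR

namespace GKR

/-! ### Rounds, words and degrees -/

namespace LayeredCircuit

variable {n : ℕ} (C : LayeredCircuit n)

/-- A sum over the layers is at most the depth times a bound for its terms. -/
theorem sum_depth_le {f : ℕ → ℕ} {c : ℕ} (h : ∀ i < C.depth, f i ≤ c * Nat.log 2 C.size) :
    ∑ i ∈ Finset.range C.depth, f i ≤ c * (C.depth * Nat.log 2 C.size) := by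
  refine (Finset.sum_le_card_nsmul _ _ _ fun i hi => h i (Finset.mem_range.1 hi)).trans
    (le_of_eq ?_)
  simp; ring

theorem bits_succ_le {i : ℕ} (hi : i < C.depth) : C.bits (i + 1) ≤ 2 * Nat.log 2 C.size := by
  have := C.bits_le (i := i + 1) hi
  have := C.one_le_log
  omega

theorem numChallenges_le : C.numChallenges ≤ 7 * (C.depth * Nat.log 2 C.size) :=
  C.sum_depth_le fun i hi => by
    have := C.rounds_le hi
    have := C.one_le_log
    omega

theorem totalDegree_le : C.totalDegree ≤ 14 * (C.depth * Nat.log 2 C.size) :=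
  C.sum_depth_le fun i hi => by
    have := C.rounds_le hi
    have := C.bits_succ_le hi
    omega

theorem sum_flatMap_range (f : ℕ → List ℕ) (d : ℕ) :
    ((List.range d).flatMap f).sum = ∑ i ∈ Finset.range d, (f i).sum := by
  induction d with
  | zero => rfl
  | succ d ih => simp [List.range_succ, List.flatMap_append, ih, Finset.sum_range_succ]

theorem communication_le : C.communication ≤ 29 * (C.depth * Nat.log 2 C.size) := by
  have hhead : ∀ l : List ℕ, (l.modifyHead (· + 1)).sum ≤ l.sum + 1 := by
    intro l
    cases l <;> simp; omega
  have hsum : ((List.range C.depth).flatMap fun i =>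
      List.replicate (C.rounds i) 3 ++ [C.bits (i + 1) + 1]).sum ≤
        21 * (C.depth * Nat.log 2 C.size) := by
    rw [sum_flatMap_range]
    refine C.sum_depth_le fun i hi => ?_
    have := C.rounds_le hi
    have := C.bits_succ_le hi
    have := C.one_le_log
    simp
    omega
  have h1 := C.numChallenges_le
  have h2 := hhead ((List.range C.depth).flatMap fun i =>
      List.replicate (C.rounds i) 3 ++ [C.bits (i + 1) + 1])
  have h3 : 1 ≤ C.depth * Nat.log 2 C.size := Nat.mul_pos C.depth_pos C.one_le_log
  unfold communication msgLengths
  omega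

end LayeredCircuit

end GKR


theorem mainTheorem1 (C : (n : ℕ+) → GKR.LayeredCircuit n) (hC : GKR.LogSpaceUniform C) :
    ∃ (prover verifier : GKR.Prog) (c : ℕ), ∀ n : ℕ+,
      (C n).numChallenges ≤ c * ((C n).depth * Nat.log 2 (C n).size) ∧
      (C n).communication ≤ c * ((C n).depth * Nat.log 2 (C n).size) ∧
      (C n).totalDegree ≤ c * ((C n).depth * Nat.log 2 (C n).size) ∧
      ∃ e : Equiv.Perm (Fin (C n).numChallenges),
        ∀ (F K : Type*) [Field F] [Field K] [Algebra F K] (σ : List (Fin n × F)),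
          (∀ Ω : Finset K, Ω.Nonempty →
            GKR.Complete (C n) Ω σ ∧
            (3 * (C n).totalDegree ≤ Ω.card → GKR.Sound (C n) Ω σ)) ∧
          GKR.ImplementsProver prover (C n) K σ
            (c * ((C n).size * Nat.log 2 (C n).size) + c * σ.length) ((C n).size ^ c) ∧
          GKR.ImplementsVerifier verifier (C n) e K σ
            (c * Nat.log 2 (C n).size) ((C n).size ^ c) := by
  obtain ⟨M, c₀, hM⟩ := hC
  -- larger than every factor and every exponent in the bounds
  set c := M.numStates + M.numSymbols + c₀ + 100000 with hc
  refine ⟨GKR.proverCode.compile, (GKR.verifierCode M).compile, c, fun n => ?_⟩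
  have hS : 1 ≤ (C n).size := by have := (C n).two_le_size; omega
  refine ⟨(C n).numChallenges_le.trans (Nat.mul_le_mul_right _ (by omega)),
    (C n).communication_le.trans (Nat.mul_le_mul_right _ (by omega)),
    (C n).totalDegree_le.trans (Nat.mul_le_mul_right _ (by omega)), (C n).coinOrder, ?_⟩
  intro F K _ _ _ σ
  refine ⟨fun Ω hΩ => ⟨GKR.complete (C n) Ω σ, GKR.sound (C n) Ω σ hΩ⟩, fun r => ?_, fun P ρ => ?_⟩
  · obtain ⟨s, h1, h2, h3, h4⟩ := GKR.implementsProver (K := K) (C n) σ r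
    refine ⟨s, h1, h2, h3.trans ?_, h4.trans (Nat.pow_le_pow_right hS (by omega))⟩
    exact Nat.add_le_add (Nat.mul_le_mul_right _ (by omega)) (Nat.mul_le_mul_right _ (by omega))
  · obtain ⟨s, h1, h2, h3, h4, h5⟩ := GKR.implementsVerifier (K := K) (C n) (hM n) σ P ρ
    exact ⟨s, h1, h2, h3, h4.trans (Nat.mul_le_mul_right _ (by omega)),
      h5.trans (Nat.pow_le_pow_right hS (by omega))⟩
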